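/- Let $n\ge 3$ and let $q=e^{h}$, $q^{1/2}=e^{h/2}\in\mathbb C[[h]]$. Let $U_h=U_h(d_n^{(1)})$ be the ($h$-adically complete) algebra over $\mathbb C[[h]]$ with generators $x_j^{\pm},h_j$ ($0\le j\le n$) and relations $[h_i,h_j]=0$, $[h_i,x_j^\pm]=\pm a_{ij}x_j^\pm$, $[x_i^+,x_j^-]=\delta_{ij}\frac{q^{h_i}-q^{-h_i}}{q-q^{-1}}$ and the quantum Serre relations, where $(a_{ij})$ is the Cartan matrix of $d_n^{(1)}$ (for $n=3$, that of $d_3^{(1)}=a_3^{(1)}$), and with $\Delta(h_i)=h_i\otimes1+1\otimes h_i$, $\Delta(x_i^\pm)=x_i^\pm\otimes q^{-h_i/2}+q^{h_i/2}\otimes x_i^\pm$. Put $\bar a=2n+1-a$ for $1\le a\le 2n$, and let $E_{a,b}$ be the matrix units of size $2n$. For every unit $x$ of $\mathbb C[[h]]$ there is exactly one representation $\pi_x$ of $U_h$ by $2n\times 2n$ matrices over $\mathbb C[[h]]$ such that $$\pi_x(x_j^+)=E_{j,j+1}-E_{\overline{j+1},\bar j},\quad \pi_x(x_j^-)=E_{j+1,j}-E_{\bar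 j,\overline{j+1}},\quad \pi_x(h_j)=E_{j,j}-E_{j+1,j+1}-E_{\bar j,\bar j}+E_{\overline{j+1},\overline{j+1}}\quad(1\le j\le n-1),$$ $$\pi_x(x_n^+)=E_{n-1,\bar n}-E_{n,\overline{n-1}},\quad \pi_x(x_n^-)=E_{\bar n,n-1}-E_{\overline{n-1},n},\quad \pi_x(h_n)=E_{n,n}-E_{\bar n,\bar n}-E_{\overline{n-1},\overline{n-1}}+E_{n-1,n-1},$$ $$\pi_x(x_0^+)=x\,(E_{\bar 2,1}-E_{\bar 1,2}),\quad \pi_x(x_0^-)=x^{-1}(E_{1,\bar 2}-E_{2,\bar 1}),\quad \pi_x(h_0)=E_{\bar 2,\bar 2}-E_{1,1}-E_{2,2}+E_{\bar 1,\bar 1}.$$ For $\hat\epsilon=(\hat\epsilon_0,\dots,\hat\epsilon_n)\in\mathbb C((h))^{n+1}$ let $\mathcal B_{\hat\epsilon}$ be the subalgebra of $\mathbb C((h))\otimes_{\mathbb C[[h]]}U_h$ generated by $\hat Q_j=q^{h_j/2}(x_j^++x_j^-)+\hat\epsilon_j(q^{h_j}-1)$, $0\le j\le n$. For units $\eta,x$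 of $\mathbb C[[h]]$ consider the equation for a matrix $K$ of size $2n$ over $\mathbb C((h))$ $$K\,\pi_{\eta x}(\hat Q)=\pi_{\eta/x}(\hat Q)\,K\qquad\text{for all }\hat Q\in\mathcal B_{\hat\epsilon}.\tag{1}$$ **(i)** Suppose that the $\hat\epsilon_j$ are not all zero. If (1) has a nonzero solution $K$ for some $x$ with $x^2\ne1$, then $$\eta=\pm(-1)^nq^{1-n},\qquad \hat\epsilon_j=\pm i\,(q^{1/2}-q^{-1/2})^{-1}\quad(0\le j\le n),$$ where the signs are independent of one another. **(ii)** Let $\eta=(-1)^nq^{1-n}$ and $\hat\epsilon_j=i(q^{1/2}-q^{-1/2})^{-1}$ for all $j$. Then for every unit $x$ a nonzero solution of (1) is the matrix $K(x)=\sum K_{ab}(x)E_{a,b}$ defined as follows. Put $k(x)=q^{n/2-1}(1-x)$; $a'=a+\frac12$, $\underline a=a$ for $a\le n$ and $a'=a-\frac12$, $\underline a=\bar a$ for $a>n$; and let a tilde denote the change $q\mapsto1/q$. Then $$K_{ab}(x)=\begin{cases} i^{-\underline a-\underline b}q^{b'-n}k(x) & a+b\le 2n,\ a\ne b,\\ i^{-\underline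 a-\underline b}q^{b'-n}\bigl(k(x)+(-1)^n\tilde k(1/x)\bigr)(q+1)^{-1} & b=\bar a,\ a\le n,\\ i^{-\underline a-\underline b}q^{b'-n}k(x)-(-1)^nq^{1/2}k(x)+(-1)^nq^{(n-1)/2}+q^{(1-n)/2} & b=a\le n,\end{cases}$$ and the remaining entries are given by $K_{\bar a\bar b}(x)=(-1)^n\widetilde K_{ab}(1/x)$. If $x^2\ne1$, every solution of (1) is a scalar multiple of $K(x)$. For $\eta=-(-1)^nq^{1-n}$ and the same $\hat\epsilon_j$, the matrix $K(-x)$ is a solution of (1). **(iii)** Let $\xi=q^{2-2n}$ and let $\check R(x)$ be Jimbo's trigonometric R-matrix $$\check R(x)=(x-q^{-2})(x-\xi)\sum_aE_{a,a}\otimes E_{a,a}+\frac{(x-1)(x-\xi)}q\sum_{a\ne b,\bar b}E_{a,b}\otimes E_{b,a}$$ $$\qquad+(1-q^{-2})(x-\xi)\Bigl(\sum_{a<b,\,a\ne\bar b}+x\sum_{a>b,\,a\ne\bar b}\Bigr)E_{b,b}\otimes E_{a,a}+\sum_{a,b}b_{ab}(x)\,E_{b,\bar a}\otimes E_{\bar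 b,a},$$ where $b_{ab}(x)$ is $(q^{-2}x-\xi)(x-1)$ for $a=b$, $(q^{-2}-1)\bigl(\xi q^{b'-a'}(x-1)-\delta_{a,\bar b}(x-\xi)\bigr)$ for $a<b$, and $(q^{-2}-1)x\bigl(q^{b'-a'}(x-1)-\delta_{a,\bar b}(x-\xi)\bigr)$ for $a>b$. It satisfies $\check R(x)(\pi_x\otimes\pi_1)(\Delta(Q))=(\pi_1\otimes\pi_x)(\Delta(Q))\check R(x)$ for every unit $x$ of $\mathbb C[[h]]$ and every generator $Q=x_j^\pm,h_j$ of $U_h$. The matrix $K(x)$ satisfies the reflection equation $$(1\otimes K(y))\check R(xy)(1\otimes K(x))\check R(x/y)=\check R(x/y)(1\otimes K(x))\check R(xy)(1\otimes K(y))$$ for all nonzero $x,y\in\mathbb C((h))$. **(iv)** For units $\sigma_0,\dots,\sigma_n$ of $\mathbb C[[h]]$ let $\Sigma=\mathrm{diag}(\Sigma_1,\dots,\Sigma_{2n})$ with $\Sigma_j=(\sigma_j\cdots\sigma_{n-2})^{-1}$ and $\Sigma_{\bar j}=\sigma_j\cdots\sigma_n$ for $1\le j\le n-2$, $\Sigma_{n-1}=1$,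 $\Sigma_n=\sigma_{n-1}$, $\Sigma_{\bar n}=\sigma_n$, $\Sigma_{\overline{n-1}}=\sigma_{n-1}\sigma_n$. Then $K^+_\sigma(x)=\Sigma^{-1}K(x)\Sigma$ and $K^-_\sigma(x)=K^+_\sigma(-x)$ also satisfy the reflection equation, and the family has $n$ effective parameters: $K^+_\sigma=K^+_\tau$ if and only if $\sigma_j=\tau_j$ for $1\le j\le n$. -/

import Mathlib

open scoped PowerSeries LaurentSeries Kronecker TensorProduct

noncomputable section

namespace QARefl

/-! ## The quantum affine algebra of type `d_n^{(1)}` over `ℂ[[h]]`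

The formal variable `h` is `PowerSeries.X`, and `q = e^h`. -/

/-- The generators `x_i^+`, `x_i^-`, `h_i`, for `i = 0, …, n`. -/
inductive Gen (n : ℕ) : Type
  | xp (i : Fin (n + 1)) : Gen n
  | xm (i : Fin (n + 1)) : Gen n
  | h (i : Fin (n + 1)) : Gen n

/-- The finite parts of the simple roots of `d_n^{(1)}` in an orthonormal basis `e_1, …, e_n`
(the vector `e_k` has index `k - 1`): `-(e_1 + e_2)` for `i = 0`, `e_i - e_{i+1}` for `0 < i < n`
and `e_{n-1} + e_n` for `i = n`. -/
def root (n : ℕ) (i : Fin (n + 1)) (k : Fin n) : ℤ :=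
  if i.val = 0 then (if k.val + 1 = 1 ∨ k.val + 1 = 2 then -1 else 0)
  else if i.val = n then (if k.val + 1 = n - 1 ∨ k.val + 1 = n then 1 else 0)
  else if k.val + 1 = i.val then 1 else if k.val + 1 = i.val + 1 then -1 else 0

/-- The generalized Cartan matrix of `d_n^{(1)}`. All roots have square length two, so it is the
Gram matrix of the simple roots, and `d_i = 1`. -/
def cartan (n : ℕ) (i j : Fin (n + 1)) : ℤ := ∑ k, root n i k * root n j k

/-- The free algebra over `ℂ[[h]]`, completed `h`-adically: power series in the central variable
`h` with coefficients in the free complex algebra on the generators. -/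
abbrev FreeHat (n : ℕ) : Type := PowerSeries (FreeAlgebra ℂ (Gen n))

/-- A generator as an element of the completed free algebra. -/
def gen {n : ℕ} (g : Gen n) : FreeHat n := PowerSeries.C (FreeAlgebra.ι ℂ g)

/-- The scalars `ℂ[[h]]` inside the completed free algebra. -/
def scal (n : ℕ) : ℂ⟦X⟧ →+* FreeHat n := PowerSeries.map (algebraMap ℂ (FreeAlgebra ℂ (Gen n)))

lemma scal_commute (n : ℕ) (f : ℂ⟦X⟧) (a : FreeHat n) : scal n f * a = a * scal n f := by
  ext m
  simp only [scal, PowerSeries.coeff_mul, PowerSeries.coeff_map]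
  rw [← Finset.Nat.sum_antidiagonal_swap]
  exact Finset.sum_congr rfl fun p _ => Algebra.commutes _ _

/-- `q^{c h_i} = exp(c h h_i)`. -/
def expH {n : ℕ} (c : ℂ) (i : Fin (n + 1)) : FreeHat n :=
  PowerSeries.mk fun k => (c ^ k / (k.factorial : ℂ)) • FreeAlgebra.ι ℂ (Gen.h i) ^ k

/-- `e^{c h}`, so that `q^c = qpow c`. -/
def qpow (c : ℂ) : ℂ⟦X⟧ := PowerSeries.rescale c (PowerSeries.exp ℂ)

lemma qpow_mul (a b : ℂ) : qpow a * qpow b = qpow (a + b) :=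
  PowerSeries.exp_mul_exp_eq_exp_add a b

/-- A power series without its constant term, divided by `h`. -/
def divX {A : Type*} [Semiring A] (f : PowerSeries A) : PowerSeries A :=
  PowerSeries.mk fun k => PowerSeries.coeff (k + 1) f

/-- `(q^{h_i} - q^{-h_i}) / (q - q^{-1})`; numerator and denominator are both divisible by `h`. -/
def qbracket {n : ℕ} (i : Fin (n + 1)) : FreeHat n :=
  scal n (divX (qpow 1 - qpow (-1)))⁻¹ * divX (expH 1 i - expH (-1) i)

/-- The defining relations, each written as an element that is to vanish. Since the matrix is
simply laced, the quantum Serre relations are those for `a_ij = 0` and `a_ij = -1`. -/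
inductive Relator (n : ℕ) : FreeHat n → Prop
  | hh (i j) : Relator n (gen (.h i) * gen (.h j) - gen (.h j) * gen (.h i))
  | hxp (i j) : Relator n
      (gen (.h i) * gen (.xp j) - gen (.xp j) * gen (.h i) - (cartan n i j) • gen (.xp j))
  | hxm (i j) : Relator n
      (gen (.h i) * gen (.xm j) - gen (.xm j) * gen (.h i) + (cartan n i j) • gen (.xm j))
  | xx (i j) : Relator n
      (gen (.xp i) * gen (.xm j) - gen (.xm j) * gen (.xp i) - if i = j then qbracket i else 0)
  | serre_zero_p (i j) (_ : cartan n i j = 0) : Relator n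
      (gen (.xp j) * gen (.xp i) - gen (.xp i) * gen (.xp j))
  | serre_zero_m (i j) (_ : cartan n i j = 0) : Relator n
      (gen (.xm j) * gen (.xm i) - gen (.xm i) * gen (.xm j))
  | serre_one_p (i j) (_ : cartan n i j = -1) : Relator n
      (gen (.xp j) * gen (.xp i) ^ 2
        - scal n (qpow 1 + qpow (-1)) * (gen (.xp i) * gen (.xp j) * gen (.xp i))
        + gen (.xp i) ^ 2 * gen (.xp j))
  | serre_one_m (i j) (_ : cartan n i j = -1) : Relator n
      (gen (.xm j) * gen (.xm i) ^ 2
        - scal n (qpow 1 + qpow (-1)) * (gen (.xm i) * gen (.xm j) * gen (.xm i))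
        + gen (.xm i) ^ 2 * gen (.xm j))

/-- The smallest `h`-adically closed two-sided ideal that contains the relators. -/
def relIdeal (n : ℕ) : TwoSidedIdeal (FreeHat n) :=
  sInf {J | (∀ a, Relator n a → a ∈ J) ∧
    ∀ a, (∀ m : ℕ, ∃ b ∈ J, ∃ c, a - b = PowerSeries.X ^ m * c) → a ∈ J}

/-- The quantum affine algebra `U_h(d_n^{(1)})`. -/
def Uh (n : ℕ) : Type := (relIdeal n).ringCon.Quotient

instance (n : ℕ) : Ring (Uh n) := inferInstanceAs (Ring (relIdeal n).ringCon.Quotient)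

/-- The quotient map from the completed free algebra. -/
def toUh (n : ℕ) : FreeHat n →+* Uh n := (relIdeal n).ringCon.mk'

lemma toUh_surjective (n : ℕ) : Function.Surjective (toUh n) := Quotient.mk''_surjective

instance (n : ℕ) : Algebra ℂ⟦X⟧ (Uh n) :=
  ((toUh n).comp (scal n)).toAlgebra' (by
    intro f u
    obtain ⟨a, rfl⟩ := toUh_surjective n u
    rw [RingHom.comp_apply, ← map_mul, ← map_mul, scal_commute])

/-- `x_i^+` in `U_h`. -/
def xp {n : ℕ} (i : Fin (n + 1)) : Uh n := toUh n (gen (.xp i))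

/-- `x_i^-` in `U_h`. -/
def xm {n : ℕ} (i : Fin (n + 1)) : Uh n := toUh n (gen (.xm i))

/-- `h_i` in `U_h`. -/
def hh {n : ℕ} (i : Fin (n + 1)) : Uh n := toUh n (gen (.h i))

/-- `q^{c h_i}` in `U_h`. -/
def qh {n : ℕ} (c : ℂ) (i : Fin (n + 1)) : Uh n := toUh n (expH c i)

/-! ## The vector representation -/

/-- Square matrices of size `2n`; the row with number `a ∈ {1, …, 2n}` has index `a - 1`. -/
abbrev Mat (n : ℕ) (R : Type*) : Type _ := Matrix (Fin (2 * n)) (Fin (2 * n)) R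

/-- The matrix unit `E_{j,k}`, with rows and columns numbered from `1`. -/
def E {n : ℕ} {R : Type*} [Zero R] [One R] (j k : ℕ) : Mat n R :=
  Matrix.of fun a b => if a.val + 1 = j ∧ b.val + 1 = k then 1 else 0

/-- `bar j = 2n + 1 - j`. -/
def bar (n j : ℕ) : ℕ := 2 * n + 1 - j

/-- `π(x_j^+)`. -/
def piXp (n : ℕ) (j : Fin (n + 1)) : Mat n ℂ⟦X⟧ :=
  if j.val = 0 then E (bar n 2) 1 - E (bar n 1) 2
  else if j.val = n then E (n - 1) (bar n n) - E n (bar n (n - 1))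
  else E j.val (j.val + 1) - E (bar n (j.val + 1)) (bar n j.val)

/-- `π(x_j^-)`. -/
def piXm (n : ℕ) (j : Fin (n + 1)) : Mat n ℂ⟦X⟧ :=
  if j.val = 0 then E 1 (bar n 2) - E 2 (bar n 1)
  else if j.val = n then E (bar n n) (n - 1) - E (bar n (n - 1)) n
  else E (j.val + 1) j.val - E (bar n j.val) (bar n (j.val + 1))

/-- `π(h_j)`. -/
def piH (n : ℕ) (j : Fin (n + 1)) : Mat n ℂ⟦X⟧ :=
  if j.val = 0 then
    E (bar n 2) (bar n 2) - E 1 1 - E 2 2 + E (bar n 1) (bar n 1)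
  else if j.val = n then
    E n n - E (bar n n) (bar n n) - E (bar n (n - 1)) (bar n (n - 1)) + E (n - 1) (n - 1)
  else
    E j.val j.val - E (j.val + 1) (j.val + 1) - E (bar n j.val) (bar n j.val) + E (bar n (j.val + 1)) (bar n (j.val + 1))

/-- The factor by which the automorphism `σ_x` rescales `x_j^+`: `x` for `j = 0`, else `1`. -/
def specFactor {n : ℕ} (x : ℂ⟦X⟧ˣ) (j : Fin (n + 1)) : ℂ⟦X⟧ˣ := if j.val = 0 then x else 1

/-- `ρ` is the representation `π_x = π ∘ σ_x`: it takes the prescribed values on the generators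
(an algebra map over `ℂ[[h]]` into these matrices is automatically `h`-adically continuous). -/
def IsVectorRep (n : ℕ) (x : ℂ⟦X⟧ˣ) (ρ : Uh n →ₐ[ℂ⟦X⟧] Mat n ℂ⟦X⟧) : Prop :=
  ∀ j : Fin (n + 1),
    ρ (xp j) = (specFactor x j : ℂ⟦X⟧) • piXp n j ∧
    ρ (xm j) = ((specFactor x j)⁻¹ : ℂ⟦X⟧ˣ).val • piXm n j ∧
    ρ (hh j) = piH n j

/-! ## The coideal subalgebra and the intertwining equation

The parameters `ε̂_j` may have a pole at `h = 0`, so scalars are extended to `ℂ((h))`. -/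

/-- `U_h` with scalars extended to `ℂ((h))`. -/
abbrev UhL (n : ℕ) : Type := ℂ⸨X⸩ ⊗[ℂ⟦X⟧] Uh n

/-- `Q̂_j = q^{h_j/2} (x_j^+ + x_j^-) + ε̂_j (q^{h_j} - 1)`. -/
def Qhat {n : ℕ} (ε : Fin (n + 1) → ℂ⸨X⸩) (j : Fin (n + 1)) : UhL n :=
  1 ⊗ₜ[ℂ⟦X⟧] (qh (1 / 2) j * (xp j + xm j)) + ε j ⊗ₜ[ℂ⟦X⟧] (qh 1 j - 1)

/-- The coideal subalgebra generated by `Q̂_0, …, Q̂_n`. -/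
def coidealSubalgebra (n : ℕ) (ε : Fin (n + 1) → ℂ⸨X⸩) : Subalgebra ℂ⸨X⸩ (UhL n) :=
  Algebra.adjoin ℂ⸨X⸩ (Set.range (Qhat ε))

/-- The extension of a representation of `U_h` to `ℂ((h))`. -/
def extend {n : ℕ} (ρ : Uh n →ₐ[ℂ⟦X⟧] Mat n ℂ⟦X⟧) : UhL n →ₐ[ℂ⸨X⸩] Mat n ℂ⸨X⸩ :=
  Algebra.TensorProduct.lift (Algebra.ofId ℂ⸨X⸩ (Mat n ℂ⸨X⸩))
    ((Algebra.ofId ℂ⟦X⟧ ℂ⸨X⸩).mapMatrix.comp ρ)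
    (fun f y => by
      rw [Algebra.ofId_apply]
      exact Algebra.commute_algebraMap_left f _)

lemma extend_tmul {n : ℕ} (ρ : Uh n →ₐ[ℂ⟦X⟧] Mat n ℂ⟦X⟧) (f : ℂ⸨X⸩) (u : Uh n) :
    extend ρ (f ⊗ₜ[ℂ⟦X⟧] u) = f • (ρ u).map (algebraMap ℂ⟦X⟧ ℂ⸨X⸩) := by
  rw [extend, Algebra.TensorProduct.lift_tmul, Algebra.ofId_apply, ← Algebra.smul_def]
  rfl

/-- `K` is an intertwiner `V_{ηx} → V_{η/x}` of the coideal subalgebra: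
`K π_{ηx}(Q̂) = π_{η/x}(Q̂) K` for all `Q̂` in it. -/
def IsIntertwiner (n : ℕ) (ε : Fin (n + 1) → ℂ⸨X⸩) (η x : ℂ⟦X⟧ˣ) (K : Mat n ℂ⸨X⸩) : Prop :=
  ∀ ρ ρ' : Uh n →ₐ[ℂ⟦X⟧] Mat n ℂ⟦X⟧, IsVectorRep n (η * x) ρ → IsVectorRep n (η / x) ρ' →
    ∀ Q ∈ coidealSubalgebra n ε, K * extend ρ Q = extend ρ' Q * K

/-! ## Constants -/

/-- `q^{1/2} = e^{h/2}` as a unit of `ℂ[[h]]`. -/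
def sqrtQ : ℂ⟦X⟧ˣ where
  val := qpow (1 / 2)
  inv := qpow (-(1 / 2))
  val_inv := by rw [qpow_mul, add_neg_cancel]; simp [qpow]
  inv_val := by rw [qpow_mul, neg_add_cancel]; simp [qpow]

/-- `q^{1/2}` in `ℂ((h))`. -/
def s : ℂ⸨X⸩ := algebraMap ℂ⟦X⟧ ℂ⸨X⸩ sqrtQ

/-- `i = √-1` in `ℂ((h))`. -/
def I : ℂ⸨X⸩ := algebraMap ℂ⟦X⟧ ℂ⸨X⸩ (PowerSeries.C Complex.I)

/-- `η = (-1)^n q^{1-n}`. -/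
def etaPlus (n : ℕ) : ℂ⟦X⟧ˣ := (-1) ^ n * sqrtQ ^ (2 * (1 - (n : ℤ)))

/-- `i (q^{1/2} - q^{-1/2})^{-1}`. -/
def epsPlus : ℂ⸨X⸩ := I * (s - s⁻¹)⁻¹

/-! ## The matrices `K(x)`, `Σ` and `Ř(x)`

Here `F` is a field, `s` stands for `q^{1/2}` and `I` for `√-1`. Half-integral powers of `q` are
integral powers of `s`, and the change `q ↦ 1/q` is `s ↦ s⁻¹`. -/

section Matrices

variable {F : Type*} [Field F]

/-- The number in `{1, …, 2n}` of an index. -/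
def num {n : ℕ} (a : Fin (2 * n)) : ℕ := a.val + 1

/-- The integer `2a'`, where `a' = a + 1/2` for `a ≤ n` and `a' = a - 1/2` for `a > n`. -/
def twicePrime {n : ℕ} (a : Fin (2 * n)) : ℤ :=
  if num a ≤ n then 2 * (num a : ℤ) + 1 else 2 * (num a : ℤ) - 1

/-- `a` for `a ≤ n`, and `2n + 1 - a` for `a > n`. -/
def under {n : ℕ} (a : Fin (2 * n)) : ℤ :=
  if num a ≤ n then (num a : ℤ) else 2 * (n : ℤ) + 1 - num a

/-- `k(x) = q^{n/2-1} (1 - x)`. -/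
def kfun (n : ℕ) (s x : F) : F := s ^ ((n : ℤ) - 2) * (1 - x)

/-- `i^{-a̲-b̲} q^{b'-n}`. -/
def kpre {n : ℕ} (I s : F) (a b : Fin (2 * n)) : F :=
  I ^ (-under a - under b) * s ^ (twicePrime b - 2 * (n : ℤ))

/-- The entries of `K(x)` on the diagonal, above the antidiagonal, and on its upper half. -/
def kentry {n : ℕ} (I s x : F) (a b : Fin (2 * n)) : F :=
  if b = Fin.rev a then
    kpre I s a b * (kfun n s x + (-1) ^ n * kfun n s⁻¹ x⁻¹) * (s ^ 2 + 1)⁻¹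
  else if b = a then
    kpre I s a b * kfun n s x - (-1) ^ n * s * kfun n s x
      + ((-1) ^ n * s ^ ((n : ℤ) - 1) + s ^ (1 - (n : ℤ)))
  else kpre I s a b * kfun n s x

/-- The matrix `K(x)`. The entries with `a + b ≤ 2n`, and those with `b = ā`, `a ≤ n`, are given by
`kentry`; the others are given by `K_{āb̄}(x) = (-1)^n K̃_{ab}(1/x)`. -/
def Kmat (n : ℕ) (I s x : F) : Mat n F :=
  Matrix.of fun a b =>
    if num a + num b ≤ 2 * n ∨ (b = Fin.rev a ∧ num a ≤ n) then kentry I s x a b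
    else (-1) ^ n * kentry I s⁻¹ x⁻¹ (Fin.rev a) (Fin.rev b)

/-- `σ_j σ_{j+1} ⋯ σ_k`, the empty product being `1`. -/
def prodSigma {n : ℕ} (σ : Fin (n + 1) → F) (j k : ℕ) : F :=
  ∏ m : Fin (n + 1), if j ≤ m.val ∧ m.val ≤ k then σ m else 1

/-- The entry `Σ_a`: for `j ≤ n - 2`, `Σ_j = (σ_j ⋯ σ_{n-2})⁻¹` and `Σ_j̄ = σ_j ⋯ σ_n`; moreover
`Σ_{n-1} = 1`, `Σ_n = σ_{n-1}`, `Σ_n̄ = σ_n`, and `Σ_j̄ = σ_{n-1} σ_n` for `j = n - 1`. -/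
def sigmaEntry {n : ℕ} (σ : Fin (n + 1) → F) (a : Fin (2 * n)) : F :=
  if num a ≤ n - 2 then (prodSigma σ (num a) (n - 2))⁻¹
  else if num a = n - 1 then 1
  else if num a = n then prodSigma σ (n - 1) (n - 1)
  else if num a = bar n n then prodSigma σ n n
  else if num a = bar n (n - 1) then prodSigma σ (n - 1) n
  else prodSigma σ (bar n (num a)) n

/-- `Σ = diag(Σ_1, …, Σ_{2n})`. -/
def sigmaMat {n : ℕ} (σ : Fin (n + 1) → F) : Mat n F := Matrix.diagonal (sigmaEntry σ)

/-- `K^+_σ(x) = Σ⁻¹ K(x) Σ`. -/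
def Kplus {n : ℕ} (I s : F) (σ : Fin (n + 1) → F) (x : F) : Mat n F :=
  (sigmaMat σ)⁻¹ * Kmat n I s x * sigmaMat σ

/-- `K^-_σ(x) = K^+_σ(-x)`. -/
def Kminus {n : ℕ} (I s : F) (σ : Fin (n + 1) → F) (x : F) : Mat n F := Kplus I s σ (-x)

/-- Matrices on `V ⊗ V`. -/
abbrev Mat₂ (n : ℕ) (R : Type*) : Type _ :=
  Matrix (Fin (2 * n) × Fin (2 * n)) (Fin (2 * n) × Fin (2 * n)) R

/-- `E_{a,b} ⊗ E_{c,d}`. -/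
def EE {n : ℕ} (a b c d : Fin (2 * n)) : Mat₂ n F := Matrix.single a b 1 ⊗ₖ Matrix.single c d 1

/-- `ξ = q^{2-2n}`. -/
def xi (n : ℕ) (s : F) : F := s ^ (2 * (2 - 2 * (n : ℤ)))

/-- The coefficients `b_{ab}(x)` of the trigonometric R-matrix. -/
def bcoef {n : ℕ} (s x : F) (a b : Fin (2 * n)) : F :=
  if a = b then (s ^ (-4 : ℤ) * x - xi n s) * (x - 1)
  else if a < b then
    (s ^ (-4 : ℤ) - 1) * (xi n s * s ^ (twicePrime b - twicePrime a) * (x - 1)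
      - if a = Fin.rev b then x - xi n s else 0)
  else
    (s ^ (-4 : ℤ) - 1) * x * (s ^ (twicePrime b - twicePrime a) * (x - 1)
      - if a = Fin.rev b then x - xi n s else 0)

/-- Jimbo's trigonometric R-matrix `Ř(x)` of type `d_n^{(1)}` (with `q = s²`), in the form that
intertwines `V_x ⊗ V_1 → V_1 ⊗ V_x` for the comultiplication
`Δ(x_i^±) = x_i^± ⊗ q^{-h_i/2} + q^{h_i/2} ⊗ x_i^±`. -/
def Rcheck (n : ℕ) (s x : F) : Mat₂ n F :=
  ((x - s ^ (-4 : ℤ)) * (x - xi n s)) • ∑ a, EE a a a a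
  + ((x - 1) * (x - xi n s) / s ^ 2) •
      ∑ a, ∑ b, (if a ≠ b ∧ a ≠ Fin.rev b then EE a b b a else 0)
  + ((1 - s ^ (-4 : ℤ)) * (x - xi n s)) •
      ((∑ a, ∑ b, if a < b ∧ a ≠ Fin.rev b then EE b b a a else 0)
        + x • ∑ a, ∑ b, if b < a ∧ a ≠ Fin.rev b then EE b b a a else 0)
  + ∑ a, ∑ b, bcoef s x a b • EE b (Fin.rev a) (Fin.rev b) a

/-- The reflection equation for a matrix function `K` of the nonzero spectral parameter:
`(1 ⊗ K(y)) Ř(xy) (1 ⊗ K(x)) Ř(x/y) = Ř(x/y) (1 ⊗ K(x)) Ř(xy) (1 ⊗ K(y))`. -/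
def ReflectionEquation (n : ℕ) (s : F) (K : F → Mat n F) : Prop :=
  ∀ x y : F, x ≠ 0 → y ≠ 0 →
    ((1 : Mat n F) ⊗ₖ K y) * Rcheck n s (x * y) * ((1 : Mat n F) ⊗ₖ K x) * Rcheck n s (x / y)
      = Rcheck n s (x / y) * ((1 : Mat n F) ⊗ₖ K x) * Rcheck n s (x * y)
          * ((1 : Mat n F) ⊗ₖ K y)

end Matrices

/-- `R (π_x ⊗ π_1)(Δ(Q)) = (π_1 ⊗ π_x)(Δ(Q)) R` for every generator `Q` of `U_h`, with the
comultiplication `Δ(h_i) = h_i ⊗ 1 + 1 ⊗ h_i`, `Δ(x_i^±) = x_i^± ⊗ q^{-h_i/2} + q^{h_i/2} ⊗ x_i^±`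
written out. -/
def IsRIntertwiner (n : ℕ) (x : ℂ⟦X⟧ˣ) (R : Mat₂ n ℂ⸨X⸩) : Prop :=
  ∀ ρ ρ₁ : Uh n →ₐ[ℂ⟦X⟧] Mat n ℂ⟦X⟧, IsVectorRep n x ρ → IsVectorRep n 1 ρ₁ →
    let t : Uh n → Uh n → Mat₂ n ℂ⸨X⸩ := fun u v =>
      ((ρ u).map (algebraMap ℂ⟦X⟧ ℂ⸨X⸩)) ⊗ₖ ((ρ₁ v).map (algebraMap ℂ⟦X⟧ ℂ⸨X⸩))
    let t' : Uh n → Uh n → Mat₂ n ℂ⸨X⸩ := fun u v =>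
      ((ρ₁ u).map (algebraMap ℂ⟦X⟧ ℂ⸨X⸩)) ⊗ₖ ((ρ v).map (algebraMap ℂ⟦X⟧ ℂ⸨X⸩))
    ∀ i : Fin (n + 1),
      R * (t (hh i) 1 + t 1 (hh i)) = (t' (hh i) 1 + t' 1 (hh i)) * R ∧
      R * (t (xp i) (qh (-(1 / 2)) i) + t (qh (1 / 2) i) (xp i))
        = (t' (xp i) (qh (-(1 / 2)) i) + t' (qh (1 / 2) i) (xp i)) * R ∧
      R * (t (xm i) (qh (-(1 / 2)) i) + t (qh (1 / 2) i) (xm i))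
        = (t' (xm i) (qh (-(1 / 2)) i) + t' (qh (1 / 2) i) (xm i)) * R

end QARefl

end

/-! Each generator acts on the vector representation through one pair of indices: `π(x_j^+) = E_{ab}
- E_{b̄ā}` with `(a, b) = (nodeA j, nodeB j)`, and the affine node differs from the others only in
its indices and its spectral parameter. Everything therefore reduces to identities about four
indices `a, b, ā, b̄` and about how neighbouring pairs overlap.

Representations. The eigenvalues of `h_j` lie in `{-1, 0, 1}`, where the quantum bracket of `h_j` is
`h_j` itself, and `X_i² = X_i X_j X_i = 0`, which makes every term of a cubic Serre relation vanish.
So the relations are the classical ones. Evaluation of the completed free algebra is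
coefficientwise, and `h`-adic separatedness of matrices gives both the factorization through `U_h`
and uniqueness.

Intertwiners. For an index `u` off the block of a node, `K_{ua}` and `K_{ub}` satisfy a homogeneous
2×2 system with determinant `1 - ε_j² (q - 1)(q⁻¹ - 1)`. If it is nonzero at one node, zeros spread
over the whole diagram until `K` lives on the diagonal and the antidiagonal, and there `ηx ≠ η/x`
and some `ε_i ≠ 0` kill it (`eq_zero_of_exists_nondegenerate`). So every `ε_j` is a root of the
determinant, that is `±` the stated value, and a diagonal matrix of signs makes all of them equal
(`exists_gauge`). Then the generator has rank two, `Q = colMat * rowMat`, and `K` induces a 2×2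
matrix `G_j` on these factors. Comparing neighbouring nodes ties all the `G_j` to four scalars
subject to linear relations (`NodeMats.summary`). If they do not all vanish, going once around the
diagram yields `η² = q^{2-2n}`; if they do, `K` is a multiple of one rank-one matrix `w vᵀ`, and the
same condition comes out. This gives `param_of_ne_zero` and `exists_smul_of_ne_zero`. Existence
(`Kmat_mul_Qmat`) is a computation from the form `K_{ab} = w_a v_b κ_{ab} + δ_{ab} (c - d κ_{aa})`,
where `κ` depends only on the side of the antidiagonal.

R-matrix. `RNode.mul_copX` checks `x_j^+` on the basis vectors `e_c ⊗ e_d`, given a list of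
relations between the coefficients at a node; `x_j^-` follows because `Ř` is a symmetric matrix.

Reflection equation. Both sides intertwine the coideal subalgebra between the same two modules `V ⊗
V` (`reflDiff_mul_copQ`), so a Schur lemma is wanted. It is proved in the classical limit: at `x =
α/h`, `y = β/h` a nonzero difference can be rescaled to have a nonzero reduction modulo `h`. The
reduction intertwines the limit of the action, as does `ψ ⊗ ψ`, where `ψ` is the limit of `h
K(1/h)`; for `α ≠ β` the commutant is scalar (`eq_smul_one_of_twistComm`), so the reduction is a
multiple of `ψ ⊗ ψ`. One matrix entry of the difference is zero by the symmetry between `x` and `y`,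
and that entry of `ψ ⊗ ψ` is not, a contradiction (`reflDiff_pole`). The difference has Laurent
polynomial entries, and infinitely many `α`, `β` are available, so it vanishes everywhere.

Family. `Σ_a Σ_ā` is independent of `a`, so `Σ ⊗ Σ` commutes with `Ř` and conjugation preserves the
equation. One column of `K⁺_σ(0)` recovers `σ_1, …, σ_n` (`Kplus_eq_iff`). -/

noncomputable section

namespace QARefl

/-! ## Nodes of the Dynkin diagram and the matrices of the vector representation -/

open Matrix (single)

section Nodes

variable {n : ℕ}

/-- The index `α` with `π(x_j^+) = E_{αβ} - E_{β̄ᾱ}`. -/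
def nodeA (hn : 3 ≤ n) (j : Fin (n + 1)) : Fin (2 * n) :=
  ⟨if j.val = 0 then 2 * n - 2 else if j.val = n then n - 2 else j.val - 1, by
    split_ifs <;> omega⟩

/-- The index `β` with `π(x_j^+) = E_{αβ} - E_{β̄ᾱ}`. -/
def nodeB (hn : 3 ≤ n) (j : Fin (n + 1)) : Fin (2 * n) :=
  ⟨if j.val = 0 then 0 else if j.val = n then n else j.val, by split_ifs <;> omega⟩

lemma node_val (hn : 3 ≤ n) (j : Fin (n + 1)) :
    (j.val = 0 ∧ (nodeA hn j).val = 2 * n - 2 ∧ (nodeB hn j).val = 0) ∨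
    (j.val ≠ 0 ∧ j.val = n ∧ (nodeA hn j).val = n - 2 ∧ (nodeB hn j).val = n) ∨
    (1 ≤ j.val ∧ j.val < n ∧ (nodeA hn j).val = j.val - 1 ∧ (nodeB hn j).val = j.val) := by
  have := j.isLt
  simp only [nodeA, nodeB]
  split_ifs <;> omega

/-- `E_{ab} - E_{b̄ā}`. -/
def Xmat {R : Type*} [Ring R] (a b : Fin (2 * n)) : Mat n R :=
  single a b 1 - single b.rev a.rev 1

/-- The weight of the index `c` with respect to the coroot of the pair `(a, b)`. -/
def Hval (a b c : Fin (2 * n)) : ℤ :=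
  (if c = a then 1 else 0) - (if c = b then 1 else 0) - (if c = a.rev then 1 else 0)
    + (if c = b.rev then 1 else 0)

lemma rev_ne (a : Fin (2 * n)) : a.rev ≠ a := by
  intro h; have := congrArg Fin.val h; rw [Fin.val_rev] at this; omega

lemma ne_rev (a : Fin (2 * n)) : a ≠ a.rev := (rev_ne a).symm

/-- The indices `a, b, ā, b̄` are distinct. -/
structure Quad (a b : Fin (2 * n)) : Prop where
  ne : a ≠ b
  ner : a ≠ b.rev

lemma node_quad (hn : 3 ≤ n) (j : Fin (n + 1)) : Quad (nodeA hn j) (nodeB hn j) := by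
  have := j.isLt
  constructor <;> intro h <;> have := congrArg Fin.val h <;>
    simp only [nodeA, nodeB, Fin.val_rev] at this <;> split_ifs at this <;> omega

lemma E_eq_single {R : Type*} [Zero R] [One R] (a b : Fin (2 * n)) (j k : ℕ)
    (hj : a.val + 1 = j) (hk : b.val + 1 = k) : (E j k : Mat n R) = single a b 1 := by
  subst hj hk
  ext p r
  simp only [E, Matrix.of_apply, Matrix.single_apply, Fin.ext_iff, Nat.add_right_cancel_iff]
  congr 1
  simp only [eq_iff_iff]
  constructor <;> rintro ⟨h1, h2⟩ <;> exact ⟨h1.symm, h2.symm⟩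

lemma piXp_eq (hn : 3 ≤ n) (j : Fin (n + 1)) :
    piXp n j = Xmat (nodeA hn j) (nodeB hn j) := by
  have hj := j.isLt
  have hv := node_val hn j
  unfold piXp Xmat
  split_ifs with h0 h1
  all_goals
    congr 1 <;> apply E_eq_single <;> (try simp only [bar, Fin.val_rev]) <;> omega

lemma piXm_eq (hn : 3 ≤ n) (j : Fin (n + 1)) :
    piXm n j = Xmat (nodeB hn j) (nodeA hn j) := by
  have hj := j.isLt
  have hv := node_val hn j
  unfold piXm Xmat
  split_ifs with h0 h1
  all_goals
    congr 1 <;> apply E_eq_single <;> (try simp only [bar, Fin.val_rev]) <;> omega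

lemma diag_Hval {R : Type*} [Ring R] (a b : Fin (2 * n)) :
    (Matrix.diagonal fun c => ((Hval a b c : ℤ) : R)) =
      single a a 1 - single b b 1 - single a.rev a.rev 1 + single b.rev b.rev 1 := by
  ext p r
  by_cases h : p = r
  · subst h
    simp only [Matrix.diagonal_apply_eq, Hval, Matrix.sub_apply, Matrix.add_apply,
      Matrix.single_apply, and_self, eq_comm (a := p)]
    push_cast
    rfl
  · have hh : ∀ c : Fin (2 * n), ¬ (c = p ∧ c = r) := fun c hc => h (hc.1.symm.trans hc.2)
    simp [Matrix.diagonal_apply_ne _ h, hh]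

lemma piH_eq (hn : 3 ≤ n) (j : Fin (n + 1)) :
    piH n j = Matrix.diagonal fun c => ((Hval (nodeA hn j) (nodeB hn j) c : ℤ) : ℂ⟦X⟧) := by
  have hj := j.isLt
  rw [diag_Hval]
  set a := nodeA hn j with ha
  set b := nodeB hn j with hb
  have hv := node_val hn j
  rw [← ha, ← hb] at hv
  have hra : a.rev.val = 2 * n - (a.val + 1) := Fin.val_rev a
  have hrb : b.rev.val = 2 * n - (b.val + 1) := Fin.val_rev b
  unfold piH
  split_ifs with h0 h1
  · rw [E_eq_single a a _ _ (by simp only [bar]; omega) (by simp only [bar]; omega),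
      E_eq_single b b _ _ (by omega) (by omega),
      E_eq_single a.rev a.rev 2 2 (by omega) (by omega),
      E_eq_single b.rev b.rev _ _ (by simp only [bar]; omega) (by simp only [bar]; omega)]
  · rw [E_eq_single a a (n - 1) (n - 1) (by omega) (by omega),
      E_eq_single b b (bar n n) _ (by simp only [bar]; omega) (by simp only [bar]; omega),
      E_eq_single a.rev a.rev (bar n (n - 1)) _ (by simp only [bar]; omega)
        (by simp only [bar]; omega),
      E_eq_single b.rev b.rev n n (by omega) (by omega)]
    abel
  · rw [E_eq_single a a j.val _ (by omega) (by omega),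
      E_eq_single b b (j.val + 1) _ (by omega) (by omega),
      E_eq_single a.rev a.rev _ _ (by simp only [bar]; omega) (by simp only [bar]; omega),
      E_eq_single b.rev b.rev _ _ (by simp only [bar]; omega) (by simp only [bar]; omega)]

lemma Hval_rev (a b c : Fin (2 * n)) : Hval a b c.rev = - Hval a b c := by
  simp only [Hval, Fin.rev_eq_iff, Fin.rev_rev]
  ring

lemma Quad.symm {a b : Fin (2 * n)} (h : Quad a b) : Quad b a :=
  ⟨h.ne.symm, fun e => h.ner (by rw [e, Fin.rev_rev])⟩

lemma Hval_left {a b : Fin (2 * n)} (h : Quad a b) : Hval a b a = 1 := by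
  simp [Hval, h.ne, h.ner, ne_rev]

lemma Hval_right {a b : Fin (2 * n)} (h : Quad a b) : Hval a b b = -1 := by
  simp [Hval, h.ne.symm, h.symm.ner, ne_rev]

lemma Hval_of_ne {a b c : Fin (2 * n)} (h1 : c ≠ a) (h2 : c ≠ b) (h3 : c ≠ a.rev)
    (h4 : c ≠ b.rev) : Hval a b c = 0 := by
  simp [Hval, *]

lemma Hval_eq_neg_one {a b c : Fin (2 * n)} (h : Quad a b) (hc : Hval a b c = -1) :
    c = b ∨ c = a.rev := by
  by_contra! hh
  by_cases h1 : c = a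
  · rw [h1, Hval_left h] at hc; omega
  by_cases h2 : c = b.rev
  · rw [h2, Hval_rev, Hval_right h] at hc; omega
  rw [Hval_of_ne h1 hh.1 hh.2 h2] at hc; omega

lemma Hval_eq_one {a b c : Fin (2 * n)} (h : Quad a b) (hc : Hval a b c = 1) :
    c = a ∨ c = b.rev := by
  have := Hval_eq_neg_one (c := c.rev) h (by rw [Hval_rev, hc])
  rcases this with h | h
  · right; rw [← h, Fin.rev_rev]
  · left; exact Fin.rev_inj.mp h

/-- This lemma and the next five record the possible coincidences among the indices of two nodes.
The shape of the diagram enters the defining relations only through them and through `cartan_eq`. -/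
lemma nodeB_inj (hn : 3 ≤ n) {i j : Fin (n + 1)} (h : nodeB hn i = nodeB hn j) : i = j := by
  have hi := i.isLt
  have hj := j.isLt
  have := congrArg Fin.val h
  simp only [nodeB] at this
  ext
  split_ifs at this <;> omega

lemma nodeB_of_nodeA_eq (hn : 3 ≤ n) {i j : Fin (n + 1)} (hij : i ≠ j)
    (h : nodeA hn i = nodeA hn j) : nodeB hn i = (nodeB hn j).rev := by
  have hi := i.isLt
  have hj := j.isLt
  have h2 : i.val ≠ j.val := fun h => hij (Fin.ext h)
  have := congrArg Fin.val h
  simp only [nodeA] at this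
  ext
  simp only [nodeB, Fin.val_rev]
  split_ifs at * <;> omega

lemma nodeA_of_nodeB_eq_rev (hn : 3 ≤ n) {i j : Fin (n + 1)}
    (h : nodeB hn i = (nodeB hn j).rev) : nodeA hn i = nodeA hn j := by
  have hi := i.isLt
  have hj := j.isLt
  have := congrArg Fin.val h
  simp only [nodeB, Fin.val_rev] at this
  ext
  simp only [nodeA]
  split_ifs at * <;> omega

lemma nodeA_eq_of_nodeB_eq_rev (hn : 3 ≤ n) {i j : Fin (n + 1)}
    (h : nodeB hn i = (nodeA hn j).rev) : nodeA hn i = nodeB hn j := by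
  have hi := i.isLt
  have hj := j.isLt
  have := congrArg Fin.val h
  simp only [nodeB, nodeA, Fin.val_rev] at this
  ext
  simp only [nodeA, nodeB]
  split_ifs at * <;> omega

lemma not_opposite (hn : 3 ≤ n) {i j : Fin (n + 1)}
    (h : nodeB hn i = nodeA hn j) : nodeA hn i ≠ nodeB hn j := by
  have hi := i.isLt
  have hj := j.isLt
  intro h'
  have := congrArg Fin.val h
  have h3 := congrArg Fin.val h'
  simp only [nodeA, nodeB] at this h3
  split_ifs at * <;> omega

lemma not_opposite_rev (hn : 3 ≤ n) {i j : Fin (n + 1)}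
    (h : nodeB hn i = (nodeB hn j).rev) : nodeA hn i ≠ (nodeA hn j).rev := by
  rw [nodeA_of_nodeB_eq_rev hn h]
  exact ne_rev _

/-- The weight of an index in the orthonormal basis. -/
def wt (a : Fin (2 * n)) (k : Fin n) : ℤ :=
  (if k.val = a.val then 1 else 0) - (if k.val = a.rev.val then 1 else 0)

lemma root_eq (hn : 3 ≤ n) (i : Fin (n + 1)) (k : Fin n) :
    root n i k = wt (nodeA hn i) k - wt (nodeB hn i) k := by
  have hi := i.isLt
  have hk := k.isLt
  simp only [root, wt, nodeA, nodeB, Fin.val_rev]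
  split_ifs <;> omega

lemma sum_ite_val (m : ℕ) (f : Fin n → ℤ) (g : ℕ → ℤ) (hg : ∀ k, f k = g k.val) :
    (∑ k : Fin n, (if k.val = m then 1 else 0) * f k) = if m < n then g m else 0 := by
  split_ifs with h
  · rw [Finset.sum_eq_single ⟨m, h⟩]
    · simp [hg]
    · intro b _ hb
      rw [if_neg (fun h' => hb (Fin.ext h')), zero_mul]
    · simp
  · apply Finset.sum_eq_zero
    intro k _
    have := k.isLt
    rw [if_neg (by omega), zero_mul]

lemma sum_wt (a c : Fin (2 * n)) :
    ∑ k, wt a k * wt c k = (if c = a then 1 else 0) - (if c = a.rev then 1 else 0) := by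
  obtain ⟨g, hg, h⟩ : ∃ g : ℕ → ℤ, (∀ m, g m = (if m = c.val then 1 else 0)
      - (if m = c.rev.val then 1 else 0)) ∧ ∀ k : Fin n, wt c k = g k.val :=
    ⟨_, fun _ => rfl, fun _ => rfl⟩
  have ha := a.isLt
  have hc := c.isLt
  conv_lhs =>
    enter [2, k]
    rw [wt, sub_mul]
  rw [Finset.sum_sub_distrib, sum_ite_val _ _ g h, sum_ite_val _ _ g h, hg, hg]
  simp only [Fin.ext_iff, Fin.val_rev]
  split_ifs <;> omega

/-- Each simple root is the difference of the weights of `nodeA` and `nodeB`, and the weights are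
signed orthonormal vectors. The Gram matrix thus expands into four inner products, which `sum_wt`
evaluates. -/
lemma cartan_eq (hn : 3 ≤ n) (i j : Fin (n + 1)) :
    cartan n i j = Hval (nodeA hn i) (nodeB hn i) (nodeA hn j)
      - Hval (nodeA hn i) (nodeB hn i) (nodeB hn j) := by
  unfold cartan
  simp_rw [root_eq hn]
  have : ∀ k, (wt (nodeA hn i) k - wt (nodeB hn i) k) * (wt (nodeA hn j) k - wt (nodeB hn j) k)
      = wt (nodeA hn i) k * wt (nodeA hn j) k - wt (nodeA hn i) k * wt (nodeB hn j) k
        - wt (nodeB hn i) k * wt (nodeA hn j) k + wt (nodeB hn i) k * wt (nodeB hn j) k :=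
    fun k => by ring
  simp_rw [this]
  rw [Finset.sum_add_distrib, Finset.sum_sub_distrib, Finset.sum_sub_distrib, sum_wt, sum_wt,
    sum_wt, sum_wt]
  simp only [Hval]
  ring

/-! ### Products of the matrices `Xmat` and the defining relations. -/

section Products

variable {R : Type*} [Ring R]

lemma single_mul_single_ite (a b c d : Fin (2 * n)) :
    (single a b 1 * single c d 1 : Mat n R) = if b = c then single a d 1 else 0 := by
  split_ifs with h
  · subst h; simp
  · rw [Matrix.single_mul_single_of_ne]; exact h

lemma Xmat_mul_Xmat (a b c d : Fin (2 * n)) :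
    (Xmat a b * Xmat c d : Mat n R) = (if b = c then single a d 1 else 0)
      - (if b = d.rev then single a c.rev 1 else 0) - (if a.rev = c then single b.rev d 1 else 0)
      + (if a = d then single b.rev c.rev 1 else 0) := by
  simp only [Xmat, sub_mul, mul_sub, single_mul_single_ite, Fin.rev_inj]
  abel

lemma Xmat_transpose (a b : Fin (2 * n)) : (Xmat a b : Mat n R).transpose = Xmat b a := by
  simp [Xmat, Matrix.transpose_sub, Matrix.transpose_single]

lemma diagonal_commutator_Xmat (d : Fin (2 * n) → R) (hd : ∀ c, d c.rev = - d c)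
    (a b : Fin (2 * n)) :
    Matrix.diagonal d * Xmat a b - Xmat a b * Matrix.diagonal d = (d a - d b) • Xmat a b := by
  ext p r
  simp only [Matrix.sub_apply, Matrix.diagonal_mul, Matrix.mul_diagonal, Xmat, Matrix.smul_apply,
    Matrix.single_apply, smul_eq_mul]
  by_cases h1 : a = p ∧ b = r <;> by_cases h2 : b.rev = p ∧ a.rev = r
  · obtain ⟨rfl, rfl⟩ := h1
    rw [if_pos ⟨rfl, rfl⟩, if_pos h2]; noncomm_ring
  · obtain ⟨rfl, rfl⟩ := h1
    rw [if_pos ⟨rfl, rfl⟩, if_neg h2]; noncomm_ring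
  · obtain ⟨rfl, rfl⟩ := h2
    rw [if_neg h1, if_pos ⟨rfl, rfl⟩, hd, hd]; noncomm_ring
  · rw [if_neg h1, if_neg h2]; noncomm_ring

lemma Xmat_sq {a b : Fin (2 * n)} (h : Quad a b) : (Xmat a b * Xmat a b : Mat n R) = 0 := by
  rw [Xmat_mul_Xmat, if_neg h.ne.symm, if_neg (ne_rev b), if_neg (rev_ne a), if_neg h.ne]
  simp

lemma Xmat_bracket {a b : Fin (2 * n)} (h : Quad a b) :
    (Xmat a b * Xmat b a - Xmat b a * Xmat a b : Mat n R)
      = Matrix.diagonal fun c => ((Hval a b c : ℤ) : R) := by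
  have h1 : b ≠ a.rev := fun e => h.ner (by rw [e, Fin.rev_rev])
  have h2 : a.rev ≠ b := h1.symm
  have h3 : b.rev ≠ a := h.ner.symm
  rw [diag_Hval, Xmat_mul_Xmat, Xmat_mul_Xmat]
  simp only [if_true, if_neg h.ner, if_neg h1, if_neg h2, if_neg h3]
  abel

/-- Both products are sums of four matrix units, each guarded by a coincidence of indices. For `i ≠
j` equal `nodeB` is impossible, and every other coincidence forces a companion that makes the
guarded terms vanish or agree. -/
lemma Xmat_comm_minus (hn : 3 ≤ n) {i j : Fin (n + 1)} (hij : i ≠ j) :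
    (Xmat (nodeA hn i) (nodeB hn i) * Xmat (nodeB hn j) (nodeA hn j) : Mat n R)
      = Xmat (nodeB hn j) (nodeA hn j) * Xmat (nodeA hn i) (nodeB hn i) := by
  have e1 := nodeB_inj hn (i := i) (j := j)
  have e2 := nodeB_of_nodeA_eq hn hij
  have e3 := nodeA_eq_of_nodeB_eq_rev hn (i := i) (j := j)
  have e4 := nodeA_eq_of_nodeB_eq_rev hn (i := j) (j := i)
  have q1 := node_quad hn i
  have q2 := node_quad hn j
  rw [Xmat_mul_Xmat, Xmat_mul_Xmat]
  generalize nodeA hn i = a at *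
  generalize nodeB hn i = b at *
  generalize nodeA hn j = d at *
  generalize nodeB hn j = c at *
  have h1 : b ≠ c := fun h => hij (e1 h)
  rw [if_neg h1, if_neg h1.symm]
  by_cases h2 : a = d
  · subst h2
    have hb := e2 rfl
    subst hb
    have : c.rev ≠ a.rev := fun h => q2.ne (Fin.rev_inj.mp h).symm
    have h3 : a.rev ≠ c := fun h => q2.ner (by rw [← h, Fin.rev_rev])
    have h4 : c.rev.rev ≠ a.rev := by rw [Fin.rev_rev]; exact h3.symm
    have h5 : c.rev ≠ a := fun h => q1.ne h.symm
    simp [h3, h5, this, q2.ne]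
  · have h2' : d ≠ a := fun h => h2 h.symm
    rw [if_neg h2, if_neg h2']
    by_cases h3 : b = d.rev
    · have := e3 h3
      subst h3
      subst this
      simp [rev_ne]
    · have h3' : d ≠ b.rev := fun h => h3 (by rw [h, Fin.rev_rev])
      rw [if_neg h3, if_neg h3']
      by_cases h4 : a.rev = c
      · have := e4 h4.symm
        subst this
        subst h4
        simp
      · have h4' : c.rev ≠ a := fun h => h4 (by rw [← h, Fin.rev_rev])
        rw [if_neg h4, if_neg h4']

/-- By `cartan_eq` the two indices of `j` have equal weight under the coroot of `i`. A coincidence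
makes this weight `±1`, and only two indices have a given weight `±1`; one of them is excluded, so
the other index is forced. -/
lemma node_coincidences (hn : 3 ≤ n) {i j : Fin (n + 1)} (h : cartan n i j = 0) :
    (nodeB hn i = nodeA hn j → nodeA hn i = (nodeB hn j).rev) ∧
    (nodeA hn i = nodeB hn j → nodeB hn i = (nodeA hn j).rev) ∧
    (nodeB hn i = (nodeB hn j).rev → nodeA hn i = nodeA hn j) ∧
    (nodeA hn i).rev ≠ nodeA hn j := by
  rw [cartan_eq hn] at h
  have q1 := node_quad hn i
  have q2 := node_quad hn j
  have e := nodeB_inj hn (i := i) (j := j)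
  refine ⟨fun h' => ?_, fun h' => ?_, nodeA_of_nodeB_eq_rev hn, fun h' => ?_⟩
  · rw [← h', Hval_right q1] at h
    rcases Hval_eq_neg_one q1 (c := nodeB hn j) (by omega) with h2 | h2
    · exact absurd (h'.symm.trans h2.symm) q2.ne
    · rw [h2, Fin.rev_rev]
  · rw [← h', Hval_left q1] at h
    rcases Hval_eq_one q1 (c := nodeA hn j) (by omega) with h2 | h2
    · exact absurd (h2.trans h') q2.ne
    · rw [h2, Fin.rev_rev]
  · rw [← h', Hval_rev, Hval_left q1] at h
    rcases Hval_eq_neg_one q1 (c := nodeB hn j) (by omega) with h2 | h2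
    · rw [e h2.symm] at h'
      exact rev_ne _ h'
    · exact q2.ne (h'.symm.trans h2.symm)

lemma Xmat_comm_of_cartan (hn : 3 ≤ n) {i j : Fin (n + 1)} (h : cartan n i j = 0) :
    (Xmat (nodeA hn j) (nodeB hn j) * Xmat (nodeA hn i) (nodeB hn i) : Mat n R)
      = Xmat (nodeA hn i) (nodeB hn i) * Xmat (nodeA hn j) (nodeB hn j) := by
  obtain ⟨e1, e2, e3, e4⟩ := node_coincidences hn h
  rw [Xmat_mul_Xmat, Xmat_mul_Xmat]
  generalize nodeA hn i = a at *
  generalize nodeB hn i = b at *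
  generalize nodeA hn j = c at *
  generalize nodeB hn j = d at *
  have e4' : c.rev ≠ a := fun h => e4 (by rw [← h, Fin.rev_rev])
  rw [if_neg e4, if_neg e4']
  have t1 : (if d = b.rev then single c a.rev 1 else 0 : Mat n R)
      = if b = d.rev then single a c.rev 1 else 0 := by
    by_cases h : b = d.rev
    · have := e3 h
      subst h; subst this; simp
    · have : d ≠ b.rev := fun h' => h (by rw [h', Fin.rev_rev])
      rw [if_neg h, if_neg this]
  have t2 : (if d = a then single c b 1 else 0 : Mat n R)
      = if a = d then single b.rev c.rev 1 else 0 := by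
    by_cases h : a = d
    · have := e2 h
      subst h; subst this; simp
    · rw [if_neg h, if_neg (Ne.symm h)]
  have t3 : (if c = b then single d.rev a.rev 1 else 0 : Mat n R)
      = if b = c then single a d 1 else 0 := by
    by_cases h : b = c
    · have := e1 h
      subst h; subst this; simp
    · rw [if_neg h, if_neg (Ne.symm h)]
  rw [t1, t2, t3]
  abel

lemma Xmat_mul_mul_Xmat (a b : Fin (2 * n)) (Y : Mat n R) :
    Xmat a b * Y * Xmat a b = Y b a • single a b 1 - Y b b.rev • single a a.rev 1
      - Y a.rev a • single b.rev b 1 + Y a.rev b.rev • single b.rev a.rev 1 := by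
  have key : ∀ p r p' r' : Fin (2 * n), (single p r 1 * Y * single p' r' 1 : Mat n R)
      = Y r p' • single p r' 1 := by
    intro p r p' r'
    ext x y
    by_cases hx : x = p <;> by_cases hy : y = r'
    · subst hx; subst hy; simp
    · subst hx
      rw [Matrix.mul_single_apply_of_ne _ _ _ _ _ hy, Matrix.smul_apply, Matrix.single_apply,
        if_neg (fun h => hy h.2.symm), smul_zero]
    · subst hy
      rw [Matrix.mul_single_apply_same, Matrix.single_mul_apply_of_ne _ _ _ _ _ hx,
        Matrix.smul_apply, Matrix.single_apply, if_neg (fun h => hx h.1.symm), smul_zero, zero_mul]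
    · rw [Matrix.mul_single_apply_of_ne _ _ _ _ _ hy, Matrix.smul_apply, Matrix.single_apply,
        if_neg (fun h => hy h.2.symm), smul_zero]
  simp only [Xmat, sub_mul, mul_sub, key]
  abel

/-- Together with `Xmat_sq` this kills each term of a cubic Serre relation separately, whatever its
coefficient. Sandwiching picks four entries of `X_j`: those at `(y, ȳ)` vanish since `X_j` has none
there, and the other two would make `X_j` opposite to `X_i`, which no two nodes are. -/
lemma Xmat_cubic (hn : 3 ≤ n) (i j : Fin (n + 1)) :
    (Xmat (nodeA hn i) (nodeB hn i) * Xmat (nodeA hn j) (nodeB hn j) *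
      Xmat (nodeA hn i) (nodeB hn i) : Mat n R) = 0 := by
  have e1 := not_opposite hn (i := i) (j := j)
  have e2 := not_opposite_rev hn (i := i) (j := j)
  have q := node_quad hn j
  rw [Xmat_mul_mul_Xmat]
  generalize nodeA hn i = a at *
  generalize nodeB hn i = b at *
  generalize nodeA hn j = c at *
  generalize nodeB hn j = d at *
  have h1 : ¬ (c = b ∧ d = a) := fun h => e1 h.1.symm h.2.symm
  have h2 : ¬ (d.rev = b ∧ c.rev = a) := fun h => e2 h.1.symm h.2.symm
  have h3 : ∀ y, ¬ (c = y ∧ d = y.rev) := by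
    rintro y ⟨rfl, h⟩
    exact q.ner (by rw [h, Fin.rev_rev])
  have h4 : ∀ y, ¬ (d.rev = y ∧ c.rev = y.rev) := by
    rintro y ⟨rfl, h⟩
    exact q.ner (Fin.rev_inj.mp h)
  have h5 : ¬ (c = a.rev ∧ d = a) := by
    rintro ⟨h, rfl⟩; exact q.ner h
  have h6 : ¬ (d.rev = a.rev ∧ c.rev = a) := by
    rintro ⟨h, rfl⟩; rw [Fin.rev_inj] at h; exact q.ner (by rw [h, Fin.rev_rev])
  have h7 : ¬ (c = a.rev ∧ d = b.rev) := by
    rintro ⟨rfl, rfl⟩; exact h2 (by simp)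
  have h9 : ¬ (d.rev = b ∧ c = b) := by
    rintro ⟨rfl, h⟩; exact q.ner h
  have h10 : ¬ (d = a ∧ c.rev = a) := by
    rintro ⟨rfl, h⟩; exact q.ner (by rw [← h, Fin.rev_rev])
  have h11 : ¬ (d = a ∧ c = b) := fun h => h1 ⟨h.2, h.1⟩
  have h8 : ¬ (d.rev = a.rev ∧ c.rev = b.rev) := by
    rintro ⟨h, h'⟩; rw [Fin.rev_inj] at h h'; exact h1 ⟨h', h⟩
  simp [Xmat, h1, h2, h3, h5, h7, h9, h10, h11]

end Products

end Nodes

/-! ## Evaluation of the completed free algebra on matrices over `ℂ[[h]]` -/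

section Evaluation

variable {n : ℕ}

/-- The coefficient of `h^k` of a matrix over `ℂ[[h]]`. -/
def mcoeff (k : ℕ) (M : Mat n ℂ⟦X⟧) : Mat n ℂ := M.map (PowerSeries.coeff k)

lemma mcoeff_ext {M N : Mat n ℂ⟦X⟧} (h : ∀ k, mcoeff k M = mcoeff k N) : M = N := by
  ext a b k
  exact congrFun (congrFun (h k) a) b

lemma mcoeff_add (k : ℕ) (M N : Mat n ℂ⟦X⟧) : mcoeff k (M + N) = mcoeff k M + mcoeff k N := by
  ext a b; simp [mcoeff]

lemma mcoeff_sum {ι : Type*} (t : Finset ι) (k : ℕ) (M : ι → Mat n ℂ⟦X⟧) :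
    mcoeff k (∑ i ∈ t, M i) = ∑ i ∈ t, mcoeff k (M i) := by
  ext a b; simp [mcoeff, Matrix.sum_apply]

lemma mcoeff_mul (k : ℕ) (M N : Mat n ℂ⟦X⟧) :
    mcoeff k (M * N)
      = ∑ p ∈ Finset.HasAntidiagonal.antidiagonal k, mcoeff p.1 M * mcoeff p.2 N := by
  ext a b
  simp only [mcoeff, Matrix.map_apply, Matrix.mul_apply, map_sum, PowerSeries.coeff_mul,
    Matrix.sum_apply]
  rw [Finset.sum_comm]

/-- Both sides run over quadruples with total `k`; exchanging the two middle entries is an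
involution between them. This is the rearrangement that makes `evalHat` multiplicative. -/
lemma sum_antidiagonal_interchange {A : Type*} [AddCommMonoid A] (k : ℕ)
    (f : ℕ → ℕ → ℕ → ℕ → A) :
    ∑ p ∈ Finset.HasAntidiagonal.antidiagonal k, ∑ l ∈ Finset.HasAntidiagonal.antidiagonal p.1,
        ∑ m ∈ Finset.HasAntidiagonal.antidiagonal p.2,
        f l.1 l.2 m.1 m.2
      = ∑ p ∈ Finset.HasAntidiagonal.antidiagonal k, ∑ l ∈ Finset.HasAntidiagonal.antidiagonal p.1,
        ∑ m ∈ Finset.HasAntidiagonal.antidiagonal p.2, f l.1 m.1 l.2 m.2 := by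
  simp only [← Finset.sum_product', Finset.sum_sigma']
  refine Finset.sum_bij'
    (fun x _ => ⟨(x.2.1.1 + x.2.2.1, x.2.1.2 + x.2.2.2), ((x.2.1.1, x.2.2.1), (x.2.1.2, x.2.2.2))⟩)
    (fun x _ => ⟨(x.2.1.1 + x.2.2.1, x.2.1.2 + x.2.2.2), ((x.2.1.1, x.2.2.1), (x.2.1.2, x.2.2.2))⟩)
    ?_ ?_ ?_ ?_ ?_
  · rintro ⟨⟨p, p'⟩, ⟨l, l'⟩, ⟨m, m'⟩⟩ h
    simp only [Finset.mem_sigma, Finset.mem_product, Finset.HasAntidiagonal.mem_antidiagonal] at h ⊢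
    refine ⟨?_, trivial, trivial⟩
    omega
  · rintro ⟨⟨p, p'⟩, ⟨l, l'⟩, ⟨m, m'⟩⟩ h
    simp only [Finset.mem_sigma, Finset.mem_product, Finset.HasAntidiagonal.mem_antidiagonal] at h ⊢
    refine ⟨?_, trivial, trivial⟩
    omega
  · rintro ⟨⟨p, p'⟩, ⟨l, l'⟩, ⟨m, m'⟩⟩ h
    simp only [Finset.mem_sigma, Finset.mem_product, Finset.HasAntidiagonal.mem_antidiagonal] at h
    obtain ⟨-, rfl, rfl⟩ := h
    rfl
  · rintro ⟨⟨p, p'⟩, ⟨l, l'⟩, ⟨m, m'⟩⟩ h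
    simp only [Finset.mem_sigma, Finset.mem_product, Finset.HasAntidiagonal.mem_antidiagonal] at h
    obtain ⟨-, rfl, rfl⟩ := h
    rfl
  · intros; rfl

/-- The evaluation `Σ a_k h^k ↦ Σ φ(a_k) h^k` attached to an algebra map `φ` of the free algebra. -/
def evalHat (φ : FreeAlgebra ℂ (Gen n) →ₐ[ℂ] Mat n ℂ⟦X⟧) (f : FreeHat n) : Mat n ℂ⟦X⟧ :=
  Matrix.of fun a b => PowerSeries.mk fun k =>
    (∑ p ∈ Finset.HasAntidiagonal.antidiagonal k, mcoeff p.2 (φ (PowerSeries.coeff p.1 f))) a b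

lemma mcoeff_evalHat (φ : FreeAlgebra ℂ (Gen n) →ₐ[ℂ] Mat n ℂ⟦X⟧) (f : FreeHat n) (k : ℕ) :
    mcoeff k (evalHat φ f)
      = ∑ p ∈ Finset.HasAntidiagonal.antidiagonal k, mcoeff p.2 (φ (PowerSeries.coeff p.1 f)) := by
  ext a b
  simp [mcoeff, evalHat]

lemma evalHat_mul (φ : FreeAlgebra ℂ (Gen n) →ₐ[ℂ] Mat n ℂ⟦X⟧) (f g : FreeHat n) :
    evalHat φ (f * g) = evalHat φ f * evalHat φ g := by
  apply mcoeff_ext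
  intro k
  simp only [mcoeff_evalHat, mcoeff_mul, PowerSeries.coeff_mul, map_sum, map_mul, mcoeff_sum,
    Finset.sum_mul_sum]
  exact sum_antidiagonal_interchange k fun i j i' j' =>
    mcoeff i' (φ (PowerSeries.coeff i f)) * mcoeff j' (φ (PowerSeries.coeff j g))

lemma evalHat_C (φ : FreeAlgebra ℂ (Gen n) →ₐ[ℂ] Mat n ℂ⟦X⟧) (a : FreeAlgebra ℂ (Gen n)) :
    evalHat φ (PowerSeries.C a) = φ a := by
  apply mcoeff_ext
  intro k
  rw [mcoeff_evalHat, Finset.sum_eq_single (0, k)]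
  · simp
  · rintro ⟨i, j⟩ h hne
    rw [Finset.HasAntidiagonal.mem_antidiagonal] at h
    have hi : i ≠ 0 := by
      rintro rfl
      exact hne (by simp at h; rw [h])
    ext a b
    simp [PowerSeries.coeff_C, hi, mcoeff]
  · intro h; simp at h

lemma evalHat_add (φ : FreeAlgebra ℂ (Gen n) →ₐ[ℂ] Mat n ℂ⟦X⟧) (f g : FreeHat n) :
    evalHat φ (f + g) = evalHat φ f + evalHat φ g := by
  apply mcoeff_ext
  intro k
  simp only [mcoeff_evalHat, mcoeff_add, map_add, Finset.sum_add_distrib]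

/-- `evalHat` as a ring homomorphism. -/
def evalHom (φ : FreeAlgebra ℂ (Gen n) →ₐ[ℂ] Mat n ℂ⟦X⟧) : FreeHat n →+* Mat n ℂ⟦X⟧ where
  toFun := evalHat φ
  map_one' := by
    have := evalHat_C φ 1
    rwa [map_one, map_one] at this
  map_mul' := evalHat_mul φ
  map_zero' := by
    have := evalHat_C φ 0
    rwa [map_zero, map_zero] at this
  map_add' := evalHat_add φ

lemma evalHom_gen (φ : FreeAlgebra ℂ (Gen n) →ₐ[ℂ] Mat n ℂ⟦X⟧) (g : Gen n) :
    evalHom φ (gen g) = φ (FreeAlgebra.ι ℂ g) := evalHat_C φ _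

lemma algebraMap_mat (c : ℂ) :
    algebraMap ℂ (Mat n ℂ⟦X⟧) c = (PowerSeries.C c : ℂ⟦X⟧) • (1 : Mat n ℂ⟦X⟧) := by
  rw [Algebra.algebraMap_eq_smul_one]
  ext a b : 2
  rw [Matrix.smul_apply, Matrix.smul_apply, PowerSeries.smul_eq_C_mul, smul_eq_mul]

lemma evalHom_scal (φ : FreeAlgebra ℂ (Gen n) →ₐ[ℂ] Mat n ℂ⟦X⟧) (f : ℂ⟦X⟧) :
    evalHom φ (scal n f) = f • 1 := by
  apply mcoeff_ext
  intro k
  change mcoeff k (evalHat φ _) = _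
  rw [mcoeff_evalHat, Finset.sum_eq_single (k, 0)]
  · ext a b
    simp only [scal, PowerSeries.coeff_map, AlgHom.commutes, algebraMap_mat, mcoeff,
      Matrix.map_apply, Matrix.smul_apply]
    by_cases h : a = b
    · subst h; simp
    · simp [h]
  · rintro ⟨i, j⟩ h hne
    rw [Finset.HasAntidiagonal.mem_antidiagonal] at h
    have hj : j ≠ 0 := by
      rintro rfl
      exact hne (by simp at h; rw [h])
    ext a b
    simp only [scal, PowerSeries.coeff_map, AlgHom.commutes, algebraMap_mat, mcoeff,
      Matrix.map_apply, Matrix.smul_apply]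
    by_cases h : a = b
    · subst h; simp [PowerSeries.coeff_C, hj]
    · simp [h]
  · intro h; simp at h

lemma X_eq_scal : (PowerSeries.X : FreeHat n) = scal n PowerSeries.X := by
  rw [scal, PowerSeries.map_X]

/-- Matrices over `ℂ[[h]]` are `h`-adically separated; this takes the place of continuity arguments.
-/
lemma eq_zero_of_forall_X_pow {M : Mat n ℂ⟦X⟧}
    (h : ∀ m : ℕ, ∃ N : Mat n ℂ⟦X⟧, M = (PowerSeries.X ^ m : ℂ⟦X⟧) • N) : M = 0 := by
  apply mcoeff_ext
  intro k
  obtain ⟨N, rfl⟩ := h (k + 1)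
  ext a b
  simp only [mcoeff, Matrix.map_apply, Matrix.smul_apply, smul_eq_mul, Matrix.zero_apply, map_zero]
  rw [PowerSeries.coeff_X_pow_mul', if_neg (by omega)]

lemma ringHom_X_pow_mul (ψ : FreeHat n →+* Mat n ℂ⟦X⟧) (hψ : ∀ f, ψ (scal n f) = f • 1) (m : ℕ)
    (c : FreeHat n) : ψ (PowerSeries.X ^ m * c) = (PowerSeries.X ^ m : ℂ⟦X⟧) • ψ c := by
  rw [X_eq_scal, ← map_pow, map_mul, hψ, smul_mul_assoc, one_mul]

/-- The kernel of a `ℂ[[h]]`-linear ring homomorphism into matrices contains the closed ideal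
generated by the relators that it kills. -/
lemma map_eq_zero_of_mem_relIdeal (ψ : FreeHat n →+* Mat n ℂ⟦X⟧)
    (hψ : ∀ f, ψ (scal n f) = f • 1) (hrel : ∀ a, Relator n a → ψ a = 0) {a : FreeHat n}
    (ha : a ∈ relIdeal n) : ψ a = 0 := by
  -- The kernel is a member of the family whose infimum is `relIdeal`: it contains the relators, and
  -- it is closed because `ψ` is linear over `ℂ[[h]]`.
  have : relIdeal n ≤ TwoSidedIdeal.ker ψ := by
    apply sInf_le
    refine ⟨fun a ha => (TwoSidedIdeal.mem_ker _).2 (hrel a ha), fun a ha => ?_⟩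
    rw [TwoSidedIdeal.mem_ker]
    apply eq_zero_of_forall_X_pow
    intro m
    obtain ⟨b, hb, c, hc⟩ := ha m
    rw [TwoSidedIdeal.mem_ker] at hb
    refine ⟨ψ c, ?_⟩
    rw [← ringHom_X_pow_mul ψ hψ, ← hc, map_sub, hb, sub_zero]
  exact (TwoSidedIdeal.mem_ker _).1 (this ha)

/-- A `ℂ[[h]]`-linear ring homomorphism into matrices is determined by its values on the
generators. -/
lemma ringHom_ext_gen {ψ χ : FreeHat n →+* Mat n ℂ⟦X⟧} (hψ : ∀ f, ψ (scal n f) = f • 1)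
    (hχ : ∀ f, χ (scal n f) = f • 1) (h : ∀ g, ψ (gen g) = χ (gen g)) : ψ = χ := by
  have hC : ∀ a : FreeAlgebra ℂ (Gen n), ψ (PowerSeries.C a) = χ (PowerSeries.C a) := by
    intro a
    induction a using FreeAlgebra.induction with
    | grade0 c =>
      have : (PowerSeries.C (algebraMap ℂ (FreeAlgebra ℂ (Gen n)) c) : FreeHat n)
          = scal n (PowerSeries.C c) := by rw [scal, PowerSeries.map_C]
      rw [this, hψ, hχ]
    | grade1 g => exact h g
    | mul a b ha hb => rw [map_mul, map_mul, map_mul, ha, hb]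
    | add a b ha hb => rw [map_add, map_add, map_add, ha, hb]
  -- The constant term of `f` lies in the free algebra, where the maps agree by `hC`; splitting it
  -- off gains one factor `h` at each step.
  have key : ∀ (m : ℕ) (f : FreeHat n), ∃ N : Mat n ℂ⟦X⟧,
      ψ f - χ f = (PowerSeries.X ^ m : ℂ⟦X⟧) • N := by
    intro m
    induction m with
    | zero => intro f; exact ⟨_, by rw [pow_zero, one_smul]⟩
    | succ m ih =>
      intro f
      obtain ⟨N, hN⟩ := ih (divX f)
      refine ⟨N, ?_⟩
      have hf : f = PowerSeries.X ^ 1 * divX f + PowerSeries.C (PowerSeries.constantCoeff f) := by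
        ext k
        cases k with
        | zero => simp
        | succ k => simp [divX, PowerSeries.coeff_succ_X_mul]
      have h1 : ψ f - χ f = (PowerSeries.X : ℂ⟦X⟧) • (ψ (divX f) - χ (divX f)) := by
        conv_lhs => rw [hf]
        rw [map_add, map_add, ringHom_X_pow_mul ψ hψ, ringHom_X_pow_mul χ hχ, hC, pow_one,
          smul_sub]
        abel
      rw [h1, hN, smul_smul, pow_succ']
  ext1 f
  rw [← sub_eq_zero]
  exact eq_zero_of_forall_X_pow fun m => key m f

lemma qpow_coeff (c : ℂ) (k : ℕ) :
    PowerSeries.coeff k (qpow c) = c ^ k / (k.factorial : ℂ) := by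
  simp [qpow, PowerSeries.coeff_rescale, PowerSeries.coeff_exp, div_eq_mul_inv]

/-- The value of `q^{c h_i}` under a homomorphism that sends `h_i` to an integral diagonal
matrix. -/
lemma ringHom_expH (ψ : FreeHat n →+* Mat n ℂ⟦X⟧) (hψ : ∀ f, ψ (scal n f) = f • 1) (c : ℂ)
    (i : Fin (n + 1)) (w : Fin (2 * n) → ℤ)
    (hw : ψ (gen (.h i)) = Matrix.diagonal fun a => ((w a : ℤ) : ℂ⟦X⟧)) :
    ψ (expH c i) = Matrix.diagonal fun a => qpow (c * w a) := by
  set φ : FreeAlgebra ℂ (Gen n) →ₐ[ℂ] Mat n ℂ⟦X⟧ :=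
    FreeAlgebra.lift ℂ fun g => ψ (gen g) with hφ
  -- By uniqueness `ψ` is a coefficientwise evaluation, so the exponential series may be evaluated
  -- term by term.
  have h0 : ψ = evalHom φ := by
    apply ringHom_ext_gen hψ (evalHom_scal φ)
    intro g
    rw [evalHom_gen, hφ, FreeAlgebra.lift_ι_apply]
  rw [h0]
  apply mcoeff_ext
  intro k
  change mcoeff k (evalHat φ _) = _
  have h1 : ∀ i' : ℕ, φ (PowerSeries.coeff i' (expH c i)) = Matrix.diagonal fun a =>
      PowerSeries.C ((c * w a) ^ i' / (i'.factorial : ℂ)) := by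
    intro i'
    rw [expH, PowerSeries.coeff_mk, map_smul, map_pow, hφ, FreeAlgebra.lift_ι_apply, hw,
      Matrix.diagonal_pow]
    ext a b : 2
    by_cases hab : a = b
    · subst hab
      simp only [Matrix.smul_apply, Matrix.diagonal_apply_eq, Pi.pow_apply,
        PowerSeries.smul_eq_C_mul]
      rw [show ((w a : ℤ) : ℂ⟦X⟧) = PowerSeries.C ((w a : ℤ) : ℂ) by simp, ← map_pow, ← map_mul]
      congr 1
      rw [mul_pow, mul_div_right_comm]
    · simp [Matrix.diagonal_apply_ne _ hab]
  rw [mcoeff_evalHat, Finset.sum_eq_single (k, 0)]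
  · rw [h1]
    ext a b
    by_cases hab : a = b
    · subst hab
      simp only [mcoeff, Matrix.map_apply, Matrix.diagonal_apply_eq, qpow_coeff,
        PowerSeries.coeff_zero_C]
    · simp [mcoeff, Matrix.diagonal_apply_ne _ hab]
  · rintro ⟨i', j⟩ h hne
    rw [Finset.HasAntidiagonal.mem_antidiagonal] at h
    have hj : j ≠ 0 := by
      rintro rfl
      exact hne (by simp at h; rw [h])
    rw [h1]
    ext a b
    by_cases hab : a = b
    · subst hab
      simp [mcoeff, PowerSeries.coeff_C, hj]
    · simp [mcoeff, Matrix.diagonal_apply_ne _ hab]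
  · intro h; simp at h

lemma X_mul_divX {A : Type*} [Ring A] (f : PowerSeries A)
    (hf : PowerSeries.constantCoeff f = 0) : PowerSeries.X * divX f = f := by
  ext k
  cases k with
  | zero => simp [hf]
  | succ k => simp [divX, PowerSeries.coeff_succ_X_mul]

lemma qpow_zero : qpow 0 = 1 := by
  ext k
  rw [qpow_coeff, PowerSeries.coeff_one]
  by_cases hk : k = 0
  · simp [hk]
  · simp [hk]

/-- The image of `(q^{h_i} - q^{-h_i})/(q - q^{-1})` is that of `h_i` when `h_i` has eigenvalues
in `{-1, 0, 1}`. -/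
lemma ringHom_qbracket (ψ : FreeHat n →+* Mat n ℂ⟦X⟧) (hψ : ∀ f, ψ (scal n f) = f • 1)
    (i : Fin (n + 1)) (w : Fin (2 * n) → ℤ) (hw1 : ∀ a, w a = -1 ∨ w a = 0 ∨ w a = 1)
    (hw : ψ (gen (.h i)) = Matrix.diagonal fun a => ((w a : ℤ) : ℂ⟦X⟧)) :
    ψ (qbracket i) = Matrix.diagonal fun a => ((w a : ℤ) : ℂ⟦X⟧) := by
  set d : ℂ⟦X⟧ := divX (qpow 1 - qpow (-1)) with hd
  have hXd : PowerSeries.X * d = qpow 1 - qpow (-1) := by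
    apply X_mul_divX
    rw [map_sub, ← PowerSeries.coeff_zero_eq_constantCoeff_apply,
      ← PowerSeries.coeff_zero_eq_constantCoeff_apply, qpow_coeff, qpow_coeff]
    simp
  have hd0 : PowerSeries.constantCoeff d ≠ 0 := by
    rw [← PowerSeries.coeff_zero_eq_constantCoeff_apply, hd, divX, PowerSeries.coeff_mk, map_sub,
      qpow_coeff, qpow_coeff]
    norm_num
  have hN : (PowerSeries.X : FreeHat n) * divX (expH 1 i - expH (-1) i)
      = expH 1 i - expH (-1) i := by
    apply X_mul_divX
    rw [map_sub, ← PowerSeries.coeff_zero_eq_constantCoeff_apply,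
      ← PowerSeries.coeff_zero_eq_constantCoeff_apply, expH, expH, PowerSeries.coeff_mk,
      PowerSeries.coeff_mk]
    simp
  have h1 := congrArg ψ hN
  have h2 := ringHom_X_pow_mul ψ hψ 1 (divX (expH 1 i - expH (-1) i))
  rw [pow_one, pow_one] at h2
  rw [h2, map_sub, ringHom_expH ψ hψ 1 i w hw, ringHom_expH ψ hψ (-1) i w hw] at h1
  -- The quotients by `h` are reached by multiplying back by `h` and cancelling. The identity used
  -- is `q^w - q^{-w} = w (q - q⁻¹)`, valid for `w ∈ {-1, 0, 1}`.
  have h3 : ψ (divX (expH 1 i - expH (-1) i))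
      = d • Matrix.diagonal fun a => ((w a : ℤ) : ℂ⟦X⟧) := by
    refine Matrix.ext fun a b => ?_
    apply mul_left_cancel₀ (PowerSeries.X_ne_zero (R := ℂ))
    have := congrFun (congrFun h1 a) b
    rw [Matrix.smul_apply, smul_eq_mul] at this
    rw [this, Matrix.smul_apply, smul_eq_mul, ← mul_assoc, hXd, Matrix.sub_apply]
    by_cases hab : a = b
    · subst hab
      simp only [Matrix.diagonal_apply_eq]
      rcases hw1 a with h | h | h <;> rw [h] <;> simp
    · simp [Matrix.diagonal_apply_ne _ hab]
  rw [qbracket, map_mul, hψ, ← hd, h3, smul_mul_assoc, one_mul, smul_smul,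
    PowerSeries.inv_mul_cancel _ hd0, one_smul]

end Evaluation

/-! ## Existence and uniqueness of the vector representations -/

section VectorRep

variable {n : ℕ}

/-- The prescribed values of `π_x` on the generators. -/
def vecGen (x : ℂ⟦X⟧ˣ) : Gen n → Mat n ℂ⟦X⟧
  | .xp j => (specFactor x j : ℂ⟦X⟧) • piXp n j
  | .xm j => ((specFactor x j)⁻¹ : ℂ⟦X⟧ˣ).val • piXm n j
  | .h j => piH n j

/-- The evaluation of the completed free algebra under `π_x`. -/
def vecHom (x : ℂ⟦X⟧ˣ) : FreeHat n →+* Mat n ℂ⟦X⟧ := evalHom (FreeAlgebra.lift ℂ (vecGen x))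

lemma vecHom_gen (x : ℂ⟦X⟧ˣ) (g : Gen n) : vecHom x (gen g) = vecGen x g := by
  rw [vecHom, evalHom_gen, FreeAlgebra.lift_ι_apply]

lemma vecHom_scal (x : ℂ⟦X⟧ˣ) (f : ℂ⟦X⟧) : vecHom x (scal n f) = f • 1 := evalHom_scal _ f

lemma Hval_cases {a b : Fin (2 * n)} (h : Quad a b) (c : Fin (2 * n)) :
    Hval a b c = -1 ∨ Hval a b c = 0 ∨ Hval a b c = 1 := by
  by_cases h1 : c = a
  · subst h1; right; right; exact Hval_left h
  by_cases h2 : c = b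
  · subst h2; left; exact Hval_right h
  by_cases h3 : c = a.rev
  · subst h3; left; rw [Hval_rev, Hval_left h]
  by_cases h4 : c = b.rev
  · subst h4; right; right; rw [Hval_rev, Hval_right h]; rfl
  right; left; exact Hval_of_ne h1 h2 h3 h4

/-- The spectral parameter cancels in `[x_0^+, x_0^-]`, and the other relations are homogeneous in
it. The relations for `x_j^-` are the transposes of those for `x_j^+`. -/
lemma vecHom_relator (hn : 3 ≤ n) (x : ℂ⟦X⟧ˣ) {a : FreeHat n} (ha : Relator n a) :
    vecHom x a = 0 := by
  have hrev : ∀ i c, ((Hval (nodeA hn i) (nodeB hn i) (Fin.rev c) : ℤ) : ℂ⟦X⟧)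
      = - ((Hval (nodeA hn i) (nodeB hn i) c : ℤ) : ℂ⟦X⟧) := by
    intro i c; rw [Hval_rev]; push_cast; rfl
  cases ha with
  | hh i j =>
    simp only [map_sub, map_mul, vecHom_gen, vecGen, piH_eq hn, Matrix.diagonal_mul_diagonal]
    rw [sub_eq_zero]
    congr 1
    funext c
    ring
  | hxp i j =>
    simp only [map_sub, map_mul, map_zsmul, vecHom_gen, vecGen, piH_eq hn, piXp_eq hn]
    rw [mul_smul_comm, smul_mul_assoc, ← smul_sub, diagonal_commutator_Xmat _ (hrev i),
      cartan_eq hn, smul_comm, sub_eq_zero, ← Int.cast_smul_eq_zsmul ℂ⟦X⟧]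
    push_cast
    rfl
  | hxm i j =>
    simp only [map_sub, map_add, map_mul, map_zsmul, vecHom_gen, vecGen, piH_eq hn, piXm_eq hn]
    rw [mul_smul_comm, smul_mul_assoc, ← smul_sub, diagonal_commutator_Xmat _ (hrev i),
      cartan_eq hn, smul_comm, ← Int.cast_smul_eq_zsmul ℂ⟦X⟧, ← add_smul]
    push_cast
    rw [sub_add_sub_cancel, sub_self, zero_smul]
  | xx i j =>
    simp only [map_sub, map_mul, vecHom_gen, vecGen, piXp_eq hn, piXm_eq hn]
    by_cases hij : i = j
    · subst hij
      have hb := ringHom_qbracket (vecHom x) (vecHom_scal x) i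
        (Hval (nodeA hn i) (nodeB hn i)) (Hval_cases (node_quad hn i))
        (by rw [vecHom_gen, vecGen, piH_eq hn])
      rw [if_pos rfl, hb]
      rw [smul_mul_smul_comm, smul_mul_smul_comm, Units.mul_inv, Units.inv_mul, one_smul, one_smul,
        Xmat_bracket (node_quad hn i), sub_self]
    · rw [if_neg hij, map_zero, sub_zero, smul_mul_smul_comm, smul_mul_smul_comm,
        Xmat_comm_minus hn hij, mul_comm (_ : ℂ⟦X⟧), sub_self]
  | serre_zero_p i j h =>
    simp only [map_sub, map_mul, vecHom_gen, vecGen, piXp_eq hn]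
    rw [smul_mul_smul_comm, smul_mul_smul_comm, Xmat_comm_of_cartan hn h, mul_comm (_ : ℂ⟦X⟧),
      sub_self]
  | serre_zero_m i j h =>
    simp only [map_sub, map_mul, vecHom_gen, vecGen, piXm_eq hn]
    have := congrArg Matrix.transpose (Xmat_comm_of_cartan (R := ℂ⟦X⟧) hn h)
    rw [Matrix.transpose_mul, Matrix.transpose_mul] at this
    simp only [Xmat_transpose] at this
    rw [smul_mul_smul_comm, smul_mul_smul_comm, this, mul_comm (_ : ℂ⟦X⟧), sub_self]
  | serre_one_p i j h =>
    simp only [map_sub, map_add, map_mul, vecHom_gen, vecGen, piXp_eq hn, pow_two]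
    simp only [smul_mul_assoc, mul_smul_comm, Xmat_sq (node_quad hn i),
      Xmat_cubic hn i j, zero_mul, smul_zero, mul_zero]
    simp
  | serre_one_m i j h =>
    have h1 := congrArg Matrix.transpose (Xmat_sq (R := ℂ⟦X⟧) (node_quad hn i))
    have h2 := congrArg Matrix.transpose (Xmat_cubic (R := ℂ⟦X⟧) hn i j)
    simp only [Matrix.transpose_mul, Xmat_transpose, Matrix.transpose_zero] at h1 h2
    rw [← mul_assoc] at h2
    simp only [map_sub, map_add, map_mul, vecHom_gen, vecGen, piXm_eq hn, pow_two]
    simp only [smul_mul_assoc, mul_smul_comm, h1, h2, zero_mul, smul_zero, mul_zero]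
    simp

/-- The representation `π_x` as a ring homomorphism. -/
def vecRepHom (hn : 3 ≤ n) (x : ℂ⟦X⟧ˣ) : Uh n →+* Mat n ℂ⟦X⟧ :=
  (relIdeal n).ringCon.lift (vecHom x) (by
    intro a b hab
    have h0 : vecHom x (a - b) = 0 :=
      map_eq_zero_of_mem_relIdeal _ (vecHom_scal x) (fun _ h => vecHom_relator hn x h)
        ((relIdeal n).rel_iff a b |>.1 hab)
    rw [map_sub, sub_eq_zero] at h0
    exact h0)

lemma vecRepHom_toUh (hn : 3 ≤ n) (x : ℂ⟦X⟧ˣ) (a : FreeHat n) :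
    vecRepHom hn x (toUh n a) = vecHom x a := rfl

lemma algebraMap_Uh (f : ℂ⟦X⟧) : algebraMap ℂ⟦X⟧ (Uh n) f = toUh n (scal n f) := rfl

/-- The representation `π_x`. -/
def vecRep (hn : 3 ≤ n) (x : ℂ⟦X⟧ˣ) : Uh n →ₐ[ℂ⟦X⟧] Mat n ℂ⟦X⟧ where
  __ := vecRepHom hn x
  commutes' f := by
    change vecRepHom hn x _ = _
    rw [algebraMap_Uh, vecRepHom_toUh, vecHom_scal, Algebra.algebraMap_eq_smul_one]

lemma vecRep_isVectorRep (hn : 3 ≤ n) (x : ℂ⟦X⟧ˣ) : IsVectorRep n x (vecRep hn x) :=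
  fun j => ⟨vecHom_gen x (.xp j), vecHom_gen x (.xm j), vecHom_gen x (.h j)⟩

lemma isVectorRep_comp_toUh {x : ℂ⟦X⟧ˣ} {ρ : Uh n →ₐ[ℂ⟦X⟧] Mat n ℂ⟦X⟧}
    (h : IsVectorRep n x ρ) : (ρ : Uh n →+* Mat n ℂ⟦X⟧).comp (toUh n) = vecHom x := by
  apply ringHom_ext_gen _ (vecHom_scal x)
  · rintro (j | j | j)
    · exact (h j).1.trans (vecHom_gen x (.xp j)).symm
    · exact (h j).2.1.trans (vecHom_gen x (.xm j)).symm
    · exact (h j).2.2.trans (vecHom_gen x (.h j)).symm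
  · intro f
    change ρ (toUh n (scal n f)) = _
    rw [← algebraMap_Uh, AlgHom.commutes, Algebra.algebraMap_eq_smul_one]

theorem existsUnique_isVectorRep (hn : 3 ≤ n) (x : ℂ⟦X⟧ˣ) :
    ∃! ρ : Uh n →ₐ[ℂ⟦X⟧] Mat n ℂ⟦X⟧, IsVectorRep n x ρ := by
  refine ⟨vecRep hn x, vecRep_isVectorRep hn x, fun ρ hρ => ?_⟩
  ext1 u
  obtain ⟨a, rfl⟩ := toUh_surjective n u
  have h1 := isVectorRep_comp_toUh hρ
  have h2 := isVectorRep_comp_toUh (vecRep_isVectorRep hn x)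
  exact (RingHom.congr_fun h1 a).trans (RingHom.congr_fun h2 a).symm

lemma IsVectorRep.qh_eq (hn : 3 ≤ n) {x : ℂ⟦X⟧ˣ} {ρ : Uh n →ₐ[ℂ⟦X⟧] Mat n ℂ⟦X⟧}
    (h : IsVectorRep n x ρ) (c : ℂ) (j : Fin (n + 1)) :
    ρ (qh c j) = Matrix.diagonal fun a => qpow (c * (Hval (nodeA hn j) (nodeB hn j) a : ℤ)) := by
  have h1 := RingHom.congr_fun (isVectorRep_comp_toUh h) (expH c j)
  change ρ (qh c j) = _ at h1
  rw [h1]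
  exact ringHom_expH _ (vecHom_scal x) c j _ (by rw [vecHom_gen, vecGen, piH_eq hn])

end VectorRep

/-! ## The generators of the coideal subalgebra as matrices -/

section CoidealMatrices

variable {n : ℕ} {F : Type*} [Field F]

/-- The matrix of `q^{h_j/2} (x_j^+ + x_j^-) + e (q^{h_j} - 1)` for the node with indices `a, b` and
with spectral parameter `t`. -/
def Qmat (s e t : F) (a b : Fin (2 * n)) : Mat n F :=
  Matrix.diagonal (fun c => s ^ Hval a b c) * (t • Xmat a b + t⁻¹ • Xmat b a)
    + e • (Matrix.diagonal (fun c => s ^ (2 * Hval a b c)) - 1)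

lemma Hval_rev_right {a b : Fin (2 * n)} (h : Quad a b) : Hval a b b.rev = 1 := by
  rw [Hval_rev, Hval_right h]; rfl

lemma Hval_rev_left {a b : Fin (2 * n)} (h : Quad a b) : Hval a b a.rev = -1 := by
  rw [Hval_rev, Hval_left h]

lemma Qmat_eq {a b : Fin (2 * n)} (h : Quad a b) (s e t : F) :
    Qmat s e t a b = (s * t) • single a b 1 - (s * t) • single b.rev a.rev 1
      + (s⁻¹ * t⁻¹) • single b a 1 - (s⁻¹ * t⁻¹) • single a.rev b.rev 1
      + (e * (s ^ 2 - 1)) • (single a a 1 + single b.rev b.rev 1)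
      + (e * (s⁻¹ ^ 2 - 1)) • (single b b 1 + single a.rev a.rev 1) := by
  have h1 : ∀ (d : Fin (2 * n) → F) (p r : Fin (2 * n)),
      Matrix.diagonal d * (single p r 1 : Mat n F) = d p • single p r 1 := by
    intro d p r
    ext x y
    rw [Matrix.diagonal_mul, Matrix.smul_apply, Matrix.single_apply]
    split_ifs with hh
    · rw [hh.1, smul_eq_mul]
    · simp
  have h2 : (Matrix.diagonal (fun c => s ^ (2 * Hval a b c)) - 1 : Mat n F)
      = (s ^ 2 - 1) • (single a a 1 + single b.rev b.rev 1)
        + (s⁻¹ ^ 2 - 1) • (single b b 1 + single a.rev a.rev 1) := by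
    have e2 : s ^ (2 * 1 : ℤ) = s ^ 2 := by norm_cast
    have e3 : s ^ (2 * (-1) : ℤ) = s⁻¹ ^ 2 := by
      rw [inv_pow]; rw [show (2 * (-1) : ℤ) = -(2 : ℕ) by norm_num, zpow_neg, zpow_natCast]
    have hb1 : b ≠ a.rev := h.symm.ner
    have hb2 : a.rev ≠ b.rev := fun e => h.ne (Fin.rev_inj.mp e)
    rw [← Matrix.diagonal_one, Matrix.diagonal_sub]
    ext p r
    by_cases hpr : p = r
    · subst hpr
      simp only [Matrix.diagonal_apply_eq, Matrix.add_apply, Matrix.smul_apply, Matrix.single_apply,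
        and_self, smul_eq_mul]
      by_cases p1 : p = a
      · subst p1
        simp [Hval_left h, h.ne.symm, h.ner.symm, rev_ne]
      by_cases p2 : p = b
      · subst p2
        simp [Hval_right h, h.ne, hb1.symm, rev_ne]
      by_cases p3 : p = a.rev
      · subst p3
        simp [Hval_rev_left h, hb1, hb2.symm, ne_rev]
      by_cases p4 : p = b.rev
      · subst p4
        simp [Hval_rev_right h, h.ner, hb2, ne_rev]
      rw [Hval_of_ne p1 p2 p3 p4]
      simp [Ne.symm p1, Ne.symm p2, Ne.symm p3, Ne.symm p4]
    · have hh : ∀ c : Fin (2 * n), ¬ (c = p ∧ c = r) := fun c hc => hpr (hc.1.symm.trans hc.2)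
      simp [Matrix.diagonal_apply_ne _ hpr, hh]
  rw [Qmat, h2]
  simp only [Xmat, mul_add, mul_smul_comm, mul_sub, h1, Hval_left h, Hval_right h,
    Hval_rev_left h, Hval_rev_right h, zpow_one, zpow_neg_one]
  module

lemma mul_single_one_apply (M : Mat n F) (p r x y : Fin (2 * n)) :
    (M * (single p r 1 : Mat n F)) x y = if r = y then M x p else 0 := by
  split_ifs with h
  · subst h; simp
  · exact Matrix.mul_single_apply_of_ne _ _ _ _ _ (fun e => h e.symm) _

lemma single_one_mul_apply (M : Mat n F) (p r x y : Fin (2 * n)) :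
    ((single p r 1 : Mat n F) * M) x y = if p = x then M r y else 0 := by
  split_ifs with h
  · subst h; simp
  · exact Matrix.single_mul_apply_of_ne _ _ _ _ _ (fun e => h e.symm) _

section Entries

variable {a b : Fin (2 * n)} (h : Quad a b) (s e t : F) (M : Mat n F)

lemma Quad.rev_ne_rev {a b : Fin (2 * n)} (h : Quad a b) : a.rev ≠ b.rev :=
  fun e => h.ne (Fin.rev_inj.mp e)

lemma mul_Qmat_apply (h : Quad a b) (x y : Fin (2 * n)) :
    (M * Qmat s e t a b) x y = (if b = y then s * t * M x a + e * (s⁻¹ ^ 2 - 1) * M x b else 0)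
      + (if a = y then s⁻¹ * t⁻¹ * M x b + e * (s ^ 2 - 1) * M x a else 0)
      + (if a.rev = y then -(s * t * M x b.rev) + e * (s⁻¹ ^ 2 - 1) * M x a.rev else 0)
      + (if b.rev = y then -(s⁻¹ * t⁻¹ * M x a.rev) + e * (s ^ 2 - 1) * M x b.rev else 0) := by
  rw [Qmat_eq h]
  simp only [mul_add, mul_sub, mul_smul_comm, Matrix.add_apply, Matrix.sub_apply,
    Matrix.smul_apply, mul_single_one_apply, smul_eq_mul]
  split_ifs <;> ring

lemma Qmat_mul_apply (h : Quad a b) (x y : Fin (2 * n)) :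
    (Qmat s e t a b * M) x y = (if a = x then s * t * M b y + e * (s ^ 2 - 1) * M a y else 0)
      + (if b = x then s⁻¹ * t⁻¹ * M a y + e * (s⁻¹ ^ 2 - 1) * M b y else 0)
      + (if b.rev = x then -(s * t * M a.rev y) + e * (s ^ 2 - 1) * M b.rev y else 0)
      + (if a.rev = x then -(s⁻¹ * t⁻¹ * M b.rev y) + e * (s⁻¹ ^ 2 - 1) * M a.rev y else 0) := by
  rw [Qmat_eq h]
  simp only [add_mul, sub_mul, smul_mul_assoc, Matrix.add_apply, Matrix.sub_apply,
    Matrix.smul_apply, single_one_mul_apply, smul_eq_mul, smul_add]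
  split_ifs <;> ring

lemma mul_Qmat_left (h : Quad a b) (x : Fin (2 * n)) :
    (M * Qmat s e t a b) x a = s⁻¹ * t⁻¹ * M x b + e * (s ^ 2 - 1) * M x a := by
  rw [mul_Qmat_apply s e t M h, if_neg h.ne.symm, if_pos rfl, if_neg (rev_ne a),
    if_neg h.ner.symm]
  ring

lemma mul_Qmat_right (h : Quad a b) (x : Fin (2 * n)) :
    (M * Qmat s e t a b) x b = s * t * M x a + e * (s⁻¹ ^ 2 - 1) * M x b := by
  rw [mul_Qmat_apply s e t M h, if_pos rfl, if_neg h.ne, if_neg h.symm.ner.symm, if_neg (rev_ne b)]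
  ring

lemma mul_Qmat_rev_left (h : Quad a b) (x : Fin (2 * n)) :
    (M * Qmat s e t a b) x a.rev = -(s * t * M x b.rev) + e * (s⁻¹ ^ 2 - 1) * M x a.rev := by
  rw [mul_Qmat_apply s e t M h, if_neg h.symm.ner, if_neg (ne_rev a), if_pos rfl,
    if_neg h.rev_ne_rev.symm]
  ring

lemma mul_Qmat_rev_right (h : Quad a b) (x : Fin (2 * n)) :
    (M * Qmat s e t a b) x b.rev = -(s⁻¹ * t⁻¹ * M x a.rev) + e * (s ^ 2 - 1) * M x b.rev := by
  rw [mul_Qmat_apply s e t M h, if_neg (ne_rev b), if_neg h.ner, if_neg h.rev_ne_rev, if_pos rfl]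
  ring

lemma mul_Qmat_of_ne (h : Quad a b) (x : Fin (2 * n)) {y : Fin (2 * n)} (h1 : y ≠ a) (h2 : y ≠ b)
    (h3 : y ≠ a.rev) (h4 : y ≠ b.rev) : (M * Qmat s e t a b) x y = 0 := by
  rw [mul_Qmat_apply s e t M h, if_neg h2.symm, if_neg h1.symm, if_neg h3.symm, if_neg h4.symm]
  ring

lemma Qmat_mul_left (h : Quad a b) (y : Fin (2 * n)) :
    (Qmat s e t a b * M) a y = s * t * M b y + e * (s ^ 2 - 1) * M a y := by
  rw [Qmat_mul_apply s e t M h, if_neg h.ne.symm, if_pos rfl, if_neg (rev_ne a),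
    if_neg h.ner.symm]
  ring

lemma Qmat_mul_right (h : Quad a b) (y : Fin (2 * n)) :
    (Qmat s e t a b * M) b y = s⁻¹ * t⁻¹ * M a y + e * (s⁻¹ ^ 2 - 1) * M b y := by
  rw [Qmat_mul_apply s e t M h, if_pos rfl, if_neg h.ne, if_neg h.symm.ner.symm, if_neg (rev_ne b)]
  ring

lemma Qmat_mul_rev_left (h : Quad a b) (y : Fin (2 * n)) :
    (Qmat s e t a b * M) a.rev y
      = -(s⁻¹ * t⁻¹ * M b.rev y) + e * (s⁻¹ ^ 2 - 1) * M a.rev y := by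
  rw [Qmat_mul_apply s e t M h, if_neg h.symm.ner, if_neg (ne_rev a), if_pos rfl,
    if_neg h.rev_ne_rev.symm]
  ring

lemma Qmat_mul_rev_right (h : Quad a b) (y : Fin (2 * n)) :
    (Qmat s e t a b * M) b.rev y = -(s * t * M a.rev y) + e * (s ^ 2 - 1) * M b.rev y := by
  rw [Qmat_mul_apply s e t M h, if_neg (ne_rev b), if_neg h.ner, if_neg h.rev_ne_rev, if_pos rfl]
  ring

lemma Qmat_mul_of_ne (h : Quad a b) {x : Fin (2 * n)} (y : Fin (2 * n)) (h1 : x ≠ a) (h2 : x ≠ b)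
    (h3 : x ≠ a.rev) (h4 : x ≠ b.rev) : (Qmat s e t a b * M) x y = 0 := by
  rw [Qmat_mul_apply s e t M h, if_neg h2.symm, if_neg h1.symm, if_neg h3.symm, if_neg h4.symm]
  ring

end Entries

end CoidealMatrices

/-! ### The intertwining equation in terms of matrices over `ℂ((h))`. -/

section Intertwiners

variable {n : ℕ}

lemma algebraMap_qpow_half {m : ℤ} (hm : m = -1 ∨ m = 0 ∨ m = 1) :
    algebraMap ℂ⟦X⟧ ℂ⸨X⸩ (qpow (1 / 2 * (m : ℤ))) = s ^ m := by
  rcases hm with rfl | rfl | rfl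
  · have : qpow (1 / 2 * ((-1 : ℤ) : ℂ)) = (sqrtQ⁻¹ : ℂ⟦X⟧ˣ).val := by
      change _ = qpow (-(1 / 2))
      congr 1
      push_cast
      ring
    rw [this, map_units_inv, zpow_neg_one]
    rfl
  · simp [qpow_zero]
  · simp [s, sqrtQ]

lemma algebraMap_qpow_neg_half {m : ℤ} (hm : m = -1 ∨ m = 0 ∨ m = 1) :
    algebraMap ℂ⟦X⟧ ℂ⸨X⸩ (qpow (-(1 / 2) * (m : ℤ))) = s ^ (-m) := by
  rw [← algebraMap_qpow_half (m := -m) (by omega)]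
  congr 2
  push_cast
  ring

lemma s_ne_zero : s ≠ 0 := by
  have : IsUnit s := (Units.isUnit sqrtQ).map (algebraMap ℂ⟦X⟧ ℂ⸨X⸩)
  exact this.ne_zero

lemma algebraMap_qpow_one {m : ℤ} (hm : m = -1 ∨ m = 0 ∨ m = 1) :
    algebraMap ℂ⟦X⟧ ℂ⸨X⸩ (qpow (1 * (m : ℤ))) = s ^ (2 * m) := by
  have : qpow (1 * ((m : ℤ) : ℂ)) = qpow (1 / 2 * (m : ℤ)) * qpow (1 / 2 * (m : ℤ)) := by
    rw [qpow_mul]; congr 1; ring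
  rw [this, map_mul, algebraMap_qpow_half hm, two_mul, zpow_add₀ s_ne_zero]

/-- The spectral parameter attached to a node: `x` for `j = 0`, else `1`. -/
def nodeParam {F : Type*} [Field F] (x : F) (j : Fin (n + 1)) : F := if j.val = 0 then x else 1

lemma nodeParam_ne_zero {F : Type*} [Field F] {x : F} (hx : x ≠ 0) (j : Fin (n + 1)) :
    nodeParam x j ≠ 0 := by
  unfold nodeParam; split_ifs
  · exact hx
  · exact one_ne_zero

lemma algebraMap_specFactor (x : ℂ⟦X⟧ˣ) (j : Fin (n + 1)) :
    algebraMap ℂ⟦X⟧ ℂ⸨X⸩ (specFactor x j : ℂ⟦X⟧ˣ)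
      = nodeParam (algebraMap ℂ⟦X⟧ ℂ⸨X⸩ x) j := by
  unfold specFactor nodeParam
  split_ifs <;> simp

lemma algebraMap_specFactor_inv (x : ℂ⟦X⟧ˣ) (j : Fin (n + 1)) :
    algebraMap ℂ⟦X⟧ ℂ⸨X⸩ ((specFactor x j)⁻¹ : ℂ⟦X⟧ˣ).val
      = (nodeParam (algebraMap ℂ⟦X⟧ ℂ⸨X⸩ x) j)⁻¹ := by
  rw [map_units_inv, algebraMap_specFactor]

lemma Xmat_map (a b : Fin (2 * n)) :
    (Xmat a b : Mat n ℂ⟦X⟧).map (algebraMap ℂ⟦X⟧ ℂ⸨X⸩) = Xmat a b := by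
  rw [Xmat, Xmat, Matrix.map_sub _ (map_sub _), Matrix.map_single, Matrix.map_single, map_one]

section RepValues

variable (hn : 3 ≤ n) {x : ℂ⟦X⟧ˣ} {ρ : Uh n →ₐ[ℂ⟦X⟧] Mat n ℂ⟦X⟧}

lemma IsVectorRep.map_xp (hn : 3 ≤ n) (h : IsVectorRep n x ρ) (j : Fin (n + 1)) :
    (ρ (xp j)).map (algebraMap ℂ⟦X⟧ ℂ⸨X⸩)
      = nodeParam (algebraMap ℂ⟦X⟧ ℂ⸨X⸩ x) j • Xmat (nodeA hn j) (nodeB hn j) := by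
  rw [(h j).1, piXp_eq hn, ← Xmat_map, ← algebraMap_specFactor]
  ext1 p r
  simp only [Matrix.map_apply, Matrix.smul_apply, smul_eq_mul, map_mul]

lemma IsVectorRep.map_xm (hn : 3 ≤ n) (h : IsVectorRep n x ρ) (j : Fin (n + 1)) :
    (ρ (xm j)).map (algebraMap ℂ⟦X⟧ ℂ⸨X⸩)
      = (nodeParam (algebraMap ℂ⟦X⟧ ℂ⸨X⸩ x) j)⁻¹ • Xmat (nodeB hn j) (nodeA hn j) := by
  rw [(h j).2.1, piXm_eq hn, ← Xmat_map, ← algebraMap_specFactor_inv]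
  ext1 p r
  simp only [Matrix.map_apply, Matrix.smul_apply, smul_eq_mul, map_mul]

lemma IsVectorRep.map_hh (hn : 3 ≤ n) (h : IsVectorRep n x ρ) (j : Fin (n + 1)) :
    (ρ (hh j)).map (algebraMap ℂ⟦X⟧ ℂ⸨X⸩)
      = Matrix.diagonal fun c => ((Hval (nodeA hn j) (nodeB hn j) c : ℤ) : ℂ⸨X⸩) := by
  rw [(h j).2.2, piH_eq hn, Matrix.diagonal_map (map_zero _)]
  congr 1
  funext c
  exact map_intCast _ _

lemma IsVectorRep.map_qh_half (hn : 3 ≤ n) (h : IsVectorRep n x ρ) (j : Fin (n + 1)) :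
    (ρ (qh (1 / 2) j)).map (algebraMap ℂ⟦X⟧ ℂ⸨X⸩)
      = Matrix.diagonal fun c => s ^ Hval (nodeA hn j) (nodeB hn j) c := by
  rw [h.qh_eq hn, Matrix.diagonal_map (map_zero _)]
  congr 1
  funext c
  exact algebraMap_qpow_half (Hval_cases (node_quad hn j) c)

lemma IsVectorRep.map_qh_neg_half (hn : 3 ≤ n) (h : IsVectorRep n x ρ) (j : Fin (n + 1)) :
    (ρ (qh (-(1 / 2)) j)).map (algebraMap ℂ⟦X⟧ ℂ⸨X⸩)
      = Matrix.diagonal fun c => s ^ (-Hval (nodeA hn j) (nodeB hn j) c) := by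
  rw [h.qh_eq hn, Matrix.diagonal_map (map_zero _)]
  congr 1
  funext c
  exact algebraMap_qpow_neg_half (Hval_cases (node_quad hn j) c)

lemma IsVectorRep.map_qh_one (hn : 3 ≤ n) (h : IsVectorRep n x ρ) (j : Fin (n + 1)) :
    (ρ (qh 1 j)).map (algebraMap ℂ⟦X⟧ ℂ⸨X⸩)
      = Matrix.diagonal fun c => s ^ (2 * Hval (nodeA hn j) (nodeB hn j) c) := by
  rw [h.qh_eq hn, Matrix.diagonal_map (map_zero _)]
  congr 1
  funext c
  exact algebraMap_qpow_one (Hval_cases (node_quad hn j) c)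

lemma extend_Qhat (hn : 3 ≤ n) (h : IsVectorRep n x ρ) (ε : Fin (n + 1) → ℂ⸨X⸩)
    (j : Fin (n + 1)) : extend ρ (Qhat ε j)
      = Qmat s (ε j) (nodeParam (algebraMap ℂ⟦X⟧ ℂ⸨X⸩ x) j) (nodeA hn j) (nodeB hn j) := by
  rw [Qhat, map_add, extend_tmul, extend_tmul, one_smul, map_mul, map_add, map_sub, map_one,
    Matrix.map_mul, Matrix.map_add _ (map_add _), Matrix.map_sub _ (map_sub _), h.map_xp hn,
    h.map_xm hn, h.map_qh_half hn, h.map_qh_one hn,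
    Matrix.map_one _ (map_zero _) (map_one _)]
  rfl

end RepValues

/-- The intertwining property, in terms of the matrices of the generators. -/
lemma isIntertwiner_iff (hn : 3 ≤ n) (ε : Fin (n + 1) → ℂ⸨X⸩) (η x : ℂ⟦X⟧ˣ) (K : Mat n ℂ⸨X⸩) :
    IsIntertwiner n ε η x K ↔ ∀ j : Fin (n + 1),
      K * Qmat s (ε j) (nodeParam (algebraMap ℂ⟦X⟧ ℂ⸨X⸩ (η * x : ℂ⟦X⟧ˣ)) j)
          (nodeA hn j) (nodeB hn j)
        = Qmat s (ε j) (nodeParam (algebraMap ℂ⟦X⟧ ℂ⸨X⸩ (η / x : ℂ⟦X⟧ˣ)) j)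
          (nodeA hn j) (nodeB hn j) * K := by
  constructor
  · intro h j
    have h1 := vecRep_isVectorRep hn (η * x)
    have h2 := vecRep_isVectorRep hn (η / x)
    have := h _ _ h1 h2 (Qhat ε j) (Algebra.subset_adjoin ⟨j, rfl⟩)
    rwa [extend_Qhat hn h1, extend_Qhat hn h2] at this
  · intro h ρ ρ' h1 h2 Q hQ
    induction hQ using Algebra.adjoin_induction with
    | mem y hy =>
      obtain ⟨j, rfl⟩ := hy
      rw [extend_Qhat hn h1, extend_Qhat hn h2]
      exact h j
    | algebraMap r => rw [AlgHom.commutes, AlgHom.commutes, Algebra.commutes]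
    | add y z _ _ hy hz => rw [map_add, map_add, mul_add, add_mul, hy, hz]
    | mul y z _ _ hy hz =>
      rw [map_mul, map_mul, ← mul_assoc, hy, mul_assoc, hz, mul_assoc]

end Intertwiners

/-! ## The matrix `K(x)` and its intertwining property -/

section Kap

variable {n : ℕ}

/-- The function that is `k₁` above, `k₂` below and `k₀` on the antidiagonal. -/
def kap {A : Type*} (k₁ k₀ k₂ : A) (a b : Fin (2 * n)) : A :=
  if num a + num b ≤ 2 * n then k₁ else if b = a.rev then k₀ else k₂

lemma num_rev (a : Fin (2 * n)) : num a.rev = 2 * n + 1 - num a := by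
  have := a.isLt
  simp only [num, Fin.val_rev]
  omega

lemma num_le (a : Fin (2 * n)) : num a ≤ 2 * n := by
  have := a.isLt
  simp only [num]
  omega

lemma one_le_num (a : Fin (2 * n)) : 1 ≤ num a := by simp [num]

lemma kap_low {A : Type*} (k₁ k₀ k₂ : A) {a b : Fin (2 * n)} (h : num a + num b ≤ 2 * n) :
    kap k₁ k₀ k₂ a b = k₁ := if_pos h

lemma kap_mid {A : Type*} (k₁ k₀ k₂ : A) (a : Fin (2 * n)) : kap k₁ k₀ k₂ a a.rev = k₀ := by
  have := num_le a
  rw [kap, if_neg (by rw [num_rev]; omega), if_pos rfl]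

lemma kap_high {A : Type*} (k₁ k₀ k₂ : A) {a b : Fin (2 * n)} (h : 2 * n + 2 ≤ num a + num b) :
    kap k₁ k₀ k₂ a b = k₂ := by
  have := num_le a
  rw [kap, if_neg (by omega), if_neg]
  rintro rfl
  rw [num_rev] at h
  omega

lemma kap_comm {A : Type*} (k₁ k₀ k₂ : A) (a b : Fin (2 * n)) :
    kap k₁ k₀ k₂ a b = kap k₁ k₀ k₂ b a := by
  have : b = a.rev ↔ a = b.rev := by
    constructor <;> rintro rfl <;> rw [Fin.rev_rev]
  simp only [kap, add_comm (num a), this]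

lemma under_rev (a : Fin (2 * n)) : under a.rev = under a := by
  have := num_le a
  have := one_le_num a
  simp only [under, num_rev]
  split_ifs <;> omega

lemma twicePrime_rev (a : Fin (2 * n)) : twicePrime a.rev = 4 * n + 2 - twicePrime a := by
  have := num_le a
  have := one_le_num a
  simp only [twicePrime, num_rev]
  split_ifs <;> omega

end Kap

section KMatrix

variable {n : ℕ} {F : Type*} [Field F]

/-- `i^{-a̲}`. -/
def wvec (I : F) (a : Fin (2 * n)) : F := I ^ (-under a)

/-- `i^{-b̲} q^{b'-n}`. -/
def vvec (I s : F) (b : Fin (2 * n)) : F := I ^ (-under b) * s ^ (twicePrime b - 2 * (n : ℤ))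

/-- `k₁ = q^{n/2-1} (1 - x)`. -/
def k1fun (n : ℕ) (s x : F) : F := s ^ ((n : ℤ) - 2) * (1 - x)

/-- `k₂ = (-1)^n q^{-n/2} (1 - x⁻¹)`. -/
def k2fun (n : ℕ) (s x : F) : F := (-1) ^ n * s ^ (-(n : ℤ)) * (1 - x⁻¹)

/-- `k₀ = (k₁ + q k₂) / (q + 1)`. -/
def k0fun (n : ℕ) (s x : F) : F := (k1fun n s x + s ^ 2 * k2fun n s x) * (s ^ 2 + 1)⁻¹

/-- `c = (-1)^n q^{(n-1)/2} + q^{(1-n)/2}`. -/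
def cconst (n : ℕ) (s : F) : F := (-1) ^ n * s ^ ((n : ℤ) - 1) + s ^ (1 - (n : ℤ))

lemma neg_one_pow_mul_self (n : ℕ) : ((-1 : F) ^ n) * (-1) ^ n = 1 := by
  rw [← mul_pow]; simp

lemma kpre_eq {I : F} (hI : I ≠ 0) (s : F) (a b : Fin (2 * n)) :
    kpre I s a b = wvec I a * vvec I s b := by
  rw [kpre, wvec, vvec, ← mul_assoc, ← zpow_add₀ hI]; rfl

lemma kpre_rev {I s : F} (hI : I ≠ 0) (hs : s ≠ 0) (a b : Fin (2 * n)) :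
    kpre I s⁻¹ a.rev b.rev = wvec I a * vvec I s b * (s ^ 2)⁻¹ := by
  rw [kpre_eq hI, wvec, vvec, wvec, vvec, under_rev, under_rev, twicePrime_rev, inv_zpow',
    show -(4 * (n : ℤ) + 2 - twicePrime b - 2 * n) = (twicePrime b - 2 * n) - (2 : ℕ) by
      push_cast; ring, zpow_sub₀ hs, zpow_natCast, div_eq_mul_inv]
  ring

lemma kfun_inv {s : F} (hs : s ≠ 0) (x : F) :
    (-1) ^ n * kfun n s⁻¹ x⁻¹ = s ^ 2 * k2fun n s x := by
  have h : s⁻¹ ^ ((n : ℤ) - 2) = s ^ 2 * s ^ (-(n : ℤ)) := by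
    rw [inv_zpow', ← zpow_natCast, ← zpow_add₀ hs]
    congr 1
    push_cast
    ring
  rw [kfun, k2fun, h]
  ring

lemma kfun_inv' {s : F} (hs : s ≠ 0) (x : F) :
    kfun n s⁻¹ x⁻¹ = (-1) ^ n * (s ^ 2 * k2fun n s x) := by
  rw [← kfun_inv hs, ← mul_assoc, neg_one_pow_mul_self, one_mul]

/-- The entries of `K(x)`. -/
lemma Kmat_apply {I s : F} (hI : I ≠ 0) (hs : s ≠ 0) (hs2 : s ^ 2 + 1 ≠ 0) (x : F)
    (a b : Fin (2 * n)) :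
    Kmat n I s x a b
      = wvec I a * vvec I s b * kap (k1fun n s x) (k0fun n s x) (k2fun n s x) a b
        + if a = b then cconst n s
            - (-1) ^ n * s * kap (k1fun n s x) (k0fun n s x) (k2fun n s x) a a else 0 := by
  have ha := num_le a
  have hb := num_le b
  have hk : kfun n s x = k1fun n s x := rfl
  have hk' : kfun n s⁻¹⁻¹ x⁻¹⁻¹ = k1fun n s x := by rw [inv_inv, inv_inv]; rfl
  have hσ := neg_one_pow_mul_self (F := F) n
  have hcc : (-1) ^ n * ((-1) ^ n * s⁻¹ ^ ((n : ℤ) - 1) + s⁻¹ ^ (1 - (n : ℤ))) = cconst n s := by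
    rw [cconst, inv_zpow', inv_zpow', neg_sub, neg_sub, mul_add, ← mul_assoc, hσ]
    ring
  simp only [Kmat, Matrix.of_apply]
  by_cases h1 : num a + num b ≤ 2 * n
  · have hr : b ≠ a.rev := by rintro rfl; rw [num_rev] at h1; omega
    rw [if_pos (Or.inl h1), kentry, if_neg hr, kpre_eq hI, kap_low _ _ _ h1, hk]
    by_cases hab : b = a
    · subst hab
      rw [if_pos rfl, if_pos rfl, kap_low _ _ _ h1, cconst]
      ring
    · rw [if_neg hab, if_neg (Ne.symm hab), add_zero]
  · by_cases h2 : b = a.rev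
    · subst h2
      rw [kap_mid, if_neg (ne_rev a), add_zero]
      by_cases h3 : num a ≤ n
      · rw [if_pos (Or.inr ⟨rfl, h3⟩), kentry, if_pos rfl, kpre_eq hI, kfun_inv hs, hk, k0fun]
        ring
      · rw [if_neg (by simp [h1, h3]), kentry, if_pos rfl, kpre_rev hI hs, hk', kfun_inv' hs,
          k0fun]
        have : s⁻¹ ^ 2 + 1 ≠ 0 := by
          intro h
          apply hs2
          field_simp at h
          linear_combination h
        -- The factor `q⁻¹` from `kpre_rev` turns `(q⁻¹ + 1)⁻¹` into `(q + 1)⁻¹`, so the lower half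
        -- of the antidiagonal obeys the same formula as the upper half.
        have e1 : (s ^ 2)⁻¹ * (s⁻¹ ^ 2 + 1)⁻¹ = (s ^ 2 + 1)⁻¹ := by
          rw [← mul_inv]
          congr 1
          field_simp
          ring
        linear_combination (wvec I a * vvec I s a.rev * (s ^ 2 * k2fun n s x + k1fun n s x)
          * (s ^ 2)⁻¹ * (s⁻¹ ^ 2 + 1)⁻¹) * hσ
          + wvec I a * vvec I s a.rev * (k1fun n s x + s ^ 2 * k2fun n s x) * e1
    · rw [if_neg (by simp [h1, h2]), kentry, if_neg (by rw [Fin.rev_rev]; rintro rfl; simp at h2),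
        kap_high]
      · by_cases hab : a = b
        · subst hab
          rw [if_pos rfl, if_pos rfl, kap_high, kpre_rev hI hs, kfun_inv' hs, mul_add, hcc]
          · field_simp
            linear_combination (wvec I a * vvec I s a * k2fun n s x
              - (-1) ^ n * s * k2fun n s x) * hσ
          · have : num a ≠ n ∧ 2 * num a ≠ 2 * n + 1 := by omega
            omega
        · rw [if_neg (by rw [Fin.rev_inj]; exact Ne.symm hab), if_neg hab, kpre_rev hI hs,
            kfun_inv' hs]
          field_simp
          linear_combination (wvec I a * vvec I s b * k2fun n s x) * hσ
      · by_contra h3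
        apply h2
        ext
        simp only [num] at *
        rw [Fin.val_rev]
        omega

lemma I_ne_zero {I : F} (hI : I ^ 2 = -1) : I ≠ 0 := by
  rintro rfl
  norm_num at hI

lemma I_inv {I : F} (hI : I ^ 2 = -1) : I⁻¹ = -I :=
  inv_eq_of_mul_eq_one_right (by linear_combination (-1 : F) * hI)

lemma wvec_rev (I : F) (a : Fin (2 * n)) : wvec I a.rev = wvec I a := by
  rw [wvec, under_rev, wvec]

lemma I_zpow_pred {I : F} (hI : I ^ 2 = -1) (m : ℤ) : I ^ (m - 1) = -I * I ^ m := by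
  rw [zpow_sub_one₀ (I_ne_zero hI), I_inv hI]; ring

lemma wvec_succ {I : F} (hI : I ^ 2 = -1) {a b : Fin (2 * n)} (h : under b = under a + 1) :
    wvec I b = -I * wvec I a := by
  rw [wvec, wvec, h, ← I_zpow_pred hI]; congr 1; ring

lemma vvec_succ {I s : F} (hI : I ^ 2 = -1) (hs : s ≠ 0) {a b : Fin (2 * n)}
    (h : under b = under a + 1) (h' : twicePrime b = twicePrime a + 2) :
    vvec I s b = -I * s ^ 2 * vvec I s a := by
  have e := wvec_succ hI h
  simp only [wvec] at e
  rw [vvec, vvec, e, h', show twicePrime a + 2 - 2 * (n : ℤ) = (twicePrime a - 2 * n) + (2 : ℕ) by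
    push_cast; ring, zpow_add₀ hs, zpow_natCast]
  ring

end KMatrix

/-! ### Entrywise conditions under which a matrix intertwines a generator. -/

section KIntertwining

variable {n : ℕ} {F : Type*} [Field F]

lemma quad_cases (a b c : Fin (2 * n)) :
    c = a ∨ c = b ∨ c = a.rev ∨ c = b.rev ∨ (c ≠ a ∧ c ≠ b ∧ c ≠ a.rev ∧ c ≠ b.rev) := by
  tauto

/-- A matrix `w_x v_y κ_{xy} + δ_{xy} (c - d κ_{xx})` commutes with the generator of a node `j ≠ 0`
of the coideal subalgebra. -/
lemma commute_Qmat_of_entries {I s e : F} (hI : I ^ 2 = -1) (hs : s ≠ 0)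
    (he : e * (s ^ 2 - 1) = I * s) (he' : e * (s⁻¹ ^ 2 - 1) = -I * s⁻¹)
    {a b : Fin (2 * n)} (h : Quad a b) {w v : Fin (2 * n) → F} {κ : Fin (2 * n) → Fin (2 * n) → F}
    {c d k₁ k₀ k₂ : F} {K : Mat n F}
    (hK : ∀ x y, K x y = w x * v y * κ x y + if x = y then c - d * κ x x else 0)
    (hκ : ∀ x y, κ x y = κ y x)
    (hwa : w a.rev = w a) (hwb : w b = -I * w a) (hwb' : w b.rev = -I * w a)
    (hvb : v b = -I * s ^ 2 * v a) (hva : v a.rev = I * s ^ 2 * v b.rev)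
    (hab : κ a a = k₁) (haa : κ a b = k₁) (hab' : κ a b.rev = k₁) (haa' : κ a a.rev = k₀)
    (hbb' : κ b b.rev = k₀) (hba' : κ b a.rev = k₂) (ha'b' : κ a.rev b.rev = k₂)
    (ha'a' : κ a.rev a.rev = k₂)
    (hbb : w b * v b * κ b b - d * κ b b = w b * v b * k₁ - d * k₁)
    (hb'b' : w b.rev * v b.rev * κ b.rev b.rev - d * κ b.rev b.rev
      = w b.rev * v b.rev * k₂ - d * k₂)
    (hk : k₀ * (s ^ 2 + 1) = k₁ + s ^ 2 * k₂)
    (hx : ∀ x, x ≠ a → x ≠ b → x ≠ a.rev → x ≠ b.rev → κ x a = κ x b ∧ κ x a.rev = κ x b.rev) :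
    K * Qmat s e 1 a b = Qmat s e 1 a b * K := by
  have n1 := h.ne
  have n2 := h.ner
  have n3 := h.symm.ner
  have n4 := h.rev_ne_rev
  have n5 := ne_rev a
  have n6 := ne_rev b
  refine Matrix.ext fun x y => ?_
  have kba := hκ b a
  have kb'a := hκ b.rev a
  have ka'a := hκ a.rev a
  have kb'b := hκ b.rev b
  have ka'b := hκ a.rev b
  have kb'a' := hκ b.rev a.rev
  -- At node `n` the index `b` lies past the middle, so `κ b b` is not `k₁` there. The hypotheses
  -- `hbb` and `hb'b'` say that the diagonal entries are nevertheless what they would be with `k₁`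
  -- and `k₂`.
  have Kbb : K b b = -(w a * v a * s ^ 2) * k₁ + c - d * k₁ := by
    rw [hK, if_pos rfl]
    linear_combination hbb + k₁ * w b * hvb - I * s ^ 2 * v a * k₁ * hwb
      + w a * v a * s ^ 2 * k₁ * hI
  have Kb'b' : K b.rev b.rev = -I * w a * v b.rev * k₂ + c - d * k₂ := by
    rw [hK, if_pos rfl]
    linear_combination hb'b' + k₂ * v b.rev * hwb'
  -- Inside the block there are sixteen entries to compare. If one index is outside, a row or column
  -- of the generator is zero, so the other side must vanish by itself; that is `hl` and `hr`.
  have hin : ∀ x y, (x = a ∨ x = b ∨ x = a.rev ∨ x = b.rev) →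
      (y = a ∨ y = b ∨ y = a.rev ∨ y = b.rev) →
      (K * Qmat s e 1 a b) x y = (Qmat s e 1 a b * K) x y := by
    rintro x y (hx' | hx' | hx' | hx') (hy' | hy' | hy' | hy') <;> rw [hx', hy'] <;>
    simp only [mul_Qmat_left _ _ _ _ h, mul_Qmat_right _ _ _ _ h, mul_Qmat_rev_left _ _ _ _ h,
      mul_Qmat_rev_right _ _ _ _ h, Qmat_mul_left _ _ _ _ h, Qmat_mul_right _ _ _ _ h,
      Qmat_mul_rev_left _ _ _ _ h, Qmat_mul_rev_right _ _ _ _ h, he, he', inv_one, mul_one] <;>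
    (try simp only [Kbb, Kb'b']) <;>
    simp only [hK, n1, n2, n3, n4, n5, n6, n1.symm, n2.symm, n3.symm, n4.symm, n5.symm, n6.symm,
      if_true, if_false, add_zero] <;>
    simp only [kba, kb'a, ka'a, kb'b, ka'b, kb'a', hab, haa, hab', haa', hbb', hba', ha'b', ha'a',
      hwa, hwb, hwb', hvb, hva]
    all_goals
      clear hbb hb'b' Kbb Kb'b' hx
      generalize w a = wa, v a = va, v b.rev = vb
      clear hab haa hab' haa' hbb' hba' ha'b' ha'a' hwa hwb hwb' hvb hva hK hκ kba kb'a ka'a kb'b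
        ka'b kb'a' h n1 n2 n3 n4 n5 n6
      grind
  have hl : ∀ x, x ≠ a → x ≠ b → x ≠ a.rev → x ≠ b.rev → ∀ y, (K * Qmat s e 1 a b) x y = 0 := by
    intro x x1 x2 x3 x4 y
    obtain ⟨e1, e2⟩ := hx x x1 x2 x3 x4
    rcases quad_cases a b y with hy' | hy' | hy' | hy' | ⟨y1, y2, y3, y4⟩
    on_goal 5 => exact mul_Qmat_of_ne _ _ _ _ h _ y1 y2 y3 y4
    all_goals
      rw [hy']
      simp only [mul_Qmat_left _ _ _ _ h, mul_Qmat_right _ _ _ _ h, mul_Qmat_rev_left _ _ _ _ h,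
        mul_Qmat_rev_right _ _ _ _ h, he, he', inv_one, mul_one, hK, x1, x2, x3, x4, if_false,
        add_zero, e1, e2, hvb, hva]
      field_simp
      grind
  have hr : ∀ y, y ≠ a → y ≠ b → y ≠ a.rev → y ≠ b.rev → ∀ x, (Qmat s e 1 a b * K) x y = 0 := by
    intro x x1 x2 x3 x4 y
    obtain ⟨e1, e2⟩ := hx x x1 x2 x3 x4
    rw [hκ x, hκ x] at e1 e2
    rcases quad_cases a b y with hy' | hy' | hy' | hy' | ⟨y1, y2, y3, y4⟩
    on_goal 5 => exact Qmat_mul_of_ne _ _ _ _ h _ y1 y2 y3 y4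
    all_goals
      rw [hy']
      simp only [Qmat_mul_left _ _ _ _ h, Qmat_mul_right _ _ _ _ h,
        Qmat_mul_rev_left _ _ _ _ h, Qmat_mul_rev_right _ _ _ _ h, he, he', inv_one, mul_one, hK,
        x1.symm, x2.symm, x3.symm, x4.symm, if_false, add_zero, e1, e2, hwa, hwb, hwb']
      field_simp
      grind
  rcases quad_cases a b x with hx' | hx' | hx' | hx' | ⟨x1, x2, x3, x4⟩
  on_goal 5 => rw [hl x x1 x2 x3 x4, Qmat_mul_of_ne _ _ _ _ h _ x1 x2 x3 x4]
  all_goals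
    rcases quad_cases a b y with hy' | hy' | hy' | hy' | ⟨y1, y2, y3, y4⟩
    on_goal 5 => rw [hr y y1 y2 y3 y4, mul_Qmat_of_ne _ _ _ _ h _ y1 y2 y3 y4]
    all_goals exact hin x y (by tauto) (by tauto)

set_option maxHeartbeats 1000000 in
/-- The same for the node `0`, where the spectral parameters are `η x` and `η / x`. -/
lemma Qmat_intertwine_of_entries {I s e u σ z t t' : F} (hI : I ^ 2 = -1) (hs : s ≠ 0)
    (hu : u ≠ 0) (hz : z ≠ 0) (hσ : σ ^ 2 = 1)
    (ht : t = σ * s ^ 2 * (u ^ 2)⁻¹ * z) (ht' : t' = σ * s ^ 2 * (u ^ 2)⁻¹ * z⁻¹)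
    (he : e * (s ^ 2 - 1) = I * s) (he' : e * (s⁻¹ ^ 2 - 1) = -I * s⁻¹)
    {a b : Fin (2 * n)} (h : Quad a b) {w v : Fin (2 * n) → F} {κ : Fin (2 * n) → Fin (2 * n) → F}
    {c d k₁ k₀ k₂ : F} {K : Mat n F}
    (hK : ∀ x y, K x y = w x * v y * κ x y + if x = y then c - d * κ x x else 0)
    (hκ : ∀ x y, κ x y = κ y x)
    (hwa : w a = -1) (hwa' : w a.rev = -1) (hwb : w b = -I) (hwb' : w b.rev = -I)
    (hva : v a = -(u ^ 2 * (s ^ 3)⁻¹)) (hvb : v b = -(I * ((u ^ 2)⁻¹ * s ^ 3)))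
    (hva' : v a.rev = -((u ^ 2)⁻¹ * s ^ 5)) (hvb' : v b.rev = -(I * (u ^ 2 * s⁻¹)))
    (hbb : κ b b = k₁) (haa : κ b a = k₁) (hab' : κ b a.rev = k₁) (haa' : κ a a.rev = k₀)
    (hbb' : κ b b.rev = k₀) (hba' : κ a b.rev = k₂) (ha'b' : κ a.rev b.rev = k₂)
    (ha'a' : κ a.rev a.rev = k₁) (hab : κ a a = k₂) (hb'b' : κ b.rev b.rev = k₂)
    (hk : k₀ * (s ^ 2 + 1) = k₁ + s ^ 2 * k₂) (hk1 : k₁ = u * (s ^ 2)⁻¹ * (1 - z))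
    (hk2 : k₂ = σ * u⁻¹ * (1 - z⁻¹)) (hc : c = σ * u * s⁻¹ + s * u⁻¹) (hd : d = σ * s)
    (hx : ∀ x, x ≠ a → x ≠ b → x ≠ a.rev → x ≠ b.rev → κ x a = k₂ ∧ κ x b = k₁ ∧ κ x a.rev = k₁ ∧
      κ x b.rev = k₂) :
    K * Qmat s e t a b = Qmat s e t' a b * K := by
  have n1 := h.ne
  have n2 := h.ner
  have n3 := h.symm.ner
  have n4 := h.rev_ne_rev
  have n5 := ne_rev a
  have n6 := ne_rev b
  have hσ0 : σ ≠ 0 := by rintro rfl; norm_num at hσ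
  have hti : t⁻¹ = σ * (s ^ 2)⁻¹ * u ^ 2 * z⁻¹ := by
    rw [ht]
    field_simp
    linear_combination -hσ
  have hti' : t'⁻¹ = σ * (s ^ 2)⁻¹ * u ^ 2 * z := by
    rw [ht']
    field_simp
    linear_combination -hσ
  refine Matrix.ext fun x y => ?_
  have kba := hκ a b
  have kb'a := hκ b.rev a
  have ka'a := hκ a.rev a
  have kb'b := hκ b.rev b
  have ka'b := hκ a.rev b
  have kb'a' := hκ b.rev a.rev
  have hin : ∀ x y, (x = a ∨ x = b ∨ x = a.rev ∨ x = b.rev) →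
      (y = a ∨ y = b ∨ y = a.rev ∨ y = b.rev) →
      (K * Qmat s e t a b) x y = (Qmat s e t' a b * K) x y := by
    rintro x y (hx' | hx' | hx' | hx') (hy' | hy' | hy' | hy') <;> rw [hx', hy'] <;>
    simp only [mul_Qmat_left _ _ _ _ h, mul_Qmat_right _ _ _ _ h, mul_Qmat_rev_left _ _ _ _ h,
      mul_Qmat_rev_right _ _ _ _ h, Qmat_mul_left _ _ _ _ h, Qmat_mul_right _ _ _ _ h,
      Qmat_mul_rev_left _ _ _ _ h, Qmat_mul_rev_right _ _ _ _ h, he, he', hti, hti'] <;>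
    simp only [hK, n1, n2, n3, n4, n5, n6, n1.symm, n2.symm, n3.symm, n4.symm, n5.symm, n6.symm,
      if_true, if_false, add_zero] <;>
    simp only [kba, kb'a, ka'a, kb'b, ka'b, kb'a', hab, haa, hab', haa', hbb', hba', ha'b', ha'a',
      hbb, hb'b', hwa, hwb, hwa', hwb', hva, hvb, hva', hvb', hk1, hk2, hc, hd, ht, ht']
    all_goals
      clear hx hab haa hab' haa' hbb' hba' ha'b' ha'a' hwa hwb hwb' hvb hva hK hκ kba kb'a ka'a kb'b
        ka'b kb'a' h n1 n2 n3 n4 n5 n6 hwa' hva' hvb' hbb hb'b' hti hti' ht ht' he he'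
      subst hk1 hk2
      clear hc hd
      field_simp at hk ⊢ <;> grind
  have hl : ∀ x, x ≠ a → x ≠ b → x ≠ a.rev → x ≠ b.rev → ∀ y, (K * Qmat s e t a b) x y = 0 := by
    intro x x1 x2 x3 x4 y
    obtain ⟨e1, e2, e3, e4⟩ := hx x x1 x2 x3 x4
    rcases quad_cases a b y with hy' | hy' | hy' | hy' | ⟨y1, y2, y3, y4⟩
    on_goal 5 => exact mul_Qmat_of_ne _ _ _ _ h _ y1 y2 y3 y4
    all_goals
      rw [hy']
      simp only [mul_Qmat_left _ _ _ _ h, mul_Qmat_right _ _ _ _ h, mul_Qmat_rev_left _ _ _ _ h,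
        mul_Qmat_rev_right _ _ _ _ h, he, he', hK, x1, x2, x3, x4, if_false,
        add_zero, e1, e2, e3, e4, hva, hvb, hva', hvb', ht, hk1, hk2]
      clear * - hI hs hu hz hσ
      field_simp
      grind
  have hr : ∀ y, y ≠ a → y ≠ b → y ≠ a.rev → y ≠ b.rev → ∀ x, (Qmat s e t' a b * K) x y = 0 := by
    intro x x1 x2 x3 x4 y
    obtain ⟨e1, e2, e3, e4⟩ := hx x x1 x2 x3 x4
    rw [hκ x] at e1 e2 e3 e4
    rcases quad_cases a b y with hy' | hy' | hy' | hy' | ⟨y1, y2, y3, y4⟩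
    on_goal 5 => exact Qmat_mul_of_ne _ _ _ _ h _ y1 y2 y3 y4
    all_goals
      rw [hy']
      simp only [Qmat_mul_left _ _ _ _ h, Qmat_mul_right _ _ _ _ h,
        Qmat_mul_rev_left _ _ _ _ h, Qmat_mul_rev_right _ _ _ _ h, he, he', hK,
        x1.symm, x2.symm, x3.symm, x4.symm, if_false, add_zero, e1, e2, e3, e4, hwa, hwa', hwb,
        hwb', ht', hk1, hk2]
      clear * - hI hs hu hz hσ
      field_simp
      grind
  rcases quad_cases a b x with hx' | hx' | hx' | hx' | ⟨x1, x2, x3, x4⟩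
  on_goal 5 => rw [hl x x1 x2 x3 x4, Qmat_mul_of_ne _ _ _ _ h _ x1 x2 x3 x4]
  all_goals
    rcases quad_cases a b y with hy' | hy' | hy' | hy' | ⟨y1, y2, y3, y4⟩
    on_goal 5 => rw [hr y y1 y2 y3 y4, mul_Qmat_of_ne _ _ _ _ h _ y1 y2 y3 y4]
    all_goals exact hin x y (by tauto) (by tauto)

end KIntertwining

/-! ### The entries of `K(x)` meet these conditions at every node. -/

section KIntertwines

variable {n : ℕ} {F : Type*} [Field F]

lemma k0fun_mul {s : F} (hs2 : s ^ 2 + 1 ≠ 0) (x : F) :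
    k0fun n s x * (s ^ 2 + 1) = k1fun n s x + s ^ 2 * k2fun n s x := by
  rw [k0fun, mul_assoc, inv_mul_cancel₀ hs2, mul_one]

lemma I_zpow_neg_two_mul {I : F} (hI : I ^ 2 = -1) (m : ℕ) : I ^ (-(m : ℤ) - m) = (-1) ^ m := by
  rw [show (-(m : ℤ) - m) = -((2 * m : ℕ) : ℤ) by push_cast; ring, zpow_neg, zpow_natCast, pow_mul,
    hI]
  rcases neg_one_pow_eq_or F m with h | h <;> rw [h] <;> norm_num

/-- At the middle indices `w_b v_b` equals the coefficient `d = (-1)^n q^{1/2}` of the diagonal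
correction, so `κ_{bb}` drops out of `K_{bb}`. This lets node `n` be treated like the others
although its pair straddles the middle. -/
lemma wvec_mul_vvec_mid {I s : F} (hI : I ^ 2 = -1) {b : Fin (2 * n)}
    (hb : num b = n + 1) : wvec I b * vvec I s b = (-1) ^ n * s := by
  have h1 : under b = n := by simp only [under, hb]; split_ifs <;> push_cast <;> omega
  have h2 : twicePrime b = 2 * n + 1 := by
    simp only [twicePrime, hb]; split_ifs <;> push_cast <;> omega
  rw [← kpre_eq (I_ne_zero hI), kpre, h1, h2, I_zpow_neg_two_mul hI,
    show (2 * (n : ℤ) + 1 - 2 * n) = 1 by ring, zpow_one]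

lemma wvec_mul_vvec_mid' {I s : F} (hI : I ^ 2 = -1) {b : Fin (2 * n)}
    (hb : num b = n) : wvec I b * vvec I s b = (-1) ^ n * s := by
  have h1 : under b = n := by simp only [under, hb]; split_ifs <;> omega
  have h2 : twicePrime b = 2 * n + 1 := by
    simp only [twicePrime, hb]; split_ifs <;> omega
  rw [← kpre_eq (I_ne_zero hI), kpre, h1, h2, I_zpow_neg_two_mul hI,
    show (2 * (n : ℤ) + 1 - 2 * n) = 1 by ring, zpow_one]

/-- `η = (-1)^n q^{1-n}` over an arbitrary field. -/
def etaval (n : ℕ) (s : F) : F := (-1) ^ n * s ^ (2 * (1 - (n : ℤ)))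

/-- Stated over any field and for any nonzero `x`: the reflection equation needs it at points with a
pole at `h = 0`, not only at units. Of the parameter `e` only the products with `q - 1` and `q⁻¹ -
1` matter. -/
theorem Kmat_mul_Qmat (hn : 3 ≤ n) {I s e x : F} (hI : I ^ 2 = -1) (hs : s ≠ 0)
    (hs2 : s ^ 2 + 1 ≠ 0) (hx : x ≠ 0) (he : e * (s ^ 2 - 1) = I * s)
    (he' : e * (s⁻¹ ^ 2 - 1) = -I * s⁻¹) (j : Fin (n + 1)) :
    Kmat n I s x * Qmat s e (nodeParam (etaval n s * x) j) (nodeA hn j) (nodeB hn j)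
      = Qmat s e (nodeParam (etaval n s / x) j) (nodeA hn j) (nodeB hn j) * Kmat n I s x := by
  have h := node_quad hn j
  have hv := node_val hn j
  have hjl := j.isLt
  set a := nodeA hn j
  set b := nodeB hn j
  have hI0 := I_ne_zero hI
  have hra := num_rev a
  have hrb := num_rev b
  have hna : num a = a.val + 1 := rfl
  have hnb : num b = b.val + 1 := rfl
  have hK := Kmat_apply hI0 hs hs2 x (n := n)
  by_cases hj : j.val = 0
  · have ha : num a = 2 * n - 1 := by omega
    have hb : num b = 1 := by omega
    have ua : under a = 2 := by simp only [under, ha]; split_ifs <;> omega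
    have ub : under b = 1 := by simp only [under, hb]; split_ifs <;> omega
    have ta : twicePrime a = 4 * n - 3 := by simp only [twicePrime, ha]; split_ifs <;> omega
    have tb : twicePrime b = 3 := by simp only [twicePrime, hb]; split_ifs <;> omega
    have hIi := I_inv hI
    have hI1 : I ^ (-1 : ℤ) = -I := by rw [zpow_neg_one, hIi]
    have hI2 : I ^ (-2 : ℤ) = -1 := by
      rw [zpow_neg, show (2 : ℤ) = ((2 : ℕ) : ℤ) by rfl, zpow_natCast, hI]; norm_num
    have hu : s ^ n ≠ 0 := pow_ne_zero _ hs
    rw [nodeParam, nodeParam, if_pos hj, if_pos hj]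
    have hz : ∀ m : ℤ, s ^ (m - 2 * (n : ℤ)) = s ^ m * ((s ^ n) ^ 2)⁻¹ := by
      intro m
      rw [zpow_sub₀ hs, div_eq_mul_inv, ← pow_mul, ← zpow_natCast]
      congr 3; push_cast; ring
    have hz' : ∀ m : ℤ, s ^ (m + 2 * (n : ℤ)) = s ^ m * (s ^ n) ^ 2 := by
      intro m
      rw [zpow_add₀ hs, ← pow_mul, ← zpow_natCast]
      congr 2; push_cast; ring
    have hη : etaval n s = (-1) ^ n * s ^ 2 * ((s ^ n) ^ 2)⁻¹ := by
      rw [etaval, show 2 * (1 - (n : ℤ)) = (2 : ℕ) - 2 * n by push_cast; ring, hz, zpow_natCast]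
      ring
    have g : ∀ m : ℕ, s ^ (m : ℤ) = s ^ m := fun m => zpow_natCast _ _
    have g' : ∀ m : ℕ, s ^ (-(m : ℤ)) = (s ^ m)⁻¹ := fun m => by rw [zpow_neg, zpow_natCast]
    refine Qmat_intertwine_of_entries (u := s ^ n) (σ := (-1) ^ n) (z := x) hI hs hu hx
      (by rw [sq]; exact neg_one_pow_mul_self n) (by rw [hη]) (by rw [hη, div_eq_mul_inv])
      he he' h hK (kap_comm _ _ _) ?_ ?_ ?_ ?_ ?_ ?_ ?_ ?_ (kap_low _ _ _ (by omega))
      (kap_low _ _ _ (by omega)) (kap_low _ _ _ (by omega)) (kap_mid _ _ _ _) (kap_mid _ _ _ _)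
      (kap_high _ _ _ (by omega)) (kap_high _ _ _ (by omega)) (kap_low _ _ _ (by omega))
      (kap_high _ _ _ (by omega)) (kap_high _ _ _ (by omega)) (k0fun_mul hs2 x) ?_ ?_ ?_ rfl ?_
    · rw [wvec, ua, hI2]
    · rw [wvec_rev, wvec, ua, hI2]
    · rw [wvec, ub, hI1]
    · rw [wvec_rev, wvec, ub, hI1]
    · rw [vvec, ua, ta, hI2, show 4 * (n : ℤ) - 3 - 2 * n = -(3 : ℕ) + 2 * n by push_cast; ring,
        hz', g']
      ring
    · rw [vvec, ub, tb, hI1, show (3 : ℤ) = (3 : ℕ) by rfl, hz, g]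
      ring
    · rw [vvec, under_rev, twicePrime_rev, ua, ta, hI2,
        show (4 * n + 2 - (4 * (n : ℤ) - 3)) = (5 : ℕ) by push_cast; ring, hz, g]
      ring
    · rw [vvec, under_rev, twicePrime_rev, ub, tb, hI1,
        show (4 * n + 2 - 3 - 2 * (n : ℤ)) = -(1 : ℕ) + 2 * n by push_cast; ring, hz', g', pow_one]
      ring
    · rw [k1fun, zpow_sub₀ hs, zpow_natCast, div_eq_mul_inv, show (2 : ℤ) = (2 : ℕ) by rfl,
        zpow_natCast]
    · rw [k2fun, zpow_neg, zpow_natCast]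
    · rw [cconst, zpow_sub₀ hs, zpow_sub₀ hs, zpow_one, zpow_natCast]
      ring
    -- Here `b, ā` are the first two indices and `a, b̄` the last two. Every other index lies
    -- strictly between, hence above the antidiagonal against `b, ā` and below it against `a, b̄`.
    · intro y y1 y2 y3 y4
      have e1 : y.val ≠ a.val := fun e => y1 (Fin.ext e)
      have e2 : y.val ≠ b.val := fun e => y2 (Fin.ext e)
      have e3 : y.val ≠ a.rev.val := fun e => y3 (Fin.ext e)
      have e4 : y.val ≠ b.rev.val := fun e => y4 (Fin.ext e)
      have hy := y.isLt
      have hny : num y = y.val + 1 := rfl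
      rw [Fin.val_rev] at e3 e4
      exact ⟨kap_high _ _ _ (by omega), kap_low _ _ _ (by omega), kap_low _ _ _ (by omega),
        kap_high _ _ _ (by omega)⟩
  · have hm : (num a + 1 = num b ∧ num b ≤ n) ∨ (num a = n - 1 ∧ num b = n + 1) := by omega
    have hub : under b = under a + 1 := by simp only [under]; split_ifs <;> omega
    have htb : twicePrime b = twicePrime a + 2 := by simp only [twicePrime]; split_ifs <;> omega
    have hwb := wvec_succ hI hub
    have hmid : ∀ k : F, num b = n + 1 → wvec I b * vvec I s b * k - (-1) ^ n * s * k = 0 := by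
      intro k hk
      rw [wvec_mul_vvec_mid hI hk, sub_self]
    have hmid' : ∀ k : F, num b = n + 1 →
        wvec I b.rev * vvec I s b.rev * k - (-1) ^ n * s * k = 0 := by
      intro k hk
      rw [wvec_mul_vvec_mid' hI (by omega), sub_self]
    rw [nodeParam, nodeParam, if_neg hj, if_neg hj]
    refine commute_Qmat_of_entries hI hs he he' h hK (kap_comm _ _ _) (wvec_rev I a) hwb
      (by rw [wvec_rev, hwb]) (vvec_succ hI hs hub htb) ?_ (kap_low _ _ _ (by omega))
      (kap_low _ _ _ (by omega)) (kap_low _ _ _ (by omega)) (kap_mid _ _ _ _) (kap_mid _ _ _ _)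
      (kap_high _ _ _ (by omega)) (kap_high _ _ _ (by omega)) (kap_high _ _ _ (by omega))
      ?_ ?_ (k0fun_mul hs2 x) ?_
    · have h1 : wvec I a = I * wvec I b := by rw [hwb]; linear_combination (wvec I a) * hI
      simp only [wvec] at h1
      rw [vvec, vvec, under_rev, under_rev, twicePrime_rev, twicePrime_rev, htb, h1,
        show 4 * (n : ℤ) + 2 - twicePrime a - 2 * n
          = (4 * n + 2 - (twicePrime a + 2) - 2 * n) + (2 : ℕ) by push_cast; ring,
        zpow_add₀ hs, zpow_natCast]
      ring
    · rcases hm with hm | hm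
      · rw [kap_low _ _ _ (by omega)]
      · rw [hmid _ hm.2, hmid _ hm.2]
    · rcases hm with hm | hm
      · rw [kap_high _ _ _ (by omega)]
      · rw [hmid' _ hm.2, hmid' _ hm.2]
    · intro y y1 y2 y3 y4
      have e1 : y.val ≠ a.val := fun e => y1 (Fin.ext e)
      have e2 : y.val ≠ b.val := fun e => y2 (Fin.ext e)
      have e3 : y.val ≠ a.rev.val := fun e => y3 (Fin.ext e)
      have e4 : y.val ≠ b.rev.val := fun e => y4 (Fin.ext e)
      have hy := y.isLt
      have hny : num y = y.val + 1 := rfl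
      rw [Fin.val_rev] at e3 e4
      constructor
      · by_cases hlow : num y + num b ≤ 2 * n
        · rw [kap_low _ _ _ hlow, kap_low _ _ _ (by omega)]
        · rw [kap_high (a := y) (b := b) _ _ _ (by omega), kap_high _ _ _ (by omega)]
      · by_cases hlow : num y + num a.rev ≤ 2 * n
        · rw [kap_low _ _ _ hlow, kap_low _ _ _ (by omega)]
        · rw [kap_high (a := y) (b := a.rev) _ _ _ (by omega), kap_high _ _ _ (by omega)]

end KIntertwines

/-! ## The columns of the R-matrix -/

section RColumns

variable {n : ℕ} {F : Type*} [Field F]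

/-- The basis vector `e_c ⊗ e_d`. -/
def ee (c d : Fin (2 * n)) : Fin (2 * n) × Fin (2 * n) → F := Pi.single (c, d) 1

lemma ee_apply (c d : Fin (2 * n)) (p : Fin (2 * n) × Fin (2 * n)) :
    (ee c d : _ → F) p = if p = (c, d) then 1 else 0 := Pi.single_apply _ _ _

lemma mat₂_ext {A B : Mat₂ n F} (h : ∀ c d, A.mulVec (ee c d) = B.mulVec (ee c d)) : A = B := by
  refine Matrix.ext fun p r => ?_
  have := congrFun (h r.1 r.2) p
  simpa [ee, Matrix.mulVec_single_one] using this

lemma EE_mulVec (a b c d p r : Fin (2 * n)) :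
    (EE a b c d : Mat₂ n F).mulVec (ee p r) = if b = p ∧ d = r then ee a c else 0 := by
  funext x
  rw [ee, Matrix.mulVec_single_one, Matrix.col_apply, EE, Matrix.kroneckerMap_apply,
    Matrix.single_apply, Matrix.single_apply]
  obtain ⟨x, y⟩ := x
  by_cases h1 : b = p <;> by_cases h2 : d = r <;> simp [h1, h2, ee_apply, Prod.ext_iff]
  by_cases h3 : a = x <;> by_cases h4 : c = y <;> simp [h3, h4, eq_comm]

/-- The diagonal coefficients of `Ř(z)` on `e_c ⊗ e_d`, `d ≠ c, c̄`. -/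
def ccoef (n : ℕ) (s z : F) (c d : Fin (2 * n)) : F :=
  (1 - s ^ (-4 : ℤ)) * (z - xi n s) * if d < c then 1 else z

lemma sum_sum_ite_eq {M : Type*} [AddCommMonoid M] (c d : Fin (2 * n))
    (f : Fin (2 * n) → Fin (2 * n) → M) :
    (∑ a, ∑ b, if a = c ∧ b = d then f a b else 0) = f c d := by
  simp [ite_and]

lemma ite_mulVec (P : Prop) [Decidable P] (M : Mat₂ n F) (v : Fin (2 * n) × Fin (2 * n) → F) :
    (if P then M else 0).mulVec v = if P then M.mulVec v else 0 := by
  split_ifs <;> simp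

/-- `Ř` preserves weights, which leaves three shapes of columns: `e_c ⊗ e_c` is an eigenvector, a
pair with `c ≠ d, d̄` mixes only with its swap, and the pairs `e_p ⊗ e_p̄` span the zero weight
space. -/
lemma Rcheck_mulVec (s z : F) (c d : Fin (2 * n)) :
    (Rcheck n s z).mulVec (ee c d)
      = (if c = d then ((z - s ^ (-4 : ℤ)) * (z - xi n s)) • ee c d else 0)
        + (if c ≠ d ∧ c ≠ d.rev then ((z - 1) * (z - xi n s) / s ^ 2) • ee d c
            + ccoef n s z c d • ee c d else 0)
        + (if c = d.rev then ∑ p, bcoef s z d p • ee p p.rev else 0) := by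
  have hcd : d ≠ c.rev ↔ c ≠ d.rev := by
    constructor <;> intro h e <;> apply h <;> rw [e, Fin.rev_rev]
  have e1 : ∀ a : Fin (2 * n), (EE a a a a : Mat₂ n F).mulVec (ee c d)
      = if a = c then (if c = d then ee c d else 0) else 0 := by
    intro a
    rw [EE_mulVec]
    by_cases h : a = c
    · subst h; by_cases h' : a = d <;> simp [h']
    · simp [h]
  have e2 : ∀ (P : Fin (2 * n) → Fin (2 * n) → Prop) [∀ a b, Decidable (P a b)],
      (∑ a, ∑ b, if P a b then (EE a b b a : Mat₂ n F) else 0).mulVec (ee c d)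
        = if P d c then ee d c else 0 := by
    intro P _
    simp only [Matrix.sum_mulVec, ite_mulVec, EE_mulVec]
    rw [← sum_sum_ite_eq d c fun a b =>
      if P a b then ee a b else (0 : Fin (2 * n) × Fin (2 * n) → F)]
    refine Finset.sum_congr rfl fun a _ => Finset.sum_congr rfl fun b _ => ?_
    by_cases h1 : a = d <;> by_cases h2 : b = c <;> by_cases h3 : P a b <;> simp [h1, h2]
  have e3 : ∀ (P : Fin (2 * n) → Fin (2 * n) → Prop) [∀ a b, Decidable (P a b)],
      (∑ a, ∑ b, if P a b then (EE b b a a : Mat₂ n F) else 0).mulVec (ee c d)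
        = if P d c then ee c d else 0 := by
    intro P _
    simp only [Matrix.sum_mulVec, ite_mulVec, EE_mulVec]
    rw [← sum_sum_ite_eq d c fun a b =>
      if P a b then ee b a else (0 : Fin (2 * n) × Fin (2 * n) → F)]
    refine Finset.sum_congr rfl fun a _ => Finset.sum_congr rfl fun b _ => ?_
    by_cases h1 : a = d <;> by_cases h2 : b = c <;> by_cases h3 : P a b <;> simp [h1, h2]
  have e4 : (∑ a, ∑ b, bcoef s z a b • (EE b a.rev b.rev a : Mat₂ n F)).mulVec (ee c d)
      = if c = d.rev then ∑ p, bcoef s z d p • ee p p.rev else 0 := by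
    simp only [Matrix.sum_mulVec, Matrix.smul_mulVec, EE_mulVec]
    rw [Finset.sum_eq_single d]
    · by_cases h : c = d.rev
      · simp [h]
      · simp [h, Ne.symm h]
    · intro a _ h
      simp [h]
    · simp
  rw [Rcheck, Matrix.add_mulVec, Matrix.add_mulVec, Matrix.add_mulVec, Matrix.smul_mulVec,
    Matrix.smul_mulVec, Matrix.smul_mulVec, Matrix.add_mulVec, Matrix.smul_mulVec, e2, e3, e3, e4,
    Matrix.sum_mulVec]
  simp only [e1, Finset.sum_ite_eq', Finset.mem_univ, if_true]
  congr 1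
  by_cases h1 : c = d
  · subst h1
    simp
  by_cases h2 : c = d.rev
  · simp [h2, rev_ne, ne_rev]
  rw [ccoef]
  rcases lt_or_gt_of_ne h1 with h3 | h3
  · simp [h1, Ne.symm h1, h2, hcd, h3, h3.not_gt, smul_smul]
  · simp [h1, Ne.symm h1, h2, hcd, h3, h3.not_gt]

lemma Rcheck_mulVec_self (s z : F) (c : Fin (2 * n)) :
    (Rcheck n s z).mulVec (ee c c) = ((z - s ^ (-4 : ℤ)) * (z - xi n s)) • ee c c := by
  simp [Rcheck_mulVec, ne_rev]

lemma Rcheck_mulVec_of_ne (s z : F) {c d : Fin (2 * n)} (h : c ≠ d) (h' : c ≠ d.rev) :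
    (Rcheck n s z).mulVec (ee c d) = ((z - 1) * (z - xi n s) / s ^ 2) • ee d c
      + ccoef n s z c d • ee c d := by
  simp [Rcheck_mulVec, h, h']

lemma Rcheck_mulVec_rev (s z : F) (d : Fin (2 * n)) :
    (Rcheck n s z).mulVec (ee d.rev d) = ∑ p, bcoef s z d p • ee p p.rev := by
  simp [Rcheck_mulVec, rev_ne]

/-- The coproduct of `x_j^+` on the tensor product of two vector representations. -/
def copX (s ρ υ : F) (a b : Fin (2 * n)) : Mat₂ n F :=
  ρ • (Xmat a b ⊗ₖ Matrix.diagonal fun c => s ^ (-Hval a b c))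
    + υ • ((Matrix.diagonal fun c => s ^ Hval a b c) ⊗ₖ Xmat a b)

lemma single_kronecker_diagonal_mulVec (D : Fin (2 * n) → F) (p r c d : Fin (2 * n)) :
    ((single p r 1 : Mat n F) ⊗ₖ Matrix.diagonal D).mulVec (ee c d)
      = if c = r then D d • ee p d else 0 := by
  funext x
  obtain ⟨x, y⟩ := x
  rw [ee, Matrix.mulVec_single_one, Matrix.col_apply, Matrix.kroneckerMap_apply,
    Matrix.single_apply, Matrix.diagonal_apply]
  by_cases h1 : c = r
  · subst h1
    by_cases h2 : x = p <;> by_cases h3 : y = d <;> simp [ee_apply, h2, h3, Ne.symm]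
  · simp [h1, Ne.symm h1]

lemma diagonal_kronecker_single_mulVec (D : Fin (2 * n) → F) (p r c d : Fin (2 * n)) :
    ((Matrix.diagonal D) ⊗ₖ (single p r 1 : Mat n F)).mulVec (ee c d)
      = if d = r then D c • ee c p else 0 := by
  funext x
  obtain ⟨x, y⟩ := x
  rw [ee, Matrix.mulVec_single_one, Matrix.col_apply, Matrix.kroneckerMap_apply,
    Matrix.single_apply, Matrix.diagonal_apply]
  by_cases h1 : d = r
  · subst h1
    by_cases h2 : x = c <;> by_cases h3 : y = p <;> simp [ee_apply, h2, h3, Ne.symm]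
  · simp [h1, Ne.symm h1]

lemma sub_kronecker (A B C : Mat n F) : (A - B) ⊗ₖ C = A ⊗ₖ C - B ⊗ₖ C := by
  ext p r
  simp [sub_mul]

lemma kronecker_sub (A B C : Mat n F) : A ⊗ₖ (B - C) = A ⊗ₖ B - A ⊗ₖ C := by
  ext p r
  simp [mul_sub]

lemma neg_ite_zero {M : Type*} [AddGroup M] (P : Prop) [Decidable P] (x : M) :
    -(if P then x else 0) = if P then -x else 0 := by
  split_ifs <;> simp

lemma copX_mulVec (s ρ υ : F) (a b c d : Fin (2 * n)) :
    (copX s ρ υ a b).mulVec (ee c d)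
      = (if c = b then (ρ * s ^ (-Hval a b d)) • ee a d else 0)
        + (if c = a.rev then (-(ρ * s ^ (-Hval a b d))) • ee b.rev d else 0)
        + (if d = b then (υ * s ^ Hval a b c) • ee c a else 0)
        + (if d = a.rev then (-(υ * s ^ Hval a b c)) • ee c b.rev else 0) := by
  rw [copX, Xmat, Matrix.add_mulVec, Matrix.smul_mulVec, Matrix.smul_mulVec, sub_kronecker,
    kronecker_sub, Matrix.sub_mulVec, Matrix.sub_mulVec, single_kronecker_diagonal_mulVec,
    single_kronecker_diagonal_mulVec, diagonal_kronecker_single_mulVec,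
    diagonal_kronecker_single_mulVec, smul_sub, smul_sub, smul_ite, smul_ite, smul_ite, smul_ite,
    sub_eq_add_neg, sub_eq_add_neg]
  simp only [smul_zero, smul_smul, neg_smul, add_assoc, neg_ite_zero]

end RColumns

/-! ### `Ř(x)` and the action of `x_j^+`, from relations between coefficients. -/

section RIntertwining

variable {n : ℕ} {F : Type*} [Field F]

lemma Rcheck_mulVec_rev' (s z : F) (d : Fin (2 * n)) :
    (Rcheck n s z).mulVec (ee d d.rev) = ∑ p, bcoef s z d.rev p • ee p p.rev := by
  rw [← Rcheck_mulVec_rev, Fin.rev_rev]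

lemma sum_quad {a b : Fin (2 * n)} (h : Quad a b) {M : Type*} [AddCommMonoid M]
    (f : Fin (2 * n) → M)
    (hf : ∀ p, p ≠ a → p ≠ b → p ≠ a.rev → p ≠ b.rev → f p = 0) :
    ∑ p, f p = f a + f b + f a.rev + f b.rev := by
  rw [← Finset.sum_subset (Finset.subset_univ ({a, b, a.rev, b.rev} : Finset (Fin (2 * n))))]
  · rw [Finset.sum_insert, Finset.sum_insert, Finset.sum_pair h.rev_ne_rev, add_assoc, add_assoc]
    · simp [h.symm.ner, ne_rev]
    · simp [h.ne, h.ner, ne_rev]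
  · intro p _ hp
    simp only [Finset.mem_insert, Finset.mem_singleton, not_or] at hp
    exact hf p hp.1 hp.2.1 hp.2.2.1 hp.2.2.2

/-- On the zero weight space only the four block indices contribute, and the image lies in the
weight space of the root, spanned by `e_a ⊗ e_b̄` and `e_b̄ ⊗ e_a`. -/
lemma copX_mulVec_sum (s ρ υ : F) {a b : Fin (2 * n)} (h : Quad a b) (g : Fin (2 * n) → F) :
    (copX s ρ υ a b).mulVec (∑ p, g p • ee p p.rev)
      = (ρ * s⁻¹ * g b - υ * s * g a) • ee a b.rev
        + (υ * s * g b.rev - ρ * s⁻¹ * g a.rev) • ee b.rev a := by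
  have n1 := h.ne
  have n2 := h.ner
  have n3 := h.symm.ner
  have n4 := h.rev_ne_rev
  have n5 := ne_rev a
  have n6 := ne_rev b
  have key : ∀ p : Fin (2 * n), p ≠ a → p ≠ b → p ≠ a.rev → p ≠ b.rev →
      (copX s ρ υ a b).mulVec (g p • ee p p.rev) = 0 := by
    intro p p1 p2 p3 p4
    rw [Matrix.mulVec_smul, copX_mulVec, if_neg p2, if_neg p3, if_neg, if_neg]
    · simp
    · intro e; exact p1 (Fin.rev_inj.mp e)
    · intro e; exact p4 (by rw [← e, Fin.rev_rev])
  rw [Matrix.mulVec_sum, sum_quad h _ key]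
  simp only [Matrix.mulVec_smul, copX_mulVec, n1, n3, n5, n3.symm, n4.symm, n6.symm, if_true,
    if_false, Fin.rev_rev, Hval_left h, Hval_right h, Hval_rev_left h, Hval_rev_right h, zero_add,
    add_zero, zpow_one, zpow_neg_one, neg_neg]
  module

/-- The relations between the coefficients of `Ř(z)` at a node, with `ρ = z` for the node `0` and
`ρ = 1` otherwise. -/
structure RNode (s z ρ g : F) (a b : Fin (2 * n)) : Prop where
  quad : Quad a b
  s_ne : s ≠ 0
  ρ_ne : ρ ≠ 0
  g_ne : g ≠ 0
  z_ne : z ≠ 0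
  cab : ccoef n s z a b = (1 - s ^ (-4 : ℤ)) * (z - xi n s) * (z * ρ⁻¹)
  cba : ccoef n s z b a = (1 - s ^ (-4 : ℤ)) * (z - xi n s) * ρ
  cab' : ccoef n s z a b.rev = (1 - s ^ (-4 : ℤ)) * (z - xi n s) * z
  cb'a : ccoef n s z b.rev a = (1 - s ^ (-4 : ℤ)) * (z - xi n s)
  cba' : ccoef n s z b a.rev = (1 - s ^ (-4 : ℤ)) * (z - xi n s) * z
  ca'b : ccoef n s z a.rev b = (1 - s ^ (-4 : ℤ)) * (z - xi n s)
  cb'a' : ccoef n s z b.rev a.rev = (1 - s ^ (-4 : ℤ)) * (z - xi n s) * (z * ρ⁻¹)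
  ca'b' : ccoef n s z a.rev b.rev = (1 - s ^ (-4 : ℤ)) * (z - xi n s) * ρ
  other : ∀ p, p ≠ a → p ≠ b → p ≠ a.rev → p ≠ b.rev →
    ccoef n s z b p = ρ * ccoef n s z a p ∧ ccoef n s z p a = ρ * ccoef n s z p b ∧
    ccoef n s z a.rev p = ρ * ccoef n s z b.rev p ∧ ccoef n s z p b.rev = ρ * ccoef n s z p a.rev
  bother : ∀ p, p ≠ a → p ≠ b → p ≠ a.rev → p ≠ b.rev →
    bcoef s z p b = ρ * s ^ 2 * bcoef s z p a ∧ bcoef s z p a.rev = ρ * s ^ 2 * bcoef s z p b.rev ∧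
    bcoef s z b.rev p = ρ * s ^ 2 * bcoef s z a.rev p ∧ bcoef s z a p = ρ * s ^ 2 * bcoef s z b p
  baa : bcoef s z a a = (s ^ (-4 : ℤ) * z - xi n s) * (z - 1)
  bbb : bcoef s z b b = (s ^ (-4 : ℤ) * z - xi n s) * (z - 1)
  ba'a' : bcoef s z a.rev a.rev = (s ^ (-4 : ℤ) * z - xi n s) * (z - 1)
  bb'b' : bcoef s z b.rev b.rev = (s ^ (-4 : ℤ) * z - xi n s) * (z - 1)
  bab : bcoef s z a b = ρ * (s ^ (-4 : ℤ) - 1) * xi n s * s ^ 2 * (z - 1)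
  bb'a' : bcoef s z b.rev a.rev = ρ * (s ^ (-4 : ℤ) - 1) * xi n s * s ^ 2 * (z - 1)
  bba : bcoef s z b a = z * ρ⁻¹ * (s ^ (-4 : ℤ) - 1) * (s ^ 2)⁻¹ * (z - 1)
  ba'b' : bcoef s z a.rev b.rev = z * ρ⁻¹ * (s ^ (-4 : ℤ) - 1) * (s ^ 2)⁻¹ * (z - 1)
  -- The scalar `g` is `q^{b̄' - a'}`, which equals `q^{ā' - b'}`; it is the only datum of the
  -- coefficients below that varies with the node besides `ρ`.
  bab' : bcoef s z a b.rev = (s ^ (-4 : ℤ) - 1) * xi n s * g * (z - 1)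
  bba' : bcoef s z b a.rev = (s ^ (-4 : ℤ) - 1) * xi n s * g * (z - 1)
  bb'a : bcoef s z b.rev a = (s ^ (-4 : ℤ) - 1) * z * g⁻¹ * (z - 1)
  ba'b : bcoef s z a.rev b = (s ^ (-4 : ℤ) - 1) * z * g⁻¹ * (z - 1)
  baa' : bcoef s z a a.rev = ρ * (s ^ (-4 : ℤ) - 1) * (xi n s * g * s ^ 2 * (z - 1) - (z - xi n s))
  ba'a : bcoef s z a.rev a
    = z * ρ⁻¹ * (s ^ (-4 : ℤ) - 1) * (g⁻¹ * (s ^ 2)⁻¹ * (z - 1) - (z - xi n s))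
  bbb' : bcoef s z b b.rev
    = ρ⁻¹ * (s ^ (-4 : ℤ) - 1) * (xi n s * g * (s ^ 2)⁻¹ * (z - 1) - (z - xi n s))
  bb'b : bcoef s z b.rev b
    = z * ρ * (s ^ (-4 : ℤ) - 1) * (g⁻¹ * s ^ 2 * (z - 1) - (z - xi n s))

/-- `Ř(z)` intertwines the action of `x_j^+`. -/
theorem RNode.mul_copX {s z ρ g : F} {a b : Fin (2 * n)} (H : RNode s z ρ g a b) :
    Rcheck n s z * copX s ρ 1 a b = copX s 1 ρ a b * Rcheck n s z := by
  have h := H.quad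
  have n1 := h.ne
  have n2 := h.ner
  have n3 := h.symm.ner
  have n4 := h.rev_ne_rev
  have n5 := ne_rev a
  have n6 := ne_rev b
  have hs := H.s_ne
  have hρ := H.ρ_ne
  have hs4 : s ^ (-4 : ℤ) = (s ^ 4)⁻¹ := by
    rw [zpow_neg, show (4 : ℤ) = (4 : ℕ) by rfl, zpow_natCast]
  have hg := H.g_ne
  have hz := H.z_ne
  have R1 := Rcheck_mulVec_of_ne s z n1 n2
  have R2 := Rcheck_mulVec_of_ne s z n1.symm n3
  have R3 := Rcheck_mulVec_of_ne s z n2 (by rwa [Fin.rev_rev])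
  have R4 := Rcheck_mulVec_of_ne s z n2.symm n4.symm
  have R5 := Rcheck_mulVec_of_ne s z n3 (by rwa [Fin.rev_rev, ne_comm])
  have R6 := Rcheck_mulVec_of_ne s z n3.symm n4
  have R7 := Rcheck_mulVec_of_ne s z n4.symm (by rwa [Fin.rev_rev, ne_comm])
  have R8 := Rcheck_mulVec_of_ne s z n4 (by rwa [Fin.rev_rev, ne_comm])
  have R9 := Rcheck_mulVec_rev' s z a
  have R10 := Rcheck_mulVec_rev s z a
  have R11 := Rcheck_mulVec_rev' s z b
  have R12 := Rcheck_mulVec_rev s z b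
  rw [H.cab] at R1
  rw [H.cba] at R2
  rw [H.cab'] at R3
  rw [H.cb'a] at R4
  rw [H.cba'] at R5
  rw [H.ca'b] at R6
  rw [H.cb'a'] at R7
  rw [H.ca'b'] at R8
  -- With one index off the block no zero weight vector occurs, so only the swap and the diagonal
  -- coefficient enter; `other` relates the latter at the two ends of the root.
  have hother : ∀ d, d ≠ a → d ≠ b → d ≠ a.rev → d ≠ b.rev → ∀ c,
      (c = a ∨ c = b ∨ c = a.rev ∨ c = b.rev) →
      (Rcheck n s z).mulVec ((copX s ρ 1 a b).mulVec (ee c d))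
        = (copX s 1 ρ a b).mulVec ((Rcheck n s z).mulVec (ee c d)) := by
    intro d d1 d2 d3 d4
    have hH := Hval_of_ne d1 d2 d3 d4
    have d1' : a.rev ≠ d.rev := fun e => d1 (Fin.rev_inj.mp e.symm)
    have d2' : b.rev ≠ d.rev := fun e => d2 (Fin.rev_inj.mp e.symm)
    have d3' : a ≠ d.rev := fun e => d3 (by rw [e, Fin.rev_rev])
    have d4' : b ≠ d.rev := fun e => d4 (by rw [e, Fin.rev_rev])
    have R1 := Rcheck_mulVec_of_ne s z d1.symm d3'
    have R2 := Rcheck_mulVec_of_ne s z d2.symm d4'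
    have R3 := Rcheck_mulVec_of_ne s z d3.symm d1'
    have R4 := Rcheck_mulVec_of_ne s z d4.symm d2'
    obtain ⟨e1, -, e3, -⟩ := H.other d d1 d2 d3 d4
    rw [e1] at R2
    rw [e3] at R3
    rintro c (hc | hc | hc | hc) <;> rw [hc] <;>
      simp only [copX_mulVec, n1, n3, n5, n3.symm, n4.symm, n6.symm, d2, d3, if_true, if_false,
        Hval_left h, Hval_right h, Hval_rev_left h, Hval_rev_right h, hH, zero_add, add_zero,
        Matrix.mulVec_add, Matrix.mulVec_smul, Matrix.mulVec_zero, smul_zero, neg_zero, zpow_zero,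
        R1, R2, R3, R4]
    all_goals try module
  have hother' : ∀ d, d ≠ a → d ≠ b → d ≠ a.rev → d ≠ b.rev → ∀ c,
      (c = a ∨ c = b ∨ c = a.rev ∨ c = b.rev) →
      (Rcheck n s z).mulVec ((copX s ρ 1 a b).mulVec (ee d c))
        = (copX s 1 ρ a b).mulVec ((Rcheck n s z).mulVec (ee d c)) := by
    intro d d1 d2 d3 d4
    have hH := Hval_of_ne d1 d2 d3 d4
    have d3' : d ≠ b.rev.rev := by rwa [Fin.rev_rev]
    have d1' : d ≠ a.rev.rev := by rwa [Fin.rev_rev]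
    have R1 := Rcheck_mulVec_of_ne s z d1 d3
    have R2 := Rcheck_mulVec_of_ne s z d2 d4
    have R3 := Rcheck_mulVec_of_ne s z d3 d1'
    have R4 := Rcheck_mulVec_of_ne s z d4 d3'
    obtain ⟨-, e2, -, e4⟩ := H.other d d1 d2 d3 d4
    rw [e2] at R1
    rw [e4] at R4
    rintro c (hc | hc | hc | hc) <;> rw [hc] <;>
      simp only [copX_mulVec, n1, n3, n5, n3.symm, n4.symm, n6.symm, d2, d3, if_true, if_false,
        Hval_left h, Hval_right h, Hval_rev_left h, Hval_rev_right h, hH, zero_add, add_zero,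
        Matrix.mulVec_add, Matrix.mulVec_smul, Matrix.mulVec_zero, smul_zero, neg_zero, zpow_zero,
        R1, R2, R3, R4]
    all_goals try module
  refine mat₂_ext fun c d => ?_
  rw [← Matrix.mulVec_mulVec, ← Matrix.mulVec_mulVec]
  rcases quad_cases a b c with hc | hc | hc | hc | ⟨c1, c2, c3, c4⟩
  on_goal 5 =>
    rcases quad_cases a b d with hd | hd | hd | hd | ⟨d1, d2, d3, d4⟩
    on_goal 5 =>
      have hz0 : ∀ ρ υ : F, ∀ c d : Fin (2 * n), c ≠ b → c ≠ a.rev → d ≠ b → d ≠ a.rev →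
          (copX s ρ υ a b).mulVec (ee c d) = 0 := by
        intro ρ υ c d h1 h2 h3 h4
        simp only [copX_mulVec, h1, h2, h3, h4, if_false, add_zero]
      rw [hz0 _ _ c d c2 c3 d2 d3, Matrix.mulVec_zero]
      by_cases h1 : c = d
      · rw [h1, Rcheck_mulVec_self, Matrix.mulVec_smul, hz0 _ _ d d d2 d3 d2 d3, smul_zero]
      by_cases h2 : c = d.rev
      · obtain ⟨e1, e2, -, -⟩ := H.bother d d1 d2 d3 d4
        rw [h2, Rcheck_mulVec_rev, copX_mulVec_sum _ _ _ h, e1, e2]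
        match_scalars <;> field_simp <;> ring
      · rw [Rcheck_mulVec_of_ne s z h1 h2, Matrix.mulVec_add, Matrix.mulVec_smul,
          Matrix.mulVec_smul, hz0 _ _ c d c2 c3 d2 d3, hz0 _ _ d c d2 d3 c2 c3, smul_zero,
          smul_zero, add_zero]
    all_goals rw [hd]
    on_goal 1 => exact hother' c c1 c2 c3 c4 a (Or.inl rfl)
    on_goal 1 => exact hother' c c1 c2 c3 c4 b (Or.inr (Or.inl rfl))
    on_goal 1 => exact hother' c c1 c2 c3 c4 a.rev (Or.inr (Or.inr (Or.inl rfl)))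
    on_goal 1 => exact hother' c c1 c2 c3 c4 b.rev (Or.inr (Or.inr (Or.inr rfl)))
  all_goals rcases quad_cases a b d with hd | hd | hd | hd | ⟨d1, d2, d3, d4⟩
  on_goal 5 => rw [hc]; exact hother d d1 d2 d3 d4 a (Or.inl rfl)
  on_goal 9 => rw [hc]; exact hother d d1 d2 d3 d4 b (Or.inr (Or.inl rfl))
  on_goal 13 => rw [hc]; exact hother d d1 d2 d3 d4 a.rev (Or.inr (Or.inr (Or.inl rfl)))
  on_goal 17 => rw [hc]; exact hother d d1 d2 d3 d4 b.rev (Or.inr (Or.inr (Or.inr rfl)))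
  -- The case `e_b ⊗ e_ā`, which `x_j^+` sends into the zero weight space, so that `Ř` spreads it
  -- over all `e_p ⊗ e_p̄`. By `bother` the two contributions cancel at every `p` off the block. The
  -- case `e_ā ⊗ e_b` below is alike.
  on_goal 7 =>
    rw [hc, hd]
    simp only [copX_mulVec, n3, n3.symm, if_true, if_false, Hval_right h, Hval_rev_left h,
      zero_add, add_zero, Matrix.mulVec_add, Matrix.mulVec_smul, zpow_one, neg_neg, zpow_neg, R5,
      R9, R11]
    simp only [Finset.smul_sum, ← Finset.sum_add_distrib, smul_smul, ← add_smul]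
    rw [sum_quad h]
    · simp only [H.ba'a', H.bb'b', H.bb'a', H.ba'b', H.bb'a, H.ba'b, H.ba'a, H.bb'b, hs4,
        Fin.rev_rev]
      match_scalars
      all_goals field_simp
      all_goals ring
    · intro p p1 p2 p3 p4
      obtain ⟨-, -, e, -⟩ := H.bother p p1 p2 p3 p4
      rw [e, show ρ * s * bcoef s z a.rev p
        + -(1 * s⁻¹) * (ρ * s ^ 2 * bcoef s z a.rev p) = 0 by field_simp; ring, zero_smul]
  on_goal 9 =>
    rw [hc, hd]
    simp only [copX_mulVec, n3, n3.symm, if_true, if_false, Hval_right h, Hval_rev_left h,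
      zero_add, add_zero, Matrix.mulVec_add, Matrix.mulVec_smul, zpow_one, neg_neg, zpow_neg, R6,
      R10, R12]
    simp only [Finset.smul_sum, ← Finset.sum_add_distrib, smul_smul, ← add_smul]
    rw [sum_quad h]
    · simp only [H.baa, H.bbb, H.bab, H.bba, H.bab', H.bba', H.baa', H.bbb', hs4, Fin.rev_rev]
      match_scalars
      all_goals field_simp
      all_goals ring
    · intro p p1 p2 p3 p4
      obtain ⟨-, -, -, e⟩ := H.bother p p1 p2 p3 p4
      rw [e, show -(ρ * s) * bcoef s z b p + 1 * s⁻¹ * (ρ * s ^ 2 * bcoef s z b p) = 0 by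
        field_simp; ring, zero_smul]
  all_goals rw [hc, hd]
  all_goals clear hc hd
  all_goals
    simp only [copX_mulVec, n1, n3, n5, n3.symm, n4.symm, n6.symm, if_true, if_false, Hval_left h,
      Hval_right h, Hval_rev_left h, Hval_rev_right h, zero_add, add_zero, Matrix.mulVec_add,
      Matrix.mulVec_smul, Matrix.mulVec_zero, smul_zero, zpow_one, neg_neg, zpow_neg, R1, R2, R3,
      R4, R7, R8, R9, R10, R11, R12, Rcheck_mulVec_self, copX_mulVec_sum _ _ _ h]
  all_goals try simp only [H.baa, H.bbb, H.ba'a', H.bb'b', H.bab, H.bb'a', H.bba, H.ba'b',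
      H.bab', H.bba', H.bb'a, H.ba'b, H.baa', H.ba'a, H.bbb', H.bb'b]
  all_goals try rw [hs4]
  all_goals match_scalars
  all_goals field_simp
  all_goals ring

end RIntertwining

/-! ### The coefficients of `Ř(x)` at the affine and at the finite nodes. -/

section RNodes

variable {n : ℕ} {F : Type*} [Field F]

lemma bcoef_self (s z : F) (a : Fin (2 * n)) :
    bcoef s z a a = (s ^ (-4 : ℤ) * z - xi n s) * (z - 1) := by
  rw [bcoef, if_pos rfl]

lemma bcoef_lt {s : F} (hs : s ≠ 0) (z : F) {a b : Fin (2 * n)} (h : a.val < b.val)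
    (h' : a ≠ b.rev) : bcoef s z a b
      = (s ^ (-4 : ℤ) - 1) * (xi n s * (s ^ twicePrime b / s ^ twicePrime a) * (z - 1)) := by
  rw [bcoef, if_neg (by rintro rfl; omega), if_pos (Fin.lt_def.mpr h), if_neg h', sub_zero,
    zpow_sub₀ hs]

lemma bcoef_gt {s : F} (hs : s ≠ 0) (z : F) {a b : Fin (2 * n)} (h : b.val < a.val)
    (h' : a ≠ b.rev) : bcoef s z a b
      = (s ^ (-4 : ℤ) - 1) * z * (s ^ twicePrime b / s ^ twicePrime a * (z - 1)) := by
  rw [bcoef, if_neg (by rintro rfl; omega), if_neg (by rw [Fin.lt_def]; omega), if_neg h',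
    sub_zero, zpow_sub₀ hs]

lemma bcoef_rev_lt {s : F} (hs : s ≠ 0) (z : F) {a b : Fin (2 * n)} (h : a.val < b.val)
    (h' : a = b.rev) : bcoef s z a b
      = (s ^ (-4 : ℤ) - 1) * (xi n s * (s ^ twicePrime b / s ^ twicePrime a) * (z - 1)
        - (z - xi n s)) := by
  rw [bcoef, if_neg (by rintro rfl; omega), if_pos (Fin.lt_def.mpr h), if_pos h', zpow_sub₀ hs]

lemma bcoef_rev_gt {s : F} (hs : s ≠ 0) (z : F) {a b : Fin (2 * n)} (h : b.val < a.val)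
    (h' : a = b.rev) : bcoef s z a b
      = (s ^ (-4 : ℤ) - 1) * z * (s ^ twicePrime b / s ^ twicePrime a * (z - 1)
        - (z - xi n s)) := by
  rw [bcoef, if_neg (by rintro rfl; omega), if_neg (by rw [Fin.lt_def]; omega), if_pos h',
    zpow_sub₀ hs]

lemma ccoef_gt (s z : F) {a b : Fin (2 * n)} (h : b.val < a.val) :
    ccoef n s z a b = (1 - s ^ (-4 : ℤ)) * (z - xi n s) := by
  rw [ccoef, if_pos (Fin.lt_def.mpr h), mul_one]

lemma ccoef_lt (s z : F) {a b : Fin (2 * n)} (h : a.val < b.val) :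
    ccoef n s z a b = (1 - s ^ (-4 : ℤ)) * (z - xi n s) * z := by
  rw [ccoef, if_neg (by rw [Fin.lt_def]; omega)]

lemma zpow_twicePrime_rev {s : F} (hs : s ≠ 0) (a : Fin (2 * n)) :
    s ^ twicePrime a.rev = s ^ 6 * (xi n s)⁻¹ * (s ^ twicePrime a)⁻¹ := by
  rw [twicePrime_rev, xi, ← zpow_natCast, ← zpow_neg, ← zpow_neg, ← zpow_add₀ hs, ← zpow_add₀ hs]
  congr 1
  push_cast
  ring

/-- The affine root joins the end of the index range to its beginning, so `a` and `b` compare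
oppositely with every other index. Each reversed comparison changes a coefficient by a factor `z`,
which accounts for `ρ = z`. -/
lemma rnode_zero (hn : 3 ≤ n) {s z : F} (hs : s ≠ 0) (hz : z ≠ 0) {j : Fin (n + 1)}
    (hj : j.val = 0) : RNode s z z (s ^ 2) (nodeA hn j) (nodeB hn j) := by
  have h := node_quad hn j
  have hv := node_val hn j
  set a := nodeA hn j
  set b := nodeB hn j
  have va : a.val = 2 * n - 2 := by omega
  have vb : b.val = 0 := by omega
  have va' : a.rev.val = 1 := by rw [Fin.val_rev]; omega
  have vb' : b.rev.val = 2 * n - 1 := by rw [Fin.val_rev]; omega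
  have n1 := h.ne
  have n2 := h.ner
  have n3 := h.symm.ner
  have n4 := h.rev_ne_rev
  have hξ : xi n s ≠ 0 := zpow_ne_zero _ hs
  have hPa : s ^ twicePrime a ≠ 0 := zpow_ne_zero _ hs
  have ra := zpow_twicePrime_rev hs a
  have rb := zpow_twicePrime_rev hs b
  have ta : s ^ twicePrime a = s * (xi n s)⁻¹ := by
    rw [xi, ← zpow_neg, ← zpow_one_add₀ hs]
    congr 1
    simp only [twicePrime, num]
    split_ifs <;> omega
  have tb : s ^ twicePrime b = s ^ 3 := by
    rw [← zpow_natCast]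
    congr 1
    simp only [twicePrime, num]
    split_ifs <;> omega
  have rr := Fin.rev_rev a
  have rr' := Fin.rev_rev b
  have ho : ∀ p : Fin (2 * n), p ≠ a → p ≠ b → p ≠ a.rev → p ≠ b.rev →
      1 < p.val ∧ p.val < 2 * n - 2 ∧ p ≠ a.rev.rev ∧ p ≠ b.rev.rev ∧ a ≠ p.rev ∧ b ≠ p.rev ∧
        a.rev ≠ p.rev ∧ b.rev ≠ p.rev := by
    intro p p1 p2 p3 p4
    have hp := p.isLt
    have e1 : p.val ≠ a.val := fun e => p1 (Fin.ext e)
    have e2 : p.val ≠ b.val := fun e => p2 (Fin.ext e)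
    have e3 : p.val ≠ a.rev.val := fun e => p3 (Fin.ext e)
    have e4 : p.val ≠ b.rev.val := fun e => p4 (Fin.ext e)
    refine ⟨by omega, by omega, by rwa [rr], by rwa [rr'], ?_, ?_, ?_, ?_⟩ <;> intro e <;>
      have := congrArg Fin.val e <;> simp only [Fin.val_rev] at this <;> omega
  refine ⟨h, hs, hz, pow_ne_zero _ hs, hz, ?_, ?_, ?_, ?_, ?_, ?_, ?_, ?_, ?_,
    ?_, bcoef_self _ _ _, bcoef_self _ _ _, bcoef_self _ _ _, bcoef_self _ _ _, ?_, ?_, ?_, ?_, ?_,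
    ?_, ?_, ?_, ?_, ?_, ?_, ?_⟩
  · rw [ccoef_gt _ _ (by omega)]; field_simp
  · rw [ccoef_lt _ _ (by omega)]
  · rw [ccoef_lt _ _ (by omega)]
  · rw [ccoef_gt _ _ (by omega)]
  · rw [ccoef_lt _ _ (by omega)]
  · rw [ccoef_gt _ _ (by omega)]
  · rw [ccoef_gt _ _ (by omega)]; field_simp
  · rw [ccoef_lt _ _ (by omega)]
  · intro p p1 p2 p3 p4
    obtain ⟨l1, l2, -⟩ := ho p p1 p2 p3 p4
    rw [ccoef_lt (a := b) _ _ (by omega), ccoef_gt (a := a) _ _ (by omega),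
      ccoef_lt (b := a) _ _ (by omega), ccoef_gt (b := b) _ _ (by omega),
      ccoef_lt (a := a.rev) _ _ (by omega), ccoef_gt (a := b.rev) _ _ (by omega),
      ccoef_lt (b := b.rev) _ _ (by omega), ccoef_gt (b := a.rev) _ _ (by omega)]
    refine ⟨?_, ?_, ?_, ?_⟩ <;> ring
  · intro p p1 p2 p3 p4
    obtain ⟨l1, l2, q1, q2, q3, q4, q5, q6⟩ := ho p p1 p2 p3 p4
    have hP : s ^ twicePrime p ≠ 0 := zpow_ne_zero _ hs
    rw [bcoef_lt (a := p) (b := a) hs _ (by omega) p3,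
      bcoef_gt (a := p) (b := b) hs _ (by omega) p4,
      bcoef_gt (a := p) (b := a.rev) hs _ (by omega) q1,
      bcoef_lt (a := p) (b := b.rev) hs _ (by omega) q2,
      bcoef_gt (a := b.rev) hs _ (by omega) q6, bcoef_lt (a := a.rev) hs _ (by omega) q5,
      bcoef_gt (a := a) hs _ (by omega) q3, bcoef_lt (a := b) hs _ (by omega) q4, ra, rb, ta, tb]
    refine ⟨?_, ?_, ?_, ?_⟩ <;> field_simp
  · rw [bcoef_gt hs _ (by omega) n2, ta, tb]; field_simp
  · rw [bcoef_gt hs _ (by omega) (by rw [rr]; exact n2.symm), ra, rb, ta, tb]; field_simp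
  · rw [bcoef_lt hs _ (by omega) n3, ta, tb]; field_simp
  · rw [bcoef_lt hs _ (by omega) (by rw [rr']; exact n3.symm), ra, rb, ta, tb]; field_simp
  · rw [bcoef_lt hs _ (by omega) (by rwa [rr']), rb, ta, tb]; field_simp
  · rw [bcoef_lt hs _ (by omega) (by rw [rr]; exact n1.symm), ra, ta, tb]; field_simp
  · rw [bcoef_gt hs _ (by omega) n4.symm, rb, ta, tb]; field_simp
  · rw [bcoef_gt hs _ (by omega) n4, ra, ta, tb]; field_simp
  · rw [bcoef_rev_gt hs _ (by omega) rr.symm, ra, ta]; field_simp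
  · rw [bcoef_rev_lt hs _ (by omega) rfl, ra, ta]; field_simp
  · rw [bcoef_rev_lt hs _ (by omega) rr'.symm, rb, tb]; field_simp; ring
  · rw [bcoef_rev_gt hs _ (by omega) rfl, rb, tb]; field_simp; ring

/-- No index off the block lies between `a` and `b`, so both compare alike with it; hence `ρ = 1`.
-/
lemma rnode_of_ne_zero (hn : 3 ≤ n) {s z : F} (hs : s ≠ 0) (hz : z ≠ 0) {j : Fin (n + 1)}
    (hj : j.val ≠ 0) :
    RNode s z 1 (s ^ (4 * (n : ℤ) - 2 * twicePrime (nodeA hn j))) (nodeA hn j) (nodeB hn j) := by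
  have h := node_quad hn j
  have hv := node_val hn j
  have hjn := j.isLt
  set a := nodeA hn j
  set b := nodeB hn j
  have va : a.val + 1 = b.val ∧ b.val < n ∨ a.val + 2 = n ∧ b.val = n := by omega
  have va' : a.rev.val = 2 * n - 1 - a.val := by rw [Fin.val_rev]; omega
  have vb' : b.rev.val = 2 * n - 1 - b.val := by rw [Fin.val_rev]; omega
  have n1 := h.ne
  have n2 := h.ner
  have n3 := h.symm.ner
  have n4 := h.rev_ne_rev
  have hξ : xi n s ≠ 0 := zpow_ne_zero _ hs
  have hPa : s ^ twicePrime a ≠ 0 := zpow_ne_zero _ hs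
  have ra := zpow_twicePrime_rev hs a
  have rb := zpow_twicePrime_rev hs b
  have htb : twicePrime b = twicePrime a + 2 := by
    simp only [twicePrime, num]; split_ifs <;> omega
  have tb : s ^ twicePrime b = s ^ twicePrime a * s ^ 2 := by
    rw [htb, zpow_add₀ hs, show (2 : ℤ) = (2 : ℕ) by rfl, zpow_natCast]
  have tg : s ^ (4 * (n : ℤ) - 2 * twicePrime a)
      = s ^ 4 * (xi n s)⁻¹ * (s ^ twicePrime a)⁻¹ ^ 2 := by
    rw [xi, ← zpow_natCast, ← zpow_natCast, ← zpow_neg, ← zpow_neg, ← zpow_mul, ← zpow_add₀ hs,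
      ← zpow_add₀ hs]
    congr 1
    push_cast
    ring
  have rr := Fin.rev_rev a
  have rr' := Fin.rev_rev b
  have ho : ∀ p : Fin (2 * n), p ≠ a → p ≠ b → p ≠ a.rev → p ≠ b.rev →
      ((p.val < a.val ∧ p.val < b.val) ∨ (p.val > a.val ∧ p.val > b.val)) ∧
      ((p.val < a.rev.val ∧ p.val < b.rev.val) ∨ (p.val > a.rev.val ∧ p.val > b.rev.val)) ∧
      p ≠ a.rev.rev ∧ p ≠ b.rev.rev ∧ a ≠ p.rev ∧ b ≠ p.rev ∧ a.rev ≠ p.rev ∧ b.rev ≠ p.rev := by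
    intro p p1 p2 p3 p4
    have hp := p.isLt
    have e1 : p.val ≠ a.val := fun e => p1 (Fin.ext e)
    have e2 : p.val ≠ b.val := fun e => p2 (Fin.ext e)
    have e3 : p.val ≠ a.rev.val := fun e => p3 (Fin.ext e)
    have e4 : p.val ≠ b.rev.val := fun e => p4 (Fin.ext e)
    refine ⟨by omega, by omega, by rwa [rr], by rwa [rr'], ?_, ?_, ?_, ?_⟩ <;> intro e <;>
      have := congrArg Fin.val e <;> simp only [Fin.val_rev] at this <;> omega
  refine ⟨h, hs, one_ne_zero, zpow_ne_zero _ hs, hz, ?_, ?_, ?_, ?_, ?_, ?_, ?_, ?_, ?_,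
    ?_, bcoef_self _ _ _, bcoef_self _ _ _, bcoef_self _ _ _, bcoef_self _ _ _, ?_, ?_, ?_, ?_, ?_,
    ?_, ?_, ?_, ?_, ?_, ?_, ?_⟩
  · rw [ccoef_lt _ _ (by omega)]; ring
  · rw [ccoef_gt _ _ (by omega)]; ring
  · rw [ccoef_lt _ _ (by omega)]
  · rw [ccoef_gt _ _ (by omega)]
  · rw [ccoef_lt _ _ (by omega)]
  · rw [ccoef_gt _ _ (by omega)]
  · rw [ccoef_lt _ _ (by omega)]; ring
  · rw [ccoef_gt _ _ (by omega)]; ring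
  · intro p p1 p2 p3 p4
    obtain ⟨l1, l2, -⟩ := ho p p1 p2 p3 p4
    refine ⟨?_, ?_, ?_, ?_⟩
    · rcases l1 with l1 | l1
      · rw [ccoef_gt _ _ l1.1, ccoef_gt _ _ l1.2, one_mul]
      · rw [ccoef_lt _ _ l1.1, ccoef_lt _ _ l1.2, one_mul]
    · rcases l1 with l1 | l1
      · rw [ccoef_lt _ _ l1.1, ccoef_lt _ _ l1.2, one_mul]
      · rw [ccoef_gt _ _ l1.1, ccoef_gt _ _ l1.2, one_mul]
    · rcases l2 with l1 | l1
      · rw [ccoef_gt _ _ l1.1, ccoef_gt _ _ l1.2, one_mul]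
      · rw [ccoef_lt _ _ l1.1, ccoef_lt _ _ l1.2, one_mul]
    · rcases l2 with l1 | l1
      · rw [ccoef_lt _ _ l1.1, ccoef_lt _ _ l1.2, one_mul]
      · rw [ccoef_gt _ _ l1.1, ccoef_gt _ _ l1.2, one_mul]
  · intro p p1 p2 p3 p4
    obtain ⟨l1, l2, q1, q2, q3, q4, q5, q6⟩ := ho p p1 p2 p3 p4
    have hP : s ^ twicePrime p ≠ 0 := zpow_ne_zero _ hs
    refine ⟨?_, ?_, ?_, ?_⟩
    · rcases l1 with l1 | l1
      · rw [bcoef_lt hs _ l1.1 p3, bcoef_lt hs _ l1.2 p4, tb]; field_simp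
      · rw [bcoef_gt hs _ l1.1 p3, bcoef_gt hs _ l1.2 p4, tb]; field_simp
    · rcases l2 with l1 | l1
      · rw [bcoef_lt hs _ l1.1 q1, bcoef_lt hs _ l1.2 q2, ra, rb, tb]; field_simp
      · rw [bcoef_gt hs _ l1.1 q1, bcoef_gt hs _ l1.2 q2, ra, rb, tb]; field_simp
    · rcases l2 with l1 | l1
      · rw [bcoef_gt hs _ l1.1 q5, bcoef_gt hs _ l1.2 q6, ra, rb, tb]; field_simp
      · rw [bcoef_lt hs _ l1.1 q5, bcoef_lt hs _ l1.2 q6, ra, rb, tb]; field_simp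
    · rcases l1 with l1 | l1
      · rw [bcoef_gt hs _ l1.1 q3, bcoef_gt hs _ l1.2 q4, tb]; field_simp
      · rw [bcoef_lt hs _ l1.1 q3, bcoef_lt hs _ l1.2 q4, tb]; field_simp
  · rw [bcoef_lt hs _ (by omega) n2, tb]; field_simp
  · rw [bcoef_lt hs _ (by omega) (by rw [rr]; exact n2.symm), ra, rb, tb]; field_simp
  · rw [bcoef_gt hs _ (by omega) n3, tb]; field_simp
  · rw [bcoef_gt hs _ (by omega) (by rw [rr']; exact n3.symm), ra, rb, tb]; field_simp
  · rw [bcoef_lt hs _ (by omega) (by rwa [rr']), rb, tb, tg]; field_simp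
  · rw [bcoef_lt hs _ (by omega) (by rw [rr]; exact n1.symm), ra, tb, tg]; field_simp
  · rw [bcoef_gt hs _ (by omega) n4.symm, rb, tb, tg]; field_simp
  · rw [bcoef_gt hs _ (by omega) n4, ra, tb, tg]; field_simp
  · rw [bcoef_rev_lt hs _ (by omega) rr.symm, ra, tg]; field_simp
  · rw [bcoef_rev_gt hs _ (by omega) rfl, ra, tg]; field_simp
  · rcases va with hb | hb
    · rw [bcoef_rev_lt hs _ (by omega) rr'.symm, rb, tb, tg]; field_simp
    -- At node `n` the order of `b` and `b̄` is reversed and the other branch of `bcoef` applies.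
    -- The two branches give the same value because `ξ q^{2a'} = q` for `a = n - 1`.
    · have e : xi n s * (s ^ twicePrime a) ^ 2 = s ^ 2 := by
        rw [xi, ← zpow_natCast, ← zpow_mul, ← zpow_add₀ hs, ← zpow_natCast]
        congr 1
        simp only [twicePrime, num]
        split_ifs <;> push_cast <;> omega
      rw [bcoef_rev_gt hs _ (by omega) rr'.symm, rb, tb, tg]
      field_simp
      linear_combination (-(s ^ 4 * z - s ^ 4 * xi n s - z + xi n s)
        + (s ^ 4 * z ^ 2 - s ^ 4 * z * xi n s + z * xi n s - z ^ 2)) * e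
  · rcases va with hb | hb
    · rw [bcoef_rev_gt hs _ (by omega) rfl, rb, tb, tg]; field_simp
    · have e : xi n s * (s ^ twicePrime a) ^ 2 = s ^ 2 := by
        rw [xi, ← zpow_natCast, ← zpow_mul, ← zpow_add₀ hs, ← zpow_natCast]
        congr 1
        simp only [twicePrime, num]
        split_ifs <;> push_cast <;> omega
      rw [bcoef_rev_lt hs _ (by omega) rfl, rb, tb, tg]
      field_simp
      linear_combination (xi n s * (s ^ 4 - s ^ 4 * z - 1 + z)
        + (s ^ 4 * z ^ 2 - s ^ 4 * z + z - z ^ 2)) * e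

end RNodes

/-! ### `Ř(x)` on all the generators of `U_h`. -/

section RMatrix

variable {n : ℕ} {F : Type*} [Field F]

theorem Rcheck_mul_copX (hn : 3 ≤ n) {s z : F} (hs : s ≠ 0) (hz : z ≠ 0) (j : Fin (n + 1)) :
    Rcheck n s z * copX s (nodeParam z j) 1 (nodeA hn j) (nodeB hn j)
      = copX s 1 (nodeParam z j) (nodeA hn j) (nodeB hn j) * Rcheck n s z := by
  unfold nodeParam
  split_ifs with hj
  · exact (rnode_zero hn hs hz hj).mul_copX
  · exact (rnode_of_ne_zero hn hs hz hj).mul_copX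

lemma EE_transpose (a b c d : Fin (2 * n)) : (EE a b c d : Mat₂ n F).transpose = EE b a d c := by
  rw [EE, EE, ← Matrix.kroneckerMap_transpose, Matrix.transpose_single, Matrix.transpose_single]

lemma bcoef_rev (s z : F) (a b : Fin (2 * n)) :
    bcoef s z b.rev a.rev = bcoef s z a b := by
  have e : twicePrime a.rev - twicePrime b.rev = twicePrime b - twicePrime a := by
    rw [twicePrime_rev, twicePrime_rev]; ring
  have e' : b.rev = a.rev.rev ↔ a = b.rev := by
    rw [Fin.rev_rev, eq_comm]
  simp only [bcoef, e, Fin.rev_inj, Fin.rev_lt_rev, e', eq_comm (a := b) (b := a)]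

/-- The diagonal sums are fixed by transposition, the swap sum is fixed after renaming its indices,
and the last sum is fixed because `b_{b̄ā} = b_{ab}`. This symmetry spares a separate verification
for `x_j^-`. -/
lemma Rcheck_transpose (s z : F) :
    (Rcheck n s z).transpose = Rcheck n s z := by
  have hite : ∀ (P : Prop) [Decidable P] (M : Mat₂ n F),
      (if P then M else 0).transpose = if P then M.transpose else 0 := by
    intro P _ M
    split_ifs <;> simp
  have e1 : ∀ a b : Fin (2 * n), b ≠ a.rev ↔ a ≠ b.rev := by
    intro a b
    constructor <;> intro h e <;> apply h <;> rw [e, Fin.rev_rev]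
  rw [Rcheck, Matrix.transpose_add, Matrix.transpose_add, Matrix.transpose_add,
    Matrix.transpose_smul, Matrix.transpose_smul, Matrix.transpose_smul, Matrix.transpose_add,
    Matrix.transpose_smul]
  simp only [Matrix.transpose_sum, hite, EE_transpose, Matrix.transpose_smul]
  congr 1
  · congr 3
    rw [Finset.sum_comm]
    refine Finset.sum_congr rfl fun a _ => Finset.sum_congr rfl fun b _ => ?_
    simp only [e1, ne_comm (a := b) (b := a)]
  · rw [Finset.sum_comm, ← Equiv.sum_comp Fin.revPerm]
    refine Finset.sum_congr rfl fun a _ => ?_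
    rw [← Equiv.sum_comp Fin.revPerm]
    refine Finset.sum_congr rfl fun b _ => ?_
    simp only [Fin.revPerm_apply, Fin.rev_rev, bcoef_rev]

/-- The coproduct of `x_j^-` on the tensor product of two vector representations. -/
def copY (s ρ υ : F) (a b : Fin (2 * n)) : Mat₂ n F :=
  ρ • (Xmat b a ⊗ₖ Matrix.diagonal fun c => s ^ (-Hval a b c))
    + υ • ((Matrix.diagonal fun c => s ^ Hval a b c) ⊗ₖ Xmat b a)

lemma copX_transpose (s ρ υ : F) (a b : Fin (2 * n)) :
    (copX s ρ υ a b).transpose = copY s ρ υ a b := by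
  rw [copX, copY, Matrix.transpose_add, Matrix.transpose_smul, Matrix.transpose_smul,
    ← Matrix.kroneckerMap_transpose, ← Matrix.kroneckerMap_transpose, Matrix.diagonal_transpose,
    Matrix.diagonal_transpose, Xmat_transpose]

lemma smul_copX (c s ρ υ : F) (a b : Fin (2 * n)) :
    c • copX s ρ υ a b = copX s (c * ρ) (c * υ) a b := by
  rw [copX, copX, smul_add, smul_smul, smul_smul]

lemma smul_copY (c s ρ υ : F) (a b : Fin (2 * n)) :
    c • copY s ρ υ a b = copY s (c * ρ) (c * υ) a b := by
  rw [copY, copY, smul_add, smul_smul, smul_smul]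

/-- The transpose of the relation for `x_j^+`, divided by the spectral parameter of the node. -/
theorem Rcheck_mul_copY (hn : 3 ≤ n) {s z : F} (hs : s ≠ 0) (hz : z ≠ 0) (j : Fin (n + 1)) :
    Rcheck n s z * copY s (nodeParam z j)⁻¹ 1 (nodeA hn j) (nodeB hn j)
      = copY s 1 (nodeParam z j)⁻¹ (nodeA hn j) (nodeB hn j) * Rcheck n s z := by
  have h := congrArg Matrix.transpose (Rcheck_mul_copX hn hs hz j)
  have hz' := nodeParam_ne_zero hz j
  rw [Matrix.transpose_mul, Matrix.transpose_mul, copX_transpose, copX_transpose,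
    Rcheck_transpose] at h
  have e := congrArg ((nodeParam z j)⁻¹ • ·) h.symm
  simpa only [← Matrix.smul_mul, ← Matrix.mul_smul (Rcheck n s z), smul_copY, inv_mul_cancel₀ hz',
    mul_one] using e

/-- `Ř(z)` commutes with diagonal matrices that respect the weights. -/
lemma Rcheck_commute_diagonal (s z : F) (φ : Fin (2 * n) × Fin (2 * n) → F)
    (h1 : ∀ c d, φ (c, d) = φ (d, c)) (h2 : ∀ c d, φ (c, c.rev) = φ (d, d.rev)) :
    Rcheck n s z * Matrix.diagonal φ = Matrix.diagonal φ * Rcheck n s z := by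
  have hd : ∀ c d, (Matrix.diagonal φ).mulVec (ee c d) = φ (c, d) • ee c d := by
    intro c d
    funext x
    rw [Matrix.mulVec_diagonal, Pi.smul_apply, smul_eq_mul, ee_apply]
    split_ifs with h
    · rw [h]
    · ring
  refine mat₂_ext fun c d => ?_
  rw [← Matrix.mulVec_mulVec, ← Matrix.mulVec_mulVec, hd, Matrix.mulVec_smul]
  by_cases e1 : c = d
  · rw [e1, Rcheck_mulVec_self, Matrix.mulVec_smul, hd, smul_comm]
  by_cases e2 : c = d.rev
  · rw [e2, Rcheck_mulVec_rev, Matrix.mulVec_sum, Finset.smul_sum]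
    refine Finset.sum_congr rfl fun p _ => ?_
    have e3 := h2 p d.rev
    rw [Fin.rev_rev] at e3
    rw [Matrix.mulVec_smul, hd, e3, smul_comm]
  · rw [Rcheck_mulVec_of_ne s z e1 e2, Matrix.mulVec_add, Matrix.mulVec_smul, Matrix.mulVec_smul,
      hd, hd, h1 d c]
    module

lemma diagonal_kronecker (f g : Fin (2 * n) → F) :
    (Matrix.diagonal f : Mat n F) ⊗ₖ (Matrix.diagonal g : Mat n F)
      = Matrix.diagonal fun c => f c.1 * g c.2 :=
  Matrix.diagonal_kronecker_diagonal f g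

end RMatrix

theorem Rcheck_isRIntertwiner {n : ℕ} (hn : 3 ≤ n) (x : ℂ⟦X⟧ˣ) :
    IsRIntertwiner n x (Rcheck n s (algebraMap ℂ⟦X⟧ ℂ⸨X⸩ x)) := by
  intro ρ ρ₁ h h₁ t t' j
  have hx : algebraMap ℂ⟦X⟧ ℂ⸨X⸩ x ≠ 0 := ((Units.isUnit x).map _).ne_zero
  have np : nodeParam (algebraMap ℂ⟦X⟧ ℂ⸨X⸩ ((1 : ℂ⟦X⟧ˣ) : ℂ⟦X⟧)) j = 1 := by
    rw [Units.val_one, map_one, nodeParam, ite_self]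
  have m1 : ∀ σ : Uh n →ₐ[ℂ⟦X⟧] Mat n ℂ⟦X⟧, (σ 1).map (algebraMap ℂ⟦X⟧ ℂ⸨X⸩) = 1 := by
    intro σ
    rw [map_one, Matrix.map_one _ (map_zero _) (map_one _)]
  refine ⟨?_, ?_, ?_⟩
  · simp only [t, t', h.map_hh hn, h₁.map_hh hn, m1]
    have e : ∀ f : Fin (2 * n) → ℂ⸨X⸩, (Matrix.diagonal f : Mat n ℂ⸨X⸩) ⊗ₖ (1 : Mat n ℂ⸨X⸩)
        + (1 : Mat n ℂ⸨X⸩) ⊗ₖ (Matrix.diagonal f : Mat n ℂ⸨X⸩)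
        = Matrix.diagonal fun c => f c.1 + f c.2 := by
      intro f
      rw [← Matrix.diagonal_one, diagonal_kronecker, diagonal_kronecker, Matrix.diagonal_add]
      simp
    rw [e]
    refine Rcheck_commute_diagonal _ _ _ (fun c d => add_comm _ _) fun c d => ?_
    simp [Hval_rev]
  · simp only [t, t', h.map_xp hn, h₁.map_xp hn, h.map_qh_half hn, h₁.map_qh_half hn,
      h.map_qh_neg_half hn, h₁.map_qh_neg_half hn, np, one_smul, Matrix.smul_kronecker,
      Matrix.kronecker_smul]
    have := Rcheck_mul_copX hn s_ne_zero hx j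
    simpa only [copX, one_smul] using this
  · simp only [t, t', h.map_xm hn, h₁.map_xm hn, h.map_qh_half hn, h₁.map_qh_half hn,
      h.map_qh_neg_half hn, h₁.map_qh_neg_half hn, np, inv_one, one_smul, Matrix.smul_kronecker,
      Matrix.kronecker_smul]
    have := Rcheck_mul_copY hn s_ne_zero hx j
    simpa only [copY, one_smul] using this

/-! ## The two sides of the reflection equation as intertwiners -/

section ReflectionIntertwiner

variable {n : ℕ} {F : Type*} [Field F]

/-- The coproduct of a generator of the coideal subalgebra on a tensor product. -/
def copQ (s e t u : F) (a b : Fin (2 * n)) : Mat₂ n F :=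
  Qmat s e t a b ⊗ₖ (1 : Mat n F)
    + (Matrix.diagonal fun c => s ^ (2 * Hval a b c)) ⊗ₖ Qmat s e u a b

/-- `q^{h_j}` is grouplike and `q^{h_j/2} x_j^±` has the coproduct `q^{h_j/2} x_j^± ⊗ 1 + q^{h_j} ⊗
q^{h_j/2} x_j^±`. So `copQ` is assembled from operators that `Ř` is already known to intertwine. -/
lemma copQ_eq {s : F} (hs : s ≠ 0) (e t u : F) (a b : Fin (2 * n)) :
    copQ s e t u a b
      = ((Matrix.diagonal fun c => s ^ Hval a b c) ⊗ₖ (Matrix.diagonal fun c => s ^ Hval a b c))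
          * (copX s t u a b + copY s t⁻¹ u⁻¹ a b)
        + e • ((Matrix.diagonal fun c => s ^ (2 * Hval a b c))
          ⊗ₖ (Matrix.diagonal fun c => s ^ (2 * Hval a b c)) - 1) := by
  have e1 : (Matrix.diagonal fun c => s ^ Hval a b c : Mat n F)
      * (Matrix.diagonal fun c => s ^ (-Hval a b c)) = 1 := by
    rw [Matrix.diagonal_mul_diagonal, ← Matrix.diagonal_one]
    congr 1
    funext c
    rw [← zpow_add₀ hs, add_neg_cancel, zpow_zero]
  have e2 : (Matrix.diagonal fun c => s ^ Hval a b c : Mat n F)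
      * (Matrix.diagonal fun c => s ^ Hval a b c)
        = Matrix.diagonal fun c => s ^ (2 * Hval a b c) := by
    rw [Matrix.diagonal_mul_diagonal]
    congr 1
    funext c
    rw [← zpow_add₀ hs, two_mul]
  have e3 : ∀ A B C : Mat n F, (A + B) ⊗ₖ C = A ⊗ₖ C + B ⊗ₖ C := Matrix.add_kronecker
  have e4 : ∀ A B C : Mat n F, A ⊗ₖ (B + C) = A ⊗ₖ B + A ⊗ₖ C := Matrix.kronecker_add
  simp only [copQ, copX, copY, Qmat, mul_add, e3, e4, Matrix.smul_kronecker, Matrix.kronecker_smul,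
    Matrix.mul_smul, ← Matrix.mul_kronecker_mul, e1, e2, kronecker_sub, sub_kronecker,
    Matrix.one_kronecker_one, smul_sub]
  abel

lemma nodeParam_div {t u : F} (hu : u ≠ 0) (j : Fin (n + 1)) :
    nodeParam u j * nodeParam (t / u) j = nodeParam t j := by
  unfold nodeParam
  split_ifs
  · field_simp
  · rw [one_mul]

/-- The relations for the parameters `(t/u, 1)` become those for `(t, u)` after multiplication by
`u` for `x_0^+` and by `u⁻¹` for `x_0^-`; so `Ř` depends only on the ratio. -/
theorem Rcheck_mul_copQ (hn : 3 ≤ n) {s : F} (hs : s ≠ 0) (e : F) {t u : F} (ht : t ≠ 0)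
    (hu : u ≠ 0) (j : Fin (n + 1)) :
    Rcheck n s (t / u) * copQ s e (nodeParam t j) (nodeParam u j) (nodeA hn j) (nodeB hn j)
      = copQ s e (nodeParam u j) (nodeParam t j) (nodeA hn j) (nodeB hn j)
        * Rcheck n s (t / u) := by
  have hz : t / u ≠ 0 := div_ne_zero ht hu
  have hX := congrArg (nodeParam u j • ·) (Rcheck_mul_copX hn hs hz j)
  have hY := congrArg ((nodeParam u j)⁻¹ • ·) (Rcheck_mul_copY hn hs hz j)
  have e1 := nodeParam_div (t := t) hu j
  simp only [← Matrix.smul_mul, ← Matrix.mul_smul (Rcheck n s _), smul_copX, smul_copY, e1, mul_one,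
    ← mul_inv] at hX hY
  have hD := Rcheck_commute_diagonal s (t / u) (fun c : Fin (2 * n) × Fin (2 * n) =>
    s ^ Hval (nodeA hn j) (nodeB hn j) c.1 * s ^ Hval (nodeA hn j) (nodeB hn j) c.2)
    (fun c d => mul_comm _ _) (fun c d => by
      simp only [Hval_rev, zpow_neg]
      rw [mul_inv_cancel₀ (zpow_ne_zero _ hs), mul_inv_cancel₀ (zpow_ne_zero _ hs)])
  have hD2 := Rcheck_commute_diagonal s (t / u) (fun c : Fin (2 * n) × Fin (2 * n) =>
    s ^ (2 * Hval (nodeA hn j) (nodeB hn j) c.1) * s ^ (2 * Hval (nodeA hn j) (nodeB hn j) c.2))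
    (fun c d => mul_comm _ _) (fun c d => by
      simp only [Hval_rev, mul_neg, zpow_neg]
      rw [mul_inv_cancel₀ (zpow_ne_zero _ hs), mul_inv_cancel₀ (zpow_ne_zero _ hs)])
  rw [copQ_eq hs, copQ_eq hs, diagonal_kronecker, diagonal_kronecker, mul_add, add_mul, ← mul_assoc,
    hD, mul_assoc, mul_assoc, mul_add, add_mul, hX, hY, Matrix.mul_smul, Matrix.smul_mul, mul_sub,
    sub_mul, hD2, mul_one, one_mul]

/-- The coideal property: in `Q ⊗ 1 + q^{h_j} ⊗ Q` the right tensor factors are `1` and `Q`, and `K`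
may be applied there. For this reason the equation involves `1 ⊗ K` and not `K ⊗ 1`. -/
lemma one_kronecker_mul_copQ {s e t u u' : F} {a b : Fin (2 * n)} {K : Mat n F}
    (h : K * Qmat s e u a b = Qmat s e u' a b * K) :
    ((1 : Mat n F) ⊗ₖ K) * copQ s e t u a b = copQ s e t u' a b * ((1 : Mat n F) ⊗ₖ K) := by
  rw [copQ, copQ, mul_add, add_mul, ← Matrix.mul_kronecker_mul, ← Matrix.mul_kronecker_mul,
    ← Matrix.mul_kronecker_mul, ← Matrix.mul_kronecker_mul, h, one_mul, one_mul, mul_one, mul_one,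
    one_mul, mul_one]

/-- The difference of the two sides of the reflection equation. -/
def reflDiff (n : ℕ) (s : F) (K : F → Mat n F) (x y : F) : Mat₂ n F :=
  ((1 : Mat n F) ⊗ₖ K y) * Rcheck n s (x * y) * ((1 : Mat n F) ⊗ₖ K x) * Rcheck n s (x / y)
    - Rcheck n s (x / y) * ((1 : Mat n F) ⊗ₖ K x) * Rcheck n s (x * y) * ((1 : Mat n F) ⊗ₖ K y)

/-- Each side is a composite of four intertwiners. On the left the parameters run `(ηx, ηy) → (ηy,
ηx) → (ηy, η/x) → (η/x, ηy) → (η/x, η/y)`; on the right they take the other route between the same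
ends. -/
theorem reflDiff_mul_copQ (hn : 3 ≤ n) {I s e : F} (hI : I ^ 2 = -1) (hs : s ≠ 0)
    (hs2 : s ^ 2 + 1 ≠ 0) (he : e * (s ^ 2 - 1) = I * s) (he' : e * (s⁻¹ ^ 2 - 1) = -I * s⁻¹)
    {x y : F} (hx : x ≠ 0) (hy : y ≠ 0) (j : Fin (n + 1)) :
    reflDiff n s (Kmat n I s) x y * copQ s e (nodeParam (etaval n s * x) j)
        (nodeParam (etaval n s * y) j) (nodeA hn j) (nodeB hn j)
      = copQ s e (nodeParam (etaval n s / x) j) (nodeParam (etaval n s / y) j)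
        (nodeA hn j) (nodeB hn j) * reflDiff n s (Kmat n I s) x y := by
  have hη : etaval n s ≠ 0 := mul_ne_zero (pow_ne_zero _ (by norm_num)) (zpow_ne_zero _ hs)
  have kx := fun t => one_kronecker_mul_copQ (t := t) (Kmat_mul_Qmat hn hI hs hs2 hx he he' j)
  have ky := fun t => one_kronecker_mul_copQ (t := t) (Kmat_mul_Qmat hn hI hs hs2 hy he he' j)
  have r1 := Rcheck_mul_copQ hn hs e (mul_ne_zero hη hx) (mul_ne_zero hη hy) j
  have r2 := Rcheck_mul_copQ hn hs e (mul_ne_zero hη hy) (div_ne_zero hη hx) j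
  have r3 := Rcheck_mul_copQ hn hs e (mul_ne_zero hη hx) (div_ne_zero hη hy) j
  have r4 := Rcheck_mul_copQ hn hs e (div_ne_zero hη hy) (div_ne_zero hη hx) j
  rw [show etaval n s * x / (etaval n s * y) = x / y by field_simp] at r1
  rw [show etaval n s * y / (etaval n s / x) = x * y by field_simp] at r2
  rw [show etaval n s * x / (etaval n s / y) = x * y by field_simp] at r3
  rw [show etaval n s / y / (etaval n s / x) = x / y by field_simp] at r4
  rw [reflDiff, sub_mul, mul_sub]
  congr 1
  · rw [mul_assoc, r1, ← mul_assoc, mul_assoc _ (_ ⊗ₖ _) (copQ _ _ _ _ _ _), kx, ← mul_assoc,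
      mul_assoc _ (Rcheck n s (x * y)) (copQ _ _ _ _ _ _), r2, ← mul_assoc, ky]
    simp only [mul_assoc]
  · rw [mul_assoc, ky, ← mul_assoc, mul_assoc _ (Rcheck n s (x * y)) (copQ _ _ _ _ _ _), r3,
      ← mul_assoc, mul_assoc _ (_ ⊗ₖ _) (copQ _ _ _ _ _ _), kx, ← mul_assoc, r4]
    simp only [mul_assoc]

lemma mulVec_ee_apply (M : Mat₂ n F) (c d : Fin (2 * n)) (p : Fin (2 * n) × Fin (2 * n)) :
    M.mulVec (ee c d) p = M p (c, d) := by
  rw [ee, Matrix.mulVec_single_one, Matrix.col_apply]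

lemma one_kronecker_mulVec (K : Mat n F) (c d : Fin (2 * n)) :
    ((1 : Mat n F) ⊗ₖ K).mulVec (ee c d) = ∑ b, K b d • ee c b := by
  funext x
  obtain ⟨x, y⟩ := x
  rw [ee, Matrix.mulVec_single_one, Matrix.col_apply, Matrix.kroneckerMap_apply, Matrix.one_apply,
    Finset.sum_apply]
  simp only [Pi.smul_apply, ee_apply, Prod.mk.injEq, smul_eq_mul]
  by_cases h : x = c
  · simp [h]
  · simp [h]

lemma one_kronecker_mulVec_apply (K : Mat n F) (v : Fin (2 * n) × Fin (2 * n) → F)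
    (c d : Fin (2 * n)) :
    ((1 : Mat n F) ⊗ₖ K).mulVec v (c, d) = ∑ p, K d p * v (c, p) := by
  rw [Matrix.mulVec, dotProduct, Fintype.sum_prod_type]
  simp only [Matrix.kroneckerMap_apply, Matrix.one_apply]
  rw [Finset.sum_eq_single c]
  · simp
  · intro b _ hb
    simp [Ne.symm hb]
  · simp

/-- The entry of `(1 ⊗ K) Ř (1 ⊗ K')` from `e_a ⊗ e_a` to `e_c ⊗ e_c`. -/
lemma kronecker_Rcheck_kronecker_apply (s z : F) (K K' : Mat n F) {a c : Fin (2 * n)} (h : c ≠ a)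
    (h' : a ≠ c.rev) :
    (((1 : Mat n F) ⊗ₖ K) * Rcheck n s z * ((1 : Mat n F) ⊗ₖ K')) (c, c) (a, a)
      = (z - 1) * (z - xi n s) / s ^ 2 * K c a * K' c a
        + bcoef s z a.rev c * K c c.rev * K' a.rev a := by
  have hR : ∀ b p, (Rcheck n s z).mulVec (ee a b) (c, p)
      = (if b = c then (if p = a then (z - 1) * (z - xi n s) / s ^ 2 else 0) else 0)
        + (if b = a.rev then (if p = c.rev then bcoef s z a.rev c else 0) else 0) := by
    intro b p
    by_cases e1 : a = b
    · subst e1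
      rw [Rcheck_mulVec_self, Pi.smul_apply, ee_apply, if_neg (by simp [h]), smul_zero,
        if_neg h.symm, if_neg (ne_rev a), add_zero]
    by_cases e2 : b = a.rev
    · subst e2
      rw [Rcheck_mulVec_rev', if_pos rfl, if_neg (fun e => h' (by rw [← e, Fin.rev_rev])),
        zero_add, Finset.sum_apply, Finset.sum_eq_single c]
      · rw [Pi.smul_apply, ee_apply]
        by_cases e : p = c.rev <;> simp [e]
      · intro q _ hq
        rw [Pi.smul_apply, ee_apply, if_neg (by simp [Ne.symm hq]), smul_zero]
      · simp
    · rw [Rcheck_mulVec_of_ne s z e1 (fun e => e2 (by rw [e, Fin.rev_rev])), if_neg e2, add_zero,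
        Pi.add_apply, Pi.smul_apply, Pi.smul_apply, ee_apply, ee_apply,
        if_neg (by simp [h] : ¬ (c, p) = (a, b)), smul_zero, add_zero]
      by_cases e3 : b = c
      · subst e3
        by_cases e4 : p = a <;> simp [e4]
      · simp [e3, Ne.symm e3]
  refine (mulVec_ee_apply _ _ _ _).symm.trans ?_
  rw [← Matrix.mulVec_mulVec, ← Matrix.mulVec_mulVec, one_kronecker_mulVec,
    one_kronecker_mulVec_apply, Matrix.mulVec_sum]
  simp only [Matrix.mulVec_smul, Finset.sum_apply, Pi.smul_apply, hR, smul_eq_mul, mul_add,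
    mul_ite, mul_zero, Finset.sum_add_distrib, Finset.sum_ite_eq', Finset.mem_univ, if_true]
  ring

lemma Kmat_antidiagonal {I s : F} (hI : I ≠ 0) (hs : s ≠ 0) (hs2 : s ^ 2 + 1 ≠ 0) (x : F)
    (a : Fin (2 * n)) : Kmat n I s x a a.rev = wvec I a * vvec I s a.rev * k0fun n s x := by
  rw [Kmat_apply hI hs hs2, kap_mid, if_neg (ne_rev a), add_zero]

/-- Some entries of the two sides of the reflection equation agree by symmetry. -/
lemma reflDiff_apply {I s : F} (hI : I ≠ 0) (hs : s ≠ 0) (hs2 : s ^ 2 + 1 ≠ 0) (x y : F)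
    {a c : Fin (2 * n)} (h : c ≠ a) (h' : a ≠ c.rev) :
    reflDiff n s (Kmat n I s) x y (c, c) (a, a) = 0 := by
  -- `Ř` acts by a scalar on `e_a ⊗ e_a` and, being symmetric, on the row of `e_c ⊗ e_c`. So the
  -- outer factor `Ř(x/y)` contributes the same scalar to both sides.
  have e1 : ∀ (M : Mat₂ n F) (z : F), (M * Rcheck n s z) (c, c) (a, a)
      = (z - s ^ (-4 : ℤ)) * (z - xi n s) * M (c, c) (a, a) := by
    intro M z
    refine (mulVec_ee_apply _ _ _ _).symm.trans ?_
    rw [← Matrix.mulVec_mulVec, Rcheck_mulVec_self, Matrix.mulVec_smul,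
      Pi.smul_apply, mulVec_ee_apply,
      smul_eq_mul]
  have e2 : ∀ (M : Mat₂ n F) (z : F), (Rcheck n s z * M) (c, c) (a, a)
      = (z - s ^ (-4 : ℤ)) * (z - xi n s) * M (c, c) (a, a) := by
    intro M z
    rw [← Matrix.transpose_apply (Rcheck n s z * M), Matrix.transpose_mul, Rcheck_transpose]
    refine (mulVec_ee_apply _ _ _ _).symm.trans ?_
    rw [← Matrix.mulVec_mulVec, Rcheck_mulVec_self, Matrix.mulVec_smul,
      Pi.smul_apply, mulVec_ee_apply,
      smul_eq_mul, Matrix.transpose_apply]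
  -- Antidiagonal entries are constants times `k₀`, so the remaining middle entry is symmetric under
  -- the exchange of `x` and `y`.
  have k1 := fun x => Kmat_antidiagonal hI hs hs2 x c
  have k2 := fun x => Kmat_antidiagonal hI hs hs2 x a.rev
  simp only [Fin.rev_rev] at k2
  rw [reflDiff, Matrix.sub_apply, e1, mul_assoc (Rcheck n s _), mul_assoc (Rcheck n s _), e2,
    kronecker_Rcheck_kronecker_apply _ _ _ _ h h', kronecker_Rcheck_kronecker_apply _ _ _ _ h h',
    k1, k1, k2, k2]
  ring

end ReflectionIntertwiner

/-! ## Reduction modulo `h` -/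

section Reduction

/-- The Laurent series `x` is a power series with constant term `c`. -/
def Red (x : ℂ⸨X⸩) (c : ℂ) : Prop :=
  ∃ f : ℂ⟦X⟧, algebraMap ℂ⟦X⟧ ℂ⸨X⸩ f = x ∧ PowerSeries.constantCoeff f = c

lemma algebraMap_laurent_injective : Function.Injective (algebraMap ℂ⟦X⟧ ℂ⸨X⸩) :=
  IsFractionRing.injective _ _

namespace Red

variable {x y : ℂ⸨X⸩} {c d : ℂ}

lemma unique (h : Red x c) (h' : Red x d) : c = d := by
  obtain ⟨f, rfl, rfl⟩ := h
  obtain ⟨g, e, rfl⟩ := h'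
  rw [algebraMap_laurent_injective e]

lemma algebraMap (f : ℂ⟦X⟧) : Red (algebraMap ℂ⟦X⟧ ℂ⸨X⸩ f) (PowerSeries.constantCoeff f) :=
  ⟨f, rfl, rfl⟩

lemma zero : Red 0 0 := ⟨0, map_zero _, map_zero _⟩

lemma one : Red 1 1 := ⟨1, map_one _, map_one _⟩

lemma add (h : Red x c) (h' : Red y d) : Red (x + y) (c + d) := by
  obtain ⟨f, rfl, rfl⟩ := h
  obtain ⟨g, rfl, rfl⟩ := h'
  exact ⟨f + g, map_add _ _ _, map_add _ _ _⟩

lemma mul (h : Red x c) (h' : Red y d) : Red (x * y) (c * d) := by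
  obtain ⟨f, rfl, rfl⟩ := h
  obtain ⟨g, rfl, rfl⟩ := h'
  exact ⟨f * g, map_mul _ _ _, map_mul _ _ _⟩

lemma neg (h : Red x c) : Red (-x) (-c) := by
  obtain ⟨f, rfl, rfl⟩ := h
  exact ⟨-f, map_neg _ _, map_neg _ _⟩

lemma sub (h : Red x c) (h' : Red y d) : Red (x - y) (c - d) := by
  rw [sub_eq_add_neg, sub_eq_add_neg]
  exact h.add h'.neg

lemma pow (h : Red x c) (k : ℕ) : Red (x ^ k) (c ^ k) := by
  obtain ⟨f, rfl, rfl⟩ := h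
  exact ⟨f ^ k, map_pow _ _ _, map_pow _ _ _⟩

lemma sum {ι : Type*} (t : Finset ι) {f : ι → ℂ⸨X⸩} {g : ι → ℂ} (h : ∀ i, Red (f i) (g i)) :
    Red (∑ i ∈ t, f i) (∑ i ∈ t, g i) := by
  choose F hF hG using h
  exact ⟨∑ i ∈ t, F i, by simp [hF], by simp [hG]⟩

lemma ne_zero (h : Red x c) (hc : c ≠ 0) : x ≠ 0 := by
  rintro rfl
  exact hc (h.unique zero)

lemma inv (h : Red x c) (hc : c ≠ 0) : Red x⁻¹ c⁻¹ := by
  obtain ⟨f, rfl, rfl⟩ := h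
  refine ⟨f⁻¹, ?_, PowerSeries.constantCoeff_inv f⟩
  refine eq_inv_of_mul_eq_one_left ?_
  rw [← map_mul, PowerSeries.inv_mul_cancel f hc, map_one]

lemma zpow (h : Red x c) (hc : c ≠ 0) (k : ℤ) : Red (x ^ k) (c ^ k) := by
  cases k with
  | ofNat k => simpa using h.pow k
  | negSucc k =>
    rw [zpow_negSucc, zpow_negSucc]
    exact (h.pow _).inv (pow_ne_zero _ hc)

lemma ite {P : Prop} [Decidable P] (h : Red x c) (h' : Red y d) :
    Red (if P then x else y) (if P then c else d) := by
  split_ifs <;> assumption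

end Red

lemma red_s : Red s 1 := by
  have := Red.algebraMap (sqrtQ : ℂ⟦X⟧ˣ).val
  have e : PowerSeries.constantCoeff (sqrtQ : ℂ⟦X⟧ˣ).val = 1 := by
    change PowerSeries.constantCoeff (qpow (1 / 2)) = 1
    rw [← PowerSeries.coeff_zero_eq_constantCoeff_apply, qpow_coeff]
    simp
  rwa [e] at this

lemma red_s_zpow (k : ℤ) : Red (s ^ k) 1 := by
  simpa using red_s.zpow one_ne_zero k

lemma red_I : Red I Complex.I := by
  have := Red.algebraMap (PowerSeries.C Complex.I)
  rwa [PowerSeries.constantCoeff_C] at this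

lemma I_sq : I ^ 2 = -1 := by
  rw [I, ← map_pow, ← map_pow, Complex.I_sq, map_neg, map_neg, map_one, map_one]

lemma s_sq_add_one_ne_zero : s ^ 2 + 1 ≠ 0 :=
  ((red_s.pow 2).add Red.one).ne_zero (by norm_num)

lemma s_sq_sub_one_ne_zero : s ^ 2 - 1 ≠ 0 := by
  intro h
  have h1 : algebraMap ℂ⟦X⟧ ℂ⸨X⸩ (qpow 1) = 1 := by
    have : qpow 1 = qpow (1 / 2) * qpow (1 / 2) := by rw [qpow_mul]; norm_num
    rw [this, map_mul, ← sq]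
    exact sub_eq_zero.mp h
  have h2 : qpow 1 = 1 := algebraMap_laurent_injective (by rw [h1, map_one])
  have h3 := congrArg (PowerSeries.coeff 1) h2
  rw [qpow_coeff] at h3
  simp [PowerSeries.coeff_one] at h3

/-- `epsPlus` has a pole at `h = 0`, but by `Qmat_eq` only its products with `q - 1` and `q⁻¹ - 1`
enter the generators, and these reduce to `i` and `-i`. -/
lemma epsPlus_mul : epsPlus * (s ^ 2 - 1) = I * s := by
  have h1 := s_ne_zero
  have h2 : s - s⁻¹ ≠ 0 := by
    intro h
    apply s_sq_sub_one_ne_zero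
    field_simp at h
    linear_combination h
  have h3 : s ^ 2 - 1 = (s - s⁻¹) * s := by field_simp
  rw [epsPlus, h3, mul_assoc, inv_mul_cancel_left₀ h2]

lemma epsPlus_mul' : epsPlus * (s⁻¹ ^ 2 - 1) = -I * s⁻¹ := by
  have h1 := s_ne_zero
  have h3 : s⁻¹ ^ 2 - 1 = (s ^ 2 - 1) * -(s⁻¹ ^ 2) := by field_simp; ring
  rw [h3, ← mul_assoc, epsPlus_mul]
  field_simp

/-- The variable `h` as a Laurent series. -/
def hvar : ℂ⸨X⸩ := algebraMap ℂ⟦X⟧ ℂ⸨X⸩ PowerSeries.X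

lemma hvar_ne_zero : hvar ≠ 0 := by
  rw [hvar, Ne, map_eq_zero_iff _ algebraMap_laurent_injective]
  exact PowerSeries.X_ne_zero

lemma red_hvar : Red hvar 0 := by
  have := Red.algebraMap PowerSeries.X
  rwa [PowerSeries.constantCoeff_X] at this

/-- Entrywise reduction of matrices. -/
def MRed {m : Type*} (A : Matrix m m ℂ⸨X⸩) (a : Matrix m m ℂ) : Prop := ∀ i j, Red (A i j) (a i j)

namespace MRed

variable {m : Type*} {A B : Matrix m m ℂ⸨X⸩} {a b : Matrix m m ℂ}

lemma unique (h : MRed A a) (h' : MRed A b) : a = b :=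
  Matrix.ext fun i j => (h i j).unique (h' i j)

lemma add (h : MRed A a) (h' : MRed B b) : MRed (A + B) (a + b) := fun i j => (h i j).add (h' i j)

lemma sub (h : MRed A a) (h' : MRed B b) : MRed (A - B) (a - b) := fun i j => (h i j).sub (h' i j)

lemma mul [Fintype m] (h : MRed A a) (h' : MRed B b) : MRed (A * B) (a * b) := fun i j =>
  Red.sum _ fun k => (h i k).mul (h' k j)

lemma smul {x : ℂ⸨X⸩} {c : ℂ} (hx : Red x c) (h : MRed A a) : MRed (x • A) (c • a) := fun i j =>
  hx.mul (h i j)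

lemma single [DecidableEq m] (i j : m) : MRed (Matrix.single i j 1) (Matrix.single i j 1) := by
  intro k l
  rw [Matrix.single_apply, Matrix.single_apply]
  exact Red.one.ite Red.zero

lemma diagonal [DecidableEq m] {f : m → ℂ⸨X⸩} {g : m → ℂ} (h : ∀ i, Red (f i) (g i)) :
    MRed (Matrix.diagonal f) (Matrix.diagonal g) := by
  intro k l
  rw [Matrix.diagonal_apply, Matrix.diagonal_apply]
  exact (h k).ite Red.zero

lemma one [DecidableEq m] : MRed (1 : Matrix m m ℂ⸨X⸩) 1 := diagonal fun _ => Red.one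

lemma kronecker {m' : Type*} {A' : Matrix m' m' ℂ⸨X⸩} {a' : Matrix m' m' ℂ} (h : MRed A a)
    (h' : MRed A' a') : MRed (A ⊗ₖ A') (a ⊗ₖ a') := fun i j => (h i.1 j.1).mul (h' i.2 j.2)

/-- A nonzero matrix of Laurent series has a multiple with nonzero reduction. -/
lemma exists_smul [Fintype m] (hA : A ≠ 0) : ∃ c : ℂ⸨X⸩, ∃ a : Matrix m m ℂ,
    a ≠ 0 ∧ MRed (c • A) a := by
  -- For integral entries: divide by `h` as long as the constant terms all vanish. An entry with
  -- nonzero `k`-th coefficient bounds the number of divisions. Denominators are cleared afterwards.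
  have key : ∀ (k : ℕ) (N : Matrix m m ℂ⟦X⟧), (∃ i j, PowerSeries.coeff k (N i j) ≠ 0) →
      ∃ c : ℂ⸨X⸩, ∃ a : Matrix m m ℂ, a ≠ 0 ∧ MRed (c • N.map (algebraMap ℂ⟦X⟧ ℂ⸨X⸩)) a := by
    intro k
    induction k with
    | zero =>
      rintro N ⟨i, j, h⟩
      refine ⟨1, N.map PowerSeries.constantCoeff, fun e => h ?_, fun i j => ?_⟩
      · have := congrFun (congrFun e i) j
        rw [PowerSeries.coeff_zero_eq_constantCoeff_apply]
        exact this
      · rw [one_smul]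
        exact Red.algebraMap _
    | succ k ih =>
      rintro N ⟨i, j, h⟩
      by_cases h0 : N.map PowerSeries.constantCoeff = 0
      · have h1 : ∀ i j, PowerSeries.X ∣ N i j := fun i j =>
          PowerSeries.X_dvd_iff.mpr (congrFun (congrFun h0 i) j)
        choose N' hN' using h1
        obtain ⟨c, a, ha, hc⟩ := ih (Matrix.of N') ⟨i, j, by
          rw [hN' i j, PowerSeries.coeff_succ_X_mul] at h
          exact h⟩
        refine ⟨c * hvar⁻¹, a, ha, fun i j => ?_⟩
        have := hc i j
        simp only [Matrix.smul_apply, Matrix.map_apply, Matrix.of_apply, smul_eq_mul] at this ⊢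
        rw [hN' i j, map_mul, mul_assoc]
        change Red (c * (hvar⁻¹ * (hvar * _))) _
        rwa [inv_mul_cancel_left₀ hvar_ne_zero]
      · exact ⟨1, _, h0, fun i j => by rw [one_smul]; exact Red.algebraMap _⟩
  obtain ⟨d, hd⟩ := IsLocalization.exist_integer_multiples_of_finite (nonZeroDivisors ℂ⟦X⟧)
    (fun p : m × m => A p.1 p.2)
  choose N hN using hd
  have hd0 : algebraMap ℂ⟦X⟧ ℂ⸨X⸩ d ≠ 0 := by
    rw [Ne, map_eq_zero_iff _ algebraMap_laurent_injective]
    exact nonZeroDivisors.ne_zero d.2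
  have hNA : (Matrix.of fun i j => N (i, j)).map (algebraMap ℂ⟦X⟧ ℂ⸨X⸩)
      = (algebraMap ℂ⟦X⟧ ℂ⸨X⸩ d) • A := by
    refine Matrix.ext fun i j => ?_
    rw [Matrix.map_apply, Matrix.of_apply, hN, Matrix.smul_apply, Algebra.smul_def]
    rfl
  have hne : ∃ i j, A i j ≠ 0 := by
    by_contra! h
    exact hA (Matrix.ext h)
  obtain ⟨i, j, hij⟩ := hne
  have hNij : N (i, j) ≠ 0 := by
    intro e
    have := congrFun (congrFun hNA i) j
    rw [Matrix.map_apply, Matrix.of_apply, e, map_zero, Matrix.smul_apply, smul_eq_mul] at this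
    exact mul_ne_zero hd0 hij this.symm
  obtain ⟨k, hk⟩ : ∃ k, PowerSeries.coeff k (N (i, j)) ≠ 0 := by
    by_contra! h
    exact hNij (PowerSeries.ext h)
  obtain ⟨c, a, ha, hc⟩ := key k (Matrix.of fun i j => N (i, j)) ⟨i, j, hk⟩
  rw [hNA, smul_smul] at hc
  exact ⟨_, a, ha, hc⟩

end MRed

end Reduction

/-! ### The classical limit of the generators and of `K(x)` at points of order `h⁻¹`. -/

section ClassicalLimit

variable {n : ℕ}

/-- The classical limit of a generator of the coideal subalgebra. -/
def fmat (a b : Fin (2 * n)) : Mat n ℂ :=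
  Xmat a b + Xmat b a
    + Complex.I • (single a a 1 + single b.rev b.rev 1 - (single b b 1 + single a.rev a.rev 1))

lemma smul_Qmat_eq {F : Type*} [Field F] {I s e : F} {a b : Fin (2 * n)} (h : Quad a b)
    (he : e * (s ^ 2 - 1) = I * s) (he' : e * (s⁻¹ ^ 2 - 1) = -I * s⁻¹) (c t : F) :
    c • Qmat s e t a b = (c * (s * t)) • Xmat a b
      + (c * (s⁻¹ * t⁻¹)) • Xmat b a + ((c * (I * s)) • (single a a 1 + single b.rev b.rev 1)
        - (c * (I * s⁻¹)) • (single b b 1 + single a.rev a.rev 1)) := by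
  rw [Qmat_eq h, he, he', Xmat, Xmat]
  module

lemma smul_copQ_eq {F : Type*} [Field F] (s e t u c : F) (a b : Fin (2 * n)) :
    c • copQ s e t u a b = (c • Qmat s e t a b) ⊗ₖ (1 : Mat n F)
      + (Matrix.diagonal fun k => s ^ (2 * Hval a b k)) ⊗ₖ (c • Qmat s e u a b) := by
  rw [copQ, smul_add, Matrix.smul_kronecker, Matrix.kronecker_smul]

lemma smul_mul_eq_mul_smul {F m : Type*} [Field F] [Fintype m] {K Q Q' : Matrix m m F}
    (h : K * Q = Q' * K) (c : F) : (c • K) * Q = Q' * (c • K) := by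
  rw [Matrix.smul_mul, h, Matrix.mul_smul]

lemma smul_mul_smul_comm_of_eq {F m : Type*} [Field F] [Fintype m] {K Q Q' : Matrix m m F}
    (h : K * Q = Q' * K) (c d : F) : (c • K) * (d • Q) = (d • Q') * (c • K) := by
  rw [Matrix.mul_smul, smul_mul_eq_mul_smul h, Matrix.smul_mul]

lemma mred_Xmat (a b : Fin (2 * n)) : MRed (Xmat a b : Mat n ℂ⸨X⸩) (Xmat a b) :=
  (MRed.single _ _).sub (MRed.single _ _)

lemma mred_smul_Qmat {a b : Fin (2 * n)} (h : Quad a b) {c t : ℂ⸨X⸩} {p q r : ℂ}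
    (hp : Red (c * (s * t)) p) (hq : Red (c * (s⁻¹ * t⁻¹)) q) (hc : Red c r) :
    MRed (c • Qmat s epsPlus t a b) (p • Xmat a b + q • Xmat b a
      + (r * Complex.I) • (single a a 1 + single b.rev b.rev 1
        - (single b b 1 + single a.rev a.rev 1))) := by
  have e : c • Qmat s epsPlus t a b = (c * (s * t)) • Xmat a b
      + (c * (s⁻¹ * t⁻¹)) • Xmat b a + ((c * (I * s)) • (single a a 1 + single b.rev b.rev 1)
        - (c * (I * s⁻¹)) • (single b b 1 + single a.rev a.rev 1)) := by
    exact smul_Qmat_eq h epsPlus_mul epsPlus_mul' c t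
  rw [e, smul_sub]
  have h1 : Red (c * (I * s)) (r * Complex.I) := by
    simpa using hc.mul (red_I.mul red_s)
  have h2 : Red (c * (I * s⁻¹)) (r * Complex.I) := by
    simpa using hc.mul (red_I.mul (red_s.inv one_ne_zero))
  exact (((mred_Xmat a b).smul hp).add ((mred_Xmat b a).smul hq)).add
    ((((MRed.single _ _).add (MRed.single _ _)).smul h1).sub
      (((MRed.single _ _).add (MRed.single _ _)).smul h2))

lemma mred_Qmat_one {a b : Fin (2 * n)} (h : Quad a b) :
    MRed (Qmat s epsPlus 1 a b) (fmat a b) := by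
  have := mred_smul_Qmat h (c := 1) (t := 1) (p := 1) (q := 1) (r := 1)
    (by simpa using red_s) (by simpa using red_s.inv one_ne_zero) Red.one
  simpa only [one_smul, one_mul, fmat] using this

lemma mred_smul_Qmat_zero {a b : Fin (2 * n)} (h : Quad a b) {c t : ℂ⸨X⸩} {p q : ℂ}
    (hp : Red (c * (s * t)) p) (hq : Red (c * (s⁻¹ * t⁻¹)) q) (hc : Red c 0) :
    MRed (c • Qmat s epsPlus t a b) (p • Xmat a b + q • Xmat b a) := by
  simpa using mred_smul_Qmat h hp hq hc

lemma mred_smul_copQ {a b : Fin (2 * n)} {c t u : ℂ⸨X⸩} {A B : Mat n ℂ}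
    (ht : MRed (c • Qmat s epsPlus t a b) A) (hu : MRed (c • Qmat s epsPlus u a b) B) :
    MRed (c • copQ s epsPlus t u a b) (A ⊗ₖ (1 : Mat n ℂ) + (1 : Mat n ℂ) ⊗ₖ B) := by
  have e : c • copQ s epsPlus t u a b = (c • Qmat s epsPlus t a b) ⊗ₖ (1 : Mat n ℂ⸨X⸩)
      + (Matrix.diagonal fun k => s ^ (2 * Hval a b k)) ⊗ₖ (c • Qmat s epsPlus u a b) := by
    exact smul_copQ_eq _ _ _ _ _ _ _
  have hD : MRed (Matrix.diagonal fun k => s ^ (2 * Hval a b k) : Mat n ℂ⸨X⸩) 1 := by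
    rw [← Matrix.diagonal_one]
    exact MRed.diagonal fun k => red_s_zpow _
  rw [e]
  exact (ht.kronecker MRed.one).add (hD.kronecker hu)

lemma red_etaval : Red (etaval n s) ((-1) ^ n) := by
  simpa [etaval] using (Red.one.neg.pow n).mul (red_s_zpow (2 * (1 - (n : ℤ))))

/-- The leading coefficient of `-K(x)` at `x = ∞`, in the classical limit. -/
def psi (n : ℕ) : Mat n ℂ := Matrix.of fun a b =>
  wvec Complex.I a * wvec Complex.I b * kap (-1) (-1 / 2) 0 a b
    + if a = b then -((-1) ^ n * kap (-1) (-1 / 2) 0 a a) else 0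

/-- At `x = h⁻¹` the products of `h` with `k₁`, `k₂`, `k₀` tend to `-1`, `0`, `-1/2`, the constant
`c` is suppressed by `h`, and all powers of `q` tend to `1`. -/
lemma mred_smul_Kmat : MRed (hvar • Kmat n I s hvar⁻¹) (psi n) := by
  have h0 := hvar_ne_zero
  have hσ : Red ((-1 : ℂ⸨X⸩) ^ n) ((-1) ^ n) := Red.one.neg.pow n
  have h1 : Red (hvar * k1fun n s hvar⁻¹) (-1) := by
    have e : hvar * k1fun n s hvar⁻¹ = s ^ ((n : ℤ) - 2) * (hvar - 1) := by
      rw [k1fun]; field_simp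
    rw [e]
    simpa using (red_s_zpow ((n : ℤ) - 2)).mul (red_hvar.sub Red.one)
  have h2 : Red (hvar * k2fun n s hvar⁻¹) 0 := by
    rw [k2fun, inv_inv]
    simpa using red_hvar.mul ((hσ.mul (red_s_zpow (-(n : ℤ)))).mul (Red.one.sub red_hvar))
  have h3 : Red (hvar * k0fun n s hvar⁻¹) (-1 / 2) := by
    have e : hvar * k0fun n s hvar⁻¹ = (hvar * k1fun n s hvar⁻¹
        + s ^ 2 * (hvar * k2fun n s hvar⁻¹)) * (s ^ 2 + 1)⁻¹ := by
      rw [k0fun]; ring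
    rw [e]
    have := (h1.add ((red_s.pow 2).mul h2)).mul (((red_s.pow 2).add Red.one).inv (by norm_num))
    convert this using 1
    norm_num
  have hk : ∀ a b : Fin (2 * n), Red (hvar * kap (k1fun n s hvar⁻¹) (k0fun n s hvar⁻¹)
      (k2fun n s hvar⁻¹) a b) (kap (-1) (-1 / 2) 0 a b) := by
    intro a b
    unfold kap
    split_ifs <;> assumption
  have hw : ∀ a : Fin (2 * n), Red (wvec I a) (wvec Complex.I a) := fun a =>
    red_I.zpow Complex.I_ne_zero _
  have hv : ∀ a : Fin (2 * n), Red (vvec I s a) (wvec Complex.I a) := fun a => by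
    simpa [vvec, wvec] using (hw a).mul (red_s_zpow (twicePrime a - 2 * (n : ℤ)))
  have hcc : Red (hvar * cconst n s) 0 := by
    rw [cconst]
    simpa using red_hvar.mul ((hσ.mul (red_s_zpow ((n : ℤ) - 1))).add (red_s_zpow (1 - (n : ℤ))))
  intro a b
  rw [Matrix.smul_apply, smul_eq_mul, Kmat_apply (I_ne_zero I_sq) s_ne_zero s_sq_add_one_ne_zero,
    psi, Matrix.of_apply, mul_add, mul_ite, mul_zero]
  refine Red.add ?_ (Red.ite ?_ Red.zero)
  · rw [mul_left_comm]
    exact ((hw a).mul (hv b)).mul (hk a b)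
  · rw [mul_sub, mul_left_comm]
    simpa using hcc.sub ((hσ.mul red_s).mul (hk a a))

/-- The reduction of the intertwining property of `K(h⁻¹)`; no computation with the entries of `ψ`
is needed. -/
lemma psi_mul_fmat (hn : 3 ≤ n) {j : Fin (n + 1)} (hj : j.val ≠ 0) :
    psi n * fmat (nodeA hn j) (nodeB hn j) = fmat (nodeA hn j) (nodeB hn j) * psi n := by
  have h := Kmat_mul_Qmat hn I_sq s_ne_zero s_sq_add_one_ne_zero
    (inv_ne_zero hvar_ne_zero) epsPlus_mul epsPlus_mul' j
  rw [nodeParam, nodeParam, if_neg hj, if_neg hj] at h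
  have hQ := mred_Qmat_one (node_quad hn j)
  refine (mred_smul_Kmat.mul hQ).unique ?_
  have e : hvar • Kmat n I s hvar⁻¹ * Qmat s epsPlus 1 (nodeA hn j) (nodeB hn j)
      = Qmat s epsPlus 1 (nodeA hn j) (nodeB hn j) * hvar • Kmat n I s hvar⁻¹ :=
    smul_mul_eq_mul_smul h hvar
  rw [e]
  exact hQ.mul mred_smul_Kmat

/-- For `x = z/h` the parameter `ηx` has a pole and `η/x` a zero. After multiplication by `h` the
generator of the affine node retains only `x_0^+` in the source and only `x_0^-` in the target, each
with the factor `(-1)^n z`. -/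
lemma red_hvar_mul_etaval {z : ℂ} (hz : z ≠ 0) {j : Fin (n + 1)} (hj : j.val = 0) :
    Red (hvar * (s * nodeParam (etaval n s * (algebraMap ℂ⟦X⟧ ℂ⸨X⸩ (PowerSeries.C z) * hvar⁻¹)) j))
        ((-1) ^ n * z) ∧
    Red (hvar * (s⁻¹ * (nodeParam (etaval n s * (algebraMap ℂ⟦X⟧ ℂ⸨X⸩ (PowerSeries.C z)
      * hvar⁻¹)) j)⁻¹)) 0 ∧
    Red (hvar * (s * nodeParam (etaval n s / (algebraMap ℂ⟦X⟧ ℂ⸨X⸩ (PowerSeries.C z) * hvar⁻¹)) j))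
        0 ∧
    Red (hvar * (s⁻¹ * (nodeParam (etaval n s / (algebraMap ℂ⟦X⟧ ℂ⸨X⸩ (PowerSeries.C z)
      * hvar⁻¹)) j)⁻¹)) ((-1) ^ n * z) := by
  have h0 := hvar_ne_zero
  have hC : Red (algebraMap ℂ⟦X⟧ ℂ⸨X⸩ (PowerSeries.C z)) z := by
    simpa using Red.algebraMap (PowerSeries.C z)
  set C := algebraMap ℂ⟦X⟧ ℂ⸨X⸩ (PowerSeries.C z)
  have hσ0 : ((-1 : ℂ) ^ n) ≠ 0 := pow_ne_zero _ (by norm_num)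
  have hCi := hC.inv hz
  have hη := red_etaval (n := n)
  have hηi := hη.inv hσ0
  have hs := red_s
  have hsi := red_s.inv one_ne_zero
  have hC0 : C ≠ 0 := hC.ne_zero hz
  have hη0 : etaval n s ≠ 0 := hη.ne_zero hσ0
  have hs0 := s_ne_zero
  simp only [nodeParam, hj, if_true]
  refine ⟨?_, ?_, ?_, ?_⟩
  · rw [show hvar * (s * (etaval n s * (C * hvar⁻¹))) = s * (etaval n s * C) by field_simp]
    simpa using hs.mul (hη.mul hC)
  · rw [show hvar * (s⁻¹ * (etaval n s * (C * hvar⁻¹))⁻¹)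
      = hvar ^ 2 * (s⁻¹ * ((etaval n s)⁻¹ * C⁻¹))
      by field_simp]
    simpa using (red_hvar.pow 2).mul (hsi.mul (hηi.mul hCi))
  · rw [show hvar * (s * (etaval n s / (C * hvar⁻¹))) = hvar ^ 2 * (s * (etaval n s * C⁻¹))
      by field_simp]
    simpa using (red_hvar.pow 2).mul (hs.mul (hη.mul hCi))
  · rw [show hvar * (s⁻¹ * (etaval n s / (C * hvar⁻¹))⁻¹)
      = s⁻¹ * ((etaval n s)⁻¹ * C) by field_simp]
    have := hsi.mul (hηi.mul hC)
    rwa [inv_one, one_mul, ← inv_pow, inv_neg_one] at this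

lemma psi_mul_Xmat (hn : 3 ≤ n) {j : Fin (n + 1)} (hj : j.val = 0) :
    psi n * Xmat (nodeA hn j) (nodeB hn j) = Xmat (nodeB hn j) (nodeA hn j) * psi n := by
  have h := Kmat_mul_Qmat hn I_sq s_ne_zero s_sq_add_one_ne_zero
    (inv_ne_zero hvar_ne_zero) epsPlus_mul epsPlus_mul' j
  obtain ⟨h1, h2, h3, h4⟩ := red_hvar_mul_etaval (n := n) one_ne_zero hj
  rw [map_one, map_one, one_mul] at h1 h2 h3 h4
  have hQ := mred_smul_Qmat_zero (node_quad hn j) h1 h2 red_hvar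
  have hQ' := mred_smul_Qmat_zero (node_quad hn j) h3 h4 red_hvar
  have e := mred_smul_Kmat.mul hQ
  have e' : hvar • Kmat n I s hvar⁻¹ * hvar • Qmat s epsPlus _ _ _
      = hvar • Qmat s epsPlus _ _ _ * hvar • Kmat n I s hvar⁻¹ :=
    smul_mul_smul_comm_of_eq h hvar hvar
  rw [e'] at e
  have := e.unique (hQ'.mul mred_smul_Kmat)
  rw [zero_smul, zero_smul, add_zero, zero_add, Matrix.mul_smul, Matrix.smul_mul, mul_one] at this
  exact smul_right_injective _ (pow_ne_zero n (by norm_num : (-1 : ℂ) ≠ 0)) this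

lemma psi_ne_zero {a b : Fin (2 * n)} (hab : a ≠ b) (h : num a + num b ≤ 2 * n) :
    psi n a b ≠ 0 := by
  rw [psi, Matrix.of_apply, if_neg hab, kap_low _ _ _ h, add_zero]
  have := zpow_ne_zero (-under a) Complex.I_ne_zero
  have := zpow_ne_zero (-under b) Complex.I_ne_zero
  simp_all [wvec]

/-- The limit of `h k₂` is zero, so `ψ` vanishes below the antidiagonal; with its columns reversed
it is triangular with nonzero diagonal. -/
lemma det_psi_ne_zero : (psi n).det ≠ 0 := by
  have h1 : ((psi n).submatrix id Fin.revPerm).det ≠ 0 := by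
    rw [Matrix.det_of_isUpperTriangular]
    · rw [Finset.prod_ne_zero_iff]
      intro a _
      rw [Matrix.submatrix_apply, id, Fin.revPerm_apply, psi, Matrix.of_apply, kap_mid,
        if_neg (ne_rev a), add_zero]
      have := zpow_ne_zero (-under a) Complex.I_ne_zero
      have := zpow_ne_zero (-under a.rev) Complex.I_ne_zero
      simp_all [wvec]
    · intro a b hab
      have h2 : 2 * n + 2 ≤ num a + num b.rev := by
        have := b.isLt
        have : b.val < a.val := hab
        rw [num_rev]
        simp only [num]
        omega
      rw [Matrix.submatrix_apply, id, Fin.revPerm_apply, psi, Matrix.of_apply, kap_high _ _ _ h2]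
      by_cases e : a = b.rev
      · rw [if_pos e, kap_high _ _ _ (by rw [← e] at h2; exact h2)]
        simp
      · rw [if_neg e]
        simp
  rw [Matrix.det_permute'] at h1
  exact right_ne_zero_of_mul h1

end ClassicalLimit

/-! ## The commutant of the classical limit -/

section Commutant

variable {n : ℕ}

/-- `γ X ⊗ 1 + δ 1 ⊗ X`. -/
def twist (γ δ : ℂ) (X : Mat n ℂ) : Mat₂ n ℂ :=
  γ • (X ⊗ₖ (1 : Mat n ℂ)) + δ • ((1 : Mat n ℂ) ⊗ₖ X)

lemma twist_add (γ δ : ℂ) (X Y : Mat n ℂ) : twist γ δ (X + Y) = twist γ δ X + twist γ δ Y := by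
  rw [twist, Matrix.add_kronecker, Matrix.kronecker_add, twist, twist]
  module

lemma twist_smul (γ δ c : ℂ) (X : Mat n ℂ) : twist γ δ (c • X) = c • twist γ δ X := by
  rw [twist, Matrix.smul_kronecker, Matrix.kronecker_smul, twist]
  module

lemma twist_mul_twist (γ δ γ' δ' : ℂ) (X Y : Mat n ℂ) :
    twist γ δ X * twist γ' δ' Y
      = twist (γ * γ') (δ * δ') (X * Y) + (γ * δ') • (X ⊗ₖ Y) + (δ * γ') • (Y ⊗ₖ X) := by
  simp only [twist, add_mul, mul_add, Matrix.smul_mul, Matrix.mul_smul, ← Matrix.mul_kronecker_mul,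
    Matrix.one_mul, Matrix.mul_one]
  module

/-- `C` commutes with `γ X ⊗ 1 + δ 1 ⊗ X`. -/
def TwistComm (C : Mat₂ n ℂ) (γ δ : ℂ) (X : Mat n ℂ) : Prop := Commute C (twist γ δ X)

namespace TwistComm

variable {C : Mat₂ n ℂ} {γ δ γ' δ' : ℂ} {X Y : Mat n ℂ}

lemma add (h : TwistComm C γ δ X) (h' : TwistComm C γ δ Y) : TwistComm C γ δ (X + Y) := by
  rw [TwistComm, twist_add]
  exact h.add_right h'

lemma smul (h : TwistComm C γ δ X) (c : ℂ) : TwistComm C γ δ (c • X) := by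
  rw [TwistComm, twist_smul]
  exact h.smul_right c

lemma neg (h : TwistComm C γ δ X) : TwistComm C γ δ (-X) := by
  simpa using h.smul (-1)

lemma sub (h : TwistComm C γ δ X) (h' : TwistComm C γ δ Y) : TwistComm C γ δ (X - Y) := by
  rw [sub_eq_add_neg]
  exact h.add h'.neg

/-- The mixed terms `X ⊗ Y` and `Y ⊗ X` cancel in the commutator, leaving the bracket with
multiplied weights. -/
lemma bracket (h : TwistComm C γ δ X) (h' : TwistComm C γ' δ' Y) :
    TwistComm C (γ * γ') (δ * δ') (X * Y - Y * X) := by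
  have e : twist (γ * γ') (δ * δ') (X * Y - Y * X)
      = twist γ δ X * twist γ' δ' Y - twist γ' δ' Y * twist γ δ X := by
    rw [twist_mul_twist, twist_mul_twist, sub_eq_add_neg (X * Y), ← neg_one_smul ℂ (Y * X),
      twist_add, twist_smul, mul_comm γ' γ, mul_comm δ' δ]
    module
  rw [TwistComm, e]
  exact (Commute.mul_right h h').sub_right (Commute.mul_right h' h)

lemma mul (h0 : γ * δ = 0) (h1 : γ * γ = γ) (h2 : δ * δ = δ) (h : TwistComm C γ δ X)
    (h' : TwistComm C γ δ Y) : TwistComm C γ δ (X * Y) := by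
  have e : twist γ δ (X * Y) = twist γ δ X * twist γ δ Y := by
    rw [twist_mul_twist, mul_comm δ γ, h0, h1, h2]
    module
  rw [TwistComm, e]
  exact Commute.mul_right h h'

/-- The vectors `(γ, δ)` and `(γ², δ²)` are linearly independent (Vandermonde), so their
combinations isolate `X ⊗ 1` and `1 ⊗ X`. -/
lemma of_sq (hγ : γ ≠ 0) (hδ : δ ≠ 0) (hγδ : γ ≠ δ) (h : TwistComm C γ δ X)
    (h' : TwistComm C (γ * γ) (δ * δ) X) : TwistComm C 1 0 X ∧ TwistComm C 0 1 X := by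
  have hs : γ - δ ≠ 0 := sub_ne_zero.mpr hγδ
  constructor
  · have e : twist 1 0 X = (γ * (γ - δ))⁻¹ • (twist (γ * γ) (δ * δ) X - δ • twist γ δ X) := by
      unfold twist
      match_scalars <;> field_simp <;> ring
    rw [TwistComm, e]
    exact (Commute.sub_right h' (Commute.smul_right h δ)).smul_right _
  · have e : twist 0 1 X = (δ * (γ - δ))⁻¹ • (γ • twist γ δ X - twist (γ * γ) (δ * δ) X) := by
      unfold twist
      match_scalars <;> field_simp <;> ring
    rw [TwistComm, e]
    exact (Commute.sub_right (Commute.smul_right h γ) h').smul_right _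

end TwistComm

/-- Bracketing with `f = fmat a b` moves `X_{ac}` to `X_{bc}` and back, up to a multiple of the
starting matrix. Hence commutation with one twisted matrix passes to the other along a node;
`fmat_bracket_single` serves the matrix units in the same way. -/
lemma fmat_bracket {a b c : Fin (2 * n)} (h : Quad a b) (h1 : Quad a c) (h2 : Quad b c) :
    fmat a b * Xmat b c - Xmat b c * fmat a b = Xmat a c - Complex.I • Xmat b c ∧
    fmat a b * Xmat a c - Xmat a c * fmat a b = Xmat b c + Complex.I • Xmat a c ∧
    fmat a b * Xmat a.rev c - Xmat a.rev c * fmat a b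
      = -Xmat b.rev c - Complex.I • Xmat a.rev c ∧
    fmat a b * Xmat b.rev c - Xmat b.rev c * fmat a b
      = -Xmat a.rev c + Complex.I • Xmat b.rev c := by
  have := h.ne; have := h.ner; have := h.symm.ne; have := h.symm.ner
  have := h1.ne; have := h1.ner; have := h1.symm.ne; have := h1.symm.ner
  have := h2.ne; have := h2.ner; have := h2.symm.ne; have := h2.symm.ner
  refine ⟨?_, ?_, ?_, ?_⟩ <;>
    simp [fmat, Xmat, mul_add, add_mul, mul_sub, sub_mul,
      Fin.rev_eq_iff, ne_rev, -Matrix.smul_single, *] <;> module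

lemma fmat_bracket_single {a b c : Fin (2 * n)} (h : Quad a b) (h1 : Quad a c) (h2 : Quad b c) :
    fmat a b * single b c 1 - single b c 1 * fmat a b = single a c 1 - Complex.I • single b c 1 ∧
    fmat a b * single a c 1 - single a c 1 * fmat a b = single b c 1 + Complex.I • single a c 1 ∧
    fmat a b * single a.rev c 1 - single a.rev c 1 * fmat a b
      = -single b.rev c 1 - Complex.I • single a.rev c 1 ∧
    fmat a b * single b.rev c 1 - single b.rev c 1 * fmat a b
      = -single a.rev c 1 + Complex.I • single b.rev c 1 := by
  have := h.ne; have := h.ner; have := h.symm.ne; have := h.symm.ner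
  have := h1.ne; have := h1.ner; have := h1.symm.ne; have := h1.symm.ner
  have := h2.ne; have := h2.ner; have := h2.symm.ne; have := h2.symm.ner
  refine ⟨?_, ?_, ?_, ?_⟩ <;>
    simp [fmat, Xmat, mul_add, add_mul, mul_sub, sub_mul,
      Fin.rev_eq_iff, ne_rev, -Matrix.smul_single, *] <;> module

/-- The nodes `2, …, n - 1` connect the indices within each half, and node `n` joins the halves. The
first and the last index are out of reach: they occur only at the nodes `0` and `1`. -/
lemma node_chain (hn : 3 ≤ n) (P : Fin (2 * n) → Prop)
    (h : ∀ j : Fin (n + 1), 2 ≤ j.val → (P (nodeA hn j) ↔ P (nodeB hn j)) ∧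
      (P (nodeA hn j).rev ↔ P (nodeB hn j).rev)) {u v : Fin (2 * n)}
    (hu : u.val ≠ 0) (hu' : u.rev.val ≠ 0) (hv : v.val ≠ 0) (hv' : v.rev.val ≠ 0) :
    P u ↔ P v := by
  have key : ∀ k (hk : k < n), 1 ≤ k →
      (P ⟨k, by omega⟩ ↔ P ⟨1, by omega⟩) ∧
        (P (Fin.rev ⟨k, by omega⟩) ↔ P (Fin.rev ⟨1, by omega⟩)) := by
    intro k hk h1
    induction k, h1 using Nat.le_induction with
    | base => simp
    | succ k h1 ih =>
      have hj := h ⟨k + 1, by omega⟩ (by simp; omega)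
      have eA : nodeA hn ⟨k + 1, by omega⟩ = ⟨k, by omega⟩ := by
        rw [nodeA, Fin.mk.injEq, if_neg (by simp), if_neg (by simp; omega)]; simp
      have eB : nodeB hn ⟨k + 1, by omega⟩ = ⟨k + 1, by omega⟩ := by
        rw [nodeB, Fin.mk.injEq, if_neg (by simp), if_neg (by simp; omega)]
      rw [eA, eB] at hj
      have := ih (by omega)
      tauto
  have hlast : P ⟨1, by omega⟩ ↔ P (Fin.rev ⟨1, by omega⟩) := by
    have hj := (h ⟨n, by omega⟩ (by simp; omega)).1
    have eA : nodeA hn ⟨n, by omega⟩ = ⟨n - 2, by omega⟩ := by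
      rw [nodeA, Fin.mk.injEq, if_neg (by simp; omega), if_pos rfl]
    have eB : nodeB hn ⟨n, by omega⟩ = Fin.rev ⟨n - 1, by omega⟩ := by
      simp [nodeB, Fin.ext_iff, Fin.val_rev]; split_ifs <;> omega
    rw [eA, eB] at hj
    have h1 := (key (n - 2) (by omega) (by omega)).1
    have h2 := (key (n - 1) (by omega) (by omega)).2
    tauto
  have all : ∀ w : Fin (2 * n), w.val ≠ 0 → w.rev.val ≠ 0 → (P w ↔ P ⟨1, by omega⟩) := by
    intro w hw hw'
    by_cases hwn : w.val < n
    · exact (key w.val hwn (by omega)).1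
    · rw [Fin.val_rev] at hw'
      have := (key w.rev.val (by rw [Fin.val_rev]; omega) (by rw [Fin.val_rev]; omega)).2
      rw [Fin.eta, Fin.rev_rev] at this
      exact this.trans hlast.symm
  exact (all u hu hu').trans (all v hv hv').symm

lemma TwistComm.chain_step {C : Mat₂ n ℂ} {γ δ : ℂ} {f X Y : Mat n ℂ} {c d : ℂ} (hd : d ≠ 0)
    (hf : TwistComm C 1 1 f) (hX : TwistComm C γ δ X) (h : f * X - X * f = d • Y + c • X) :
    TwistComm C γ δ Y := by
  have h1 := hf.bracket hX
  rw [one_mul, one_mul, h] at h1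
  have h2 := (h1.sub (hX.smul c)).smul d⁻¹
  rwa [add_sub_cancel_right, smul_smul, inv_mul_cancel₀ hd, one_smul] at h2

lemma twistComm_Xmat_iff {C : Mat₂ n ℂ} {γ δ : ℂ} {a b c : Fin (2 * n)} (h : Quad a b)
    (h1 : Quad a c) (h2 : Quad b c) (hf : TwistComm C 1 1 (fmat a b)) :
    (TwistComm C γ δ (Xmat a c) ↔ TwistComm C γ δ (Xmat b c)) ∧
    (TwistComm C γ δ (Xmat a.rev c) ↔ TwistComm C γ δ (Xmat b.rev c)) := by
  obtain ⟨e1, e2, e3, e4⟩ := fmat_bracket h h1 h2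
  have n1 : (-1 : ℂ) ≠ 0 := by norm_num
  refine ⟨⟨fun hX => hf.chain_step one_ne_zero hX (c := Complex.I) ?_,
    fun hX => hf.chain_step one_ne_zero hX (c := -Complex.I) ?_⟩,
    ⟨fun hX => hf.chain_step n1 hX (c := -Complex.I) ?_,
    fun hX => hf.chain_step n1 hX (c := Complex.I) ?_⟩⟩
  · rw [e2]; module
  · rw [e1]; module
  · rw [e3]; module
  · rw [e4]; module

lemma twistComm_single_iff {C : Mat₂ n ℂ} {γ δ : ℂ} {a b c : Fin (2 * n)} (h : Quad a b)
    (h1 : Quad a c) (h2 : Quad b c) (hf : TwistComm C 1 1 (fmat a b)) :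
    (TwistComm C γ δ (single a c 1) ↔ TwistComm C γ δ (single b c 1)) ∧
    (TwistComm C γ δ (single a.rev c 1) ↔ TwistComm C γ δ (single b.rev c 1)) := by
  obtain ⟨e1, e2, e3, e4⟩ := fmat_bracket_single h h1 h2
  have n1 : (-1 : ℂ) ≠ 0 := by norm_num
  refine ⟨⟨fun hX => hf.chain_step one_ne_zero hX (c := Complex.I) ?_,
    fun hX => hf.chain_step one_ne_zero hX (c := -Complex.I) ?_⟩,
    ⟨fun hX => hf.chain_step n1 hX (c := -Complex.I) ?_,
    fun hX => hf.chain_step n1 hX (c := Complex.I) ?_⟩⟩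
  · rw [e2]; module
  · rw [e1]; module
  · rw [e3]; module
  · rw [e4]; module

/-! ### Matrix identities that generate the matrix units of the first column. -/

section Relations

variable {p r t : Fin (2 * n)}

lemma fmat_bracket_Xmat_swap (h : Quad p r) :
    fmat p r * Xmat r p - Xmat r p * fmat p r
      = (1 : ℂ) • (Xmat p p - Xmat r r) + (-2 * Complex.I) • Xmat r p := by
  have := h.ne; have := h.ner; have := h.symm.ne; have := h.symm.ner
  simp [fmat, Xmat, mul_add, add_mul, mul_sub, sub_mul,
    Fin.rev_eq_iff, ne_rev, -Matrix.smul_single, *] <;> module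

lemma fmat_bracket_single_swap (h : Quad p r) :
    fmat p r * single r p 1 - single r p 1 * fmat p r
      = (1 : ℂ) • (single p p 1 - single r r 1) + (-2 * Complex.I) • single r p 1 := by
  have := h.ne; have := h.ner; have := h.symm.ne; have := h.symm.ner
  simp [fmat, Xmat, mul_add, add_mul, mul_sub, sub_mul,
    Fin.rev_eq_iff, ne_rev, -Matrix.smul_single, *] <;> module

lemma cartan_bracket (h : Quad p r) (h1 : Quad p t) (h2 : Quad r t) :
    (Xmat p p - Xmat r r) * Xmat t p - Xmat t p * (Xmat p p - Xmat r r)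
      = -(Xmat t p : Mat n ℂ) := by
  have := h.ne; have := h.ner; have := h.symm.ne; have := h.symm.ner
  have := h1.ne; have := h1.ner; have := h1.symm.ne; have := h1.symm.ner
  have := h2.ne; have := h2.ner; have := h2.symm.ne; have := h2.symm.ner
  simp [Xmat, mul_sub, sub_mul,
    Fin.rev_eq_iff, ne_rev, -Matrix.smul_single, *]

lemma single_eq_cartan_mul (h : Quad p r) (h1 : Quad p t) (h2 : Quad r t) :
    single t p 1 = Xmat t p + (Xmat p p - Xmat r r) * (Xmat t p : Mat n ℂ) := by
  have := h.ne; have := h.ner; have := h.symm.ne; have := h.symm.ner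
  have := h1.ne; have := h1.ner; have := h1.symm.ne; have := h1.symm.ner
  have := h2.ne; have := h2.ner; have := h2.symm.ne; have := h2.symm.ner
  simp [Xmat, mul_sub, sub_mul,
    Fin.rev_eq_iff, ne_rev, -Matrix.smul_single, *]

lemma cartan_mul_single (h : Quad p r) :
    (single p p 1 : Mat n ℂ) = (1 / 2 : ℂ) • ((Xmat p p - Xmat r r) * (single p p 1 - single r r 1)
      + (single p p 1 - single r r 1)) := by
  have := h.ne; have := h.ner; have := h.symm.ne; have := h.symm.ner
  simp [Xmat, mul_sub, sub_mul,
    Fin.rev_eq_iff, ne_rev, -Matrix.smul_single, *] <;> module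

lemma single_rev_eq_mul (h1 : Quad p t) :
    (single p.rev p 1 : Mat n ℂ) = -(Xmat t p * Xmat t.rev p) := by
  have := h1.ne; have := h1.ner; have := h1.symm.ne; have := h1.symm.ner
  simp [Xmat, mul_sub, sub_mul,
    Fin.rev_eq_iff, ne_rev, -Matrix.smul_single, *]

end Relations

/-- The only endomorphisms that commute with the classical limit are the scalars. -/
lemma eq_smul_one_of_twistComm (hn : 3 ≤ n) {C : Mat₂ n ℂ} {α β : ℂ} (hα : α ≠ 0) (hβ : β ≠ 0)
    (hαβ : α ≠ β)
    (hf : ∀ j : Fin (n + 1), j.val ≠ 0 → TwistComm C 1 1 (fmat (nodeA hn j) (nodeB hn j)))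
    (h0 : TwistComm C α β (Xmat (nodeA hn 0) (nodeB hn 0))) : ∃ c : ℂ, C = c • 1 := by
  set p : Fin (2 * n) := ⟨0, by omega⟩ with hp
  set r : Fin (2 * n) := ⟨1, by omega⟩ with hr
  set t : Fin (2 * n) := ⟨2, by omega⟩ with ht
  have qu : ∀ {a b : Fin (2 * n)}, a.val ≠ b.val → a.val ≠ 2 * n - (b.val + 1) → Quad a b := by
    intro a b h h'
    refine ⟨fun e => h (by rw [e]), fun e => h' (by rw [e, Fin.val_rev])⟩
  have hpr : Quad p r := qu (by simp [hp, hr]) (by simp [hp, hr]; omega)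
  have hpt : Quad p t := qu (by simp [hp, ht]) (by simp [hp, ht]; omega)
  have hrt : Quad r t := qu (by simp [hr, ht]) (by simp [hr, ht]; omega)
  have hA1 : nodeA hn ⟨1, by omega⟩ = p := by
    simp [nodeA, hp]; omega
  have hB1 : nodeB hn ⟨1, by omega⟩ = r := by
    rw [nodeB, hr, Fin.mk.injEq, if_neg (by simp), if_neg (by simp; omega)]
  have hA0 : nodeA hn 0 = r.rev := by
    simp [nodeA, hr, Fin.ext_iff, Fin.val_rev]
  have hB0 : nodeB hn 0 = p := by
    rw [nodeB, hp, Fin.mk.injEq, if_pos (by simp)]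
  have hf1 : TwistComm C 1 1 (fmat p r) := by
    have := hf ⟨1, by omega⟩ (by simp)
    rwa [hA1, hB1] at this
  rw [hA0, hB0] at h0
  have hq : ∀ j : Fin (n + 1), 2 ≤ j.val → Quad (nodeA hn j) p ∧ Quad (nodeB hn j) p := by
    intro j hj
    have := node_val hn j
    have := j.isLt
    constructor <;> apply qu <;> simp only [hp] <;> omega
  have chainX : ∀ γ δ : ℂ, ∀ {u v : Fin (2 * n)}, u.val ≠ 0 → u.rev.val ≠ 0 → v.val ≠ 0 →
      v.rev.val ≠ 0 → (TwistComm C γ δ (Xmat u p) ↔ TwistComm C γ δ (Xmat v p)) := by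
    intro γ δ u v hu hu' hv hv'
    exact node_chain hn (fun w => TwistComm C γ δ (Xmat w p)) (fun j hj =>
      twistComm_Xmat_iff (node_quad hn j) (hq j hj).1 (hq j hj).2 (hf j (by omega))) hu hu' hv hv'
  have chainE : ∀ γ δ : ℂ, ∀ {u v : Fin (2 * n)}, u.val ≠ 0 → u.rev.val ≠ 0 → v.val ≠ 0 →
      v.rev.val ≠ 0 → (TwistComm C γ δ (single u p 1) ↔ TwistComm C γ δ (single v p 1)) := by
    intro γ δ u v hu hu' hv hv'
    exact node_chain hn (fun w => TwistComm C γ δ (single w p 1)) (fun j hj =>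
      twistComm_single_iff (node_quad hn j) (hq j hj).1 (hq j hj).2 (hf j (by omega))) hu hu' hv hv'
  have r1 : r.val ≠ 0 := by simp [hr]
  have r2 : r.rev.val ≠ 0 := by rw [Fin.val_rev]; simp [hr]; omega
  have t1 : t.val ≠ 0 := by simp [ht]
  have t2 : t.rev.val ≠ 0 := by rw [Fin.val_rev]; simp [ht]; omega
  have hH : ∀ γ δ : ℂ, TwistComm C γ δ (Xmat r p) → TwistComm C γ δ (Xmat p p - Xmat r r) :=
    fun γ δ hX => hf1.chain_step one_ne_zero hX (fmat_bracket_Xmat_swap hpr)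
  -- `π(x_0^+)` is `X_{r̄p}`, with the affine weights `(α, β)`; the finite nodes carry it to
  -- `X_{rp}` and `X_{tp}` without changing the weights.
  have hr0 : TwistComm C α β (Xmat r p) :=
    (chainX α β r2 (by rwa [Fin.rev_rev]) r1 r2).mp h0
  have ht0 : TwistComm C α β (Xmat t p) := (chainX α β r1 r2 t1 t2).mp hr0
  -- The Cartan element `H = X_{pp} - X_{rr}` also has weights `(α, β)`, and `[H, X_{tp}] =
  -- -X_{tp}`. So `X_{tp}` has the weights `(α², β²)` as well, and `α ≠ β` separates the tensor
  -- factors.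
  have hbr := (hH α β hr0).bracket ht0
  rw [cartan_bracket hpr hpt hrt] at hbr
  obtain ⟨hl, hrr⟩ := ht0.of_sq hα hβ hαβ (by simpa using hbr.neg)
  -- For the weights `(1, 0)` and `(0, 1)` commutation is stable under products too, which yields
  -- every matrix unit `E_{vp}`.
  have full : ∀ γ δ : ℂ, γ * δ = 0 → γ * γ = γ → δ * δ = δ → TwistComm C γ δ (Xmat t p) →
      ∀ v, TwistComm C γ δ (single v p 1) := by
    intro γ δ g0 g1 g2 hX v
    have hHH := hH γ δ ((chainX γ δ t1 t2 r1 r2).mp hX)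
    have hE : TwistComm C γ δ (single t p 1) := by
      rw [single_eq_cartan_mul hpr hpt hrt]
      exact hX.add (hHH.mul g0 g1 g2 hX)
    by_cases hv : v = p
    · rw [hv, cartan_mul_single hpr]
      have hd : TwistComm C γ δ (single p p 1 - single r r 1) :=
        hf1.chain_step one_ne_zero ((chainE γ δ t1 t2 r1 r2).mp hE) (fmat_bracket_single_swap hpr)
      exact ((hHH.mul g0 g1 g2 hd).add hd).smul _
    by_cases hv' : v = p.rev
    · rw [hv', single_rev_eq_mul hpt]
      exact (hX.mul g0 g1 g2 ((chainX γ δ t1 t2 t2 (by rwa [Fin.rev_rev])).mp hX)).neg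
    · refine (chainE γ δ t1 t2 ?_ ?_).mp hE
      · intro e
        exact hv (Fin.ext e)
      · intro e
        exact hv' (by rw [← Fin.rev_eq_iff]; exact Fin.ext e)
  have fl : ∀ v, Commute C ((single v p 1 : Mat n ℂ) ⊗ₖ (1 : Mat n ℂ)) := fun v => by
    simpa [TwistComm, twist] using full 1 0 (by simp) (by simp) (by simp) hl v
  have fr : ∀ v, Commute C ((1 : Mat n ℂ) ⊗ₖ (single v p 1 : Mat n ℂ)) := fun v => by
    simpa [TwistComm, twist] using full 0 1 (by simp) (by simp) (by simp) hrr v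
  refine ⟨C (p, p) (p, p), Matrix.ext fun i k => ?_⟩
  -- `C` commutes with the matrix unit from `e_p ⊗ e_p` to any basis vector; the entries in the
  -- column `(p, p)` then show that `C` is scalar.
  have hc := ((fl k.1).mul_right (fr k.2)).eq
  rw [← Matrix.mul_kronecker_mul, mul_one, one_mul, Matrix.single_kronecker_single, mul_one] at hc
  have := congrFun (congrFun hc i) (p, p)
  rw [Matrix.mul_single_apply_same, mul_one] at this
  rw [this, Matrix.smul_apply, smul_eq_mul, Matrix.one_apply]
  by_cases hik : i = k
  · subst hik
    rw [Matrix.single_mul_apply_same, if_pos rfl, one_mul, mul_one]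
  · rw [Matrix.single_mul_apply_of_ne _ _ _ _ _ hik, if_neg hik, mul_zero]

end Commutant

/-! ## The reflection equation -/

section ClassicalReflection

variable {n : ℕ}

/-- The Laurent series `α h⁻¹`. -/
def pole (α : ℂ) : ℂ⸨X⸩ := algebraMap ℂ⟦X⟧ ℂ⸨X⸩ (PowerSeries.C α) * hvar⁻¹

lemma pole_ne_zero {α : ℂ} (hα : α ≠ 0) : pole α ≠ 0 := by
  refine mul_ne_zero ?_ (inv_ne_zero hvar_ne_zero)
  have : Red (algebraMap ℂ⟦X⟧ ℂ⸨X⸩ (PowerSeries.C α)) α := by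
    simpa using Red.algebraMap (PowerSeries.C α)
  exact this.ne_zero hα

lemma pole_injective : Function.Injective pole := by
  intro α β h
  have := mul_right_cancel₀ (inv_ne_zero hvar_ne_zero) h
  exact PowerSeries.C_injective (algebraMap_laurent_injective this)

/-- The quotient of two intertwiners with the same source and target is an endomorphism of the
source. -/
lemma conj_commute {m : Type*} [Fintype m] [DecidableEq m] {P D Y Y' : Matrix m m ℂ}
    (hP : IsUnit P.det) (h : P * Y = Y' * P) (h' : D * Y = Y' * D) : Commute (P⁻¹ * D) Y := by
  rw [Commute, SemiconjBy, mul_assoc, h', ← mul_assoc, ← mul_assoc]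
  congr 1
  calc P⁻¹ * Y' = P⁻¹ * (Y' * P) * P⁻¹ := by
        rw [mul_assoc, mul_assoc, Matrix.mul_nonsing_inv _ hP, mul_one]
    _ = Y * P⁻¹ := by rw [← h, ← mul_assoc, Matrix.nonsing_inv_mul _ hP, one_mul]

lemma kronecker_mul_twist {P Y Y' : Mat n ℂ} (h : P * Y = Y' * P) (γ δ : ℂ) :
    P ⊗ₖ P * twist γ δ Y = twist γ δ Y' * P ⊗ₖ P := by
  simp only [twist, mul_add, add_mul, Matrix.mul_smul, Matrix.smul_mul,
    ← Matrix.mul_kronecker_mul, h, Matrix.mul_one, Matrix.one_mul]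

lemma mred_smul_copQ_pole (hn : 3 ≤ n) {j : Fin (n + 1)} (hj : j.val = 0) {α β : ℂ} (hα : α ≠ 0)
    (hβ : β ≠ 0) :
    MRed (hvar • copQ s epsPlus (nodeParam (etaval n s * pole α) j)
        (nodeParam (etaval n s * pole β) j) (nodeA hn j) (nodeB hn j))
      ((-1 : ℂ) ^ n • twist α β (Xmat (nodeA hn j) (nodeB hn j))) ∧
    MRed (hvar • copQ s epsPlus (nodeParam (etaval n s / pole α) j)
        (nodeParam (etaval n s / pole β) j) (nodeA hn j) (nodeB hn j))
      ((-1 : ℂ) ^ n • twist α β (Xmat (nodeB hn j) (nodeA hn j))) := by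
  obtain ⟨a1, a2, a3, a4⟩ := red_hvar_mul_etaval (n := n) hα hj
  obtain ⟨b1, b2, b3, b4⟩ := red_hvar_mul_etaval (n := n) hβ hj
  have hQ := node_quad hn j
  have e : ∀ X : Mat n ℂ, (((-1 : ℂ) ^ n * α) • X) ⊗ₖ (1 : Mat n ℂ)
      + (1 : Mat n ℂ) ⊗ₖ (((-1 : ℂ) ^ n * β) • X) = (-1 : ℂ) ^ n • twist α β X := by
    intro X
    rw [twist, Matrix.smul_kronecker, Matrix.kronecker_smul]
    module
  constructor
  · have := mred_smul_copQ (mred_smul_Qmat_zero hQ a1 a2 red_hvar)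
      (mred_smul_Qmat_zero hQ b1 b2 red_hvar)
    rwa [zero_smul, add_zero, add_zero, e] at this
  · have := mred_smul_copQ (mred_smul_Qmat_zero hQ a3 a4 red_hvar)
      (mred_smul_Qmat_zero hQ b3 b4 red_hvar)
    rwa [zero_smul, zero_add, zero_add, e] at this

lemma mred_copQ_one (hn : 3 ≤ n) (j : Fin (n + 1)) :
    MRed (copQ s epsPlus 1 1 (nodeA hn j) (nodeB hn j))
      (twist 1 1 (fmat (nodeA hn j) (nodeB hn j))) := by
  have h : MRed ((1 : ℂ⸨X⸩) • Qmat s epsPlus 1 (nodeA hn j) (nodeB hn j))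
      (fmat (nodeA hn j) (nodeB hn j)) := by
    rw [one_smul]
    exact mred_Qmat_one (node_quad hn j)
  have := mred_smul_copQ h h
  rw [one_smul] at this
  rwa [twist, one_smul, one_smul]

/-- A nonzero difference may be scaled to a nonzero reduction `D`, an intertwiner of the classical
limits. `ψ ⊗ ψ` is an invertible one, the commutant is scalar, so `D = z ψ ⊗ ψ`; the entry of
`reflDiff_apply` gives `z = 0`. -/
lemma reflDiff_pole (hn : 3 ≤ n) {α β : ℂ} (hα : α ≠ 0) (hβ : β ≠ 0) (hαβ : α ≠ β) :
    reflDiff n s (Kmat n I s) (pole α) (pole β) = 0 := by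
  by_contra hD
  obtain ⟨c, D, hD0, hcD⟩ := MRed.exists_smul hD
  have hint := reflDiff_mul_copQ hn I_sq s_ne_zero s_sq_add_one_ne_zero epsPlus_mul epsPlus_mul'
    (pole_ne_zero hα) (pole_ne_zero hβ)
  have hf : ∀ j : Fin (n + 1), j.val ≠ 0 → D * twist 1 1 (fmat (nodeA hn j) (nodeB hn j))
      = twist 1 1 (fmat (nodeA hn j) (nodeB hn j)) * D := by
    intro j hj
    have h := hint j
    simp only [nodeParam, if_neg hj] at h
    have e := hcD.mul (mred_copQ_one hn j)
    have e' : c • reflDiff n s (Kmat n I s) (pole α) (pole β) * copQ s epsPlus 1 1 _ _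
        = copQ s epsPlus 1 1 _ _ * c • reflDiff n s (Kmat n I s) (pole α) (pole β) :=
      smul_mul_eq_mul_smul h c
    rw [e'] at e
    exact e.unique ((mred_copQ_one hn j).mul hcD)
  have h0 : D * twist α β (Xmat (nodeA hn 0) (nodeB hn 0))
      = twist α β (Xmat (nodeB hn 0) (nodeA hn 0)) * D := by
    obtain ⟨q1, q2⟩ := mred_smul_copQ_pole hn (j := 0) rfl hα hβ
    have e := hcD.mul q1
    have e' : c • reflDiff n s (Kmat n I s) (pole α) (pole β) * hvar • copQ s epsPlus _ _ _ _
        = hvar • copQ s epsPlus _ _ _ _ * c • reflDiff n s (Kmat n I s) (pole α) (pole β) :=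
      smul_mul_smul_comm_of_eq (hint 0) c hvar
    rw [e'] at e
    have := e.unique (q2.mul hcD)
    rw [Matrix.mul_smul, Matrix.smul_mul] at this
    exact smul_right_injective _ (pow_ne_zero n (by norm_num : (-1 : ℂ) ≠ 0)) this
  have hdet : IsUnit (psi n ⊗ₖ psi n).det := by
    rw [Matrix.det_kronecker]
    exact (mul_ne_zero (pow_ne_zero _ det_psi_ne_zero) (pow_ne_zero _ det_psi_ne_zero)).isUnit
  obtain ⟨z, hz⟩ := eq_smul_one_of_twistComm hn (C := (psi n ⊗ₖ psi n)⁻¹ * D) hα hβ hαβ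
    (fun j hj => conj_commute hdet (kronecker_mul_twist (psi_mul_fmat hn hj) 1 1) (hf j hj))
    (conj_commute hdet (kronecker_mul_twist (psi_mul_Xmat hn rfl) α β) h0)
  have hDz : D = z • (psi n ⊗ₖ psi n) := by
    rw [← Matrix.mul_nonsing_inv_cancel_left _ D hdet, hz, Matrix.mul_smul, mul_one]
  set p : Fin (2 * n) := ⟨0, by omega⟩
  set r : Fin (2 * n) := ⟨1, by omega⟩
  have hpr : p ≠ r := by simp [p, r]
  have hpr' : r ≠ p.rev := by
    intro e
    have := congrArg Fin.val e
    rw [Fin.val_rev] at this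
    simp only [p, r] at this
    omega
  -- The entry from `e_r ⊗ e_r` to `e_p ⊗ e_p` vanishes for the difference, while for `ψ ⊗ ψ` it is
  -- the square of `ψ_{pr} ≠ 0`.
  have e1 := (hcD (p, p) (r, r))
  rw [Matrix.smul_apply, reflDiff_apply (I_ne_zero I_sq) s_ne_zero s_sq_add_one_ne_zero _ _
    hpr hpr',
    smul_zero] at e1
  have e2 := e1.unique Red.zero
  have hψ : psi n p r ≠ 0 := psi_ne_zero hpr (by simp [num, p, r]; omega)
  rw [hDz, Matrix.smul_apply, Matrix.kronecker_apply, smul_eq_mul] at e2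
  have hz0 : z = 0 := by simpa [hψ] using e2
  rw [hz0, zero_smul] at hDz
  exact hD0 hDz

end ClassicalReflection

/-! ### Laurent polynomial dependence on the spectral parameters. -/

section LaurentPolynomial

variable {F : Type*} [Field F]

/-- On nonzero arguments the function is given by a Laurent polynomial. -/
def IsLaurentPoly (f : F → F) : Prop :=
  ∃ (p : Polynomial F) (k : ℕ), ∀ x, x ≠ 0 → x ^ k * f x = p.eval x

namespace IsLaurentPoly

variable {f g : F → F}

lemma const (c : F) : IsLaurentPoly fun _ => c := ⟨Polynomial.C c, 0, by simp⟩

lemma id : IsLaurentPoly fun x : F => x := ⟨Polynomial.X, 0, by simp⟩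

lemma inv : IsLaurentPoly fun x : F => x⁻¹ := ⟨1, 1, fun x hx => by simp [hx]⟩

lemma mul (hf : IsLaurentPoly f) (hg : IsLaurentPoly g) : IsLaurentPoly fun x => f x * g x := by
  obtain ⟨p, k, hp⟩ := hf
  obtain ⟨q, l, hq⟩ := hg
  refine ⟨p * q, k + l, fun x hx => ?_⟩
  rw [Polynomial.eval_mul, ← hp x hx, ← hq x hx]
  ring

lemma add (hf : IsLaurentPoly f) (hg : IsLaurentPoly g) : IsLaurentPoly fun x => f x + g x := by
  obtain ⟨p, k, hp⟩ := hf
  obtain ⟨q, l, hq⟩ := hg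
  refine ⟨p * Polynomial.X ^ l + q * Polynomial.X ^ k, k + l, fun x hx => ?_⟩
  rw [Polynomial.eval_add, Polynomial.eval_mul, Polynomial.eval_mul, ← hp x hx, ← hq x hx,
    Polynomial.eval_pow, Polynomial.eval_pow, Polynomial.eval_X]
  ring

lemma sub (hf : IsLaurentPoly f) (hg : IsLaurentPoly g) : IsLaurentPoly fun x => f x - g x := by
  simpa [sub_eq_add_neg] using hf.add ((const (-1)).mul hg)

lemma sum {ι : Type*} (t : Finset ι) {f : ι → F → F} (h : ∀ i, IsLaurentPoly (f i)) :
    IsLaurentPoly fun x => ∑ i ∈ t, f i x := by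
  classical
  induction t using Finset.induction_on with
  | empty => simpa using const (0 : F)
  | insert i t hi ih => simpa [Finset.sum_insert hi] using (h i).add ih

lemma ite {P : Prop} [Decidable P] (hf : IsLaurentPoly f) (hg : IsLaurentPoly g) :
    IsLaurentPoly fun x => if P then f x else g x := by
  split_ifs <;> assumption

/-- A Laurent polynomial with infinitely many zeros vanishes. -/
lemma eq_zero (hf : IsLaurentPoly f) {S : Set F} (hS : S.Infinite) (h : ∀ x ∈ S, f x = 0) {x : F}
    (hx : x ≠ 0) : f x = 0 := by
  obtain ⟨p, k, hp⟩ := hf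
  have hp0 : p = 0 := by
    refine Polynomial.eq_zero_of_infinite_isRoot p ((hS.sdiff (Set.finite_singleton 0)).mono ?_)
    rintro y ⟨hy, hy0⟩
    rw [Set.mem_ofPred_eq, Polynomial.IsRoot, ← hp y hy0, h y hy, mul_zero]
  have := hp x hx
  rw [hp0, Polynomial.eval_zero] at this
  exact (mul_eq_zero.mp this).resolve_left (pow_ne_zero _ hx)

end IsLaurentPoly

/-- Entrywise Laurent polynomials. -/
def IsLaurentMat {m : Type*} (A : F → Matrix m m F) : Prop := ∀ i j, IsLaurentPoly fun x => A x i j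

namespace IsLaurentMat

variable {m : Type*} {A B : F → Matrix m m F}

lemma const (M : Matrix m m F) : IsLaurentMat fun _ => M := fun _ _ => IsLaurentPoly.const _

lemma add (hA : IsLaurentMat A) (hB : IsLaurentMat B) : IsLaurentMat fun x => A x + B x :=
  fun i j => (hA i j).add (hB i j)

lemma sub (hA : IsLaurentMat A) (hB : IsLaurentMat B) : IsLaurentMat fun x => A x - B x :=
  fun i j => (hA i j).sub (hB i j)

lemma mul [Fintype m] (hA : IsLaurentMat A) (hB : IsLaurentMat B) :
    IsLaurentMat fun x => A x * B x := fun i j => by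
  simp only [Matrix.mul_apply]
  exact IsLaurentPoly.sum _ fun k => (hA i k).mul (hB k j)

lemma smul {f : F → F} (hf : IsLaurentPoly f) (hA : IsLaurentMat A) :
    IsLaurentMat fun x => f x • A x := fun i j => hf.mul (hA i j)

lemma sum {ι : Type*} (t : Finset ι) {A : ι → F → Matrix m m F} (h : ∀ i, IsLaurentMat (A i)) :
    IsLaurentMat fun x => ∑ i ∈ t, A i x := fun i j => by
  simp only [Matrix.sum_apply]
  exact IsLaurentPoly.sum _ fun k => h k i j

lemma kronecker {m' : Type*} {B : F → Matrix m' m' F} (hA : IsLaurentMat A)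
    (hB : IsLaurentMat B) : IsLaurentMat fun x => A x ⊗ₖ B x := fun i j =>
  (hA i.1 j.1).mul (hB i.2 j.2)

end IsLaurentMat

variable {n : ℕ}

lemma isLaurentMat_Kmat {I s : F} (hI : I ≠ 0) (hs : s ≠ 0) (hs2 : s ^ 2 + 1 ≠ 0) :
    IsLaurentMat (Kmat n I s) := by
  have h1 : IsLaurentPoly (k1fun n s) :=
    (IsLaurentPoly.const _).mul ((IsLaurentPoly.const _).sub IsLaurentPoly.id)
  have h2 : IsLaurentPoly (k2fun n s) :=
    (IsLaurentPoly.const _).mul ((IsLaurentPoly.const _).sub IsLaurentPoly.inv)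
  have h0 : IsLaurentPoly (k0fun n s) :=
    (h1.add ((IsLaurentPoly.const _).mul h2)).mul (IsLaurentPoly.const _)
  intro a b
  simp only [Kmat_apply hI hs hs2, kap]
  have hk : ∀ a b : Fin (2 * n),
      IsLaurentPoly fun x => kap (k1fun n s x) (k0fun n s x) (k2fun n s x) a b := by
    intro a b
    unfold kap
    split_ifs <;> assumption
  exact ((IsLaurentPoly.const _).mul (hk a b)).add (((IsLaurentPoly.const _).sub
    ((IsLaurentPoly.const _).mul (hk a a))).ite (IsLaurentPoly.const 0))

lemma isLaurentMat_Rcheck {f : F → F} (hf : IsLaurentPoly f) (s : F) :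
    IsLaurentMat fun x => Rcheck n s (f x) := by
  have hc := fun c : F => IsLaurentPoly.const c
  have hm := fun M : Mat₂ n F => IsLaurentMat.const M
  have hb : ∀ a b : Fin (2 * n), IsLaurentPoly fun x => bcoef s (f x) a b := by
    intro a b
    unfold bcoef
    refine IsLaurentPoly.ite ?_ (IsLaurentPoly.ite ?_ ?_)
    · exact (((hc _).mul hf).sub (hc _)).mul (hf.sub (hc _))
    · exact (hc _).mul (((hc _).mul (hf.sub (hc _))).sub ((hf.sub (hc _)).ite (hc 0)))
    · exact ((hc _).mul hf).mul
        (((hc _).mul (hf.sub (hc _))).sub ((hf.sub (hc _)).ite (hc 0)))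
  unfold Rcheck
  simp only [div_eq_mul_inv]
  refine (((IsLaurentMat.smul ((hf.sub (hc _)).mul (hf.sub (hc _))) (hm _)).add
    (IsLaurentMat.smul (((hf.sub (hc _)).mul (hf.sub (hc _))).mul (hc _)) (hm _))).add
    (IsLaurentMat.smul ((hc _).mul (hf.sub (hc _))) ((hm _).add (IsLaurentMat.smul hf (hm _))))).add
    (IsLaurentMat.sum _ fun a => IsLaurentMat.sum _ fun b => IsLaurentMat.smul (hb a b) (hm _))

lemma isLaurentMat_reflDiff_left {s : F} {K : F → Mat n F} (hK : IsLaurentMat K) (y : F) :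
    IsLaurentMat fun x => reflDiff n s K x y := by
  have hy : IsLaurentMat fun x => Rcheck n s (x * y) :=
    isLaurentMat_Rcheck (IsLaurentPoly.id.mul (IsLaurentPoly.const y)) s
  have hy' : IsLaurentMat fun x => Rcheck n s (x / y) := by
    simp only [div_eq_mul_inv]
    exact isLaurentMat_Rcheck (IsLaurentPoly.id.mul (IsLaurentPoly.const y⁻¹)) s
  have h1 := (IsLaurentMat.const (1 : Mat n F)).kronecker hK
  have h2 := IsLaurentMat.const ((1 : Mat n F) ⊗ₖ K y)
  exact (((h2.mul hy).mul h1).mul hy').sub (((hy'.mul h1).mul hy).mul h2)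

lemma isLaurentMat_reflDiff_right {s : F} {K : F → Mat n F} (hK : IsLaurentMat K) (x : F) :
    IsLaurentMat fun y => reflDiff n s K x y := by
  have hy : IsLaurentMat fun y => Rcheck n s (x * y) :=
    isLaurentMat_Rcheck ((IsLaurentPoly.const x).mul IsLaurentPoly.id) s
  have hy' : IsLaurentMat fun y => Rcheck n s (x / y) := by
    simp only [div_eq_mul_inv]
    exact isLaurentMat_Rcheck ((IsLaurentPoly.const x).mul IsLaurentPoly.inv) s
  have h1 := (IsLaurentMat.const (1 : Mat n F)).kronecker hK
  have h2 := IsLaurentMat.const ((1 : Mat n F) ⊗ₖ K x)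
  exact (((h1.mul hy).mul h2).mul hy').sub (((hy'.mul h2).mul hy).mul h1)

end LaurentPolynomial

/-- The points `α/h` with `α ∈ ℂ` are infinitely many, so the Laurent polynomial entries vanish
first in `x`, for `y = β/h` fixed, and then in `y`. The excluded values `α = 0, β` and `β = 0` are
finite in number. -/
theorem reflectionEquation_Kmat {n : ℕ} (hn : 3 ≤ n) :
    ReflectionEquation n s (Kmat n I s) := by
  have hK : IsLaurentMat (Kmat n I s) :=
    isLaurentMat_Kmat (I_ne_zero I_sq) s_ne_zero s_sq_add_one_ne_zero
  have inf : ∀ T : Set ℂ, T.Finite → (pole '' Tᶜ).Infinite := fun T hT =>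
    hT.infinite_compl.image pole_injective.injOn
  have h1 : ∀ (β : ℂ), β ≠ 0 → ∀ x : ℂ⸨X⸩, x ≠ 0 → ∀ i k,
      reflDiff n s (Kmat n I s) x (pole β) i k = 0 := by
    intro β hβ x hx i k
    refine (isLaurentMat_reflDiff_left hK (pole β) i k).eq_zero
      (inf {0, β} (Set.toFinite _)) ?_ hx
    rintro _ ⟨α, hα, rfl⟩
    rw [Set.mem_compl_iff, Set.mem_insert_iff, Set.mem_singleton_iff, not_or] at hα
    exact congrFun (congrFun (reflDiff_pole hn hα.1 hβ hα.2) i) k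
  intro x y hx hy
  refine sub_eq_zero.mp (Matrix.ext fun i k => ?_)
  refine (isLaurentMat_reflDiff_right hK x i k).eq_zero (inf {0} (Set.toFinite _)) ?_ hy
  rintro _ ⟨β, hβ, rfl⟩
  exact h1 β hβ x hx i k

/-! ## The family of solutions -/

section Family

variable {F : Type*} [Field F] {n : ℕ}

/-- `1 ⊗ P⁻¹KP` is the conjugate of `1 ⊗ K` by `P ⊗ P`, which commutes with every `Ř`; so both sides
of the equation are conjugated as a whole. -/
lemma ReflectionEquation.conj {s : F} {K : F → Mat n F} (h : ReflectionEquation n s K)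
    {P : Mat n F} (hP : IsUnit P.det)
    (hR : ∀ z, Rcheck n s z * (P ⊗ₖ P) = (P ⊗ₖ P) * Rcheck n s z) :
    ReflectionEquation n s fun x => P⁻¹ * K x * P := by
  have hk : ∀ x, (1 : Mat n F) ⊗ₖ (P⁻¹ * K x * P)
      = (P⁻¹ ⊗ₖ P⁻¹) * ((1 : Mat n F) ⊗ₖ K x) * (P ⊗ₖ P) := by
    intro x
    rw [← Matrix.mul_kronecker_mul, ← Matrix.mul_kronecker_mul, mul_one,
      Matrix.nonsing_inv_mul _ hP]
  have h1 : (P ⊗ₖ P) * (P⁻¹ ⊗ₖ P⁻¹) = 1 := by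
    rw [← Matrix.mul_kronecker_mul, Matrix.mul_nonsing_inv _ hP, Matrix.one_kronecker_one]
  have hR' : ∀ z, (P ⊗ₖ P) * Rcheck n s z * (P⁻¹ ⊗ₖ P⁻¹) = Rcheck n s z := by
    intro z
    rw [← hR, mul_assoc, h1, mul_one]
  have hR'' : ∀ z, Rcheck n s z * (P⁻¹ ⊗ₖ P⁻¹) = (P⁻¹ ⊗ₖ P⁻¹) * Rcheck n s z := by
    intro z
    have h2 : (P⁻¹ ⊗ₖ P⁻¹) * (P ⊗ₖ P) = 1 := mul_eq_one_comm.mp h1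
    calc Rcheck n s z * (P⁻¹ ⊗ₖ P⁻¹)
        = (P⁻¹ ⊗ₖ P⁻¹) * ((P ⊗ₖ P) * Rcheck n s z * (P⁻¹ ⊗ₖ P⁻¹)) := by
          rw [mul_assoc (P ⊗ₖ P), ← mul_assoc, h2, one_mul]
      _ = _ := by rw [hR']
  intro x y hx hy
  have e : ∀ (M N : Mat₂ n F) (z w : F),
      ((P⁻¹ ⊗ₖ P⁻¹) * M * (P ⊗ₖ P)) * Rcheck n s z * ((P⁻¹ ⊗ₖ P⁻¹) * N * (P ⊗ₖ P))
          * Rcheck n s w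
        = (P⁻¹ ⊗ₖ P⁻¹) * (M * Rcheck n s z * N * Rcheck n s w) * (P ⊗ₖ P) := by
    intro M N z w
    calc _ = (P⁻¹ ⊗ₖ P⁻¹) * M * ((P ⊗ₖ P) * Rcheck n s z * (P⁻¹ ⊗ₖ P⁻¹)) * N
          * ((P ⊗ₖ P) * Rcheck n s w) := by simp only [mul_assoc]
      _ = _ := by rw [hR', ← hR]; simp only [mul_assoc]
  have e' : ∀ (M N : Mat₂ n F) (z w : F),
      Rcheck n s w * ((P⁻¹ ⊗ₖ P⁻¹) * M * (P ⊗ₖ P)) * Rcheck n s z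
          * ((P⁻¹ ⊗ₖ P⁻¹) * N * (P ⊗ₖ P))
        = (P⁻¹ ⊗ₖ P⁻¹) * (Rcheck n s w * M * Rcheck n s z * N) * (P ⊗ₖ P) := by
    intro M N z w
    calc _ = (Rcheck n s w * (P⁻¹ ⊗ₖ P⁻¹)) * M * ((P ⊗ₖ P) * Rcheck n s z * (P⁻¹ ⊗ₖ P⁻¹)) * N
          * (P ⊗ₖ P) := by simp only [mul_assoc]
      _ = _ := by rw [hR', hR'']; simp only [mul_assoc]
  rw [hk, hk, e, e', h x y hx hy]

lemma ReflectionEquation.comp_neg {s : F} {K : F → Mat n F} (h : ReflectionEquation n s K) :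
    ReflectionEquation n s fun x => K (-x) := by
  intro x y hx hy
  have := h (-x) (-y) (neg_ne_zero.mpr hx) (neg_ne_zero.mpr hy)
  rwa [neg_mul_neg, neg_div_neg_eq] at this

lemma prodSigma_succ (σ : Fin (n + 1) → F) {j k : ℕ} (h : j ≤ k) (hk : k ≤ n) :
    prodSigma σ j k = σ ⟨j, by omega⟩ * prodSigma σ (j + 1) k := by
  rw [prodSigma, prodSigma, ← Finset.mul_prod_erase _ _ (Finset.mem_univ ⟨j, by omega⟩),
    ← Finset.mul_prod_erase _ (fun m : Fin (n + 1) => if j + 1 ≤ m.val ∧ m.val ≤ k then σ m else 1)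
      (Finset.mem_univ ⟨j, by omega⟩)]
  rw [if_pos ⟨le_rfl, h⟩, if_neg (by simp), one_mul]
  congr 1
  refine Finset.prod_congr rfl fun m hm => ?_
  have : m.val ≠ j := fun e => (Finset.mem_erase.mp hm).1 (Fin.ext e)
  exact if_congr (by omega) rfl rfl

lemma prodSigma_self (σ : Fin (n + 1) → F) {j : ℕ} (h : j ≤ n) :
    prodSigma σ j j = σ ⟨j, by omega⟩ := by
  rw [prodSigma_succ σ le_rfl h, prodSigma, Finset.prod_eq_one, mul_one]
  intro m _
  rw [if_neg (by omega)]

lemma prodSigma_ne_zero {σ : Fin (n + 1) → F} (h : ∀ j, σ j ≠ 0) (j k : ℕ) :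
    prodSigma σ j k ≠ 0 := by
  rw [prodSigma, Finset.prod_ne_zero_iff]
  intro m _
  split_ifs
  exacts [h m, one_ne_zero]

lemma prodSigma_mul (σ : Fin (n + 1) → F) {j k l : ℕ} (h : j ≤ k + 1) (h' : k ≤ l) :
    prodSigma σ j k * prodSigma σ (k + 1) l = prodSigma σ j l := by
  rw [prodSigma, prodSigma, prodSigma, ← Finset.prod_mul_distrib]
  refine Finset.prod_congr rfl fun m _ => ?_
  by_cases h1 : j ≤ m.val ∧ m.val ≤ k
  · rw [if_pos h1, if_neg (by omega), if_pos (by omega), mul_one]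
  · by_cases h2 : k + 1 ≤ m.val ∧ m.val ≤ l
    · rw [if_neg h1, if_pos h2, if_pos (by omega), one_mul]
    · rw [if_neg h1, if_neg h2, if_neg (by omega), one_mul]

lemma sigmaEntry_ne_zero {σ : Fin (n + 1) → F} (h : ∀ j, σ j ≠ 0) (a : Fin (2 * n)) :
    sigmaEntry σ a ≠ 0 := by
  unfold sigmaEntry
  split_ifs <;>
    first
    | exact inv_ne_zero (prodSigma_ne_zero h _ _)
    | exact prodSigma_ne_zero h _ _
    | exact one_ne_zero

/-- Independence of `a` is what `Rcheck_commute_diagonal` requires of `Σ ⊗ Σ` on the zero weight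
space. -/
lemma sigmaEntry_mul_rev (hn : 3 ≤ n) {σ : Fin (n + 1) → F} (h : ∀ j, σ j ≠ 0) (a : Fin (2 * n)) :
    sigmaEntry σ a * sigmaEntry σ a.rev = prodSigma σ (n - 1) n := by
  have key : ∀ a : Fin (2 * n), num a ≤ n →
      sigmaEntry σ a * sigmaEntry σ a.rev = prodSigma σ (n - 1) n := by
    intro a ha
    have h1 : num a.rev = 2 * n + 1 - num a := num_rev a
    have hb : bar n n = n + 1 := by simp only [bar]; omega
    have hb' : bar n (n - 1) = n + 2 := by simp only [bar]; omega
    have hbr : bar n (num a.rev) = num a := by rw [h1]; simp only [bar]; omega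
    rw [sigmaEntry, sigmaEntry, hbr, hb, hb', h1]
    rcases (by omega : num a ≤ n - 2 ∨ num a = n - 1 ∨ num a = n) with h2 | h2 | h2
    · rw [if_pos h2, if_neg (by omega), if_neg (by omega), if_neg (by omega), if_neg (by omega),
        if_neg (by omega), ← prodSigma_mul σ (by omega : num a ≤ n - 2 + 1) (by omega : n - 2 ≤ n),
        inv_mul_cancel_left₀ (prodSigma_ne_zero h _ _), show n - 2 + 1 = n - 1 by omega]
    · rw [if_neg (by omega), if_pos h2, if_neg (by omega), if_neg (by omega), if_neg (by omega),
        if_neg (by omega), if_pos (by omega), one_mul]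
    · rw [if_neg (by omega), if_neg (by omega), if_pos h2, if_neg (by omega), if_neg (by omega),
        if_neg (by omega), if_pos (by omega)]
      have := prodSigma_mul σ (by omega : n - 1 ≤ n - 1 + 1) (by omega : n - 1 ≤ n)
      rwa [show n - 1 + 1 = n by omega] at this
  by_cases ha : num a ≤ n
  · exact key a ha
  · have := key a.rev (by rw [num_rev]; omega)
    rwa [Fin.rev_rev, mul_comm] at this

lemma isUnit_det_sigmaMat {σ : Fin (n + 1) → F} (h : ∀ j, σ j ≠ 0) :
    IsUnit (sigmaMat σ).det := by
  rw [sigmaMat, Matrix.det_diagonal, isUnit_iff_ne_zero, Finset.prod_ne_zero_iff]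
  exact fun a _ => sigmaEntry_ne_zero h a

lemma reflectionEquation_Kplus (hn : 3 ≤ n) {I s : F} (h : ReflectionEquation n s (Kmat n I s))
    {σ : Fin (n + 1) → F} (hσ : ∀ j, σ j ≠ 0) : ReflectionEquation n s (Kplus I s σ) := by
  refine h.conj (isUnit_det_sigmaMat hσ) fun z => ?_
  rw [sigmaMat, diagonal_kronecker]
  exact Rcheck_commute_diagonal _ _ _ (fun c d => mul_comm _ _) fun c d => by
    rw [sigmaEntry_mul_rev hn hσ, sigmaEntry_mul_rev hn hσ]

lemma Kplus_apply {I s : F} {σ : Fin (n + 1) → F} (hσ : ∀ j, σ j ≠ 0) (x : F)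
    (a b : Fin (2 * n)) :
    Kplus I s σ x a b = (sigmaEntry σ a)⁻¹ * Kmat n I s x a b * sigmaEntry σ b := by
  have hinv : (sigmaMat σ)⁻¹ = Matrix.diagonal fun a => (sigmaEntry σ a)⁻¹ := by
    refine Matrix.inv_eq_left_inv ?_
    rw [sigmaMat, Matrix.diagonal_mul_diagonal, ← Matrix.diagonal_one]
    exact congrArg _ (funext fun a => inv_mul_cancel₀ (sigmaEntry_ne_zero hσ a))
  rw [Kplus, hinv, sigmaMat, Matrix.mul_diagonal, Matrix.diagonal_mul]

lemma Kmat_apply_ne_zero {I s : F} (hI : I ≠ 0) (hs : s ≠ 0) (hs2 : s ^ 2 + 1 ≠ 0) {x : F}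
    (hx : x ≠ 1) {a b : Fin (2 * n)} (hab : a ≠ b) (h : num a + num b ≤ 2 * n) :
    Kmat n I s x a b ≠ 0 := by
  rw [Kmat_apply hI hs hs2, if_neg hab, kap_low _ _ _ h, add_zero]
  exact mul_ne_zero (mul_ne_zero (zpow_ne_zero _ hI) (mul_ne_zero (zpow_ne_zero _ hI)
    (zpow_ne_zero _ hs))) (mul_ne_zero (zpow_ne_zero _ hs) (sub_ne_zero.mpr hx.symm))

/-- The family has the effective parameters `σ_1, …, σ_n`. -/
lemma Kplus_eq_iff (hn : 3 ≤ n) {I s : F} (hI : I ≠ 0) (hs : s ≠ 0) (hs2 : s ^ 2 + 1 ≠ 0)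
    {σ τ : Fin (n + 1) → F} (hσ : ∀ j, σ j ≠ 0) (hτ : ∀ j, τ j ≠ 0) :
    Kplus I s σ = Kplus I s τ ↔ ∀ j, j ≠ 0 → σ j = τ j := by
  constructor
  · intro h
    -- Column `n - 1` is normalized by `Σ_{n-1} = 1`. Its entries with `a ≤ n + 1` satisfy `a + b ≤
    -- 2n`, so they are nonzero multiples of `Σ_a⁻¹`; this range just reaches `Σ_n̄ = σ_n`.
    have hsig : ∀ a : Fin (2 * n), num a ≤ n + 1 → sigmaEntry σ a = sigmaEntry τ a := by
      intro a ha
      set b : Fin (2 * n) := ⟨n - 2, by omega⟩ with hb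
      have hnb : num b = n - 1 := by simp only [num, hb]; omega
      have one : ∀ ρ : Fin (n + 1) → F, sigmaEntry ρ b = 1 := fun ρ => by
        rw [sigmaEntry, if_neg (by omega), if_pos hnb]
      by_cases hab : a = b
      · rw [hab, one, one]
      -- The value `x = 0` is harmless although `0⁻¹ = 0` is a convention: the entries used involve
      -- only `k₁(x)`, and `k₁(0) ≠ 0`.
      · have h1 := congrFun (congrFun (congrFun h 0) a) b
        rw [Kplus_apply hσ, Kplus_apply hτ, one, one, mul_one, mul_one] at h1
        exact inv_injective (mul_right_cancel₀
          (Kmat_apply_ne_zero hI hs hs2 zero_ne_one hab (by omega)) h1)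
    have hlow : ∀ j (h1 : 1 ≤ j) (h2 : j ≤ n - 2),
        prodSigma σ j (n - 2) = prodSigma τ j (n - 2) := by
      intro j h1 h2
      have := hsig ⟨j - 1, by omega⟩ (by simp only [num]; omega)
      rw [sigmaEntry, sigmaEntry, show num (⟨j - 1, by omega⟩ : Fin (2 * n)) = j by
        simp only [num]; omega, if_pos h2, if_pos h2] at this
      exact inv_injective this
    intro j hj
    have hjn := j.isLt
    have hj0 : j.val ≠ 0 := fun e => hj (Fin.ext e)
    rcases (by omega : j.val < n - 2 ∨ j.val = n - 2 ∨ j.val = n - 1 ∨ j.val = n)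
      with h2 | h2 | h2 | h2
    · have h3 := hlow j.val (by omega) (by omega)
      rw [prodSigma_succ σ (by omega) (by omega), prodSigma_succ τ (by omega) (by omega),
        hlow (j.val + 1) (by omega) (by omega)] at h3
      exact mul_right_cancel₀ (prodSigma_ne_zero hτ _ _) h3
    · have h3 := hlow j.val (by omega) (by omega)
      rw [← h2, prodSigma_self σ (by omega), prodSigma_self τ (by omega)] at h3
      exact h3
    · have h3 := hsig ⟨n - 1, by omega⟩ (by simp only [num]; omega)
      rw [sigmaEntry, sigmaEntry, show num (⟨n - 1, by omega⟩ : Fin (2 * n)) = n by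
        simp only [num]; omega, if_neg (by omega), if_neg (by omega), if_pos rfl,
        if_neg (by omega), if_neg (by omega), if_pos rfl, ← h2, prodSigma_self σ (by omega),
        prodSigma_self τ (by omega)] at h3
      exact h3
    · have h3 := hsig ⟨n, by omega⟩ (by simp only [num]; omega)
      have hb : bar n n = n + 1 := by simp only [bar]; omega
      rw [sigmaEntry, sigmaEntry, show num (⟨n, by omega⟩ : Fin (2 * n)) = n + 1 by
        simp only [num], hb, if_neg (by omega), if_neg (by omega), if_neg (by omega), if_pos rfl,
        if_neg (by omega), if_neg (by omega), if_neg (by omega), if_pos rfl,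
        prodSigma_self σ le_rfl, prodSigma_self τ le_rfl] at h3
      rwa [show j = ⟨n, by omega⟩ from Fin.ext h2]
  · intro h
    have hp : ∀ {j} (k : ℕ), 1 ≤ j → prodSigma σ j k = prodSigma τ j k := by
      intro j k hj
      refine Finset.prod_congr rfl fun m _ => ?_
      split_ifs with hm
      · exact h m fun e => by rw [e] at hm; simp at hm; omega
      · rfl
    have hsig : sigmaEntry σ = sigmaEntry τ := by
      funext a
      have h1 := one_le_num a
      have h2 := num_le a
      have h3 : 1 ≤ bar n (num a) := by simp only [bar]; omega
      unfold sigmaEntry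
      rw [hp _ h1, hp _ (by omega : 1 ≤ n - 1), hp _ (by omega : 1 ≤ n), hp _ h3,
        hp _ (by omega : 1 ≤ n - 1)]
    funext x
    rw [Kplus, Kplus, sigmaMat, sigmaMat, hsig]

end Family

/-! ## Intertwiners at generic parameters -/

section Generic

variable {n : ℕ}

/-- Node `1` attaches the first and the last index to those connected by `node_chain`. -/
lemma finite_node_chain (hn : 3 ≤ n) (P : Fin (2 * n) → Prop)
    (h : ∀ j : Fin (n + 1), j.val ≠ 0 → (P (nodeA hn j) ↔ P (nodeB hn j)) ∧
      (P (nodeA hn j).rev ↔ P (nodeB hn j).rev)) (u v : Fin (2 * n)) : P u ↔ P v := by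
  set r : Fin (2 * n) := ⟨1, by omega⟩ with hr
  have h2 := fun j (hj : 2 ≤ j.val) => h j (by omega)
  have hA : nodeA hn ⟨1, by omega⟩ = ⟨0, by omega⟩ := by
    simp [nodeA]; omega
  have hB : nodeB hn ⟨1, by omega⟩ = r := by
    rw [nodeB, hr, Fin.mk.injEq, if_neg (by simp), if_neg (by simp; omega)]
  obtain ⟨e1, e2⟩ := h ⟨1, by omega⟩ (by simp)
  rw [hA, hB] at e1 e2
  have r1 : r.val ≠ 0 := by simp [hr]
  have r2 : r.rev.val ≠ 0 := by rw [Fin.val_rev]; simp [hr]; omega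
  have all : ∀ w, P w ↔ P r := by
    intro w
    by_cases hw : w.val = 0
    · rw [show w = ⟨0, by omega⟩ from Fin.ext hw]
      exact e1
    by_cases hw' : w.rev.val = 0
    · rw [← Fin.rev_rev w, show w.rev = ⟨0, by omega⟩ from Fin.ext hw']
      exact e2.trans (node_chain hn P h2 r2 (by rwa [Fin.rev_rev]) r1 r2)
    · exact node_chain hn P h2 hw hw' r1 r2
  exact (all u).trans (all v).symm

variable {F : Type*} [Field F]

/-- The index `u` belongs to none of the classes of `a` and `b`. -/
def Off (a b u : Fin (2 * n)) : Prop := u ≠ a ∧ u ≠ b ∧ u ≠ a.rev ∧ u ≠ b.rev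

/-- Off the classes of `a` and `b`, the rows and columns of `K` with indices `a`, `b` vanish
simultaneously. -/
def Linked (K : Mat n F) (a b : Fin (2 * n)) : Prop := ∀ u, Off a b u →
  (K u a = 0 ↔ K u b = 0) ∧ (K u a.rev = 0 ↔ K u b.rev = 0) ∧
  (K a u = 0 ↔ K b u = 0) ∧ (K a.rev u = 0 ↔ K b.rev u = 0)

lemma Off.symm {a b u : Fin (2 * n)} (h : Off a b u) : Off b a u := ⟨h.2.1, h.1, h.2.2.2, h.2.2.1⟩

lemma Linked.symm {K : Mat n F} {a b : Fin (2 * n)} (h : Linked K a b) : Linked K b a := by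
  intro u hu
  obtain ⟨h1, h2, h3, h4⟩ := h u hu.symm
  exact ⟨h1.symm, h2.symm, h3.symm, h4.symm⟩

section Node

variable {s e t t' : F} {a b : Fin (2 * n)} {K : Mat n F}

lemma off_equations (h : Quad a b) (hK : K * Qmat s e t a b = Qmat s e t' a b * K)
    {u : Fin (2 * n)} (hu : Off a b u) :
    (s⁻¹ * t⁻¹ * K u b + e * (s ^ 2 - 1) * K u a = 0 ∧
      s * t * K u a + e * (s⁻¹ ^ 2 - 1) * K u b = 0) ∧
    (-(s * t * K u b.rev) + e * (s⁻¹ ^ 2 - 1) * K u a.rev = 0 ∧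
      -(s⁻¹ * t⁻¹ * K u a.rev) + e * (s ^ 2 - 1) * K u b.rev = 0) ∧
    (s * t' * K b u + e * (s ^ 2 - 1) * K a u = 0 ∧
      s⁻¹ * t'⁻¹ * K a u + e * (s⁻¹ ^ 2 - 1) * K b u = 0) ∧
    (-(s⁻¹ * t'⁻¹ * K b.rev u) + e * (s⁻¹ ^ 2 - 1) * K a.rev u = 0 ∧
      -(s * t' * K a.rev u) + e * (s ^ 2 - 1) * K b.rev u = 0) := by
  obtain ⟨h1, h2, h3, h4⟩ := hu
  have ent := fun x y => congrFun (congrFun hK x) y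
  have c1 := ent u a
  have c2 := ent u b
  have c3 := ent u a.rev
  have c4 := ent u b.rev
  have r1 := ent a u
  have r2 := ent b u
  have r3 := ent a.rev u
  have r4 := ent b.rev u
  rw [mul_Qmat_left _ _ _ _ h, Qmat_mul_of_ne _ _ _ _ h _ h1 h2 h3 h4] at c1
  rw [mul_Qmat_right _ _ _ _ h, Qmat_mul_of_ne _ _ _ _ h _ h1 h2 h3 h4] at c2
  rw [mul_Qmat_rev_left _ _ _ _ h, Qmat_mul_of_ne _ _ _ _ h _ h1 h2 h3 h4] at c3
  rw [mul_Qmat_rev_right _ _ _ _ h, Qmat_mul_of_ne _ _ _ _ h _ h1 h2 h3 h4] at c4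
  rw [mul_Qmat_of_ne _ _ _ _ h _ h1 h2 h3 h4, Qmat_mul_left _ _ _ _ h] at r1
  rw [mul_Qmat_of_ne _ _ _ _ h _ h1 h2 h3 h4, Qmat_mul_right _ _ _ _ h] at r2
  rw [mul_Qmat_of_ne _ _ _ _ h _ h1 h2 h3 h4, Qmat_mul_rev_left _ _ _ _ h] at r3
  rw [mul_Qmat_of_ne _ _ _ _ h _ h1 h2 h3 h4, Qmat_mul_rev_right _ _ _ _ h] at r4
  exact ⟨⟨c1, c2⟩, ⟨c3, c4⟩, ⟨r1.symm, r2.symm⟩, ⟨r3.symm, r4.symm⟩⟩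

/-- In each equation off the block one of the two entries has an invertible coefficient, so it
vanishes with the other; the equations come in pairs with the roles exchanged. -/
lemma linked_of_intertwine (h : Quad a b) (hs : s ≠ 0) (ht : t ≠ 0) (ht' : t' ≠ 0)
    (hK : K * Qmat s e t a b = Qmat s e t' a b * K) : Linked K a b := by
  intro u hu
  obtain ⟨⟨c1, c2⟩, ⟨c3, c4⟩, ⟨r1, r2⟩, ⟨r3, r4⟩⟩ := off_equations h hK hu
  refine ⟨⟨fun z => ?_, fun z => ?_⟩, ⟨fun z => ?_, fun z => ?_⟩, ⟨fun z => ?_, fun z => ?_⟩,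
    ⟨fun z => ?_, fun z => ?_⟩⟩
  · simpa [z, hs, ht] using c1
  · simpa [z, hs, ht] using c2
  · simpa [z, hs, ht] using c3
  · simpa [z, hs, ht] using c4
  · simpa [z, hs, ht'] using r1
  · simpa [z, hs, ht'] using r2
  · simpa [z, hs, ht'] using r3
  · simpa [z, hs, ht'] using r4

/-- The same equations, read in pairs, are 2×2 systems with determinant `1 - e² (q - 1)(q⁻¹ - 1)`,
because their other coefficients multiply to `1`. -/
lemma eq_zero_of_nondegenerate (h : Quad a b) (hs : s ≠ 0) (ht : t ≠ 0) (ht' : t' ≠ 0)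
    (hK : K * Qmat s e t a b = Qmat s e t' a b * K) (he : e * (s ^ 2 - 1) * (e * (s⁻¹ ^ 2 - 1)) ≠ 1)
    {u : Fin (2 * n)} (hu : Off a b u) :
    (K u a = 0 ∧ K u b = 0 ∧ K u a.rev = 0 ∧ K u b.rev = 0) ∧
    (K a u = 0 ∧ K b u = 0 ∧ K a.rev u = 0 ∧ K b.rev u = 0) := by
  obtain ⟨⟨c1, c2⟩, ⟨c3, c4⟩, ⟨r1, r2⟩, ⟨r3, r4⟩⟩ := off_equations h hK hu
  have key : ∀ {p q d d' x y : F}, p * q = 1 → d * d' ≠ 1 → p * x + d * y = 0 →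
      q * y + d' * x = 0 → y = 0 ∧ x = 0 := by
    intro p q d d' x y hpq hd e1 e2
    have hd' : 1 - d * d' ≠ 0 := sub_ne_zero.mpr hd.symm
    exact ⟨(mul_eq_zero.mp (by linear_combination p * e2 - d' * e1 - y * hpq :
        (1 - d * d') * y = 0)).resolve_left hd',
      (mul_eq_zero.mp (by linear_combination q * e1 - d * e2 - x * hpq :
        (1 - d * d') * x = 0)).resolve_left hd'⟩
  have e1 : s⁻¹ * t⁻¹ * (s * t) = 1 := by field_simp
  have e2 : -(s * t) * -(s⁻¹ * t⁻¹) = 1 := by field_simp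
  have e3 : s * t' * (s⁻¹ * t'⁻¹) = 1 := by field_simp
  have e4 : -(s⁻¹ * t'⁻¹) * -(s * t') = 1 := by field_simp
  have he' : e * (s⁻¹ ^ 2 - 1) * (e * (s ^ 2 - 1)) ≠ 1 := by rwa [mul_comm]
  rw [← neg_mul] at c3 c4 r3 r4
  obtain ⟨z1, z2⟩ := key e1 he c1 c2
  obtain ⟨z3, z4⟩ := key e2 he' c3 c4
  obtain ⟨z5, z6⟩ := key e3 he r1 r2
  obtain ⟨z7, z8⟩ := key e4 he' r3 r4
  exact ⟨⟨z1, z2, z3, z4⟩, ⟨z5, z6, z7, z8⟩⟩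

end Node

/-- The row and column blocks of `K` at the class of `a` vanish off the diagonal. -/
def Isolated (K : Mat n F) (a : Fin (2 * n)) : Prop := ∀ u, u ≠ a → u ≠ a.rev →
  (K u a = 0 ∧ K u a.rev = 0) ∧ (K a u = 0 ∧ K a.rev u = 0)

lemma Isolated.rev {K : Mat n F} {a : Fin (2 * n)} (h : Isolated K a) : Isolated K a.rev := by
  intro u h1 h2
  rw [Fin.rev_rev] at h2 ⊢
  exact ⟨(h u h2 h1).1.symm, (h u h2 h1).2.symm⟩

lemma isolated_rev_iff {K : Mat n F} {a : Fin (2 * n)} : Isolated K a.rev ↔ Isolated K a :=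
  ⟨fun h => by simpa using h.rev, Isolated.rev⟩

lemma Isolated.of_linked {K : Mat n F} {a b : Fin (2 * n)} (h : Quad a b) (ha : Isolated K a)
    (hl : Linked K a b) : Isolated K b := by
  intro u h1 h2
  by_cases h3 : u = a
  · obtain ⟨⟨z1, z2⟩, ⟨z3, z4⟩⟩ := ha b h.ne.symm h.symm.ner
    obtain ⟨⟨w1, w2⟩, ⟨w3, w4⟩⟩ := ha b.rev (fun e => h.ner e.symm) h.rev_ne_rev.symm
    rw [h3]
    exact ⟨⟨z3, w3⟩, ⟨z1, w1⟩⟩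
  by_cases h4 : u = a.rev
  · obtain ⟨⟨z1, z2⟩, ⟨z3, z4⟩⟩ := ha b h.ne.symm h.symm.ner
    obtain ⟨⟨w1, w2⟩, ⟨w3, w4⟩⟩ := ha b.rev (fun e => h.ner e.symm) h.rev_ne_rev.symm
    rw [h4]
    exact ⟨⟨z4, w4⟩, ⟨z2, w2⟩⟩
  · obtain ⟨⟨z1, z2⟩, ⟨z3, z4⟩⟩ := ha u h3 h4
    obtain ⟨l1, l2, l3, l4⟩ := hl u ⟨h3, h1, h4, h2⟩
    exact ⟨⟨l1.mp z1, l2.mp z2⟩, ⟨l3.mp z3, l4.mp z4⟩⟩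

/-- The rows and columns of `K` at the classes of `a` and `b` vanish off these classes. -/
def BlockIsolated (K : Mat n F) (a b : Fin (2 * n)) : Prop := ∀ u, Off a b u →
  (K u a = 0 ∧ K u b = 0 ∧ K u a.rev = 0 ∧ K u b.rev = 0) ∧
  (K a u = 0 ∧ K b u = 0 ∧ K a.rev u = 0 ∧ K b.rev u = 0)

lemma BlockIsolated.symm {K : Mat n F} {a b : Fin (2 * n)} (h : BlockIsolated K a b) :
    BlockIsolated K b a := by
  intro u hu
  obtain ⟨⟨z1, z2, z3, z4⟩, ⟨z5, z6, z7, z8⟩⟩ := h u hu.symm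
  exact ⟨⟨z2, z1, z4, z3⟩, ⟨z6, z5, z8, z7⟩⟩

lemma Off.rev {a b u : Fin (2 * n)} (h : Off a b u) : Off a.rev b.rev u := by
  obtain ⟨h1, h2, h3, h4⟩ := h
  refine ⟨h3, h4, ?_, ?_⟩ <;> rwa [Fin.rev_rev]

lemma BlockIsolated.rev {K : Mat n F} {a b : Fin (2 * n)} (h : BlockIsolated K a b) :
    BlockIsolated K a.rev b.rev := by
  intro u hu
  have := hu.rev
  rw [Fin.rev_rev, Fin.rev_rev] at this
  obtain ⟨⟨z1, z2, z3, z4⟩, ⟨z5, z6, z7, z8⟩⟩ := h u this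
  rw [Fin.rev_rev, Fin.rev_rev]
  exact ⟨⟨z3, z4, z1, z2⟩, ⟨z7, z8, z5, z6⟩⟩

lemma Quad.rev {a b : Fin (2 * n)} (h : Quad a b) : Quad a.rev b.rev :=
  ⟨fun e => h.ne (Fin.rev_inj.mp e), fun e => h.ner (Fin.rev_inj.mp e)⟩

/-- Only entries between the classes of `a` and `b` remain to be killed. A node `(b, d)` with `d`
off the block links them to entries between the classes of `a` and `d`, which vanish already. -/
lemma isolated_of_linked_of_off {K : Mat n F} {a b d : Fin (2 * n)} (h : Quad a b)
    (hz : BlockIsolated K a b) (hd : Off a b d) (hl : Linked K b d) : Isolated K b := by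
  obtain ⟨d1, d2, d3, d4⟩ := hd
  have hr : Off a b d.rev := by
    refine ⟨?_, ?_, ?_, ?_⟩ <;> simpa [Fin.rev_eq_iff]
  have ha : Off b d a := ⟨h.ne, d1.symm, h.ner, fun e => d3 (by rw [e, Fin.rev_rev])⟩
  have ha' : Off b d a.rev := by
    refine ⟨h.symm.ner.symm, d3.symm, h.rev_ne_rev, ?_⟩
    rw [Ne, Fin.rev_inj]
    exact d1.symm
  obtain ⟨z1, z2⟩ := hz d ⟨d1, d2, d3, d4⟩
  obtain ⟨w1, w2⟩ := hz d.rev hr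
  obtain ⟨l1, l2, l3, l4⟩ := hl a ha
  obtain ⟨m1, m2, m3, m4⟩ := hl a.rev ha'
  intro u h1 h2
  by_cases h3 : u = a
  · rw [h3]
    exact ⟨⟨l1.mpr z2.1, l2.mpr w2.1⟩, ⟨l3.mpr z1.1, l4.mpr w1.1⟩⟩
  by_cases h4 : u = a.rev
  · rw [h4]
    exact ⟨⟨m1.mpr z2.2.2.1, m2.mpr w2.2.2.1⟩, ⟨m3.mpr z1.2.2.1, m4.mpr w1.2.2.1⟩⟩
  · obtain ⟨x1, x2⟩ := hz u ⟨h3, h1, h4, h2⟩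
    exact ⟨⟨x1.2.1, x1.2.2.2⟩, ⟨x2.2.1, x2.2.2.2⟩⟩

/-- Every node has a neighbour that shares one of its two classes. -/
lemma exists_neighbour (hn : 3 ≤ n) (j : Fin (n + 1)) : ∃ (i : Fin (n + 1)) (b d : Fin (2 * n)),
    i.val ≠ 0 ∧ (b = nodeA hn j ∨ b = nodeB hn j ∨ b = (nodeA hn j).rev ∨ b = (nodeB hn j).rev) ∧
    ((b = nodeA hn i ∧ d = nodeB hn i) ∨ (b = nodeB hn i ∧ d = nodeA hn i)) ∧
    Off (nodeA hn j) (nodeB hn j) d := by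
  have hj := j.isLt
  have val := node_val hn j
  have off : ∀ d : Fin (2 * n), d.val ≠ (nodeA hn j).val → d.val ≠ (nodeB hn j).val →
      d.val ≠ 2 * n - ((nodeA hn j).val + 1) → d.val ≠ 2 * n - ((nodeB hn j).val + 1) →
      Off (nodeA hn j) (nodeB hn j) d := by
    intro d h1 h2 h3 h4
    refine ⟨fun e => h1 (by rw [e]), fun e => h2 (by rw [e]), fun e => h3 ?_, fun e => h4 ?_⟩ <;>
      rw [e, Fin.val_rev]
  by_cases h2 : j.val < 2
  · have v := node_val hn ⟨2, by omega⟩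
    simp only at v
    refine ⟨⟨2, by omega⟩, nodeA hn ⟨2, by omega⟩, nodeB hn ⟨2, by omega⟩, by simp, ?_,
      Or.inl ⟨rfl, rfl⟩, off _ ?_ ?_ ?_ ?_⟩
    · rcases (by omega : j.val = 0 ∨ j.val = 1) with h | h
      · right; right; left; apply Fin.ext; rw [Fin.val_rev]; omega
      · right; left; apply Fin.ext; omega
    all_goals omega
  · by_cases h3 : j.val < n
    · have v := node_val hn ⟨j.val - 1, by omega⟩
      simp only at v
      refine ⟨⟨j.val - 1, by omega⟩, nodeB hn ⟨j.val - 1, by omega⟩,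
        nodeA hn ⟨j.val - 1, by omega⟩, by simp only; omega, ?_,
        Or.inr ⟨rfl, rfl⟩, off _ ?_ ?_ ?_ ?_⟩
      · left; apply Fin.ext; omega
      all_goals omega
    · have v := node_val hn ⟨n - 2, by omega⟩
      simp only at v
      refine ⟨⟨n - 2, by omega⟩, nodeB hn ⟨n - 2, by omega⟩,
        nodeA hn ⟨n - 2, by omega⟩, by simp only; omega, ?_,
        Or.inr ⟨rfl, rfl⟩, off _ ?_ ?_ ?_ ?_⟩
      · left; apply Fin.ext; omega
      all_goals omega

/-- Intertwiners vanish unless all parameters `ε_j` are degenerate. -/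
theorem eq_zero_of_exists_nondegenerate (hn : 3 ≤ n) {s t t' : F} (hs : s ≠ 0) (hs4 : s ^ 4 ≠ 1)
    (ht : t ≠ 0) (ht' : t' ≠ 0) (htt : t ≠ t') {ε : Fin (n + 1) → F} {K : Mat n F}
    (hK : ∀ j, K * Qmat s (ε j) (nodeParam t j) (nodeA hn j) (nodeB hn j)
      = Qmat s (ε j) (nodeParam t' j) (nodeA hn j) (nodeB hn j) * K)
    {j : Fin (n + 1)} (hj : ε j * (s ^ 2 - 1) * (ε j * (s⁻¹ ^ 2 - 1)) ≠ 1)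
    (hε : ∃ i, ε i ≠ 0) : K = 0 := by
  have np : ∀ {x : F} (i : Fin (n + 1)), x ≠ 0 → nodeParam x i ≠ 0 := by
    intro x i hx
    rw [nodeParam]
    split_ifs
    exacts [hx, one_ne_zero]
  have hl := fun i => linked_of_intertwine (node_quad hn i) hs (np i ht) (np i ht') (hK i)
  have hz : BlockIsolated K (nodeA hn j) (nodeB hn j) := fun u hu =>
    eq_zero_of_nondegenerate (node_quad hn j) hs (np j ht) (np j ht') (hK j) hj hu
  -- The nondegenerate node isolates its block of two classes; a neighbouring node separates the
  -- two.
  have hiso : ∃ b, Isolated K b := by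
    obtain ⟨i, b, d, hi, hb, hbd, hd⟩ := exists_neighbour hn j
    have hbl : Linked K b d := by
      rcases hbd with ⟨rfl, rfl⟩ | ⟨rfl, rfl⟩
      exacts [hl i, (hl i).symm]
    have hq := node_quad hn j
    rcases hb with rfl | rfl | rfl | rfl
    · exact ⟨_, isolated_of_linked_of_off hq.symm hz.symm hd.symm hbl⟩
    · exact ⟨_, isolated_of_linked_of_off hq hz hd hbl⟩
    · exact ⟨_, isolated_of_linked_of_off hq.rev.symm hz.rev.symm hd.rev.symm hbl⟩
    · exact ⟨_, isolated_of_linked_of_off hq.rev hz.rev hd.rev hbl⟩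
  have step : ∀ i, Isolated K (nodeA hn i) ↔ Isolated K (nodeB hn i) := fun i =>
    ⟨fun h => h.of_linked (node_quad hn i) (hl i),
      fun h => h.of_linked (node_quad hn i).symm (hl i).symm⟩
  have all : ∀ c, Isolated K c := by
    obtain ⟨b, hb⟩ := hiso
    intro c
    refine (finite_node_chain hn (Isolated K) (fun i _ => ⟨step i, ?_⟩) b c).mp hb
    rw [isolated_rev_iff, isolated_rev_iff]
    exact step i
  have ent := fun i x y => congrFun (congrFun (hK i) x) y
  have off0 : ∀ {a b : Fin (2 * n)}, Quad a b → K a b = 0 := fun {a b} hab =>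
    (all a b hab.ne.symm hab.symm.ner).2.1
  have hq := fun i => node_quad hn i
  have d1 : ∀ i, nodeParam t i * K (nodeA hn i) (nodeA hn i)
      = nodeParam t' i * K (nodeB hn i) (nodeB hn i) := by
    intro i
    have := ent i (nodeA hn i) (nodeB hn i)
    rw [mul_Qmat_right _ _ _ _ (hq i), Qmat_mul_left _ _ _ _ (hq i), off0 (hq i)] at this
    exact mul_left_cancel₀ hs (by linear_combination this)
  have d2 : ∀ i, nodeParam t i * K (nodeB hn i).rev (nodeB hn i).rev
      = nodeParam t' i * K (nodeA hn i).rev (nodeA hn i).rev := by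
    intro i
    have := ent i (nodeB hn i).rev (nodeA hn i).rev
    rw [mul_Qmat_rev_left _ _ _ _ (hq i), Qmat_mul_rev_right _ _ _ _ (hq i),
      off0 (hq i).rev.symm] at this
    exact mul_left_cancel₀ hs (by linear_combination -this)
  have fin1 : ∀ (i : Fin (n + 1)) (x : F), i.val ≠ 0 → nodeParam x i = 1 := fun i x hi => if_neg hi
  -- The finite nodes make the diagonal of `K` constant, and the affine node multiplies the constant
  -- by `t` on one side and by `t'` on the other.
  have hdiag : ∀ c, K c c = 0 := by
    have hc := finite_node_chain hn (fun c => K c c = K (nodeA hn 0) (nodeA hn 0)) fun i hi => by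
      have e1 := d1 i
      have e2 := d2 i
      rw [fin1 i _ hi, fin1 i _ hi, one_mul, one_mul] at e1 e2
      rw [e1, e2]
      exact ⟨Iff.rfl, Iff.rfl⟩
    have h0 := d1 0
    rw [(hc (nodeA hn 0) (nodeB hn 0)).mp rfl] at h0
    have h1 : (t - t') * K (nodeA hn 0) (nodeA hn 0) = 0 := by
      rw [sub_mul]
      exact sub_eq_zero.mpr h0
    intro c
    rw [(hc (nodeA hn 0) c).mp rfl]
    exact (mul_eq_zero.mp h1).resolve_left (sub_ne_zero.mpr htt)
  -- At a node with `ε_i ≠ 0` the diagonal part of the generator has different eigenvalues `ε_i (q -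
  -- 1)` and `ε_i (q⁻¹ - 1)` at `a` and `ā`, so `K_{aā} = 0`; the finite nodes propagate this along
  -- the antidiagonal.
  have hanti : ∀ c, K c c.rev = 0 := by
    obtain ⟨i, hi⟩ := hε
    have h0 : K (nodeA hn i) (nodeA hn i).rev = 0 := by
      have := ent i (nodeA hn i) (nodeA hn i).rev
      rw [mul_Qmat_rev_left _ _ _ _ (hq i), Qmat_mul_left _ _ _ _ (hq i),
        (all (nodeA hn i) (nodeB hn i).rev (fun e => (hq i).ner e.symm)
          (hq i).rev_ne_rev.symm).2.1,
        (all (nodeB hn i) (nodeA hn i).rev (fun e => (hq i).symm.ner e.symm)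
          (hq i).rev_ne_rev).2.1] at this
      have h4 : s ^ 4 - 1 ≠ 0 := sub_ne_zero.mpr hs4
      have h5 : ε i * (s ^ 4 - 1) * K (nodeA hn i) (nodeA hn i).rev = 0 := by
        field_simp at this
        linear_combination -this
      exact (mul_eq_zero.mp h5).resolve_left (mul_ne_zero hi h4)
    intro c
    refine (finite_node_chain hn (fun c => K c c.rev = 0) (fun j hj => ?_) _ c).mp h0
    have e1 := ent j (nodeA hn j) (nodeB hn j).rev
    have e2 := ent j (nodeA hn j).rev (nodeB hn j)
    rw [mul_Qmat_rev_right _ _ _ _ (hq j), Qmat_mul_left _ _ _ _ (hq j), fin1 j _ hj, fin1 j _ hj,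
      (all (nodeA hn j) (nodeB hn j).rev (fun e => (hq j).ner e.symm)
        (hq j).rev_ne_rev.symm).2.1] at e1
    rw [mul_Qmat_right _ _ _ _ (hq j), Qmat_mul_rev_left _ _ _ _ (hq j), fin1 j _ hj, fin1 j _ hj,
      (all (nodeB hn j) (nodeA hn j).rev (fun e => (hq j).symm.ner e.symm)
        (hq j).rev_ne_rev).1.1] at e2
    rw [Fin.rev_rev, Fin.rev_rev]
    refine ⟨⟨fun z => ?_, fun z => ?_⟩, ⟨fun z => ?_, fun z => ?_⟩⟩
    · simpa [z, hs] using e1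
    · simpa [z, hs] using e1
    · simpa [z, hs] using e2
    · simpa [z, hs] using e2
  refine Matrix.ext fun c d => ?_
  by_cases h1 : d = c
  · rw [h1]; exact hdiag c
  by_cases h2 : d = c.rev
  · rw [h2]; exact hanti c
  · exact (all c d h1 h2).2.1

end Generic

/-! ## Intertwiners at degenerate parameters -/

section Degenerate

variable {n : ℕ} {F : Type*} [Field F]

/-- The two row vectors in the factorization of a degenerate generator. -/
def rowMat (I t : F) (a b : Fin (2 * n)) : Matrix (Fin 2) (Fin (2 * n)) F :=
  single 0 a I + single 0 b t + single 1 b.rev I - single 1 a.rev t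

/-- The two column vectors in the factorization of a degenerate generator. -/
def colMat (I s t : F) (a b : Fin (2 * n)) : Matrix (Fin (2 * n)) (Fin 2) F :=
  single a 0 s - single b 0 (I * s⁻¹ * t⁻¹) + single b.rev 1 s + single a.rev 1 (I * s⁻¹ * t⁻¹)

/-- The conditions on `e` make the determinant of each of the 2×2 blocks on `{a, b}` and `{ā, b̄}`
vanish, so each block is a column times a row. -/
lemma Qmat_eq_colMat_mul_rowMat {I s t e : F} (hI : I ^ 2 = -1) (ht : t ≠ 0)
    (he : e * (s ^ 2 - 1) = I * s) (he' : e * (s⁻¹ ^ 2 - 1) = -I * s⁻¹) {a b : Fin (2 * n)}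
    (h : Quad a b) : Qmat s e t a b = colMat I s t a b * rowMat I t a b := by
  have hII : I * I = -1 := by rw [← sq, hI]
  have sm : ∀ (i j : Fin (2 * n)) (c : F), single i j c = c • (single i j 1 : Mat n F) := by
    intro i j c
    rw [Matrix.smul_single, smul_eq_mul, mul_one]
  rw [Qmat_eq h, he, he', colMat, rowMat]
  simp only [Matrix.mul_add, Matrix.add_mul, Matrix.mul_sub, Matrix.sub_mul,
    Matrix.single_mul_single_same, ne_eq,
    zero_ne_one, one_ne_zero, not_false_eq_true, Matrix.single_mul_single_of_ne, add_zero, sub_zero,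
    zero_add]
  have e1 : I * s⁻¹ * t⁻¹ * I = -(s⁻¹ * t⁻¹) := by linear_combination (s⁻¹ * t⁻¹) * hII
  have e2 : I * s⁻¹ * t⁻¹ * t = I * s⁻¹ := by field_simp
  rw [e1, e2]
  rw [sm a b (s * t), sm a a (s * I), sm b a (-(s⁻¹ * t⁻¹)), sm b b (I * s⁻¹),
    sm b.rev b.rev (s * I), sm b.rev a.rev (s * t), sm a.rev b.rev (-(s⁻¹ * t⁻¹)),
    sm a.rev a.rev (I * s⁻¹)]
  module

section Apply

variable {m : Type*} (I s t : F) (a b : Fin (2 * n))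

lemma rowMat_mul_apply (M : Matrix (Fin (2 * n)) m F) (k : m) :
    (rowMat I t a b * M) 0 k = I * M a k + t * M b k ∧
    (rowMat I t a b * M) 1 k = I * M b.rev k - t * M a.rev k := by
  constructor <;> simp [rowMat, Matrix.add_mul, Matrix.sub_mul]

lemma mul_colMat_apply (M : Matrix m (Fin (2 * n)) F) (k : m) :
    (M * colMat I s t a b) k 0 = s * M k a - I * s⁻¹ * t⁻¹ * M k b ∧
    (M * colMat I s t a b) k 1 = s * M k b.rev + I * s⁻¹ * t⁻¹ * M k a.rev := by
  constructor <;> simp [colMat, Matrix.mul_add, Matrix.mul_sub, mul_comm]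

end Apply

/-- `K` acts by the matrix `G` on the factors of the generator at the node `(a, b)`. -/
structure NodeMat (I s t t' : F) (a b : Fin (2 * n)) (K : Mat n F) (G : Matrix (Fin 2) (Fin 2) F) :
    Prop where
  row : rowMat I t' a b * K = G * rowMat I t a b
  col : K * colMat I s t a b = colMat I s t' a b * G

/-- An intertwiner of `Q = colMat * rowMat` preserves images and coimages. Since `rowMat` has a
right inverse and `colMat` a left inverse, the induced maps on both are the same matrix `G`. -/
lemma exists_nodeMat {I s t t' e : F} (hI : I ^ 2 = -1) (hs : s ≠ 0) (ht : t ≠ 0) (ht' : t' ≠ 0)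
    (he : e * (s ^ 2 - 1) = I * s) (he' : e * (s⁻¹ ^ 2 - 1) = -I * s⁻¹) {a b : Fin (2 * n)}
    (h : Quad a b) {K : Mat n F} (hK : K * Qmat s e t a b = Qmat s e t' a b * K) :
    ∃ G, NodeMat I s t t' a b K G := by
  have hI0 := I_ne_zero hI
  rw [Qmat_eq_colMat_mul_rowMat hI ht he he' h, Qmat_eq_colMat_mul_rowMat hI ht' he he' h] at hK
  have hne := h.ne
  have hner := h.ner
  have hR : rowMat I t a b * (single a 0 I⁻¹ + single b.rev 1 I⁻¹ : Matrix _ (Fin 2) F) = 1 := by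
    ext i j
    fin_cases i <;> fin_cases j <;>
      simp [rowMat_mul_apply, hI0, hne, hner, hner.symm, ne_rev, rev_ne, hne.symm]
  have hL : (single 0 a s⁻¹ + single 1 b.rev s⁻¹ : Matrix (Fin 2) _ F) * colMat I s t' a b = 1 := by
    ext i j
    fin_cases i <;> fin_cases j <;>
      simp [mul_colMat_apply, hs, hne, hner, hner.symm, ne_rev, rev_ne, hne.symm]
  set R : Matrix (Fin (2 * n)) (Fin 2) F := single a 0 I⁻¹ + single b.rev 1 I⁻¹
  set L : Matrix (Fin 2) (Fin (2 * n)) F := single 0 a s⁻¹ + single 1 b.rev s⁻¹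
  refine ⟨rowMat I t' a b * K * R, ?_, ?_⟩
  · calc rowMat I t' a b * K = L * (colMat I s t' a b * rowMat I t' a b * K) := by
          rw [Matrix.mul_assoc (colMat _ _ _ _ _), ← Matrix.mul_assoc L, hL, Matrix.one_mul]
      _ = L * (K * colMat I s t a b) * rowMat I t a b := by
          rw [← hK]; simp only [Matrix.mul_assoc]
      _ = L * (K * (colMat I s t a b * rowMat I t a b) * R) * rowMat I t a b := by
          simp only [Matrix.mul_assoc]
          rw [← Matrix.mul_assoc (rowMat I t a b) R, hR, Matrix.one_mul]
      _ = _ := by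
          rw [hK]
          simp only [Matrix.mul_assoc]
          rw [← Matrix.mul_assoc L (colMat _ _ _ _ _), hL, Matrix.one_mul]
  · calc K * colMat I s t a b = K * (colMat I s t a b * rowMat I t a b) * R := by
          simp only [Matrix.mul_assoc]
          rw [hR, Matrix.mul_one]
      _ = _ := by
          rw [hK]
          simp only [Matrix.mul_assoc]

/-- The matrices attached to two nodes are intertwined by their overlap. -/
lemma NodeMat.overlap {I s t t' u u' : F} {a b c d : Fin (2 * n)} {K : Mat n F}
    {G H : Matrix (Fin 2) (Fin 2) F} (hG : NodeMat I s t t' a b K G)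
    (hH : NodeMat I s u u' c d K H) :
    rowMat I t' a b * colMat I s u' c d * H = G * (rowMat I t a b * colMat I s u c d) := by
  rw [Matrix.mul_assoc, ← hH.col, ← Matrix.mul_assoc, hG.row, Matrix.mul_assoc]

/-! ### The 2×2 overlaps between the factors of two nodes. -/

section Overlap

variable (I s t u : F) {a b c : Fin (2 * n)}

lemma overlap_chain (h : Quad a b) (h1 : Quad b c) (h2 : Quad a c) :
    rowMat I 1 b c * colMat I s 1 a b = !![-(I * I) * s⁻¹, 0; 0, -s] := by
  have := h.ne; have := h.ner; have := h.symm.ne; have := h.symm.ner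
  have := h1.ne; have := h1.ner; have := h1.symm.ne; have := h1.symm.ner
  have := h2.ne; have := h2.ner; have := h2.symm.ne; have := h2.symm.ner
  ext i j
  fin_cases i <;> fin_cases j <;>
    simp [rowMat_mul_apply, colMat, Fin.rev_eq_iff, ne_rev, mul_assoc, *]

lemma overlap_fork (h : Quad a b) :
    rowMat I 1 a b.rev * colMat I s 1 a b = !![I * s, s; -(I * I) * s⁻¹, -(I * s⁻¹)] := by
  have := h.ne; have := h.ner; have := h.symm.ne; have := h.symm.ner
  ext i j
  fin_cases i <;> fin_cases j <;>
    simp [rowMat_mul_apply, colMat, Fin.rev_eq_iff, ne_rev, mul_assoc, *]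

lemma overlap_zero_one (h : Quad a b) :
    rowMat I t b.rev a * colMat I s 1 a b = !![t * s, I * s; -(t * -(I * s⁻¹)), I * (I * s⁻¹)] := by
  have := h.ne; have := h.ner; have := h.symm.ne; have := h.symm.ner
  ext i j
  fin_cases i <;> fin_cases j <;>
    simp [rowMat_mul_apply, colMat, Fin.rev_eq_iff, ne_rev, *]

lemma overlap_zero_two (h : Quad a b) (h1 : Quad b c) (h2 : Quad a c) :
    rowMat I t b.rev a * colMat I s 1 b c = !![0, I * I * s⁻¹; -(t * s), 0] := by
  have := h.ne; have := h.ner; have := h.symm.ne; have := h.symm.ner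
  have := h1.ne; have := h1.ner; have := h1.symm.ne; have := h1.symm.ner
  have := h2.ne; have := h2.ner; have := h2.symm.ne; have := h2.symm.ner
  ext i j
  fin_cases i <;> fin_cases j <;>
    simp [rowMat_mul_apply, colMat, Fin.rev_eq_iff, ne_rev, mul_assoc, *]

end Overlap

end Degenerate

/-! ### Relations between the 2×2 matrices of neighbouring nodes. -/

section Solutions

variable {n : ℕ} {F : Type*} [Field F]

section Relations

variable {I s t t' : F} {a b c : Fin (2 * n)} {K : Mat n F} {G H : Matrix (Fin 2) (Fin 2) F}

/-- The overlap of consecutive nodes is diagonal and invertible, so either matrix determines the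
other. -/
lemma NodeMat.chain (hI : I ^ 2 = -1) (hs : s ≠ 0) (h : Quad a b) (h1 : Quad b c) (h2 : Quad a c)
    (hG : NodeMat I s 1 1 b c K G) (hH : NodeMat I s 1 1 a b K H) :
    G = !![H 0 0, -(s⁻¹ ^ 2) * H 0 1; -(s ^ 2) * H 1 0, H 1 1] := by
  have hII : I * I = -1 := by rw [← sq, hI]
  have e := hG.overlap hH
  rw [overlap_chain I s h h1 h2, hII, neg_neg, one_mul] at e
  have ent := fun i j => congrFun (congrFun e i) j
  simp only [Matrix.mul_apply, Fin.sum_univ_two, Matrix.of_apply, Matrix.cons_val',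
    Matrix.cons_val_zero, Matrix.cons_val_one, Matrix.cons_val_fin_one] at ent
  have e00 := ent 0 0
  have e01 := ent 0 1
  have e10 := ent 1 0
  have e11 := ent 1 1
  simp at e00 e01 e10 e11
  ext i j
  fin_cases i <;> fin_cases j <;> simp <;> grind

/-- The two end nodes of the fork overlap in a matrix of rank one, which imposes relations on their
common matrix instead of determining it. -/
lemma NodeMat.fork (hI : I ^ 2 = -1) (hs : s ≠ 0) (h : Quad a b)
    (hG : NodeMat I s 1 1 a b.rev K G) (hH : NodeMat I s 1 1 a b K G) :
    G 0 1 = s ^ 2 * G 1 0 ∧ G 0 0 - G 1 1 = I * (1 + s⁻¹ ^ 2) * G 0 1 := by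
  have hII : I * I = -1 := by rw [← sq, hI]
  have e := hG.overlap hH
  rw [overlap_fork I s h, hII, neg_neg, one_mul] at e
  have ent := fun i j => congrFun (congrFun e i) j
  simp only [Matrix.mul_apply, Fin.sum_univ_two, Matrix.of_apply, Matrix.cons_val',
    Matrix.cons_val_zero, Matrix.cons_val_one, Matrix.cons_val_fin_one] at ent
  have e00 := ent 0 0
  have e01 := ent 0 1
  simp at e00 e01
  constructor <;> grind

lemma NodeMat.zero_two (hI : I ^ 2 = -1) (hs : s ≠ 0) (ht : t ≠ 0) (h : Quad a b) (h1 : Quad b c)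
    (h2 : Quad a c) (hG : NodeMat I s t t' b.rev a K G) (hH : NodeMat I s 1 1 b c K H) :
    G = !![H 1 1, s⁻¹ ^ 2 * t⁻¹ * H 1 0; t' * s ^ 2 * H 0 1, t' / t * H 0 0] := by
  have hII : I * I = -1 := by rw [← sq, hI]
  have e := hG.overlap hH
  rw [overlap_zero_two I s t h h1 h2, overlap_zero_two I s t' h h1 h2, hII] at e
  have ent := fun i j => congrFun (congrFun e i) j
  simp only [Matrix.mul_apply, Fin.sum_univ_two, Matrix.of_apply, Matrix.cons_val',
    Matrix.cons_val_zero, Matrix.cons_val_one, Matrix.cons_val_fin_one] at ent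
  have e00 := ent 0 0
  have e01 := ent 0 1
  have e10 := ent 1 0
  have e11 := ent 1 1
  simp at e00 e01 e10 e11
  ext i j
  fin_cases i <;> fin_cases j <;> simp <;> grind

lemma NodeMat.zero_one (hI : I ^ 2 = -1) (h : Quad a b)
    (hG : NodeMat I s t t' b.rev a K G) (hH : NodeMat I s 1 1 a b K H) :
    t' * s * H 0 0 + I * s * H 1 0 = G 0 0 * (t * s) + G 0 1 * (I * s⁻¹ * t) ∧
    t' * s * H 0 1 + I * s * H 1 1 = G 0 0 * (I * s) - G 0 1 * s⁻¹ := by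
  have hII : I * I = -1 := by rw [← sq, hI]
  have e := hG.overlap hH
  rw [overlap_zero_one I s t h, overlap_zero_one I s t' h] at e
  have ent := fun i j => congrFun (congrFun e i) j
  simp only [Matrix.mul_apply, Fin.sum_univ_two, Matrix.of_apply, Matrix.cons_val',
    Matrix.cons_val_zero, Matrix.cons_val_one, Matrix.cons_val_fin_one] at ent
  have e00 := ent 0 0
  have e01 := ent 0 1
  simp at e00 e01
  constructor <;> grind

end Relations

section Summary

variable {I s t t' : F} {K : Mat n F} {G : Fin (n + 1) → Matrix (Fin 2) (Fin 2) F}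

/-- The matrices `G j` describe the action of `K` on the factors of the generators. -/
def NodeMats (hn : 3 ≤ n) (I s t t' : F) (K : Mat n F)
    (G : Fin (n + 1) → Matrix (Fin 2) (Fin 2) F) :
    Prop :=
  ∀ j, NodeMat I s (nodeParam t j) (nodeParam t' j) (nodeA hn j) (nodeB hn j) K (G j)

lemma NodeMats.at_finite {hn : 3 ≤ n} (h : NodeMats hn I s t t' K G) {j : Fin (n + 1)}
    (hj : j.val ≠ 0) : NodeMat I s 1 1 (nodeA hn j) (nodeB hn j) K (G j) := by
  have := h j
  rwa [nodeParam, nodeParam, if_neg hj, if_neg hj] at this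

lemma quad_of_val {a b : Fin (2 * n)} (h : a.val ≠ b.val) (h' : a.val ≠ 2 * n - (b.val + 1)) :
    Quad a b :=
  ⟨fun e => h (by rw [e]), fun e => h' (by rw [e, Fin.val_rev])⟩

/-- The matrices of a solution are determined by two scalars. -/
lemma NodeMats.summary {hn : 3 ≤ n} (hI : I ^ 2 = -1) (hs : s ≠ 0) (ht : t ≠ 0)
    (h : NodeMats hn I s t t' K G) : ∃ A B C D : F,
    (∀ j : Fin (n + 1), j.val ≠ 0 → ∃ k : ℕ,
      G j = !![A, (-(s⁻¹ ^ 2)) ^ k * C; (-(s ^ 2)) ^ k * B, D]) ∧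
    G 0 = !![D, -(t⁻¹ * B); -(t' * C), t' / t * A] ∧
    C = s ^ 2 * ((-(s ^ 2)) ^ (n - 2)) ^ 2 * B ∧
    A - D = I * (1 + s⁻¹ ^ 2) * ((-(s⁻¹ ^ 2)) ^ (n - 2) * C) ∧
    t' * A - t * D + I * (1 + s⁻¹ ^ 2) * B = 0 ∧ B = s ^ 2 * (t * t') * C := by
  have nval := fun (j : ℕ) (hj : j < n + 1) => node_val hn ⟨j, hj⟩
  simp only at nval
  set G1 := G ⟨1, by omega⟩ with hG1
  have mid : ∀ k (hk : k + 1 < n),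
      G ⟨k + 1, by omega⟩
        = !![G1 0 0, (-(s⁻¹ ^ 2)) ^ k * G1 0 1; (-(s ^ 2)) ^ k * G1 1 0, G1 1 1] := by
    intro k
    induction k with
    | zero =>
      intro hk
      ext i j
      fin_cases i <;> fin_cases j <;> simp [hG1]
    | succ k ih =>
      intro hk
      have v1 := nval (k + 1) (by omega)
      have v2 := nval (k + 1 + 1) (by omega)
      have hH := h.at_finite (j := ⟨k + 1, by omega⟩) (by simp)
      have hH' := h.at_finite (j := ⟨k + 1 + 1, by omega⟩) (by simp)
      have e : nodeA hn ⟨k + 1 + 1, by omega⟩ = nodeB hn ⟨k + 1, by omega⟩ := Fin.ext (by omega)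
      rw [e] at hH'
      rw [NodeMat.chain hI hs (node_quad hn _) (e ▸ node_quad hn _)
        (quad_of_val (by omega) (by omega)) hH' hH, ih (by omega)]
      ext i j
      fin_cases i <;> fin_cases j <;> simp <;> ring
  -- Node `n` is attached to node `n - 2` in the same way as node `n - 1`, so it carries the same
  -- matrix.
  have top : G ⟨n, by omega⟩ = G ⟨n - 1, by omega⟩ := by
    obtain ⟨k, hk⟩ : ∃ k, n = k + 3 := ⟨n - 3, by omega⟩
    have v1 := nval (k + 1) (by omega)
    have v2 := nval n (by omega)
    have hH := h.at_finite (j := ⟨k + 1, by omega⟩) (by simp)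
    have hH' := h.at_finite (j := ⟨n, by omega⟩) (by simp; omega)
    have e : nodeA hn ⟨n, by omega⟩ = nodeB hn ⟨k + 1, by omega⟩ := Fin.ext (by omega)
    rw [e] at hH'
    have e2 : (⟨n - 1, by omega⟩ : Fin (n + 1)) = ⟨k + 1 + 1, by omega⟩ := Fin.ext (by simp; omega)
    rw [NodeMat.chain hI hs (node_quad hn _) (e ▸ node_quad hn _)
      (quad_of_val (by omega) (by omega)) hH' hH, mid k (by omega), e2, mid (k + 1) (by omega)]
    ext i j
    fin_cases i <;> fin_cases j <;> simp <;> ring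
  have hfork := by
    have v1 := nval (n - 1) (by omega)
    have v2 := nval n (by omega)
    have hH := h.at_finite (j := ⟨n - 1, by omega⟩) (by simp; omega)
    have hH' := h.at_finite (j := ⟨n, by omega⟩) (by simp; omega)
    have e : nodeA hn ⟨n, by omega⟩ = nodeA hn ⟨n - 1, by omega⟩ := Fin.ext (by omega)
    have e' : nodeB hn ⟨n, by omega⟩ = (nodeB hn ⟨n - 1, by omega⟩).rev :=
      Fin.ext (by rw [Fin.val_rev]; omega)
    rw [e, e', top] at hH'
    exact NodeMat.fork hI hs (node_quad hn _) hH' hH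
  have e1 : (⟨n - 1, by omega⟩ : Fin (n + 1)) = ⟨n - 2 + 1, by omega⟩ := Fin.ext (by simp; omega)
  rw [e1, mid (n - 2) (by omega)] at hfork
  simp at hfork
  have v0 := nval 0 (by omega)
  have v1 := nval 1 (by omega)
  have v2 := nval 2 (by omega)
  have a0 : nodeA hn 0 = (nodeB hn ⟨1, by omega⟩).rev := Fin.ext (by
    rw [Fin.val_rev]; simp only [Fin.zero_eta] at v0; omega)
  have b0 : nodeB hn 0 = nodeA hn ⟨1, by omega⟩ := Fin.ext (by
    simp only [Fin.zero_eta] at v0; omega)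
  have a2 : nodeA hn ⟨2, by omega⟩ = nodeB hn ⟨1, by omega⟩ := Fin.ext (by omega)
  have h0 := h 0
  have h1 := h.at_finite (j := ⟨1, by omega⟩) (by simp)
  have h2 := h.at_finite (j := ⟨2, by omega⟩) (by simp)
  have np : ∀ x : F, nodeParam x (0 : Fin (n + 1)) = x := fun x => if_pos rfl
  rw [np, np, a0, b0] at h0
  rw [a2] at h2
  -- The affine node has an invertible overlap with node `2`, which determines `G 0`, and a singular
  -- one with node `1`, which contributes two scalar relations.
  have z1 := NodeMat.zero_one hI (node_quad hn _) h0 h1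
  have z2 := NodeMat.zero_two hI hs ht (node_quad hn _) (a2 ▸ node_quad hn _)
    (quad_of_val (by omega) (by omega)) h0 h2
  rw [mid 1 (by omega)] at z2
  have hG0 : G 0 = !![G1 1 1, -(t⁻¹ * G1 1 0); -(t' * G1 0 1), t' / t * G1 0 0] := by
    rw [z2]
    ext i j
    fin_cases i <;> fin_cases j <;> simp <;> field_simp
  rw [hG0] at z1
  simp at z1
  refine ⟨G1 0 0, G1 1 0, G1 0 1, G1 1 1, fun j hj => ?_, hG0, ?_, ?_, ?_, ?_⟩
  · have hjn := j.isLt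
    by_cases hj' : j.val = n
    · refine ⟨n - 2, ?_⟩
      rw [show j = ⟨n, by omega⟩ from Fin.ext hj', top, e1, mid (n - 2) (by omega)]
    · refine ⟨j.val - 1, ?_⟩
      have := mid (j.val - 1) (by omega)
      rwa [show (⟨j.val - 1 + 1, by omega⟩ : Fin (n + 1)) = j from Fin.ext (by simp; omega)] at this
  · have hp : (-(s ^ 2)) ^ (n - 2) * (-(s⁻¹ ^ 2)) ^ (n - 2) = 1 := by
      rw [← mul_pow, show -(s ^ 2) * -(s⁻¹ ^ 2) = 1 by field_simp, one_pow]
    have := hfork.1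
    simp only [inv_pow] at this hp
    linear_combination (-(s ^ 2)) ^ (n - 2) * this - G1 0 1 * hp
  · have := hfork.2
    simp only [inv_pow] at this ⊢
    linear_combination this
  · obtain ⟨z3, -⟩ := z1
    clear_value G1
    grind
  · obtain ⟨-, z4⟩ := z1
    clear_value G1
    grind

end Summary

end Solutions

/-! ### Proportionality of solutions and the condition on the spectral parameters. -/

section Uniqueness

variable {n : ℕ} {F : Type*} [Field F] {I s t t' : F}

lemma under_node (hn : 3 ≤ n) {j : Fin (n + 1)} (hj : j.val ≠ 0) :
    under (nodeB hn j) = under (nodeA hn j) + 1 := by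
  have := node_val hn j
  simp only [under, num]
  split_ifs <;> omega

lemma twicePrime_node (hn : 3 ≤ n) {j : Fin (n + 1)} (hj : j.val ≠ 0) :
    twicePrime (nodeB hn j) = twicePrime (nodeA hn j) + 2 := by
  have := node_val hn j
  simp only [twicePrime, num]
  split_ifs <;> omega

lemma wvec_node (hn : 3 ≤ n) (hI : I ^ 2 = -1) {j : Fin (n + 1)} (hj : j.val ≠ 0) :
    wvec I (nodeB hn j) = -I * wvec I (nodeA hn j) := wvec_succ hI (under_node hn hj)

lemma vvec_node (hn : 3 ≤ n) (hI : I ^ 2 = -1) (hs : s ≠ 0) {j : Fin (n + 1)} (hj : j.val ≠ 0) :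
    vvec I s (nodeB hn j) = -I * s ^ 2 * vvec I s (nodeA hn j) :=
  vvec_succ hI hs (under_node hn hj) (twicePrime_node hn hj)

lemma wvec_ne_zero (hI : I ≠ 0) (a : Fin (2 * n)) : wvec I a ≠ 0 := zpow_ne_zero _ hI

lemma vvec_ne_zero (hI : I ≠ 0) (hs : s ≠ 0) (a : Fin (2 * n)) : vvec I s a ≠ 0 :=
  mul_ne_zero (zpow_ne_zero _ hI) (zpow_ne_zero _ hs)

lemma vvec_rev_node (hn : 3 ≤ n) (hI : I ^ 2 = -1) (hs : s ≠ 0) {j : Fin (n + 1)}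
    (hj : j.val ≠ 0) :
    vvec I s (nodeA hn j).rev = I * s ^ 2 * vvec I s (nodeB hn j).rev := by
  have h1 := wvec_node hn hI hj
  rw [wvec, wvec] at h1
  rw [vvec, vvec, under_rev, under_rev, h1, twicePrime_rev, twicePrime_rev, twicePrime_node hn hj,
    show 4 * (n : ℤ) + 2 - twicePrime (nodeA hn j) - 2 * n
      = (2 : ℕ) + (4 * n + 2 - (twicePrime (nodeA hn j) + 2) - 2 * n) by push_cast; ring,
    zpow_add₀ hs, zpow_natCast]
  linear_combination ((s ^ 2 * I ^ (-under (nodeA hn j))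
    * s ^ (4 * (n : ℤ) + 2 - (twicePrime (nodeA hn j) + 2) - 2 * n))) * hI

/-- The common kernel of the rows at the finite nodes is spanned by `wvec`. -/
lemma exists_eq_mul_wvec (hn : 3 ≤ n) (hI : I ^ 2 = -1) {k : Fin (2 * n) → F}
    (h : ∀ j : Fin (n + 1), j.val ≠ 0 → I * k (nodeA hn j) + 1 * k (nodeB hn j) = 0 ∧
      I * k (nodeB hn j).rev - 1 * k (nodeA hn j).rev = 0) : ∃ μ, ∀ c, k c = μ * wvec I c := by
  have hI0 := I_ne_zero hI
  set z : Fin (2 * n) := ⟨0, by omega⟩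
  refine ⟨k z / wvec I z, fun c => ?_⟩
  refine (finite_node_chain hn (fun c => k c = k z / wvec I z * wvec I c) (fun j hj => ?_) z c).mp
    (div_mul_cancel₀ _ (wvec_ne_zero hI0 z)).symm
  obtain ⟨h1, h2⟩ := h j hj
  have w := wvec_node hn hI hj
  set μ := k z / wvec I z
  rw [wvec_rev, wvec_rev]
  refine ⟨⟨fun e => ?_, fun e => ?_⟩, ⟨fun e => ?_, fun e => ?_⟩⟩
  · linear_combination h1 - I * e - μ * w
  · linear_combination -I * h1 + I * e + k (nodeA hn j) * hI + μ * I * w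
      - μ * wvec I (nodeA hn j) * hI
  · linear_combination -I * h2 - I * e + k (nodeB hn j).rev * hI - μ * w
  · linear_combination -h2 + I * e + I * μ * w - μ * wvec I (nodeA hn j) * hI

/-- The common kernel of the columns at the finite nodes is spanned by `vvec`. -/
lemma exists_eq_mul_vvec (hn : 3 ≤ n) (hI : I ^ 2 = -1) (hs : s ≠ 0) {k : Fin (2 * n) → F}
    (h : ∀ j : Fin (n + 1), j.val ≠ 0 →
      s * k (nodeA hn j) - I * s⁻¹ * 1⁻¹ * k (nodeB hn j) = 0 ∧
      s * k (nodeB hn j).rev + I * s⁻¹ * 1⁻¹ * k (nodeA hn j).rev = 0) :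
    ∃ μ, ∀ c, k c = μ * vvec I s c := by
  have hI0 := I_ne_zero hI
  set z : Fin (2 * n) := ⟨0, by omega⟩
  refine ⟨k z / vvec I s z, fun c => ?_⟩
  refine (finite_node_chain hn (fun c => k c = k z / vvec I s z * vvec I s c)
    (fun j hj => ?_) z c).mp (div_mul_cancel₀ _ (vvec_ne_zero hI0 hs z)).symm
  obtain ⟨h1, h2⟩ := h j hj
  have v := vvec_node hn hI hs hj
  have v' := vvec_rev_node hn hI hs hj
  set μ := k z / vvec I s z
  have e1 : k (nodeB hn j) = -I * s ^ 2 * k (nodeA hn j) := by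
    field_simp at h1
    linear_combination I * h1 + k (nodeB hn j) * hI
  have e2 : k (nodeA hn j).rev = I * s ^ 2 * k (nodeB hn j).rev := by
    field_simp at h2
    linear_combination -I * h2 + k (nodeA hn j).rev * hI
  have c1 : -I * s ^ 2 ≠ 0 := mul_ne_zero (neg_ne_zero.mpr hI0) (pow_ne_zero _ hs)
  have c2 : I * s ^ 2 ≠ 0 := mul_ne_zero hI0 (pow_ne_zero _ hs)
  rw [e1, e2, v, v', mul_left_comm μ, mul_left_comm μ]
  exact ⟨⟨fun e => by rw [e], fun e => mul_left_cancel₀ c1 e⟩,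
    ⟨fun e => mul_left_cancel₀ c2 e, fun e => by rw [e]⟩⟩

lemma node_zero (hn : 3 ≤ n) : (nodeA hn 0).val = 2 * n - 2 ∧ (nodeB hn 0).val = 0 := by
  simp [nodeA, nodeB]

lemma wvec_zero (hn : 3 ≤ n) (hI : I ^ 2 = -1) :
    wvec I (nodeA hn 0) = -I * wvec I (nodeB hn 0) := by
  refine wvec_succ hI ?_
  obtain ⟨h1, h2⟩ := node_zero hn
  simp only [under, num, h1, h2]
  split_ifs <;> omega

lemma vvec_zero (hn : 3 ≤ n) (hI : I ^ 2 = -1) (hs : s ≠ 0) :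
    vvec I s (nodeA hn 0) = -I * s ^ (4 * (n - 1)) * s⁻¹ ^ 2 * vvec I s (nodeB hn 0) := by
  have hw := wvec_zero hn hI
  obtain ⟨h1, h2⟩ := node_zero hn
  have t1 : twicePrime (nodeA hn 0) = 4 * n - 3 := by
    simp only [twicePrime, num, h1]
    split_ifs <;> omega
  have t2 : twicePrime (nodeB hn 0) = 3 := by
    simp only [twicePrime, num, h2]
    split_ifs <;> omega
  rw [wvec, wvec] at hw
  rw [vvec, vvec, hw, t1, t2,
    show 4 * (n : ℤ) - 3 - 2 * n = ((4 * (n - 1) : ℕ) : ℤ) + -(2 : ℕ) + (3 - 2 * n) by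
    push_cast [Nat.cast_sub (by omega : 1 ≤ n)]; ring, zpow_add₀ hs, zpow_add₀ hs, zpow_natCast,
    show s ^ (-((2 : ℕ) : ℤ)) = s⁻¹ ^ 2 by rw [zpow_neg, zpow_natCast, inv_pow]]
  ring

/-- A solution that kills all factors has rank one, and needs special parameters. -/
lemma NodeMats.eq_rank_one {hn : 3 ≤ n} (hI : I ^ 2 = -1) (hs : s ≠ 0) (ht : t ≠ 0) {K : Mat n F}
    {G : Fin (n + 1) → Matrix (Fin 2) (Fin 2) F} (h : NodeMats hn I s t t' K G)
    (hG : ∀ j, G j = 0) :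
    ∃ μ, (∀ x c, K x c = μ * (wvec I x * vvec I s c)) ∧
      (μ ≠ 0 → t' = -1 ∧ t * s ^ (4 * (n - 1)) = -1) := by
  have hI0 := I_ne_zero hI
  have hrow : ∀ j c, I * K (nodeA hn j) c + nodeParam t' j * K (nodeB hn j) c = 0 ∧
      I * K (nodeB hn j).rev c - nodeParam t' j * K (nodeA hn j).rev c = 0 := by
    intro j c
    have := (h j).row
    rw [hG j, Matrix.zero_mul] at this
    obtain ⟨e1, e2⟩ := rowMat_mul_apply I (nodeParam t' j) (nodeA hn j) (nodeB hn j) K c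
    rw [← e1, ← e2, this]
    exact ⟨rfl, rfl⟩
  have hcol : ∀ j c, s * K c (nodeA hn j) - I * s⁻¹ * (nodeParam t j)⁻¹ * K c (nodeB hn j) = 0 ∧
      s * K c (nodeB hn j).rev + I * s⁻¹ * (nodeParam t j)⁻¹ * K c (nodeA hn j).rev = 0 := by
    intro j c
    have := (h j).col
    rw [hG j, Matrix.mul_zero] at this
    obtain ⟨e1, e2⟩ := mul_colMat_apply I s (nodeParam t j) (nodeA hn j) (nodeB hn j) K c
    rw [← e1, ← e2, this]
    exact ⟨rfl, rfl⟩
  have fin1 : ∀ {i : Fin (n + 1)} (x : F), i.val ≠ 0 → nodeParam x i = 1 := fun x hi => if_neg hi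
  have np : ∀ x : F, nodeParam x (0 : Fin (n + 1)) = x := fun x => if_pos rfl
  have hw : ∀ c, ∃ μ, ∀ x, K x c = μ * wvec I x := fun c =>
    exists_eq_mul_wvec hn hI (k := fun x => K x c) fun j hj => by
      have := hrow j c
      rwa [fin1 _ hj] at this
  have hv : ∀ x, ∃ μ, ∀ c, K x c = μ * vvec I s c := fun x =>
    exists_eq_mul_vvec hn hI hs (k := fun c => K x c) fun j hj => by
      have := hcol j x
      rwa [fin1 _ hj] at this
  choose α hα using hw
  choose β hβ using hv
  set z := nodeB hn 0
  have hwz := wvec_ne_zero hI0 z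
  have hvz := vvec_ne_zero hI0 hs z
  -- All columns are multiples of `w` and all rows multiples of `v`, so `K` is a multiple of `w vᵀ`;
  -- the factor is read off at one entry.
  have hK : ∀ x c, K x c = K z z / (wvec I z * vvec I s z) * (wvec I x * vvec I s c) := by
    intro x c
    have e1 := hα c x
    have e2 := hα c z
    have e3 := hβ z c
    have e4 := hβ z z
    rw [e4, e1]
    have e5 : α c = β z * vvec I s c / wvec I z := by
      rw [eq_div_iff hwz, ← e2, e3]
    rw [e5]
    field_simp
  refine ⟨_, hK, fun hμ => ?_⟩
  set μ := K z z / (wvec I z * vvec I s z)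
  -- Evaluated on `w` and `v`, the affine conditions leave the factors `t' + 1` and `t q^{2(n-1)} +
  -- 1`.
  have e1 := (hrow 0 z).1
  have e2 := (hcol 0 z).1
  rw [np, hK, hK, wvec_zero hn hI] at e1
  rw [np, hK, hK, vvec_zero hn hI hs] at e2
  constructor
  · have : μ * wvec I z * vvec I s z * (t' + 1) = 0 := by
      linear_combination e1 - (-μ * wvec I z * vvec I s z) * hI
    exact eq_neg_of_add_eq_zero_left ((mul_eq_zero.mp this).resolve_left
      (mul_ne_zero (mul_ne_zero hμ hwz) hvz))
  · have : I * (μ * wvec I z * vvec I s z) * (t * s ^ (4 * (n - 1)) + 1) = 0 := by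
      have h3 : (t * s) * (t⁻¹ * s⁻¹) = 1 := by field_simp
      have h4 : s * s⁻¹ = 1 := by field_simp
      change s * (μ * (wvec I z * (-I * s ^ (4 * (n - 1)) * s⁻¹ ^ 2 * vvec I s z)))
        - I * s⁻¹ * t⁻¹ * (μ * (wvec I z * vvec I s z)) = 0 at e2
      clear_value μ
      linear_combination -(t * s) * e2 - I * μ * wvec I z * vvec I s z * h3
        - I * μ * wvec I z * vvec I s z * t * s ^ (4 * (n - 1)) * (s * s⁻¹ + 1) * h4
    exact eq_neg_of_add_eq_zero_left ((mul_eq_zero.mp this).resolve_left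
      (mul_ne_zero hI0 (mul_ne_zero (mul_ne_zero hμ hwz) hvz)))

/-- For `t' = -1` the matrix of the affine node is singular. -/
lemma NodeMats.singular {hn : 3 ≤ n} {K : Mat n F} {G : Fin (n + 1) → Matrix (Fin 2) (Fin 2) F}
    (hI : I ^ 2 = -1) (h : NodeMats hn I s t t' K G) (ht' : t' = -1) (ht : t ≠ -1) :
    G 0 0 0 + G 0 0 1 * I = 0 ∧ G 0 1 0 + G 0 1 1 * I = 0 := by
  have hI0 := I_ne_zero hI
  set W : Matrix (Fin (2 * n)) (Fin 1) F := Matrix.of fun x _ => wvec I x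
  have hfin : ∀ j : Fin (n + 1), j.val ≠ 0 → rowMat I 1 (nodeA hn j) (nodeB hn j) * W = 0 := by
    intro j hj
    have w := wvec_node hn hI hj
    ext i k
    obtain ⟨e1, e2⟩ := rowMat_mul_apply I 1 (nodeA hn j) (nodeB hn j) W k
    fin_cases i
    · refine e1.trans ?_
      change I * wvec I (nodeA hn j) + 1 * wvec I (nodeB hn j) = 0
      linear_combination w
    · refine e2.trans ?_
      change I * wvec I (nodeB hn j).rev - 1 * wvec I (nodeA hn j).rev = 0
      rw [wvec_rev, wvec_rev]
      linear_combination I * w - wvec I (nodeA hn j) * hI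
  -- The rows at the finite nodes kill `w`, hence also `K w`; so `w` is an eigenvector of `K`.
  obtain ⟨μ, hμ⟩ := exists_eq_mul_wvec hn hI (k := fun x => (K * W) x 0) fun j hj => by
    obtain ⟨e1, e2⟩ := rowMat_mul_apply I 1 (nodeA hn j) (nodeB hn j) (K * W) 0
    rw [← e1, ← e2, ← Matrix.mul_assoc, (h.at_finite hj).row, Matrix.mul_assoc, hfin j hj,
      Matrix.mul_zero]
    exact ⟨rfl, rfl⟩
  have h0 := h 0
  have np : ∀ x : F, nodeParam x (0 : Fin (n + 1)) = x := fun x => if_pos rfl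
  rw [np, np] at h0
  have w0 := wvec_zero hn hI
  have wne := wvec_ne_zero hI0 (nodeB hn 0)
  have hKW : rowMat I t' (nodeA hn 0) (nodeB hn 0) * (K * W)
      = G 0 * (rowMat I t (nodeA hn 0) (nodeB hn 0) * W) := by
    rw [← Matrix.mul_assoc, h0.row, Matrix.mul_assoc]
  obtain ⟨a1, a2⟩ := rowMat_mul_apply I t' (nodeA hn 0) (nodeB hn 0) (K * W) 0
  obtain ⟨b1, b2⟩ := rowMat_mul_apply I t (nodeA hn 0) (nodeB hn 0) W 0
  change _ = I * wvec I _ + t * wvec I _ at b1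
  change _ = I * wvec I _ - t * wvec I _ at b2
  rw [hμ, hμ, ht'] at a1 a2
  rw [wvec_rev, wvec_rev] at a2 b2
  have ht1 : (1 + t) * wvec I (nodeB hn 0) ≠ 0 :=
    mul_ne_zero (fun e => ht (by linear_combination e)) wne
  have c : ∀ i, (G 0 * (rowMat I t (nodeA hn 0) (nodeB hn 0) * W)) i 0
      = G 0 i 0 * ((1 + t) * wvec I (nodeB hn 0))
        + G 0 i 1 * (I * ((1 + t) * wvec I (nodeB hn 0))) := by
    intro i
    rw [Matrix.mul_apply, Fin.sum_univ_two, b1, b2, w0]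
    linear_combination (-(G 0 i 0 * wvec I (nodeB hn 0))) * hI
  -- For `t' = -1` the affine rows in the target kill `w`, whereas those in the source, with `t ≠
  -- -1`, send it to a nonzero multiple of `(1, i)`. So `G 0` kills `(1, i)`.
  have hz : ∀ i, (rowMat I t' (nodeA hn 0) (nodeB hn 0) * (K * W)) i 0 = 0 := by
    intro i
    fin_cases i
    · rw [← ht'] at a1
      refine a1.trans ?_
      rw [w0, ht']
      linear_combination (-(μ * wvec I (nodeB hn 0))) * hI
    · rw [← ht'] at a2
      refine a2.trans ?_
      rw [w0, ht']
      ring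
  rw [hKW] at hz
  have z0 := (c 0).symm.trans (hz 0)
  have z1 := (c 1).symm.trans (hz 1)
  exact ⟨(mul_eq_zero.mp (by linear_combination z0 :
    (G 0 0 0 + G 0 0 1 * I) * ((1 + t) * wvec I (nodeB hn 0)) = 0)).resolve_right ht1,
    (mul_eq_zero.mp (by linear_combination z1 :
    (G 0 1 0 + G 0 1 1 * I) * ((1 + t) * wvec I (nodeB hn 0)) = 0)).resolve_right ht1⟩

/-- The matrices vanish as soon as one entry does. -/
lemma NodeMats.eq_zero_of_apply {hn : 3 ≤ n} {K : Mat n F}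
    {G : Fin (n + 1) → Matrix (Fin 2) (Fin 2) F} (hI : I ^ 2 = -1) (hs : s ≠ 0) (ht : t ≠ 0)
    (htt : t ≠ t') (h : NodeMats hn I s t t' K G) {i : Fin (n + 1)} (hi : i.val ≠ 0)
    (hG : G i 0 1 = 0) : ∀ j, G j = 0 := by
  obtain ⟨A, B, C, D, hj, h0, -, e2, e3, e4⟩ := h.summary hI hs ht
  have hC : C = 0 := by
    obtain ⟨k, e⟩ := hj i hi
    rw [e] at hG
    simpa [hs] using hG
  have hB : B = 0 := by rw [e4, hC, mul_zero]
  have hA : A = 0 := by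
    rw [hC, mul_zero, mul_zero] at e2
    rw [hB, ← sub_eq_zero.mp e2] at e3
    have : (t' - t) * A = 0 := by linear_combination e3
    exact (mul_eq_zero.mp this).resolve_left (sub_ne_zero.mpr htt.symm)
  have hD : D = 0 := by
    rw [hC, hA] at e2
    linear_combination -e2
  have hz : (!![0, 0; 0, 0] : Matrix (Fin 2) (Fin 2) F) = 0 := by
    ext i j
    fin_cases i <;> fin_cases j <;> rfl
  intro j
  by_cases hj0 : j.val = 0
  · rw [show j = 0 from Fin.ext hj0, h0, hA, hB, hC, hD]
    simpa using hz
  · obtain ⟨k, e⟩ := hj j hj0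
    rw [e, hA, hB, hC, hD]
    simpa using hz

/-- If `C ≠ 0`, the relations between `B` and `C` give `t t' q^{2(n-1)} = 1`, so `t' = -1`. The
singularity of `G 0` then adds two linear relations, and eliminating the unknowns leaves an equation
for `q` that only roots of unity solve. -/
lemma NodeMats.eq_zero {hn : 3 ≤ n} {K : Mat n F} {G : Fin (n + 1) → Matrix (Fin 2) (Fin 2) F}
    (hI : I ^ 2 = -1) (hs : s ≠ 0) (ht : t ≠ 0) (htt : t ≠ t')
    (h : NodeMats hn I s t t' K G) (h1 : t' = -1 ∨ t * t' * s ^ (4 * (n - 1)) ≠ 1)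
    (hq : ∀ k : ℕ, k ≠ 0 → s ^ k ≠ 1) : ∀ j, G j = 0 := by
  have hI0 := I_ne_zero hI
  obtain ⟨A, B, C, D, hj, h0, e1, e2, e3, e4⟩ := h.summary hI hs ht
  have hC : C = 0 := by
    by_contra hC
    have hp : ((-(s ^ 2)) ^ (n - 2)) ^ 2 * s ^ 4 = s ^ (4 * (n - 1)) := by
      obtain ⟨k, rfl⟩ : ∃ k, n = k + 3 := ⟨n - 3, by omega⟩
      rw [show k + 3 - 2 = k + 1 by omega, show 4 * (k + 3 - 1) = 4 * (k + 1) + 4 by omega,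
        ← pow_mul,
        mul_comm (k + 1) 2, pow_mul (-(s ^ 2)) 2, neg_sq, ← pow_mul, ← pow_mul]
      ring
    have h2 : t * t' * s ^ (4 * (n - 1)) = 1 := by
      rw [e4] at e1
      refine mul_right_cancel₀ hC ?_
      rw [← hp]
      linear_combination -e1
    have ht' : t' = -1 := h1.resolve_right (not_not_intro h2)
    obtain ⟨d1, d2⟩ := h.singular hI ht' (by rwa [← ht'])
    rw [h0] at d1 d2
    simp at d1 d2
    have hD : D = -I * s ^ 2 * C := by
      rw [e4, ht'] at d1
      field_simp at d1
      linear_combination d1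
    have hA : A = -I * t * C := by
      rw [ht'] at d2
      field_simp at d2
      linear_combination I * d2 + A * hI
    have h3 : (s ^ 2 - t) * s ^ 2 * (-(s ^ 2)) ^ (n - 2) = s ^ 2 + 1 := by
      have h4 : (-(s ^ 2)) ^ (n - 2) * (-(s⁻¹ ^ 2)) ^ (n - 2) = 1 := by
        rw [← mul_pow, show -(s ^ 2) * -(s⁻¹ ^ 2) = 1 by field_simp, one_pow]
      have h5 : s ^ 2 * s⁻¹ ^ 2 = 1 := by field_simp
      rw [hA, hD] at e2
      refine mul_left_cancel₀ (mul_ne_zero hI0 hC) ?_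
      linear_combination s ^ 2 * (-(s ^ 2)) ^ (n - 2) * e2 + I * C * (s ^ 2 + 1) * h4
        + I * C * (-(s ^ 2)) ^ (n - 2) * (-(s⁻¹ ^ 2)) ^ (n - 2) * h5
    have h6 : (-(s ^ 2)) ^ (n - 2) * s ^ 2 = (-1) ^ n * s ^ (2 * (n - 1)) := by
      obtain ⟨k, rfl⟩ : ∃ k, n = k + 2 := ⟨n - 2, by omega⟩
      rw [show k + 2 - 2 = k by omega, show 2 * (k + 2 - 1) = 2 * k + 2 by omega, neg_pow, pow_add,
        pow_add, pow_mul]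
      ring
    have h7 : t * (s ^ (2 * (n - 1))) ^ 2 = -1 := by
      rw [← pow_mul, show 2 * (n - 1) * 2 = 4 * (n - 1) by ring]
      rw [ht'] at h2
      linear_combination -h2
    have hε : ((-1 : F) ^ n) * (-1) ^ n = 1 := neg_one_pow_mul_self n
    -- What remains is `(q^{n-1} - ε)(q^n - ε) = 0` with `ε = (-1)^n`.
    have h8 : (s ^ (2 * (n - 1)) - (-1) ^ n) * (s ^ (2 * (n - 1)) * s ^ 2 - (-1) ^ n) = 0 := by
      generalize (-(s ^ 2)) ^ (n - 2) = m at h3 h6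
      have h9 : (s ^ 2 - t) * ((-1) ^ n * s ^ (2 * (n - 1))) = s ^ 2 + 1 := by
        rw [← h6]
        linear_combination h3
      generalize s ^ (2 * (n - 1)) = p at h7 h9
      generalize (-1 : F) ^ n = ε at hε h9
      linear_combination ε * p * h9 - p ^ 2 * (s ^ 2 - t) * hε + hε + h7
    rcases mul_eq_zero.mp h8 with h9 | h9
    · refine hq (2 * (n - 1) * 2) (by omega) ?_
      rw [pow_mul, sub_eq_zero.mp h9, sq, hε]
    · refine hq ((2 * (n - 1) + 2) * 2) (by omega) ?_
      rw [pow_mul, pow_add, sub_eq_zero.mp h9, sq, hε]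
  obtain ⟨k, e⟩ := hj ⟨n, by omega⟩ (by simp; omega)
  refine h.eq_zero_of_apply hI hs ht htt (i := ⟨n, by omega⟩) (by simp; omega) ?_
  rw [e, hC]
  simp

lemma NodeMats.sub_smul {hn : 3 ≤ n} {K L : Mat n F} {G H : Fin (n + 1) → Matrix (Fin 2) (Fin 2) F}
    (hG : NodeMats hn I s t t' K G) (hH : NodeMats hn I s t t' L H) (c : F) :
    NodeMats hn I s t t' (L - c • K) fun j => H j - c • G j := by
  intro j
  constructor
  · rw [Matrix.mul_sub, Matrix.mul_smul, (hG j).row, (hH j).row, Matrix.sub_mul, Matrix.smul_mul]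
  · rw [Matrix.sub_mul, Matrix.smul_mul, (hG j).col, (hH j).col, Matrix.mul_sub, Matrix.mul_smul]

section Conclusion

variable {e : F} {K : Mat n F}

lemma exists_nodeMats (hn : 3 ≤ n) (hI : I ^ 2 = -1) (hs : s ≠ 0) (ht : t ≠ 0) (ht' : t' ≠ 0)
    (he : e * (s ^ 2 - 1) = I * s) (he' : e * (s⁻¹ ^ 2 - 1) = -I * s⁻¹)
    (hK : ∀ j, K * Qmat s e (nodeParam t j) (nodeA hn j) (nodeB hn j)
      = Qmat s e (nodeParam t' j) (nodeA hn j) (nodeB hn j) * K) :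
    ∃ G, NodeMats hn I s t t' K G := by
  have np : ∀ {x : F} (i : Fin (n + 1)), x ≠ 0 → nodeParam x i ≠ 0 := by
    intro x i hx
    rw [nodeParam]
    split_ifs
    exacts [hx, one_ne_zero]
  choose G hG using fun j =>
    exists_nodeMat hI hs (np j ht) (np j ht') he he' (node_quad hn j) (hK j)
  exact ⟨G, hG⟩

/-- Nonzero solutions exist only for `η² = q^{2-2n}`. -/
theorem param_of_ne_zero (hn : 3 ≤ n) (hI : I ^ 2 = -1) (hs : s ≠ 0)
    (hq : ∀ k : ℕ, k ≠ 0 → s ^ k ≠ 1) (ht : t ≠ 0) (ht' : t' ≠ 0) (htt : t ≠ t')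
    (he : e * (s ^ 2 - 1) = I * s) (he' : e * (s⁻¹ ^ 2 - 1) = -I * s⁻¹)
    (hK : ∀ j, K * Qmat s e (nodeParam t j) (nodeA hn j) (nodeB hn j)
      = Qmat s e (nodeParam t' j) (nodeA hn j) (nodeB hn j) * K) (hK0 : K ≠ 0) :
    t * t' * s ^ (4 * (n - 1)) = 1 := by
  by_contra h1
  obtain ⟨G, hG⟩ := exists_nodeMats hn hI hs ht ht' he he' hK
  -- If the relation fails, all `G_j` vanish and `K` has rank one. But then `t' = -1` and `t
  -- q^{2(n-1)} = -1`, whose product is the relation.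
  obtain ⟨μ, hμ, hμ'⟩ := hG.eq_rank_one hI hs ht (hG.eq_zero hI hs ht htt (Or.inr h1) hq)
  have hμ0 : μ ≠ 0 := by
    rintro rfl
    exact hK0 (Matrix.ext fun x c => by rw [hμ, zero_mul, Matrix.zero_apply])
  obtain ⟨h2, h3⟩ := hμ' hμ0
  exact h1 (by rw [h2]; linear_combination -h3)

/-- Any two nonzero solutions are proportional. -/
theorem exists_smul_of_ne_zero (hn : 3 ≤ n) (hI : I ^ 2 = -1) (hs : s ≠ 0)
    (hq : ∀ k : ℕ, k ≠ 0 → s ^ k ≠ 1) (ht : t ≠ 0) (ht' : t' ≠ 0) (htt : t ≠ t')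
    (he : e * (s ^ 2 - 1) = I * s) (he' : e * (s⁻¹ ^ 2 - 1) = -I * s⁻¹)
    (hK : ∀ j, K * Qmat s e (nodeParam t j) (nodeA hn j) (nodeB hn j)
      = Qmat s e (nodeParam t' j) (nodeA hn j) (nodeB hn j) * K) (hK0 : K ≠ 0) {L : Mat n F}
    (hL : ∀ j, L * Qmat s e (nodeParam t j) (nodeA hn j) (nodeB hn j)
      = Qmat s e (nodeParam t' j) (nodeA hn j) (nodeB hn j) * L) : ∃ c : F, L = c • K := by
  -- For `t' = -1` every solution is a multiple of `w vᵀ`. Otherwise a solution whose matrix at node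
  -- `n` has zero entry `0 1` is zero, so a suitable combination of two solutions vanishes.
  by_cases h1 : t' = -1
  · have rank : ∀ M : Mat n F, (∀ j, M * Qmat s e (nodeParam t j) (nodeA hn j) (nodeB hn j)
        = Qmat s e (nodeParam t' j) (nodeA hn j) (nodeB hn j) * M) →
        ∃ μ, ∀ x c, M x c = μ * (wvec I x * vvec I s c) := by
      intro M hM
      obtain ⟨G, hG⟩ := exists_nodeMats hn hI hs ht ht' he he' hM
      obtain ⟨μ, hμ, -⟩ := hG.eq_rank_one hI hs ht (hG.eq_zero hI hs ht htt (Or.inl h1) hq)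
      exact ⟨μ, hμ⟩
    obtain ⟨μ, hμ⟩ := rank K hK
    obtain ⟨ν, hν⟩ := rank L hL
    have hμ0 : μ ≠ 0 := by
      rintro rfl
      exact hK0 (Matrix.ext fun x c => by rw [hμ, zero_mul, Matrix.zero_apply])
    refine ⟨ν / μ, Matrix.ext fun x c => ?_⟩
    rw [Matrix.smul_apply, smul_eq_mul, hμ, hν, ← mul_assoc (ν / μ), div_mul_cancel₀ _ hμ0]
  · have zero : ∀ (M : Mat n F) (G), NodeMats hn I s t t' M G →
        G ⟨n, by omega⟩ 0 1 = 0 → M = 0 := by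
      intro M G hG h0
      obtain ⟨μ, hμ, hμ'⟩ := hG.eq_rank_one hI hs ht
        (hG.eq_zero_of_apply hI hs ht htt (by simp; omega) h0)
      have hμ0 : μ = 0 := by
        by_contra h
        exact h1 (hμ' h).1
      exact Matrix.ext fun x c => by rw [hμ, hμ0, zero_mul, Matrix.zero_apply]
    obtain ⟨G, hG⟩ := exists_nodeMats hn hI hs ht ht' he he' hK
    obtain ⟨H, hH⟩ := exists_nodeMats hn hI hs ht ht' he he' hL
    have hG0 : G ⟨n, by omega⟩ 0 1 ≠ 0 := fun h0 => hK0 (zero K G hG h0)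
    refine ⟨H ⟨n, by omega⟩ 0 1 / G ⟨n, by omega⟩ 0 1,
      sub_eq_zero.mp (zero _ _ (hG.sub_smul hH _) ?_)⟩
    rw [Matrix.sub_apply, Matrix.smul_apply, smul_eq_mul, div_mul_cancel₀ _ hG0, sub_self]

end Conclusion

end Uniqueness

/-! ### Independence of the signs of the `ε_j` -/

section Gauge

variable {n : ℕ} {F : Type*} [Field F]

lemma diagonal_mul_Xmat_mul_diagonal {a b : Fin (2 * n)} {d : Fin (2 * n) → F}
    (hd : d b.rev * d a.rev = d a * d b) :
    Matrix.diagonal d * Xmat a b * Matrix.diagonal d = (d a * d b) • Xmat a b := by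
  ext x y
  rw [Matrix.mul_diagonal, Matrix.diagonal_mul, Matrix.smul_apply, smul_eq_mul, Xmat,
    Matrix.sub_apply, Matrix.single_apply, Matrix.single_apply]
  have h1 : d x * (if a = x ∧ b = y then (1 : F) else 0) * d y
      = d a * d b * if a = x ∧ b = y then 1 else 0 := by
    split_ifs with h
    · rw [h.1, h.2]; ring
    · ring
  have h2 : d x * (if b.rev = x ∧ a.rev = y then (1 : F) else 0) * d y
      = d a * d b * if b.rev = x ∧ a.rev = y then 1 else 0 := by
    rw [← hd]
    split_ifs with h
    · rw [h.1, h.2]; ring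
    · ring
  linear_combination h1 - h2

lemma diagonal_mul_self {d : Fin (2 * n) → F} (hd : ∀ c, d c * d c = 1) :
    Matrix.diagonal d * Matrix.diagonal d = 1 := by
  rw [Matrix.diagonal_mul_diagonal]
  simp [hd]

/-- A diagonal change of signs absorbs the sign `δ` of the parameter `ε` in the spectral
parameter. -/
lemma diagonal_mul_Qmat_mul_diagonal {s e t δ γ : F} {a b : Fin (2 * n)} {d : Fin (2 * n) → F}
    (hδ : δ * δ = 1) (hγ : γ * γ = 1) (hd : ∀ c, d c * d c = 1) (hab : d a * d b = γ)
    (hr : d b.rev * d a.rev = γ) :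
    Matrix.diagonal d * Qmat s (δ * e) t a b * Matrix.diagonal d
      = δ • Qmat s e (δ * γ * t) a b := by
  have hinv : (δ * γ * t)⁻¹ = δ * γ * t⁻¹ := by
    rw [mul_inv, mul_inv, inv_eq_of_mul_eq_one_left hδ, inv_eq_of_mul_eq_one_left hγ]
  have h1 := diagonal_mul_Xmat_mul_diagonal (hr.trans hab.symm)
  have h2 : Matrix.diagonal d * Xmat b a * Matrix.diagonal d = γ • Xmat b a := by
    have := diagonal_mul_Xmat_mul_diagonal (a := b) (b := a) (d := d)
      (by rw [mul_comm, hr, mul_comm, hab])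
    rwa [mul_comm (d b), hab] at this
  rw [hab] at h1
  have h3 : ∀ f : Fin (2 * n) → F, Matrix.diagonal d * Matrix.diagonal f
      = Matrix.diagonal f * Matrix.diagonal d := by
    intro f
    rw [Matrix.diagonal_mul_diagonal, Matrix.diagonal_mul_diagonal]
    simp only [mul_comm]
  have hsc : δ * (δ * γ * t) = γ * t := by linear_combination γ * t * hδ
  have hsc' : δ * (δ * γ * t⁻¹) = γ * t⁻¹ := by linear_combination γ * t⁻¹ * hδ
  rw [Qmat, Qmat, hinv, smul_add, ← Matrix.mul_smul, smul_add, smul_smul, smul_smul, smul_smul,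
    hsc, hsc', Matrix.mul_add, Matrix.add_mul, ← Matrix.mul_assoc, h3, Matrix.mul_assoc,
    Matrix.mul_assoc, ← Matrix.mul_assoc (Matrix.diagonal d), Matrix.mul_add, Matrix.add_mul,
    Matrix.mul_smul, Matrix.mul_smul, Matrix.smul_mul, Matrix.smul_mul, h1, h2, smul_smul,
    smul_smul, Matrix.mul_smul, Matrix.smul_mul, Matrix.mul_sub, Matrix.sub_mul, h3,
    Matrix.mul_assoc, Matrix.mul_one, diagonal_mul_self hd, Matrix.mul_one, mul_comm t,
    mul_comm t⁻¹]

/-- The value at `j` of a function of the nodes, extended by `1` beyond `n`. -/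
def nodeValue (δ : Fin (n + 1) → F) (j : ℕ) : F := if h : j < n + 1 then δ ⟨j, h⟩ else 1

/-- Signs `d_a` with `d_a d_b = δ_j` for `π(x_j^+) = E_{ab} - E_{b̄ā}`, `j ≠ 0`. -/
def gaugeSign (δ : Fin (n + 1) → F) (a : Fin (2 * n)) : F :=
  if a.val < n then ∏ m ∈ Finset.range a.val, nodeValue δ (m + 1)
  else nodeValue δ (n - 1) * nodeValue δ n
    * ∏ m ∈ Finset.range a.rev.val, nodeValue δ (m + 1)

variable {δ : Fin (n + 1) → F}

lemma nodeValue_mul_self (hδ : ∀ j, δ j * δ j = 1) (j : ℕ) :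
    nodeValue δ j * nodeValue δ j = 1 := by
  unfold nodeValue
  split_ifs
  exacts [hδ _, one_mul 1]

lemma prod_nodeValue_mul_self (hδ : ∀ j, δ j * δ j = 1) (k : ℕ) :
    (∏ m ∈ Finset.range k, nodeValue δ (m + 1)) * ∏ m ∈ Finset.range k, nodeValue δ (m + 1)
      = 1 := by
  rw [← Finset.prod_mul_distrib]
  exact Finset.prod_eq_one fun m _ => nodeValue_mul_self hδ _

lemma gaugeSign_rev (hδ : ∀ j, δ j * δ j = 1) (a : Fin (2 * n)) :
    gaugeSign δ a.rev = nodeValue δ (n - 1) * nodeValue δ n * gaugeSign δ a := by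
  have h1 := nodeValue_mul_self hδ (n - 1)
  have h2 := nodeValue_mul_self hδ n
  have h3 : a.rev.val = 2 * n - 1 - a.val := by rw [Fin.val_rev]; omega
  have := a.isLt
  unfold gaugeSign
  rw [Fin.rev_rev]
  by_cases h : a.val < n
  · rw [if_neg (by omega), if_pos h]
  · rw [if_pos (by omega), if_neg h]
    generalize ∏ m ∈ Finset.range a.rev.val, nodeValue δ (m + 1) = P
    linear_combination -P * (nodeValue δ n * nodeValue δ n) * h1 - P * h2

lemma gaugeSign_mul_self (hδ : ∀ j, δ j * δ j = 1) (a : Fin (2 * n)) :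
    gaugeSign δ a * gaugeSign δ a = 1 := by
  have h1 := nodeValue_mul_self hδ (n - 1)
  have h2 := nodeValue_mul_self hδ n
  unfold gaugeSign
  split_ifs
  · exact prod_nodeValue_mul_self hδ _
  · have h3 := prod_nodeValue_mul_self hδ a.rev.val
    generalize ∏ m ∈ Finset.range a.rev.val, nodeValue δ (m + 1) = P at h3 ⊢
    linear_combination P * P * (nodeValue δ n * nodeValue δ n) * h1 + P * P * h2 + h3

lemma gaugeSign_rev_mul_rev (hδ : ∀ j, δ j * δ j = 1) (a b : Fin (2 * n)) :
    gaugeSign δ b.rev * gaugeSign δ a.rev = gaugeSign δ a * gaugeSign δ b := by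
  have h1 := nodeValue_mul_self hδ (n - 1)
  have h2 := nodeValue_mul_self hδ n
  rw [gaugeSign_rev hδ, gaugeSign_rev hδ]
  linear_combination gaugeSign δ a * gaugeSign δ b * (nodeValue δ n * nodeValue δ n) * h1
    + gaugeSign δ a * gaugeSign δ b * h2

lemma gaugeSign_node (hn : 3 ≤ n) (hδ : ∀ j, δ j * δ j = 1) {j : Fin (n + 1)} (hj : j.val ≠ 0) :
    gaugeSign δ (nodeA hn j) * gaugeSign δ (nodeB hn j) = δ j := by
  have hv : nodeValue δ j.val = δ j := by rw [nodeValue, dif_pos j.isLt]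
  rcases node_val hn j with ⟨h, -⟩ | ⟨-, h, ha, hb⟩ | ⟨h1, h2, ha, hb⟩
  · exact absurd h hj
  · have hr : (nodeB hn j).rev.val = n - 2 + 1 := by rw [Fin.val_rev, hb]; omega
    have h3 := prod_nodeValue_mul_self hδ (n - 2)
    have h4 := nodeValue_mul_self hδ (n - 1)
    rw [gaugeSign, gaugeSign, if_pos (by omega), if_neg (by omega), hr, ha,
      Finset.prod_range_succ, ← hv, h, show n - 2 + 1 = n - 1 by omega]
    generalize ∏ m ∈ Finset.range (n - 2), nodeValue δ (m + 1) = P at h3 ⊢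
    linear_combination nodeValue δ n * (nodeValue δ (n - 1) * nodeValue δ (n - 1)) * h3
      + nodeValue δ n * h4
  · obtain ⟨k, hk⟩ : ∃ k, j.val = k + 1 := ⟨j.val - 1, by omega⟩
    have h3 := prod_nodeValue_mul_self hδ k
    rw [gaugeSign, gaugeSign, if_pos (by omega), if_pos (by omega), ha, hb, hk,
      Nat.add_sub_cancel, Finset.prod_range_succ, ← hv, hk, ← mul_assoc, h3, one_mul]

/-- Up to a common sign of the spectral parameters, the signs of the `ε_j` are immaterial. -/
theorem exists_gauge (hn : 3 ≤ n) {s e t t' : F} {δ : Fin (n + 1) → F}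
    (hδ : ∀ j, δ j * δ j = 1) {K : Mat n F} (hK0 : K ≠ 0)
    (hK : ∀ j, K * Qmat s (δ j * e) (nodeParam t j) (nodeA hn j) (nodeB hn j)
      = Qmat s (δ j * e) (nodeParam t' j) (nodeA hn j) (nodeB hn j) * K) :
    ∃ (κ : F) (L : Mat n F), κ * κ = 1 ∧ L ≠ 0 ∧
      ∀ j, L * Qmat s e (nodeParam (κ * t) j) (nodeA hn j) (nodeB hn j)
        = Qmat s e (nodeParam (κ * t') j) (nodeA hn j) (nodeB hn j) * L := by
  set d : Fin (2 * n) → F := gaugeSign δ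
  have hd : ∀ c, d c * d c = 1 := gaugeSign_mul_self hδ
  have hD := diagonal_mul_self hd
  set D := Matrix.diagonal d
  set γ : Fin (n + 1) → F := fun j => d (nodeA hn j) * d (nodeB hn j)
  have hγ : ∀ j, γ j * γ j = 1 := fun j => by
    have h1 := hd (nodeA hn j)
    have h2 := hd (nodeB hn j)
    simp only [γ]
    linear_combination d (nodeB hn j) * d (nodeB hn j) * h1 + h2
  -- The signs `d` are chosen so that `δ_j γ_j = 1` at the finite nodes, whose parameter stays `1`.
  -- At the affine node nothing is left to choose, and the sign `κ = δ_0 γ_0` remains.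
  have hpar : ∀ (x : F) (j : Fin (n + 1)), δ j * γ j * nodeParam x j
      = nodeParam (δ 0 * γ 0 * x) j := by
    intro x j
    by_cases h : j.val = 0
    · obtain rfl : j = 0 := Fin.ext h
      rw [nodeParam, nodeParam, if_pos h, if_pos h]
    · rw [nodeParam, nodeParam, if_neg h, if_neg h, mul_one]
      simp only [γ, d]
      rw [gaugeSign_node hn hδ h, hδ]
  have hQ : ∀ (x : F) j, D * Qmat s (δ j * e) (nodeParam x j) (nodeA hn j) (nodeB hn j) * D
      = δ j • Qmat s e (nodeParam (δ 0 * γ 0 * x) j) (nodeA hn j) (nodeB hn j) := by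
    intro x j
    rw [← hpar]
    exact diagonal_mul_Qmat_mul_diagonal (hδ j) (hγ j) hd rfl (gaugeSign_rev_mul_rev hδ _ _)
  refine ⟨δ 0 * γ 0, D * K * D, ?_, fun h => hK0 ?_, fun j => ?_⟩
  · linear_combination γ 0 * γ 0 * hδ 0 + hγ 0
  · calc K = D * D * K * (D * D) := by rw [hD, Matrix.one_mul, Matrix.mul_one]
      _ = D * (D * K * D) * D := by simp only [Matrix.mul_assoc]
      _ = 0 := by rw [h, Matrix.mul_zero, Matrix.zero_mul]
  · have h0 : δ j ≠ 0 := fun h => by simpa [h] using hδ j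
    refine smul_right_injective _ h0 ?_
    simp only
    rw [← Matrix.mul_smul, ← Matrix.smul_mul, ← hQ, ← hQ]
    calc D * K * D * (D * Qmat s (δ j * e) (nodeParam t j) (nodeA hn j) (nodeB hn j) * D)
        = D * K * (D * D) * Qmat s (δ j * e) (nodeParam t j) (nodeA hn j) (nodeB hn j) * D := by
          simp only [Matrix.mul_assoc]
      _ = D * (K * Qmat s (δ j * e) (nodeParam t j) (nodeA hn j) (nodeB hn j)) * D := by
          rw [hD, Matrix.mul_one]; simp only [Matrix.mul_assoc]
      _ = D * Qmat s (δ j * e) (nodeParam t' j) (nodeA hn j) (nodeB hn j) * (D * D) * K * D := by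
          rw [hK, hD, Matrix.mul_one]; simp only [Matrix.mul_assoc]
      _ = _ := by simp only [Matrix.mul_assoc]

end Gauge

/-! ### The intertwiners over `ℂ((h))` -/

section Specialization

variable {n : ℕ}

/-- The coefficient of `h` in `e^{kh/2}` is `k/2`. -/
lemma s_pow_ne_one (k : ℕ) (hk : k ≠ 0) : s ^ k ≠ 1 := by
  have hs : ∀ k : ℕ, qpow (1 / 2) ^ k = qpow (k / 2) := by
    intro k
    induction k with
    | zero => simp [qpow]
    | succ k ih =>
      rw [pow_succ, ih, qpow_mul]
      congr 1
      push_cast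
      ring
  intro h
  have h1 : algebraMap ℂ⟦X⟧ ℂ⸨X⸩ (qpow (k / 2)) = algebraMap ℂ⟦X⟧ ℂ⸨X⸩ 1 := by
    rw [← hs, map_pow, map_one]
    exact h
  have h2 := congrArg (PowerSeries.coeff 1) (algebraMap_laurent_injective h1)
  rw [qpow_coeff] at h2
  simp [PowerSeries.coeff_one, hk] at h2

lemma algebraMap_sqrtQ_zpow (k : ℤ) :
    algebraMap ℂ⟦X⟧ ℂ⸨X⸩ ((sqrtQ ^ k : ℂ⟦X⟧ˣ) : ℂ⟦X⟧) = s ^ k := by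
  have h := Units.val_zpow_eq_zpow_val (Units.map (algebraMap ℂ⟦X⟧ ℂ⸨X⸩).toMonoidHom sqrtQ) k
  rw [← map_zpow] at h
  exact h

lemma algebraMap_etaPlus (n : ℕ) :
    algebraMap ℂ⟦X⟧ ℂ⸨X⸩ (etaPlus n : ℂ⟦X⟧ˣ) = etaval n s := by
  rw [etaPlus, Units.val_mul, map_mul, algebraMap_sqrtQ_zpow, etaval]
  simp

lemma algebraMap_units_ne_zero (u : ℂ⟦X⟧ˣ) : algebraMap ℂ⟦X⟧ ℂ⸨X⸩ (u : ℂ⟦X⟧) ≠ 0 := by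
  rw [Ne, map_eq_zero_iff _ algebraMap_laurent_injective]
  exact u.ne_zero

lemma algebraMap_units_injective {u v : ℂ⟦X⟧ˣ}
    (h : algebraMap ℂ⟦X⟧ ℂ⸨X⸩ (u : ℂ⟦X⟧) = algebraMap ℂ⟦X⟧ ℂ⸨X⸩ (v : ℂ⟦X⟧)) : u = v :=
  Units.ext (algebraMap_laurent_injective h)

lemma algebraMap_units_div (u v : ℂ⟦X⟧ˣ) :
    algebraMap ℂ⟦X⟧ ℂ⸨X⸩ ((u / v : ℂ⟦X⟧ˣ) : ℂ⟦X⟧)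
      = algebraMap ℂ⟦X⟧ ℂ⸨X⸩ (u : ℂ⟦X⟧) / algebraMap ℂ⟦X⟧ ℂ⸨X⸩ (v : ℂ⟦X⟧) := by
  rw [eq_div_iff (algebraMap_units_ne_zero v), ← map_mul, ← Units.val_mul, div_mul_cancel]

lemma algebraMap_param_ne {η x : ℂ⟦X⟧ˣ} (hx : x ^ 2 ≠ 1) :
    algebraMap ℂ⟦X⟧ ℂ⸨X⸩ (η * x : ℂ⟦X⟧ˣ) ≠ algebraMap ℂ⟦X⟧ ℂ⸨X⸩ (η / x : ℂ⟦X⟧ˣ) := by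
  intro h
  have h1 := algebraMap_units_injective h
  rw [div_eq_mul_inv, mul_right_inj, eq_inv_iff_mul_eq_one] at h1
  exact hx (by rw [sq, h1])

lemma epsPlus_sq_mul : epsPlus * epsPlus * ((s ^ 2 - 1) * (s⁻¹ ^ 2 - 1)) = 1 := by
  have h := congrArg₂ (· * ·) epsPlus_mul epsPlus_mul'
  have hs := mul_inv_cancel₀ s_ne_zero
  linear_combination h - I * I * hs - I_sq

/-- Degeneracy is a quadratic equation for `e` without linear term, and `epsPlus` is one of its
roots. -/
lemma eq_or_eq_neg_epsPlus {e : ℂ⸨X⸩} (h : e * (s ^ 2 - 1) * (e * (s⁻¹ ^ 2 - 1)) = 1) :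
    e = epsPlus ∨ e = -epsPlus := by
  have h0 : (s ^ 2 - 1) * (s⁻¹ ^ 2 - 1) ≠ 0 := by
    intro h0
    have := epsPlus_sq_mul
    rw [h0, mul_zero] at this
    exact zero_ne_one this
  refine mul_self_eq_mul_self_iff.mp (mul_right_cancel₀ h0 ?_)
  rw [epsPlus_sq_mul]
  linear_combination h

lemma etaPlus_sq_mul (hn : 1 ≤ n) :
    algebraMap ℂ⟦X⟧ ℂ⸨X⸩ (etaPlus n : ℂ⟦X⟧ˣ) * algebraMap ℂ⟦X⟧ ℂ⸨X⸩ (etaPlus n : ℂ⟦X⟧ˣ)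
      * s ^ (4 * (n - 1)) = 1 := by
  have h1 : s ^ (2 * (1 - (n : ℤ))) * s ^ (2 * (1 - (n : ℤ))) * s ^ (4 * (n - 1)) = 1 := by
    rw [← zpow_natCast, ← zpow_add₀ s_ne_zero, ← zpow_add₀ s_ne_zero]
    convert zpow_zero s using 2
    push_cast [Nat.cast_sub hn]
    ring
  rw [algebraMap_etaPlus, etaval]
  linear_combination s ^ (2 * (1 - (n : ℤ))) * s ^ (2 * (1 - (n : ℤ))) * s ^ (4 * (n - 1))
    * neg_one_pow_mul_self (F := ℂ⸨X⸩) n + h1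

lemma eq_or_eq_neg_etaPlus (hn : 1 ≤ n) {η : ℂ⟦X⟧ˣ}
    (h : algebraMap ℂ⟦X⟧ ℂ⸨X⸩ (η : ℂ⟦X⟧) * algebraMap ℂ⟦X⟧ ℂ⸨X⸩ (η : ℂ⟦X⟧)
      * s ^ (4 * (n - 1)) = 1) : η = etaPlus n ∨ η = -etaPlus n := by
  have h1 := mul_right_cancel₀ (pow_ne_zero _ s_ne_zero) (h.trans (etaPlus_sq_mul hn).symm)
  rcases mul_self_eq_mul_self_iff.mp h1 with h2 | h2
  · exact Or.inl (algebraMap_units_injective h2)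
  · refine Or.inr (algebraMap_units_injective ?_)
    rw [h2, Units.val_neg, map_neg]

lemma exists_sign_of_eq_or_eq_neg {R : Type*} [Ring R] {e f : R} (h : e = f ∨ e = -f) :
    ∃ d : R, d * d = 1 ∧ e = d * f := by
  rcases h with rfl | rfl
  · exact ⟨1, one_mul 1, (one_mul e).symm⟩
  · exact ⟨-1, by simp, by simp⟩

/-- Nonzero intertwiners exist only for `η = ±(-1)^n q^{1-n}` and
`ε_j = ±i (q^{1/2} - q^{-1/2})⁻¹`. -/
theorem IsIntertwiner.params (hn : 3 ≤ n) {η x : ℂ⟦X⟧ˣ} {ε : Fin (n + 1) → ℂ⸨X⸩}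
    (hε : ∃ j, ε j ≠ 0) (hx : x ^ 2 ≠ 1) {K : Mat n ℂ⸨X⸩} (hK0 : K ≠ 0)
    (hK : IsIntertwiner n ε η x K) :
    (η = etaPlus n ∨ η = -etaPlus n) ∧ ∀ j, ε j = epsPlus ∨ ε j = -epsPlus := by
  rw [isIntertwiner_iff hn] at hK
  have hε' : ∀ j, ε j = epsPlus ∨ ε j = -epsPlus := by
    intro j
    by_contra hj
    exact hK0 (eq_zero_of_exists_nondegenerate hn s_ne_zero (s_pow_ne_one 4 (by norm_num))
      (algebraMap_units_ne_zero _) (algebraMap_units_ne_zero _) (algebraMap_param_ne hx) hK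
      (fun h => hj (eq_or_eq_neg_epsPlus h)) hε)
  refine ⟨?_, hε'⟩
  have hδ : ∃ δ : Fin (n + 1) → ℂ⸨X⸩, (∀ j, δ j * δ j = 1) ∧ ∀ j, ε j = δ j * epsPlus := by
    choose δ h1 h2 using fun j => exists_sign_of_eq_or_eq_neg (hε' j)
    exact ⟨δ, h1, h2⟩
  obtain ⟨δ, hδ, hδ'⟩ := hδ
  -- The common sign `κ` of the spectral parameters disappears from their product `κ² η²`, so it
  -- does not affect the condition on `η`.
  obtain ⟨κ, L, hκ, hL0, hL⟩ := exists_gauge hn hδ hK0 fun j => by rw [← hδ']; exact hK j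
  have hκ0 : κ ≠ 0 := fun h => by simp [h] at hκ
  have h := param_of_ne_zero hn I_sq s_ne_zero s_pow_ne_one
    (mul_ne_zero hκ0 (algebraMap_units_ne_zero _)) (mul_ne_zero hκ0 (algebraMap_units_ne_zero _))
    (fun h => algebraMap_param_ne hx (mul_left_cancel₀ hκ0 h)) epsPlus_mul epsPlus_mul' hL hL0
  refine eq_or_eq_neg_etaPlus (by omega) ?_
  have h2 : algebraMap ℂ⟦X⟧ ℂ⸨X⸩ (η * x : ℂ⟦X⟧ˣ) * algebraMap ℂ⟦X⟧ ℂ⸨X⸩ (η / x : ℂ⟦X⟧ˣ)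
      = algebraMap ℂ⟦X⟧ ℂ⸨X⸩ (η : ℂ⟦X⟧) * algebraMap ℂ⟦X⟧ ℂ⸨X⸩ (η : ℂ⟦X⟧) := by
    rw [← map_mul, ← map_mul, ← Units.val_mul, ← Units.val_mul, mul_mul_div_cancel]
  rw [← h2]
  linear_combination h - algebraMap ℂ⟦X⟧ ℂ⸨X⸩ (η * x : ℂ⟦X⟧ˣ)
    * algebraMap ℂ⟦X⟧ ℂ⸨X⸩ (η / x : ℂ⟦X⟧ˣ) * s ^ (4 * (n - 1)) * hκ

theorem isIntertwiner_Kmat (hn : 3 ≤ n) (x : ℂ⟦X⟧ˣ) :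
    IsIntertwiner n (fun _ => epsPlus) (etaPlus n) x
      (Kmat n I s (algebraMap ℂ⟦X⟧ ℂ⸨X⸩ x)) := by
  rw [isIntertwiner_iff hn]
  intro j
  have h := Kmat_mul_Qmat hn I_sq s_ne_zero s_sq_add_one_ne_zero (algebraMap_units_ne_zero x)
    epsPlus_mul epsPlus_mul' j
  rw [Units.val_mul, map_mul, algebraMap_units_div, algebraMap_etaPlus]
  exact h

lemma Kmat_neg_mul_Qmat {F : Type*} [Field F] (hn : 3 ≤ n) {I s e x : F} (hI : I ^ 2 = -1)
    (hs : s ≠ 0) (hs2 : s ^ 2 + 1 ≠ 0) (hx : x ≠ 0) (he : e * (s ^ 2 - 1) = I * s)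
    (he' : e * (s⁻¹ ^ 2 - 1) = -I * s⁻¹) (j : Fin (n + 1)) :
    Kmat n I s (-x) * Qmat s e (nodeParam (-etaval n s * x) j) (nodeA hn j) (nodeB hn j)
      = Qmat s e (nodeParam (-etaval n s / x) j) (nodeA hn j) (nodeB hn j) * Kmat n I s (-x) := by
  have h := Kmat_mul_Qmat hn hI hs hs2 (neg_ne_zero.mpr hx) he he' j
  rwa [mul_neg, ← neg_mul, div_neg, ← neg_div] at h

theorem isIntertwiner_Kmat_neg (hn : 3 ≤ n) (x : ℂ⟦X⟧ˣ) :
    IsIntertwiner n (fun _ => epsPlus) (-etaPlus n) x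
      (Kmat n I s (-algebraMap ℂ⟦X⟧ ℂ⸨X⸩ x)) := by
  rw [isIntertwiner_iff hn]
  intro j
  have h := Kmat_neg_mul_Qmat hn I_sq s_ne_zero s_sq_add_one_ne_zero
    (algebraMap_units_ne_zero x) epsPlus_mul epsPlus_mul' j
  rw [Units.val_mul, map_mul, algebraMap_units_div, Units.val_neg, map_neg, algebraMap_etaPlus]
  exact h

/-- `c = 0` would mean `(-1)^n q^{n-1} = -1`, hence `q^{2(n-1)} = 1`. -/
lemma cconst_ne_zero {F : Type*} [Field F] {s : F} (hs : s ≠ 0)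
    (hq : ∀ k : ℕ, k ≠ 0 → s ^ k ≠ 1) (hn : 2 ≤ n) : cconst n s ≠ 0 := by
  intro h
  refine hq (4 * (n - 1)) (by omega) ?_
  obtain ⟨k, rfl⟩ : ∃ k, n = k + 1 := ⟨n - 1, by omega⟩
  have h1 : ((k + 1 : ℕ) : ℤ) - 1 = (k : ℤ) := by push_cast; ring
  have h2 : 1 - ((k + 1 : ℕ) : ℤ) = -(k : ℤ) := by push_cast; ring
  rw [cconst, h1, h2, zpow_neg, zpow_natCast] at h
  have h3 := mul_inv_cancel₀ (pow_ne_zero k hs)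
  have h4 : (-1) ^ (k + 1) * (s ^ k * s ^ k) = -1 := by linear_combination s ^ k * h - h3
  rw [Nat.add_sub_cancel, show 4 * k = k + k + (k + k) by ring, pow_add, pow_add]
  linear_combination -(s ^ k * s ^ k * (s ^ k * s ^ k)) * neg_one_pow_mul_self (F := F) (k + 1)
    + ((-1) ^ (k + 1) * (s ^ k * s ^ k) - 1) * h4

/-- For `x ≠ 1` the entries above the antidiagonal and off the diagonal are nonzero multiples of `1
- x`. At `x = 1` all `κ` vanish, and the first diagonal entry is `c`. -/
lemma Kmat_ne_zero {F : Type*} [Field F] {I s : F} (hI : I ≠ 0) (hs : s ≠ 0)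
    (hs2 : s ^ 2 + 1 ≠ 0) (hq : ∀ k : ℕ, k ≠ 0 → s ^ k ≠ 1) (hn : 2 ≤ n) (x : F) :
    Kmat n I s x ≠ 0 := by
  intro h
  by_cases hx : x = 1
  · refine cconst_ne_zero hs hq hn ?_
    have h1 := congrFun (congrFun h ⟨0, by omega⟩) ⟨0, by omega⟩
    have h2 : (⟨0, by omega⟩ : Fin (2 * n)) ≠ Fin.rev ⟨0, by omega⟩ := (rev_ne _).symm
    rw [Kmat, Matrix.of_apply, if_pos (Or.inl (by change 0 + 1 + (0 + 1) ≤ 2 * n; omega)),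
      kentry, if_neg h2,
      if_pos rfl, kfun, hx] at h1
    rw [cconst]
    simpa using h1
  · refine Kmat_apply_ne_zero hI hs hs2 hx (a := (⟨0, by omega⟩ : Fin (2 * n)))
      (b := ⟨1, by omega⟩) (by simp) (by change 0 + 1 + (1 + 1) ≤ 2 * n; omega) ?_
    rw [h, Matrix.zero_apply]

theorem exists_smul_Kmat (hn : 3 ≤ n) {x : ℂ⟦X⟧ˣ} (hx : x ^ 2 ≠ 1) {K : Mat n ℂ⸨X⸩}
    (hK : IsIntertwiner n (fun _ => epsPlus) (etaPlus n) x K) :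
    ∃ c : ℂ⸨X⸩, K = c • Kmat n I s (algebraMap ℂ⟦X⟧ ℂ⸨X⸩ x) :=
  exists_smul_of_ne_zero hn I_sq s_ne_zero s_pow_ne_one (algebraMap_units_ne_zero _)
    (algebraMap_units_ne_zero _) (algebraMap_param_ne hx) epsPlus_mul epsPlus_mul'
    ((isIntertwiner_iff hn _ _ _ _).mp (isIntertwiner_Kmat hn x))
    (Kmat_ne_zero (I_ne_zero I_sq) s_ne_zero s_sq_add_one_ne_zero s_pow_ne_one (by omega) _)
    ((isIntertwiner_iff hn _ _ _ _).mp hK)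

end Specialization

end QARefl

end

/-! ### The main theorem. -/

open QARefl in
theorem mainTheorem1 (n : ℕ) (hn : 3 ≤ n) :
    -- The representations `π_x` exist and are determined by their values on the generators.
    (∀ x : ℂ⟦X⟧ˣ, ∃! ρ : Uh n →ₐ[ℂ⟦X⟧] Mat n ℂ⟦X⟧, IsVectorRep n x ρ) ∧
    -- A nonzero solution exists only for the stated `η` and `ε̂`.
    (∀ (η : ℂ⟦X⟧ˣ) (ε : Fin (n + 1) → ℂ⸨X⸩), (∃ j, ε j ≠ 0) →
      ∀ x : ℂ⟦X⟧ˣ, x ^ 2 ≠ 1 → ∀ K : Mat n ℂ⸨X⸩, K ≠ 0 → IsIntertwiner n ε η x K →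
        (η = etaPlus n ∨ η = -etaPlus n) ∧ ∀ j, ε j = epsPlus ∨ ε j = -epsPlus) ∧
    -- For the upper signs `K(x)` is a nonzero solution, unique up to a scalar for `x ≠ ±1`.
    (∀ x : ℂ⟦X⟧ˣ,
      IsIntertwiner n (fun _ => epsPlus) (etaPlus n) x
        (Kmat n I s (algebraMap ℂ⟦X⟧ ℂ⸨X⸩ x)) ∧
      Kmat n I s (algebraMap ℂ⟦X⟧ ℂ⸨X⸩ x) ≠ 0 ∧
      (x ^ 2 ≠ 1 → ∀ K' : Mat n ℂ⸨X⸩,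
        IsIntertwiner n (fun _ => epsPlus) (etaPlus n) x K' →
          ∃ c : ℂ⸨X⸩, K' = c • Kmat n I s (algebraMap ℂ⟦X⟧ ℂ⸨X⸩ x))) ∧
    -- For the opposite sign of `η` a solution is `K(-x)`.
    (∀ x : ℂ⟦X⟧ˣ,
      IsIntertwiner n (fun _ => epsPlus) (-etaPlus n) x
        (Kmat n I s (-algebraMap ℂ⟦X⟧ ℂ⸨X⸩ x))) ∧
    -- `Ř(x)` intertwines `V_x ⊗ V_1` and `V_1 ⊗ V_x`.
    (∀ x : ℂ⟦X⟧ˣ, IsRIntertwiner n x (Rcheck n s (algebraMap ℂ⟦X⟧ ℂ⸨X⸩ x))) ∧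
    -- `K` solves the reflection equation.
    ReflectionEquation n s (Kmat n I s) ∧
    -- So do the families `K^+_σ` and `K^-_σ`.
    (∀ σ : Fin (n + 1) → ℂ⟦X⟧ˣ,
      ReflectionEquation n s (Kplus I s fun j => algebraMap ℂ⟦X⟧ ℂ⸨X⸩ (σ j)) ∧
      ReflectionEquation n s (Kminus I s fun j => algebraMap ℂ⟦X⟧ ℂ⸨X⸩ (σ j))) ∧
    -- The family has `n` effective parameters `σ_1, …, σ_n`.
    (∀ σ τ : Fin (n + 1) → ℂ⟦X⟧ˣ,
      (Kplus I s fun j => algebraMap ℂ⟦X⟧ ℂ⸨X⸩ (σ j))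
          = (Kplus I s fun j => algebraMap ℂ⟦X⟧ ℂ⸨X⸩ (τ j)) ↔
        ∀ j, j ≠ 0 → σ j = τ j) := by
  have h0 : ∀ (σ : Fin (n + 1) → ℂ⟦X⟧ˣ) j, algebraMap ℂ⟦X⟧ ℂ⸨X⸩ (σ j) ≠ 0 := fun σ j =>
    algebraMap_units_ne_zero (σ j)
  refine ⟨fun x => existsUnique_isVectorRep hn x,
    fun η ε hε x hx K hK0 hK => hK.params hn hε hx hK0,
    fun x => ⟨isIntertwiner_Kmat hn x, ?_, fun hx K' hK' => exists_smul_Kmat hn hx hK'⟩,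
    fun x => isIntertwiner_Kmat_neg hn x, fun x => Rcheck_isRIntertwiner hn x,
    reflectionEquation_Kmat hn,
    fun σ => ⟨reflectionEquation_Kplus hn (reflectionEquation_Kmat hn) (h0 σ),
      (reflectionEquation_Kplus hn (reflectionEquation_Kmat hn) (h0 σ)).comp_neg⟩,
    fun σ τ => (Kplus_eq_iff hn (I_ne_zero I_sq) s_ne_zero s_sq_add_one_ne_zero (h0 σ)
      (h0 τ)).trans ?_⟩
  · exact Kmat_ne_zero (I_ne_zero I_sq) s_ne_zero s_sq_add_one_ne_zero s_pow_ne_one (by omega) _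
  · exact forall₂_congr fun j _ => algebraMap_laurent_injective.eq_iff.trans Units.val_inj
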